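/- Let $\mathfrak g$ be one of the complex Lie superalgebras $\mathfrak{sl}(m+1,n+1)$ ($m,n\ge 0$, $m\ne n$), $\mathfrak{osp}(2,2n)$ ($n\ge 1$), $G(3)$, $F(4)$. Let $\mathfrak h$ be a Cartan subalgebra, $(\cdot,\cdot)$ the invariant form on $\mathfrak h^*$, $\Phi_0^+$ and $\Phi_1^+$ the positive even and odd roots for the distinguished simple system, $\rho=\frac12\sum_{\alpha\in\Phi_0^+}\alpha-\frac12\sum_{\alpha\in\Phi_1^+}\alpha$, and $W$ the Weyl group of $\mathfrak g_0$, with length function $\ell$. A weight $\lambda\in\mathfrak h^*$ is dominant integral if the irreducible highest weight module $V(\lambda)$ is finite dimensional, and it is singly atypical of type $\gamma$ if $\gamma$ is the unique element of $\Phi_1^+$ with $(\lambda+\rho,\gamma)=0$. If $\mathfrak g$ is $G(3)$ or $F(4)$, fix any set $S\subseteq\mathfrak h^*$ of weights, called special; for the other $\mathfrak g$ let $S=\emptyset$. For a dominant integral singly atypical weight $\lambda$ of type $\gamma$, define the normalized Weyl numerator $$U(\lambda)=\sum_{w\in W}(-1)^{\ell(w)}\frac{e^{w(\lambda+\rho)-(\lambda+\rho)}}{1+e^{-w\gamma}}\quad(\lambda\notin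 S),\qquad U(\lambda)=\sum_{w\in W}\frac{(-1)^{\ell(w)}}{2}\,\frac{2+e^{-w\gamma}}{1+e^{-w\gamma}}\,e^{w(\lambda+\rho)-(\lambda+\rho)}\quad(\lambda\in S),$$ an element of the field of fractions of the group algebra of formal exponentials $e^{\mu}$, $\mu\in\mathfrak h^*$. Let $\nu_1,\dots,\nu_r,\mu_1,\dots,\mu_s$ be dominant integral weights that are all singly atypical of the same type $\gamma$, and suppose that $$U(\nu_1)\cdots U(\nu_r)=U(\mu_1)\cdots U(\mu_s).$$ Then $r=s$, and there is a permutation $\sigma$ of $\{1,\dots,r\}$ such that $U(\nu_k)=U(\mu_{\sigma(k)})$ for all $k$. -/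

import Mathlib

noncomputable section

open scoped Classical

namespace SuperFactor

/-- Root data of a Lie superalgebra with Cartan subalgebra `𝔥`, written in coordinates.
Vectors are elements of `κ → ℂ`; the dual `𝔥*` is the span of the roots. -/
structure RootDatum where
  /-- index set of the coordinates -/
  κ : Type
  [fintypeκ : Fintype κ]
  [decEqκ : DecidableEq κ]
  /-- Gram matrix of the invariant form in these coordinates -/
  gram : Matrix κ κ ℂ
  /-- the positive even roots -/
  evenPos : Finset (κ → ℂ)
  /-- the positive odd roots -/
  oddPos : Finset (κ → ℂ)
  /-- index set of the distinguished simple system -/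
  ι : Type
  /-- the simple roots -/
  simple : ι → (κ → ℂ)
  /-- parity (`0` or `1`) of the simple roots -/
  parity : ι → ℕ

attribute [instance] RootDatum.fintypeκ RootDatum.decEqκ

/-- The Lie superalgebras considered: `sl m n` is `𝔰𝔩(m+1,n+1)`, with `m ≠ n` so that it is simple
with nondegenerate invariant form, and `osp n` is `𝔬𝔰𝔭(2,2n)` with `n ≥ 1`. -/
inductive SuperType where
  | sl (m n : ℕ) (h : m ≠ n)
  | osp (n : ℕ) (h : 0 < n)
  | G3
  | F4

/-- `G(3)` and `F(4)`. -/
def SuperType.IsExceptional : SuperType → Prop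
  | .G3 => True
  | .F4 => True
  | _ => False

/-! ### `𝔰𝔩(m+1,n+1)` -/

/-- `ε_i` for `𝔰𝔩(m+1,n+1)` -/
def slEps (m n : ℕ) (i : Fin (m + 1)) : Fin (m + 1) ⊕ Fin (n + 1) → ℂ := Pi.single (Sum.inl i) 1

/-- `δ_j` for `𝔰𝔩(m+1,n+1)` -/
def slDel (m n : ℕ) (j : Fin (n + 1)) : Fin (m + 1) ⊕ Fin (n + 1) → ℂ := Pi.single (Sum.inr j) 1

/-- `(ε_i,ε_j) = δ_ij`, `(δ_i,δ_j) = -δ_ij`; positive even roots `ε_i - ε_j`, `δ_i - δ_j` (`i < j`),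
positive odd roots `ε_i - δ_j`; simple roots `ε_i - ε_{i+1}`, `ε_{m+1} - δ_1`, `δ_j - δ_{j+1}`. -/
def slDatum (m n : ℕ) : RootDatum where
  κ := Fin (m + 1) ⊕ Fin (n + 1)
  gram := Matrix.diagonal (Sum.elim (fun _ => 1) (fun _ => -1))
  evenPos :=
    ((Finset.univ.filter fun p : Fin (m + 1) × Fin (m + 1) => p.1 < p.2).image
      fun p => slEps m n p.1 - slEps m n p.2) ∪
    ((Finset.univ.filter fun p : Fin (n + 1) × Fin (n + 1) => p.1 < p.2).image
      fun p => slDel m n p.1 - slDel m n p.2)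
  oddPos := Finset.univ.image fun p : Fin (m + 1) × Fin (n + 1) => slEps m n p.1 - slDel m n p.2
  ι := Fin m ⊕ Unit ⊕ Fin n
  simple := Sum.elim (fun i => slEps m n i.castSucc - slEps m n i.succ)
    (Sum.elim (fun _ => slEps m n (Fin.last m) - slDel m n 0)
      (fun j => slDel m n j.castSucc - slDel m n j.succ))
  parity := Sum.elim (fun _ => 0) (Sum.elim (fun _ => 1) (fun _ => 0))

/-! ### `𝔬𝔰𝔭(2,2n)` -/

/-- `ε_1` for `𝔬𝔰𝔭(2,2n)` -/
def ospEps (n : ℕ) : Unit ⊕ Fin n → ℂ := Pi.single (Sum.inl ()) 1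

/-- `δ_j` for `𝔬𝔰𝔭(2,2n)` -/
def ospDel (n : ℕ) (j : Fin n) : Unit ⊕ Fin n → ℂ := Pi.single (Sum.inr j) 1

/-- `(ε_1,ε_1) = 1`, `(δ_i,δ_j) = -δ_ij`; positive even roots `2δ_i`, `δ_i ± δ_j` (`i < j`), positive
odd roots `ε_1 ± δ_j`; simple roots `ε_1 - δ_1`, `δ_j - δ_{j+1}`, `2δ_n`. -/
def ospDatum (n : ℕ) (h : 0 < n) : RootDatum where
  κ := Unit ⊕ Fin n
  gram := Matrix.diagonal (Sum.elim (fun _ => 1) (fun _ => -1))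
  evenPos :=
    (Finset.univ.image fun i : Fin n => (2 : ℂ) • ospDel n i) ∪
    ((Finset.univ.filter fun p : Fin n × Fin n => p.1 < p.2).image
      fun p => ospDel n p.1 - ospDel n p.2) ∪
    ((Finset.univ.filter fun p : Fin n × Fin n => p.1 < p.2).image
      fun p => ospDel n p.1 + ospDel n p.2)
  oddPos :=
    (Finset.univ.image fun j : Fin n => ospEps n - ospDel n j) ∪
    (Finset.univ.image fun j : Fin n => ospEps n + ospDel n j)
  ι := Unit ⊕ Fin n
  simple := Sum.elim (fun _ => ospEps n - ospDel n ⟨0, h⟩)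
    (fun j => if hj : j.val + 1 < n then ospDel n j - ospDel n ⟨j.val + 1, hj⟩
      else (2 : ℂ) • ospDel n j)
  parity := Sum.elim (fun _ => 1) (fun _ => 0)

/-! ### `G(3)`, in the basis `ε_1, ε_2, δ` (with `ε_3 = -ε_1 - ε_2`) -/

/-- `(ε_1,ε_1) = (ε_2,ε_2) = -2(ε_1,ε_2) = -(δ,δ) = 2`; positive even roots
`ε_1, ε_2, -ε_3, ε_2 - ε_1, ε_1 - ε_3, ε_2 - ε_3, 2δ`; positive odd roots `δ, δ ± ε_i`;
simple roots `ε_1, ε_2 - ε_1, ε_3 + δ`. -/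
def g3Datum : RootDatum where
  κ := Fin 3
  gram := !![2, -1, 0; -1, 2, 0; 0, 0, -2]
  evenPos := {![1, 0, 0], ![0, 1, 0], ![1, 1, 0], ![-1, 1, 0], ![2, 1, 0], ![1, 2, 0], ![0, 0, 2]}
  oddPos := {![0, 0, 1], ![1, 0, 1], ![-1, 0, 1], ![0, 1, 1], ![0, -1, 1], ![-1, -1, 1], ![1, 1, 1]}
  ι := Fin 3
  simple := ![![1, 0, 0], ![-1, 1, 0], ![-1, -1, 1]]
  parity := ![0, 0, 1]

/-! ### `F(4)`, in the basis `ε_1, ε_2, ε_3, δ` -/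

/-- `(ε_i,ε_j) = δ_ij`, `(δ,δ) = -3`; positive even roots `ε_i`, `ε_i ± ε_j` (`i < j`), `δ`; positive odd
roots `(± ε_1 ± ε_2 ± ε_3 + δ)/2`; simple roots
`ε_1 - ε_2, ε_2 - ε_3, ε_3, (-ε_1 - ε_2 - ε_3 + δ)/2`. -/
def f4Datum : RootDatum where
  κ := Fin 4
  gram := Matrix.diagonal ![1, 1, 1, -3]
  evenPos := {![1, 0, 0, 0], ![0, 1, 0, 0], ![0, 0, 1, 0], ![1, -1, 0, 0], ![1, 1, 0, 0],
    ![1, 0, -1, 0], ![1, 0, 1, 0], ![0, 1, -1, 0], ![0, 1, 1, 0], ![0, 0, 0, 1]}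
  oddPos := Finset.univ.image fun s : Fin 3 → ℤˣ =>
    ![((s 0 : ℤ) : ℂ) / 2, ((s 1 : ℤ) : ℂ) / 2, ((s 2 : ℤ) : ℂ) / 2, 1 / 2]
  ι := Fin 4
  simple := ![![1, -1, 0, 0], ![0, 1, -1, 0], ![0, 0, 1, 0], ![-1 / 2, -1 / 2, -1 / 2, 1 / 2]]
  parity := ![0, 0, 0, 1]

/-- The root datum of each of the Lie superalgebras. -/
def SuperType.datum : SuperType → RootDatum
  | .sl m n _ => slDatum m n
  | .osp n h => ospDatum n h
  | .G3 => g3Datum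
  | .F4 => f4Datum

namespace RootDatum

variable (D : RootDatum)

/-- The ambient coordinate space. -/
abbrev Vec : Type := D.κ → ℂ

/-- The invariant bilinear form. -/
def form (x y : D.Vec) : ℂ := ∑ a, ∑ b, x a * D.gram a b * y b

/-- The space `𝔥*`, the complex span of the roots. -/
def hStar : Submodule ℂ D.Vec := Submodule.span ℂ (↑D.evenPos ∪ ↑D.oddPos)

/-- The Weyl vector. -/
def rho : D.Vec := (1 / 2 : ℂ) • ∑ α ∈ D.evenPos, α - (1 / 2 : ℂ) • ∑ α ∈ D.oddPos, α

/-- The Weyl group: that of the even part, generated by the reflections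
`v ↦ v - (2 (v,α) / (α,α)) α` in all even roots `α`. -/
def weylGroup : Subgroup (D.Vec ≃ₗ[ℂ] D.Vec) :=
  Subgroup.closure {s | ∃ α ∈ D.evenPos, ∀ v, s v = v - (2 * D.form v α / D.form α α) • α}

/-- The sign `(-1)^{ℓ(w)}`, which is the determinant of `w` (reflections have determinant `-1`). -/
def sgn (w : D.weylGroup) : ℂ := LinearMap.det (w : D.Vec ≃ₗ[ℂ] D.Vec).toLinearMap

/-- A module over the Lie superalgebra, given by the action of Chevalley generators: `E i`, `F i` are
root vectors for `± α_i` and `H i` is the element `h_{α_i}` of `𝔥` that corresponds to `α_i` under the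
form, so that `μ (h_{α_i}) = (μ, α_i)`. The simple roots form a basis of `𝔥*`, hence the `h_{α_i}` a basis
of `𝔥`. The operator `par` is `1` on the even and `-1` on the odd part of the module.

The Lie superalgebra is the quotient of the one with these generators and relations by the largest
ideal that meets `𝔥` trivially. That ideal annihilates every irreducible highest weight module, so for
these modules no further relation has to be imposed. -/
structure ChevalleyModule (V : Type) [AddCommGroup V] [Module ℂ V] where
  E : D.ι → Module.End ℂ V
  F : D.ι → Module.End ℂ V
  H : D.ι → Module.End ℂ V
  par : Module.End ℂ V
  par_sq : par * par = 1
  par_E : ∀ i, par * E i = (-1 : ℂ) ^ D.parity i • (E i * par)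
  par_F : ∀ i, par * F i = (-1 : ℂ) ^ D.parity i • (F i * par)
  par_H : ∀ i, par * H i = H i * par
  H_H : ∀ i j, H i * H j = H j * H i
  H_E : ∀ i j, H i * E j - E j * H i = D.form (D.simple i) (D.simple j) • E j
  H_F : ∀ i j, H i * F j - F j * H i = -D.form (D.simple i) (D.simple j) • F j
  E_F : ∀ i j, E i * F j - (-1 : ℂ) ^ (D.parity i * D.parity j) • (F j * E i) =
    if i = j then H i else 0

variable {D} in
/-- No proper nonzero graded submodule. -/
def ChevalleyModule.IsIrreducible {V : Type} [AddCommGroup V] [Module ℂ V]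
    (M : D.ChevalleyModule V) : Prop :=
  Nontrivial V ∧ ∀ N : Submodule ℂ V,
    (∀ x ∈ N, M.par x ∈ N ∧ ∀ i, M.E i x ∈ N ∧ M.F i x ∈ N ∧ M.H i x ∈ N) → N = ⊥ ∨ N = ⊤

variable {D} in
/-- `v` is a highest weight vector of weight `lam`. -/
def ChevalleyModule.IsHighestWeightVector {V : Type} [AddCommGroup V] [Module ℂ V]
    (M : D.ChevalleyModule V) (lam : D.Vec) (v : V) : Prop :=
  v ≠ 0 ∧ ∀ i, M.E i v = 0 ∧ M.H i v = D.form lam (D.simple i) • v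

/-- `lam ∈ 𝔥*` is dominant integral: the irreducible module of highest weight `lam` has finite
dimension. -/
def DominantIntegral (lam : D.Vec) : Prop :=
  lam ∈ D.hStar ∧
  ∃ (V : Type) (_ : AddCommGroup V) (_ : Module ℂ V) (M : D.ChevalleyModule V),
    Module.Finite ℂ V ∧ M.IsIrreducible ∧ ∃ v, M.IsHighestWeightVector lam v

/-- `γ` is the unique positive odd root with `(lam + ρ, γ) = 0`. -/
def SinglyAtypical (γ lam : D.Vec) : Prop :=
  γ ∈ D.oddPos ∧ D.form (lam + D.rho) γ = 0 ∧
    ∀ γ' ∈ D.oddPos, D.form (lam + D.rho) γ' = 0 → γ' = γ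

/-- The field of fractions of the group algebra of formal exponentials. -/
abbrev ExpField : Type := FractionRing (AddMonoidAlgebra ℂ D.Vec)

/-- The formal exponential `e^μ`. -/
def fexp (μ : D.Vec) : D.ExpField :=
  algebraMap (AddMonoidAlgebra ℂ D.Vec) D.ExpField (AddMonoidAlgebra.single μ 1)

/-- `∑_w (-1)^{ℓ(w)} e^{w(lam+ρ)-(lam+ρ)} / (1 + e^{-wγ})` -/
def ordinaryNumerator (γ lam : D.Vec) : D.ExpField :=
  ∑ᶠ w : D.weylGroup, D.sgn w •
    (D.fexp (w.1 (lam + D.rho) - (lam + D.rho)) / (1 + D.fexp (-(w.1 γ))))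

/-- `∑_w (-1)^{ℓ(w)}/2 · (2 + e^{-wγ}) / (1 + e^{-wγ}) · e^{w(lam+ρ)-(lam+ρ)}` -/
def specialNumerator (γ lam : D.Vec) : D.ExpField :=
  ∑ᶠ w : D.weylGroup, (D.sgn w / 2) •
    ((2 + D.fexp (-(w.1 γ))) / (1 + D.fexp (-(w.1 γ))) *
      D.fexp (w.1 (lam + D.rho) - (lam + D.rho)))

end RootDatum

/-- The normalized Weyl numerator `U(lam)` of a singly atypical weight `lam` of type `γ`, where for `G(3)`
and `F(4)` the weights in `special` are those for which the second formula is used. -/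
def U (g : SuperType) (special : Set g.datum.Vec) (γ lam : g.datum.Vec) : g.datum.ExpField :=
  if g.IsExceptional ∧ lam ∈ special then g.datum.specialNumerator γ lam
  else g.datum.ordinaryNumerator γ lam

end SuperFactor

end

/-! The exponentials of a suitable lattice are evaluated in a field of Laurent series in a variable
T, so that each U(λ) becomes a series c T^o (1 + ρ T^e + ⋯) with e > 0. If, for every e, the
coefficients ρ of the different weights are linearly independent over a field of characteristic 0,
then the series are multiplicatively independent (`multiset_eq_of_prod_eq`): after cancellation of
common factors, the lowest exponent e that occurs yields a linear relation whose coefficients are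
differences of multiplicities. It also suffices that the leading coefficients be multiplicatively
independent (`multiset_eq_of_lead`). In this way the weights themselves are matched, not only their
numerators.

For osp(2,2n) put T = e^{-ε₁}. Each wγ contains ε₁ with coefficient 1, so 1/(1 + e^{-wγ}) = 1 +
O(T), and the leading coefficient of U(λ) is the normalized alternant Σ sgn(w) e^{wb - b} of the
hyperoctahedral group, where b consists of the δ-coordinates of λ + ρ. For F(4) and G(3) the Weyl
group is a product W' × {±1}, the second factor changing the sign of δ, and T is e^{-δ/2} or e^{-δ}.
If the δ-coordinate of λ + ρ is positive, the leading coefficient is the normalized alternant of W'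
as before. Representation theory leaves very few other singly atypical weights (`f4_cases`,
`g3_cases`). For these the coefficients that could interfere are alternants at singular weights,
hence vanish, and the first one that survives is conjugate to the expected one. So the leading
coefficient is in all cases a nonzero rational multiple of the normalized alternant, for the
ordinary formula and for the special one alike. Normalized alternants of the hyperoctahedral group
and of type G₂ are multiplicatively independent modulo scalars (`exists_normB_factorization`,
`exists_normG_factorization`), by the criterion above.

For sl(m+1,n+1) all ε's receive the factor T⁻¹, and U(λ) = Σ_k (-T)^k A_k, where A_k is a common
factor times alt(a - k e_i) alt(b + k e_j). Here a and b are the coordinates of λ + ρ up to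
constants, and γ = ε_i - δ_j. Let e be the first positive k for which neither alternant has a
repeated exponent. The ratio A_e / A_0 is a product of two quotients of alternants. Such quotients
are linearly independent in suitable variables (`GenericVars`, `exists_genericVars`): the variables
are added one at a time, each dominating the earlier ones, and the second term of the expansion in
the new variable is again a quotient in fewer variables. The constants missing from a and b are
recovered from atypicality and, because m ≠ n, from the vanishing of the coordinate sum. -/

noncomputable section
open scoped Classical
-- A criterion for multiplicative independence of Laurent series
namespace SuperFactor

/-! ### Leading terms of Laurent series -/

section Lead

variable {K : Type} [Field K]

/-- `u` is `c T ^ e` plus terms of higher order. -/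
def Lead (u : LaurentSeries K) (e : ℤ) (c : K) : Prop :=
  (∀ j < e, u.coeff j = 0) ∧ u.coeff e = c

/-- Up to a power of T the series is a power series with constant term `c`. Products and inverses of
leading terms are thereby reduced to those of power series. -/
theorem lead_iff {u : LaurentSeries K} {e : ℤ} {c : K} :
    Lead u e c ↔ ∃ p : PowerSeries K, PowerSeries.constantCoeff p = c ∧
      u = HahnSeries.single e 1 * HahnSeries.ofPowerSeries ℤ K p := by
  constructor
  · rintro ⟨h, hc⟩
    refine ⟨PowerSeries.mk fun n => u.coeff (e + n), by simp [← hc], ?_⟩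
    ext j
    rw [HahnSeries.coeff_single_mul, PowerSeries.coeff_coe, one_mul]
    split_ifs with hj
    · exact h j (by omega)
    · rw [PowerSeries.coeff_mk]; congr 1; omega
  · rintro ⟨p, rfl, rfl⟩
    refine ⟨fun j hj => ?_, ?_⟩
    · rw [HahnSeries.coeff_single_mul, PowerSeries.coeff_coe, if_pos (by omega), mul_zero]
    · rw [HahnSeries.coeff_single_mul, PowerSeries.coeff_coe]
      simp

theorem Lead.coeff {u : LaurentSeries K} {e : ℤ} {c : K} (h : Lead u e c) : u.coeff e = c := h.2

theorem Lead.coeff_of_lt {u : LaurentSeries K} {e : ℤ} {c : K} (h : Lead u e c) {j : ℤ}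
    (hj : j < e) : u.coeff j = 0 := h.1 j hj

theorem Lead.ne_zero {u : LaurentSeries K} {e : ℤ} {c : K} (h : Lead u e c) (hc : c ≠ 0) :
    u ≠ 0 := by
  rintro rfl
  exact hc (by simpa using h.2.symm)

theorem Lead.add {u u' : LaurentSeries K} {e : ℤ} {c c' : K} (h : Lead u e c) (h' : Lead u' e c') :
    Lead (u + u') e (c + c') :=
  ⟨fun j hj => by rw [HahnSeries.coeff_add, h.1 j hj, h'.1 j hj, add_zero],
    by rw [HahnSeries.coeff_add, h.2, h'.2]⟩

theorem Lead.neg {u : LaurentSeries K} {e : ℤ} {c : K} (h : Lead u e c) : Lead (-u) e (-c) :=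
  ⟨fun j hj => by rw [HahnSeries.coeff_neg, h.1 j hj, neg_zero],
    by rw [HahnSeries.coeff_neg, h.2]⟩

theorem Lead.sub {u u' : LaurentSeries K} {e : ℤ} {c c' : K} (h : Lead u e c) (h' : Lead u' e c') :
    Lead (u - u') e (c - c') := by
  simpa [sub_eq_add_neg] using h.add h'.neg

theorem Lead.congr {u u' : LaurentSeries K} {e e' : ℤ} {c c' : K} (h : Lead u e c) (hu : u = u')
    (he : e = e') (hc : c = c') : Lead u' e' c' := by
  subst hu he hc; exact h

/-- The coefficient in `Lead` is allowed to be `0`, so a mere bound on the order is a leading term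
as well. This makes it possible to add terms of different orders at one common exponent. -/
theorem Lead.of_lt {u : LaurentSeries K} {e e' : ℤ} {c : K} (h : Lead u e c) (he : e' < e) :
    Lead u e' 0 :=
  ⟨fun j hj => h.1 j (hj.trans he), h.1 _ he⟩

theorem lead_zero (e : ℤ) : Lead (0 : LaurentSeries K) e 0 :=
  ⟨fun _ _ => rfl, rfl⟩

theorem Lead.sum {ι : Type} (s : Finset ι) {u : ι → LaurentSeries K} {e : ℤ} {c : ι → K}
    (h : ∀ i ∈ s, Lead (u i) e (c i)) : Lead (∑ i ∈ s, u i) e (∑ i ∈ s, c i) := by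
  induction s using Finset.induction_on with
  | empty => simpa using lead_zero e
  | insert a s ha ih =>
    rw [Finset.sum_insert ha, Finset.sum_insert ha]
    exact (h a (by simp)).add (ih fun i hi => h i (by simp [hi]))

theorem Lead.mul {u u' : LaurentSeries K} {e e' : ℤ} {c c' : K} (h : Lead u e c)
    (h' : Lead u' e' c') : Lead (u * u') (e + e') (c * c') := by
  obtain ⟨p, rfl, rfl⟩ := lead_iff.1 h
  obtain ⟨q, rfl, rfl⟩ := lead_iff.1 h'
  refine lead_iff.2 ⟨p * q, map_mul _ _ _, ?_⟩
  rw [map_mul, mul_mul_mul_comm, HahnSeries.single_mul_single, one_mul]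

theorem Lead.inv {u : LaurentSeries K} {e : ℤ} {c : K} (h : Lead u e c) (hc : c ≠ 0) :
    Lead u⁻¹ (-e) c⁻¹ := by
  obtain ⟨p, rfl, rfl⟩ := lead_iff.1 h
  refine lead_iff.2 ⟨p⁻¹, by simp, ?_⟩
  refine inv_eq_of_mul_eq_one_right ?_
  rw [mul_mul_mul_comm, HahnSeries.single_mul_single, ← map_mul, PowerSeries.mul_inv_cancel _ hc]
  simp

theorem Lead.div {u u' : LaurentSeries K} {e e' : ℤ} {c c' : K} (h : Lead u e c)
    (h' : Lead u' e' c') (hc : c' ≠ 0) : Lead (u / u') (e - e') (c / c') := by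
  rw [div_eq_mul_inv, div_eq_mul_inv, sub_eq_add_neg]
  exact h.mul (h'.inv hc)

theorem lead_single (e : ℤ) (c : K) : Lead (HahnSeries.single e c) e c :=
  ⟨fun _ hj => HahnSeries.coeff_single_of_ne hj.ne, HahnSeries.coeff_single_same _ _⟩

theorem lead_C (c : K) : Lead (HahnSeries.C c : LaurentSeries K) 0 c := lead_single 0 c

theorem lead_one : Lead (1 : LaurentSeries K) 0 1 := lead_single 0 1

theorem Lead.unique {u : LaurentSeries K} {e e' : ℤ} {c c' : K} (h : Lead u e c)
    (h' : Lead u e' c') (hc : c ≠ 0) (hc' : c' ≠ 0) : e = e' ∧ c = c' := by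
  have : e = e' := by
    rcases lt_trichotomy e e' with hl | hl | hl
    · exact absurd (h.2.symm.trans (h'.1 _ hl)) hc
    · exact hl
    · exact absurd (h'.2.symm.trans (h.1 _ hl)) hc'
  subst this
  exact ⟨rfl, h.2.symm.trans h'.2⟩

end Lead

/-! ### Linear independence along a ring homomorphism -/

/-- Linear independence over `k`, where `k` acts through the homomorphism `φ`. -/
def LinIndep {k K I : Type} [Field k] [Field K] (φ : k →+* K) (u : I → K) : Prop :=
  ∀ (s : Finset I) (c : I → k), ∑ i ∈ s, φ (c i) * u i = 0 → ∀ i ∈ s, c i = 0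

section LinIndep

variable {k K I J : Type} [Field k] [Field K] {φ : k →+* K}

theorem LinIndep.comp {u : I → K} (h : LinIndep φ u) {f : J → I} (hf : Function.Injective f) :
    LinIndep φ (u ∘ f) := by
  intro s c hs j hj
  have := h (s.map ⟨f, hf⟩) (fun i => if hi : ∃ j, f j = i then c hi.choose else 0) ?_ (f j)
    (Finset.mem_map.2 ⟨j, hj, rfl⟩)
  · have hex : ∃ j', f j' = f j := ⟨j, rfl⟩
    rw [dif_pos hex] at this
    rwa [hf hex.choose_spec] at this
  · rw [Finset.sum_map]
    rw [← hs]
    refine Finset.sum_congr rfl fun i _ => ?_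
    have hex : ∃ j', f j' = f i := ⟨i, rfl⟩
    simp only [Function.Embedding.coeFn_mk, Function.comp]
    rw [dif_pos hex, hf hex.choose_spec]

theorem LinIndep.congr {u u' : I → K} (h : LinIndep φ u) (hu : ∀ i, u i = u' i) :
    LinIndep φ u' := by
  rwa [← (funext hu : u = u')]

theorem LinIndep.neg {u : I → K} (h : LinIndep φ u) : LinIndep φ fun i => -u i := by
  intro s c hs
  refine h s c ?_
  rw [← neg_eq_zero, ← Finset.sum_neg_distrib]
  simpa using hs

theorem linIndep_of_subsingleton [Subsingleton I] {u : I → K} (h : ∀ i, u i ≠ 0) :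
    LinIndep φ u := by
  intro s c hs i hi
  have : s = {i} := by
    ext j; simp [Subsingleton.elim j i, hi]
  rw [this, Finset.sum_singleton] at hs
  simpa [h i] using hs

/-- Products of linearly independent families along a tower of fields. -/
theorem LinIndep.tower {L : Type} [Field L] {ψ : K →+* L} {u : I → K} {w : J → L}
    (hu : LinIndep φ u) (hw : LinIndep ψ w) :
    LinIndep (ψ.comp φ) fun p : J × I => w p.1 * ψ (u p.2) := by
  intro s c hs
  -- The relation is grouped by the first index. The inner sums lie in `K`, so the independence of
  -- `w` over `K` makes each of them vanish.
  have key : ∀ j ∈ s.image Prod.fst,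
      ∑ p ∈ s.filter (fun p => p.1 = j), φ (c p) * u p.2 = 0 := by
    refine hw (s.image Prod.fst)
      (fun j => ∑ p ∈ s.filter (fun p => p.1 = j), φ (c p) * u p.2) ?_
    rw [← hs, ← Finset.sum_fiberwise_of_maps_to (g := Prod.fst) (t := s.image Prod.fst)
      (fun p hp => Finset.mem_image_of_mem _ hp)]
    refine Finset.sum_congr rfl fun j _ => ?_
    rw [map_sum, Finset.sum_mul]
    refine Finset.sum_congr rfl fun p hp => ?_
    rw [(Finset.mem_filter.1 hp).2.symm]
    simp only [map_mul, RingHom.comp_apply]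
    ring
  intro p hp
  have h1 := key p.1 (Finset.mem_image_of_mem _ hp)
  have h2 := hu ((s.filter (fun q => q.1 = p.1)).image Prod.snd) (fun i => c (p.1, i)) ?_ p.2
    (Finset.mem_image.2 ⟨p, by simp [hp], rfl⟩)
  · exact h2
  · rw [Finset.sum_image, ← h1]
    · refine Finset.sum_congr rfl fun q hq => ?_
      rw [← (Finset.mem_filter.1 hq).2]
    · intro a ha b hb hab
      simp only [Finset.coe_filter, Set.mem_ofPred_eq] at ha hb
      exact Prod.ext (ha.2.trans hb.2.symm) hab

/-- Linear independence of Laurent series by the coefficients at the first exponents, one common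
exponent `s` being disregarded. -/
theorem linIndep_of_coeff {u : I → LaurentSeries K} (s : ℤ) (e : I → ℤ) (he : ∀ v, e v ≠ s)
    (hlt : ∀ v, ∀ j < e v, j ≠ s → (u v).coeff j = 0)
    (hli : ∀ d, LinIndep φ fun v : {v // e v = d} => (u v).coeff d) :
    LinIndep ((HahnSeries.C : K →+* LaurentSeries K).comp φ) u := by
  intro S c hS
  by_contra hne
  push Not at hne
  obtain ⟨i₀, hi₀, hci₀⟩ := hne
  -- Among the indices with nonzero coefficient take one with the smallest exponent, and read the
  -- relation in that degree. Terms with a larger exponent contribute nothing there, because `he`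
  -- keeps this degree away from `s`, where all members may have a common term.
  obtain ⟨m, hm, hmin⟩ := Finset.exists_min_image (S.filter fun i => c i ≠ 0) e
    ⟨i₀, by simp [hi₀, hci₀]⟩
  simp only [Finset.mem_filter] at hm hmin
  have h0 : ∑ i ∈ S, φ (c i) * (u i).coeff (e m) = 0 := by
    have := congrArg (fun x : LaurentSeries K => x.coeff (e m)) hS
    simpa [HahnSeries.coeff_sum, HahnSeries.C_mul_eq_smul] using this
  have h1 : ∑ i ∈ S.filter (fun i => e i = e m), φ (c i) * (u i).coeff (e m) = 0 := by
    rw [← h0]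
    refine Finset.sum_subset (Finset.filter_subset _ _) fun i hi hi' => ?_
    have hne : e i ≠ e m := by simpa [hi] using hi'
    by_cases hc : c i = 0
    · simp [hc]
    · rw [hlt i (e m) (lt_of_le_of_ne (hmin i ⟨hi, hc⟩) hne.symm) (he m), mul_zero]
  refine hm.2 (hli (e m) (S.subtype fun i => e i = e m) (fun i => c i) ?_ ⟨m, rfl⟩
    (by simpa using hm.1))
  rw [← h1, ← Finset.subtype_map, Finset.sum_map]
  rfl

end LinIndep

/-! ### Unique factorization from expansions -/

section Factor

variable {k K I : Type} [Field k] [CharZero k] [Field K] {φ : k →+* K}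

/-- Products become sums to first order: the cross terms lie in degree 2 k₀, beyond k₀. This is what
turns a multiplicative relation into a linear one. -/
theorem lead_prod_sub_one {k₀ : ℤ} (hk₀ : 0 < k₀) (s : Multiset I) {w : I → LaurentSeries K}
    {c : I → K} (h : ∀ i ∈ s, Lead (w i - 1) k₀ (c i)) :
    Lead ((s.map w).prod - 1) k₀ (s.map c).sum := by
  induction s using Multiset.induction_on with
  | empty => simpa using lead_zero k₀
  | cons a s ih =>
    have h1 := h a (by simp)
    have h2 := ih fun i hi => h i (by simp [hi])
    have h3 := (h1.add h2).add ((h1.mul h2).of_lt (by omega : k₀ < k₀ + k₀))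
    simp only [Multiset.map_cons, Multiset.prod_cons, Multiset.sum_cons]
    exact h3.congr (by ring) rfl (by ring)

theorem lead_multiset_prod (s : Multiset I) {u : I → LaurentSeries K} {o : I → ℤ} {c : I → K}
    (h : ∀ i ∈ s, Lead (u i) (o i) (c i)) :
    Lead (s.map u).prod (s.map o).sum (s.map c).prod := by
  induction s using Multiset.induction_on with
  | empty => simpa using lead_one
  | cons a s ih =>
    simp only [Multiset.map_cons, Multiset.prod_cons, Multiset.sum_cons]
    exact (h a (by simp)).mul (ih fun i hi => h i (by simp [hi]))

/-- The common part `s ∩ t` is cancelled. No element occurs in both of the truncated differences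
that remain. -/
theorem multiset_prod_cancel {u : I → K} (hu : ∀ i, u i ≠ 0) {s t : Multiset I}
    (h : (s.map u).prod = (t.map u).prod) : ((s - t).map u).prod = ((t - s).map u).prod := by
  have hs : s = (s - t) + s ∩ t := (Multiset.sub_add_inter s t).symm
  have ht : t = (t - s) + s ∩ t := by
    rw [Multiset.inter_comm]; exact (Multiset.sub_add_inter t s).symm
  have h0 : ((s ∩ t).map u).prod ≠ 0 := by
    refine Multiset.prod_ne_zero ?_
    simp only [Multiset.mem_map, not_exists, not_and]
    exact fun i _ => hu i
  have hst : ((s - t + s ∩ t).map u).prod = ((t - s + s ∩ t).map u).prod := by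
    rw [← hs, ← ht, h]
  rw [Multiset.map_add, Multiset.map_add, Multiset.prod_add, Multiset.prod_add] at hst
  exact mul_right_cancel₀ h0 hst

/-- Laurent series `c T ^ o (1 + ρ T ^ e + ⋯)` are multiplicatively independent if for each `e` the
coefficients `ρ` are linearly independent. -/
theorem multiset_eq_of_prod_eq {u : I → LaurentSeries K} {o e : I → ℤ} {c ρ : I → K}
    (hc : ∀ i, c i ≠ 0) (he : ∀ i, 0 < e i)
    (hu : ∀ i, Lead (u i - HahnSeries.single (o i) (c i)) (o i + e i) (c i * ρ i))
    (hli : ∀ d, LinIndep φ fun v : {v // e v = d} => ρ v) {s t : Multiset I}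
    (h : (s.map u).prod = (t.map u).prod) : s = t := by
  have hu1 : ∀ i, Lead (u i) (o i) (c i) := fun i =>
    ((lead_single (o i) (c i)).add ((hu i).of_lt (by linarith [he i] : o i < o i + e i))).congr
      (by ring) rfl (by ring)
  have hu0 : ∀ i, u i ≠ 0 := fun i => (hu1 i).ne_zero (hc i)
  have h2 := multiset_prod_cancel hu0 h
  -- the normalized series
  set w : I → LaurentSeries K := fun i => u i / HahnSeries.single (o i) (c i) with hw
  have hs0 : ∀ i, (HahnSeries.single (o i) (c i) : LaurentSeries K) ≠ 0 := fun i =>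
    HahnSeries.single_ne_zero (hc i)
  have hw1 : ∀ i, Lead (w i - 1) (e i) (ρ i) := fun i =>
    ((hu i).div (lead_single (o i) (c i)) (hc i)).congr
      (by rw [hw, sub_div, div_self (hs0 i)]) (by ring) (by field_simp [hc i])
  have hprod : ∀ r : Multiset I, (r.map u).prod =
      HahnSeries.single (r.map o).sum (r.map c).prod * (r.map w).prod := by
    intro r
    induction r using Multiset.induction_on with
    | empty => simp
    | cons a r ih =>
      simp only [Multiset.map_cons, Multiset.prod_cons, Multiset.sum_cons, ih]
      rw [← HahnSeries.single_mul_single]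
      simp only [hw]
      field_simp [hs0 a]
  have hcp : ∀ r : Multiset I, (r.map c).prod ≠ 0 := by
    intro r
    refine Multiset.prod_ne_zero ?_
    simp only [Multiset.mem_map, not_exists, not_and]
    exact fun i _ => hc i
  -- The leading monomials of the two products agree and can be divided out, which leaves series
  -- with constant term 1.
  have h3 : ((s - t).map w).prod = ((t - s).map w).prod := by
    have hl := lead_multiset_prod (s - t) fun i _ => hu1 i
    have hl' := lead_multiset_prod (t - s) fun i _ => hu1 i
    rw [h2] at hl
    obtain ⟨h4, h5⟩ := hl.unique hl' (hcp _) (hcp _)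
    rw [hprod, hprod, h4, h5] at h2
    exact mul_left_cancel₀ (HahnSeries.single_ne_zero (hcp _)) h2
  by_contra hne
  -- the minimal exponent
  have hnz : (s - t) + (t - s) ≠ 0 := by
    intro h0
    obtain ⟨h4, h5⟩ := add_eq_zero.1 h0
    exact hne (le_antisymm (tsub_eq_zero_iff_le.1 h4) (tsub_eq_zero_iff_le.1 h5))
  obtain ⟨m, hm, hmin⟩ := Finset.exists_min_image ((s - t) + (t - s)).toFinset e
    (by rwa [Multiset.toFinset_nonempty])
  simp only [Multiset.mem_toFinset] at hm hmin
  have hL : ∀ r : Multiset I, r ≤ (s - t) + (t - s) → Lead ((r.map w).prod - 1) (e m)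
      (r.map fun i => if e i = e m then ρ i else 0).sum := by
    intro r hr
    refine lead_prod_sub_one (he m) r fun i hi => ?_
    split_ifs with hi'
    · exact hi' ▸ hw1 i
    · exact (hw1 i).of_lt (lt_of_le_of_ne (hmin i (Multiset.mem_of_le hr hi)) (Ne.symm hi'))
  have h6 := (hL (s - t) (Multiset.le_add_right _ _)).2
  have h7 := (hL (t - s) (Multiset.le_add_left _ _)).2
  rw [h3, h7] at h6
  have hsum : ∀ r : Multiset I, r ≤ (s - t) + (t - s) →
      (r.map fun i => if e i = e m then ρ i else 0).sum =
      ∑ i ∈ ((s - t) + (t - s)).toFinset,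
        (Multiset.count i r : K) * if e i = e m then ρ i else 0 := by
    intro r hr
    rw [Finset.sum_multiset_map_count]
    simp only [nsmul_eq_mul]
    refine Finset.sum_subset (Multiset.toFinset_subset.2 (Multiset.subset_of_le hr)) ?_
    intro i _ hi
    rw [Multiset.mem_toFinset] at hi
    simp [Multiset.count_eq_zero_of_notMem hi]
  rw [hsum _ (Multiset.le_add_right _ _), hsum _ (Multiset.le_add_left _ _), ← sub_eq_zero,
    ← Finset.sum_sub_distrib] at h6
  set S := ((s - t) + (t - s)).toFinset with hS
  -- The lowest terms give a linear relation whose coefficients are differences of multiplicities.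
  -- In characteristic 0 it forces `m` to occur equally often in `t - s` and `s - t`, whereas it
  -- occurs in exactly one of them.
  have h8 := hli (e m) (S.subtype fun i => e i = e m)
    (fun i => (Multiset.count i.1 (t - s) : k) - (Multiset.count i.1 (s - t) : k)) ?_ ⟨m, rfl⟩
    (by simpa [hS] using hm)
  · have h9 : Multiset.count m (t - s) = Multiset.count m (s - t) := by
      exact_mod_cast sub_eq_zero.1 h8
    rw [Multiset.count_sub, Multiset.count_sub] at h9
    have h10 : 0 < Multiset.count m ((s - t) + (t - s)) := Multiset.count_pos.2 hm
    rw [Multiset.count_add, Multiset.count_sub, Multiset.count_sub] at h10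
    omega
  · have : ∑ i ∈ (S.subtype fun i => e i = e m).map (Function.Embedding.subtype _),
        ((Multiset.count i (t - s) : K) - (Multiset.count i (s - t) : K)) * ρ i = 0 := by
      rw [Finset.subtype_map, Finset.sum_filter]
      refine Eq.trans (Finset.sum_congr rfl fun i _ => ?_) h6
      split_ifs
      · ring
      · ring
    rw [Finset.sum_map] at this
    simpa using this

end Factor

end SuperFactor
end

/-! ### Type A: linear independence of quotients of alternants -/

noncomputable section
open scoped Classical
namespace SuperFactor

/-! ### Alternants of the symmetric group -/

section Alternant

variable {K : Type} [Field K]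

theorem single_neg_one_zpow (z : ℤ) :
    (HahnSeries.single (-1 : ℤ) (1 : K) : LaurentSeries K) ^ z = HahnSeries.single (-z) 1 := by
  have hpow : ∀ n : ℕ, (HahnSeries.single (-1 : ℤ) (1 : K) : LaurentSeries K) ^ n =
      HahnSeries.single (-(n : ℤ)) 1 := by
    intro n
    rw [HahnSeries.single_pow]; simp
  obtain ⟨n, rfl | rfl⟩ := z.eq_nat_or_neg
  · rw [zpow_natCast, hpow]
  · rw [zpow_neg, zpow_natCast, hpow]
    refine inv_eq_of_mul_eq_one_right ?_
    rw [HahnSeries.single_mul_single]; simp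

/-- The alternant `det (x_p ^ a_q)`. -/
def alt {N : ℕ} (x : Fin N → K) (a : Fin N → ℤ) : K := (Matrix.of fun p q => x p ^ a q).det

/-- The variables `x` with a new variable in front that dominates them. -/
def addVar {N : ℕ} (x : Fin N → K) : Fin (N + 1) → LaurentSeries K :=
  Fin.cons (HahnSeries.single (-1) 1) fun p => HahnSeries.C (x p)

/-- Decrease the entry `a i` by `k`. -/
def shift {N : ℕ} (a : Fin N → ℤ) (i : Fin N) (k : ℤ) : Fin N → ℤ :=
  Function.update a i (a i - k)

/-- Laplace expansion along the row of the new variable T⁻¹. Since this variable is T⁻¹, the largest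
exponent gives the lowest degree in T. -/
theorem alt_addVar {N : ℕ} (x : Fin N → K) (a : Fin (N + 1) → ℤ) :
    alt (addVar x) a = ∑ q : Fin (N + 1),
      HahnSeries.single (-(a q)) ((-1) ^ (q : ℕ) * alt x (a ∘ q.succAbove)) := by
  rw [alt, Matrix.det_succ_row_zero]
  refine Finset.sum_congr rfl fun q _ => ?_
  have h1 : ((Matrix.of fun p q => addVar x p ^ a q).submatrix Fin.succ q.succAbove).det =
      HahnSeries.C (alt x (a ∘ q.succAbove)) := by
    rw [alt, RingHom.map_det]
    congr 1
    ext1 p r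
    simp [addVar]
  rw [h1]
  simp only [Matrix.of_apply, addVar, Fin.cons_zero, single_neg_one_zpow]
  have h2 : ((-1 : LaurentSeries K) ^ (q : ℕ)) = HahnSeries.C ((-1) ^ (q : ℕ)) := by
    rw [map_pow, map_neg, map_one]
  rw [h2]
  simp only [HahnSeries.C_apply, HahnSeries.single_mul_single]
  simp

theorem lead_alt {N : ℕ} (x : Fin N → K) {a : Fin (N + 1) → ℤ} (ha : ∀ q : Fin N, a q.succ < a 0) :
    Lead (alt (addVar x) a) (-a 0) (alt x (Fin.tail a)) := by
  rw [alt_addVar, Fin.sum_univ_succ]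
  have h1 := lead_single (-(a 0)) ((-1) ^ ((0 : Fin (N + 1)) : ℕ) * alt x (a ∘ Fin.succAbove 0))
  have h2 : Lead (∑ q : Fin N, HahnSeries.single (-(a q.succ))
      ((-1) ^ (q.succ : ℕ) * alt x (a ∘ q.succ.succAbove))) (-(a 0)) (∑ q : Fin N, (0 : K)) :=
    Lead.sum _ fun q _ => (lead_single _ _).of_lt (by linarith [ha q])
  refine (h1.add h2).congr rfl rfl ?_
  simp only [Fin.val_zero, pow_zero, one_mul, Finset.sum_const_zero, add_zero]
  congr 1

/-- The columns 0 and 1 of the Laplace expansion are split off. Deleting column 1 leaves the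
exponents a 0, a 2, a 3, …, which form the tail with its first entry replaced by a 0. -/
theorem lead_alt_rest {N : ℕ} (x : Fin (N + 1) → K) (a : Fin (N + 2) → ℤ) {e : ℤ}
    (h : ∀ q : Fin N, e < -a q.succ.succ) :
    Lead (alt (addVar x) a - HahnSeries.single (-(a 0)) (alt x (Fin.tail a))
      + HahnSeries.single (-(a 1)) (alt x (Function.update (Fin.tail a) 0 (a 0)))) e 0 := by
  rw [alt_addVar, Fin.sum_univ_succ, Fin.sum_univ_succ]
  have h2 : Lead (∑ q : Fin N, HahnSeries.single (-(a q.succ.succ))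
      ((-1) ^ (q.succ.succ : ℕ) * alt x (a ∘ q.succ.succ.succAbove))) e (∑ q : Fin N, (0 : K)) :=
    Lead.sum _ fun q _ => (lead_single _ _).of_lt (h q)
  rw [Finset.sum_const_zero] at h2
  refine h2.congr ?_ rfl rfl
  have h3 : a ∘ Fin.succAbove (0 : Fin (N + 1)).succ = Function.update (Fin.tail a) 0 (a 0) := by
    ext q
    refine Fin.cases ?_ (fun q => ?_) q
    · simp
    · simp [Function.update_of_ne, Fin.tail]
  have h4 : a ∘ Fin.succAbove 0 = Fin.tail a := by
    ext q; simp [Fin.tail]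
  rw [h3, h4]
  have h5 : ((-1 : K) ^ ((0 : Fin (N + 1)).succ : ℕ)) = -1 := by simp
  rw [h5, neg_one_mul, HahnSeries.single_neg, Fin.succ_zero_eq_one]
  simp only [Fin.val_zero, pow_zero, one_mul]
  ring

theorem shift_zero_zero {N : ℕ} (a : Fin (N + 1) → ℤ) (k : ℤ) : shift a 0 k 0 = a 0 - k := by
  simp [shift]

theorem shift_zero_succ {N : ℕ} (a : Fin (N + 1) → ℤ) (k : ℤ) (q : Fin N) :
    shift a 0 k q.succ = a q.succ := by
  simp [shift]

theorem shift_succ_zero {N : ℕ} (a : Fin (N + 1) → ℤ) (k : ℤ) (j : Fin N) :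
    shift a j.succ k 0 = a 0 := by
  simp [shift, Function.update_of_ne (Fin.succ_ne_zero j).symm]

theorem tail_shift_zero {N : ℕ} (a : Fin (N + 1) → ℤ) (k : ℤ) :
    Fin.tail (shift a 0 k) = Fin.tail a := by
  ext q; simp [Fin.tail, shift]

theorem tail_shift_succ {N : ℕ} (a : Fin (N + 1) → ℤ) (k : ℤ) (j : Fin N) :
    Fin.tail (shift a j.succ k) = shift (Fin.tail a) j k := by
  ext q
  by_cases h : q = j
  · subst h; simp [Fin.tail, shift]
  · simp [Fin.tail, shift, h]

theorem shift_le {N : ℕ} (a : Fin N → ℤ) {k : ℤ} (hk : 0 ≤ k) (i q : Fin N) :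
    shift a i k q ≤ a q := by
  by_cases h : q = i
  · subst h; simp [shift, hk]
  · simp [shift, h]

theorem strictAnti_tail {N : ℕ} {a : Fin (N + 1) → ℤ} (ha : StrictAnti a) :
    StrictAnti (Fin.tail a) := fun _ _ h => ha (Fin.succ_lt_succ_iff.2 h)

theorem strictAnti_shift_zero {N : ℕ} {a : Fin (N + 1) → ℤ} (ha : StrictAnti a) {d : ℤ}
    (hd : 0 ≤ d) : StrictAnti (shift a 0 (-d)) := by
  intro p q h
  induction q using Fin.cases with
  | zero => exact absurd h (Fin.not_lt_zero _)
  | succ q =>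
    rw [shift_zero_succ]
    induction p using Fin.cases with
    | zero => rw [shift_zero_zero]; linarith [ha h]
    | succ p => rw [shift_zero_succ]; exact ha h

/-- The quotient of alternants `alt (a - k e_i) / alt a`. -/
def altQuot {N : ℕ} (x : Fin N → K) (i : Fin N) (k : ℤ) (a : Fin N → ℤ) : K :=
  alt x (shift a i k) / alt x a

/-- The coefficient of `T ^ d` in the expansion of `altQuot`, for a dominating variable `T⁻¹` with
exponent `a 0 + d`. -/
def altCoeff {N : ℕ} (x : Fin (N + 1) → K) (i : Fin (N + 1)) (k d : ℤ) (a : Fin (N + 1) → ℤ) : K :=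
  if i = 0 then altQuot x 0 (-d) a * altQuot x 0 k a
  else altQuot x 0 (-d) a * (altQuot x i k a - altQuot x i k (shift a 0 (-d)))

variable {N : ℕ} {x : Fin (N + 1) → K}

theorem update_tail_eq_shift (a : Fin (N + 2) → ℤ) (k : ℤ) :
    Function.update (Fin.tail a) 0 (a 0 - k) = shift (Fin.tail a) 0 (k - (a 0 - a 1)) := by
  rw [shift]; congr 1; simp only [Fin.tail, Fin.succ_zero_eq_one]; ring

theorem succ_succ_lt_one {a : Fin (N + 2) → ℤ} (ha : StrictAnti a) (q : Fin N) :
    a q.succ.succ < a 1 := ha (by rw [← Fin.succ_zero_eq_one]; exact Fin.succ_lt_succ_iff.2 (Fin.succ_pos q))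

/-- After subtraction of T^k times the denominator, the terms of degree k - a 0 cancel. The next one
is the second term of the numerator, in degree -a 1, with exponents a 0 - k, a 2, …; the second term
of the denominator is delayed by T^k. The first exponent is a 1 diminished by k minus the gap a 0 -
a 1. -/
theorem lead_altQuot_zero_pos (hx : ∀ a : Fin (N + 1) → ℤ, StrictAnti a → alt x a ≠ 0)
    {a : Fin (N + 2) → ℤ} (ha : StrictAnti a) {k : ℤ} (hk : 0 < k) :
    Lead (altQuot (addVar x) 0 k a - HahnSeries.single k 1) (a 0 - a 1)
      (-altQuot x 0 (k - (a 0 - a 1)) (Fin.tail a)) := by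
  have hA := lead_alt x (a := a) (fun q => ha (Fin.succ_pos q))
  have hA0 := hx _ (strictAnti_tail ha)
  have h1 := lead_alt_rest x a (e := -a 1) (fun q => by linarith [succ_succ_lt_one ha q])
  have h2 := lead_alt_rest x (shift a 0 k) (e := -a 1)
    (fun q => by rw [shift_zero_succ]; linarith [succ_succ_lt_one ha q])
  have e1 : shift a 0 k 1 = a 1 := shift_zero_succ a k 0
  rw [tail_shift_zero, shift_zero_zero, e1, update_tail_eq_shift] at h2
  have h3 := ((lead_single k (1 : K)).mul h1).of_lt (by linarith : -a 1 < k + -a 1)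
  have h4 := lead_single (-a 1) (alt x (shift (Fin.tail a) 0 (k - (a 0 - a 1))))
  have h5 := (lead_single (k - a 1) (alt x (Function.update (Fin.tail a) 0 (a 0)))).of_lt
    (by linarith : -a 1 < k - a 1)
  have h6 := (((h2.sub h3).sub h4).add h5).div hA hA0
  refine h6.congr ?_ (by ring) ?_
  · rw [altQuot, eq_sub_iff_add_eq, div_add' _ _ _ (hA.ne_zero hA0)]
    congr 1
    simp only [mul_add, mul_sub, HahnSeries.single_mul_single, one_mul]
    have : -(a 0 - k) = k + -a 0 := by ring
    rw [this, sub_eq_add_neg k (a 1)]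
    ring
  · rw [altQuot]; ring

/-- As for positive `k`, but now the factor T^k advances the second term of the denominator, which
therefore comes before that of the numerator. -/
theorem lead_altQuot_zero_neg (hx : ∀ a : Fin (N + 1) → ℤ, StrictAnti a → alt x a ≠ 0)
    {a : Fin (N + 2) → ℤ} (ha : StrictAnti a) {k : ℤ} (hk : k < 0) :
    Lead (altQuot (addVar x) 0 k a - HahnSeries.single k 1) (a 0 - a 1 + k)
      (altQuot x 0 (-(a 0 - a 1)) (Fin.tail a)) := by
  have hA := lead_alt x (a := a) (fun q => ha (Fin.succ_pos q))
  have hA0 := hx _ (strictAnti_tail ha)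
  have h1 := lead_alt_rest x a (e := -a 1) (fun q => by linarith [succ_succ_lt_one ha q])
  have h2 := lead_alt_rest x (shift a 0 k) (e := k - a 1)
    (fun q => by rw [shift_zero_succ]; linarith [succ_succ_lt_one ha q])
  have e1 : shift a 0 k 1 = a 1 := shift_zero_succ a k 0
  have e2 := update_tail_eq_shift a 0
  rw [sub_zero, zero_sub] at e2
  rw [tail_shift_zero, shift_zero_zero, e1] at h2
  rw [e2] at h1
  have h3 := (lead_single k (1 : K)).mul h1
  have h4 := (lead_single (-a 1) (alt x (Function.update (Fin.tail a) 0 (a 0 - k)))).of_lt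
    (by linarith : k - a 1 < -a 1)
  have h5 := lead_single (k - a 1) (alt x (shift (Fin.tail a) 0 (-(a 0 - a 1))))
  have h6 := (((h2.sub h3).sub h4).add h5).div hA hA0
  refine h6.congr ?_ (by ring) ?_
  · rw [altQuot, eq_sub_iff_add_eq, div_add' _ _ _ (hA.ne_zero hA0)]
    congr 1
    simp only [mul_add, mul_sub, HahnSeries.single_mul_single, one_mul]
    have : -(a 0 - k) = k + -a 0 := by ring
    rw [this, sub_eq_add_neg k (a 1)]
    ring
  · rw [altQuot]; ring

/-- Multiply the expansions T^{-d} + ⋯ and T^k - q T^n + ⋯ of the two factors, where n is the gap a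
0 - a 1. Besides T^{k-d} the lowest product is -q T^{n-d}, since all others gain at least k or n. -/
theorem lead_altCoeff_zero (hx : ∀ a : Fin (N + 1) → ℤ, StrictAnti a → alt x a ≠ 0)
    {a : Fin (N + 2) → ℤ} (ha : StrictAnti a) {k d : ℤ} (hk : 0 < k) (hd : 0 < d) :
    Lead (altCoeff (addVar x) 0 k d a - HahnSeries.single (k - d) 1) (a 0 - a 1 - d)
      (-altQuot x 0 (k - (a 0 - a 1)) (Fin.tail a)) := by
  have h1 := lead_altQuot_zero_pos hx ha hk
  have h2 := lead_altQuot_zero_neg hx ha (neg_lt_zero.2 hd)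
  have hn : a 1 < a 0 := ha (by simp)
  have h3 := (lead_single (-d) (1 : K)).mul h1
  have h4 := ((lead_single k (1 : K)).mul h2).of_lt
    (by linarith : -d + (a 0 - a 1) < k + (a 0 - a 1 + -d))
  have h5 := (h2.mul h1).of_lt
    (by linarith : -d + (a 0 - a 1) < (a 0 - a 1 + -d) + (a 0 - a 1))
  refine ((h3.add h4).add h5).congr ?_ (by ring) (by ring)
  rw [altCoeff, if_pos rfl]
  have : (HahnSeries.single (k - d) (1 : K) : LaurentSeries K) =
      HahnSeries.single k 1 * HahnSeries.single (-d) 1 := by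
    rw [HahnSeries.single_mul_single, one_mul, sub_eq_add_neg]
  rw [this]; ring

/-- The term of the dominating exponent cancels in numerator minus constant times denominator. What
is left in degree -a 1 are the second Laplace terms of both, and their combination is `altCoeff`. -/
theorem lead_altQuot_succ (hx : ∀ a : Fin (N + 1) → ℤ, StrictAnti a → alt x a ≠ 0)
    {a : Fin (N + 2) → ℤ} (ha : StrictAnti a) {k : ℤ} (hk : 0 < k) (j : Fin (N + 1)) :
    Lead (altQuot (addVar x) j.succ k a - HahnSeries.C (altQuot x j k (Fin.tail a))) (a 0 - a 1)
      (altCoeff x j k (a 0 - a 1) (Fin.tail a)) := by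
  have hA := lead_alt x (a := a) (fun q => ha (Fin.succ_pos q))
  have hA0 := hx _ (strictAnti_tail ha)
  have hn : a 1 < a 0 := ha (by simp)
  have h1 := lead_alt_rest x a (e := -a 1) (fun q => by linarith [succ_succ_lt_one ha q])
  have h2 := lead_alt_rest x (shift a j.succ k) (e := -a 1) (fun q => by
    linarith [succ_succ_lt_one ha q, shift_le a hk.le j.succ q.succ.succ])
  have e2 := update_tail_eq_shift a 0
  rw [sub_zero, zero_sub] at e2
  rw [tail_shift_succ, shift_succ_zero] at h2
  rw [e2] at h1
  have h3 := (lead_C (altQuot x j k (Fin.tail a))).mul h1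
  have hsplit : altQuot (addVar x) j.succ k a - HahnSeries.C (altQuot x j k (Fin.tail a)) =
      (alt (addVar x) (shift a j.succ k) -
        HahnSeries.C (altQuot x j k (Fin.tail a)) * alt (addVar x) a) / alt (addVar x) a := by
    rw [altQuot, sub_div, mul_div_cancel_right₀ _ (hA.ne_zero hA0)]
  rw [hsplit]
  have hf : altQuot x j k (Fin.tail a) * alt x (Fin.tail a) = alt x (shift (Fin.tail a) j k) := by
    rw [altQuot, div_mul_cancel₀ _ hA0]
  have hC : ∀ (e : ℤ) (c c' : K), (HahnSeries.C c : LaurentSeries K) * HahnSeries.single e c' =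
      HahnSeries.single e (c * c') := by
    intro e c c'
    rw [HahnSeries.C_apply, HahnSeries.single_mul_single, zero_add]
  have h5 := lead_single (-a 1)
    (altQuot x j k (Fin.tail a) * alt x (shift (Fin.tail a) 0 (-(a 0 - a 1))))
  have hA1 : alt x (shift (Fin.tail a) 0 (-(a 0 - a 1))) ≠ 0 :=
    hx _ (strictAnti_shift_zero (strictAnti_tail ha) (by linarith))
  -- For `j = 0` the shift lowers a 1 itself and so moves the second term of the numerator beyond
  -- degree -a 1; only the denominator contributes. This is the origin of the case distinction in
  -- `altCoeff`.
  by_cases hj : j = 0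
  · subst hj
    have e1 : shift a (Fin.succ 0) k 1 = a 1 - k := by simp [shift]
    rw [e1] at h2
    have h4 := (lead_single (-(a 1 - k))
      (alt x (Function.update (shift (Fin.tail a) 0 k) 0 (a 0)))).of_lt
      (by linarith : -a 1 < -(a 1 - k))
    refine ((((h2.sub (h3.congr rfl (zero_add _) rfl)).sub h4).add h5).div hA hA0).congr ?_
      (by ring) ?_
    · congr 1
      rw [mul_add, mul_sub, hC, hC, hf]
      ring
    · rw [altCoeff, if_pos rfl, altQuot, altQuot]
      ring
  · have e1 : shift a j.succ k 1 = a 1 := by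
      obtain ⟨j, rfl⟩ := Fin.exists_succ_eq.2 hj
      rw [shift, Function.update_of_ne]
      rw [← Fin.succ_zero_eq_one]
      exact fun h => Fin.succ_ne_zero _ (Fin.succ_inj.1 h).symm
    rw [e1] at h2
    have e3 : Function.update (shift (Fin.tail a) j k) 0 (a 0) =
        shift (shift (Fin.tail a) 0 (-(a 0 - a 1))) j k := by
      rw [← e2, shift, shift, Function.update_comm (Ne.symm hj), Function.update_of_ne hj]
    rw [e3] at h2
    have h4 := lead_single (-a 1) (alt x (shift (shift (Fin.tail a) 0 (-(a 0 - a 1))) j k))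
    refine ((((h2.sub (h3.congr rfl (zero_add _) rfl)).sub h4).add h5).div hA hA0).congr ?_
      (by ring) ?_
    · congr 1
      rw [mul_add, mul_sub, hC, hC, hf]
      ring
    · rw [altCoeff, if_neg hj, altQuot, altQuot, altQuot]
      field_simp
      ring

/-- The constant terms of the two quotients in the difference coincide, because the tail is
unaffected by a shift of the first entry. The gap of the shifted sequence is larger by `d`, so only
the first quotient contributes to the leading term, and `altCoeff` reproduces itself with one
variable fewer. -/
theorem lead_altCoeff_succ (hx : ∀ a : Fin (N + 1) → ℤ, StrictAnti a → alt x a ≠ 0)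
    {a : Fin (N + 2) → ℤ} (ha : StrictAnti a) {k d : ℤ} (hk : 0 < k) (hd : 0 < d)
    (j : Fin (N + 1)) :
    Lead (altCoeff (addVar x) j.succ k d a) (a 0 - a 1 - d)
      (altCoeff x j k (a 0 - a 1) (Fin.tail a)) := by
  have ha' := strictAnti_shift_zero ha hd.le
  have h1 := lead_altQuot_succ hx ha hk j
  have h2 := lead_altQuot_succ hx ha' hk j
  have e1 : shift a 0 (-d) 1 = a 1 := shift_zero_succ a (-d) 0
  rw [tail_shift_zero, shift_zero_zero, e1] at h2
  have hA := lead_alt x (a := a) (fun q => ha (Fin.succ_pos q))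
  have hA' := lead_alt x (a := shift a 0 (-d)) (fun q => ha' (Fin.succ_pos q))
  have hA0 := hx _ (strictAnti_tail ha)
  rw [tail_shift_zero, shift_zero_zero] at hA'
  have h3 := h1.sub (h2.of_lt (by linarith : a 0 - a 1 < a 0 - -d - a 1))
  refine ((hA'.div hA hA0).mul h3).congr ?_ (by ring) ?_
  · rw [altCoeff, if_neg (Fin.succ_ne_zero j), ← altQuot]
    ring
  · rw [div_self hA0]; ring

/-- Strictly decreasing sequences with last entry `0`, such that the entries are still distinct
after the decrease of the entry `i` by `k`. -/
abbrev AltIdx (N : ℕ) (i : Fin (N + 1)) (k : ℤ) : Type :=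
  {a : Fin (N + 1) → ℤ // StrictAnti a ∧ a (Fin.last N) = 0 ∧ Function.Injective (shift a i k)}

theorem injective_shift_tail {a : Fin (N + 2) → ℤ} {j : Fin (N + 1)} {k : ℤ}
    (h : Function.Injective (shift a j.succ k)) : Function.Injective (shift (Fin.tail a) j k) := by
  rw [← tail_shift_succ]
  exact fun p q hpq => Fin.succ_injective _ (h hpq)

/-- The sequence in question is a 0 - k, a 2, a 3, …, a subsequence of the shifted one. -/
theorem injective_shift_zero_tail {a : Fin (N + 2) → ℤ} {k : ℤ}
    (h : Function.Injective (shift a 0 k)) :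
    Function.Injective (shift (Fin.tail a) 0 (k - (a 0 - a 1))) := by
  have e : shift (Fin.tail a) 0 (k - (a 0 - a 1)) =
      fun q : Fin (N + 1) => shift a 0 k (Fin.succAbove 1 q) := by
    ext q
    induction q using Fin.cases with
    | zero => simp [shift, Fin.tail]; ring
    | succ q =>
      have : Fin.succAbove (1 : Fin (N + 2)) q.succ = q.succ.succ := by
        rw [← Fin.succ_zero_eq_one, Fin.succ_succAbove_succ]; simp
      simp only [this, shift_zero_succ, Fin.tail]
  rw [e]
  exact h.comp Fin.succAbove_right_injective

theorem injective_shift_neg {a : Fin (N + 1) → ℤ} (ha : StrictAnti a) {d : ℤ} (hd : 0 ≤ d) :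
    Function.Injective (shift a 0 (-d)) := (strictAnti_shift_zero ha hd).injective

theorem ext_of_tail {a a' : Fin (N + 2) → ℤ} (h : Fin.tail a = Fin.tail a')
    (h0 : a 0 - a 1 = a' 0 - a' 1) : a = a' := by
  have h1 : a 1 = a' 1 := congrFun h 0
  ext q
  induction q using Fin.cases with
  | zero => linarith
  | succ q => exact congrFun h q

/-- The alternants in `x` are nonzero, and their quotients linearly independent. -/
structure GenericVars {k₀ K : Type} [Field k₀] [Field K] (φ : k₀ →+* K) {N : ℕ}
    (x : Fin (N + 1) → K) : Prop where
  ne_zero : ∀ p, x p ≠ 0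
  alt_ne_zero : ∀ a, StrictAnti a → alt x a ≠ 0
  -- Both signs of `k` are needed: the expansion of `altQuot x 0 k` leads to an index diminished by
  -- the gap. For `i ≠ 0` the family `quot` reduces to `coeff`, and `coeff` to itself; for `i = 0`
  -- both reduce to `quot_zero`. So the three families close up under induction.
  quot_zero : ∀ k, k ≠ 0 → LinIndep φ fun a : AltIdx N 0 k => altQuot x 0 k a.1
  quot : ∀ i k, 0 < k → LinIndep φ fun a : AltIdx N i k => altQuot x i k a.1
  coeff : ∀ i k d, 0 < k → 0 < d → LinIndep φ fun a : AltIdx N i k => altCoeff x i k d a.1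

variable {k₀ : Type} [Field k₀] {φ : k₀ →+* K}

/-- The sequences are normalized to end in 0, so the last variable may be set equal to 1. With one
variable there is at most one sequence, and every quotient is 1. -/
theorem genericVars_one : GenericVars (RingHom.id k₀) (fun _ : Fin 1 => (1 : k₀)) := by
  have hsub : ∀ i k, Subsingleton (AltIdx 0 i k) := fun i k => ⟨fun a b => Subtype.ext (by
    ext q
    rw [show q = Fin.last 0 from Subsingleton.elim (α := Fin 1) _ _, a.2.2.1, b.2.2.1])⟩
  have halt : ∀ a : Fin 1 → ℤ, alt (fun _ : Fin 1 => (1 : k₀)) a = 1 := by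
    intro a; simp [alt]
  refine ⟨fun _ => one_ne_zero, fun a _ => by rw [halt]; exact one_ne_zero, fun k _ => ?_,
    fun i k _ => ?_, fun i k d _ _ => ?_⟩
  · have := hsub 0 k
    exact linIndep_of_subsingleton fun a => by simp [altQuot, halt]
  · have := hsub i k
    exact linIndep_of_subsingleton fun a => by simp [altQuot, halt]
  · have := hsub i k
    refine linIndep_of_subsingleton fun a => ?_
    have hi : i = 0 := Subsingleton.elim (α := Fin 1) _ _
    simp [altCoeff, altQuot, halt, hi]

/-- For a given gap a 0 - a 1 the sequence is determined by its tail, and the coefficient next to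
the common term T^k is, up to sign, a quotient of alternants of that tail. For `k > 0` the
injectivity required in `AltIdx` excludes a gap equal to `k`, where this coefficient would merge
with the common term. -/
theorem quot_zero_addVar (h : GenericVars φ x) {k : ℤ} (hk : k ≠ 0) :
    LinIndep ((HahnSeries.C : K →+* LaurentSeries K).comp φ)
      fun a : AltIdx (N + 1) 0 k => altQuot (addVar x) 0 k a.1 := by
  rcases lt_or_gt_of_ne hk with hk | hk
  · have hl := fun a : AltIdx (N + 1) 0 k => lead_altQuot_zero_neg h.alt_ne_zero a.2.1 hk
    have hn : ∀ a : AltIdx (N + 1) 0 k, a.1 1 < a.1 0 := fun a => a.2.1 (by simp)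
    refine linIndep_of_coeff k (fun a => a.1 0 - a.1 1 + k)
      (fun a => by have := hn a; omega) (fun a j hj hjk => ?_) fun d => ?_
    · have := (hl a).1 j hj
      rwa [HahnSeries.coeff_sub, HahnSeries.coeff_single_of_ne hjk, sub_zero] at this
    · by_cases hd : 0 < d - k
      · refine ((h.quot_zero (-(d - k)) (by omega)).comp
          (f := fun a : {v : AltIdx (N + 1) 0 k // v.1 0 - v.1 1 + k = d} =>
            (⟨Fin.tail a.1.1, strictAnti_tail a.1.2.1, a.1.2.2.1,
              injective_shift_neg (strictAnti_tail a.1.2.1) hd.le⟩ :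
              AltIdx N 0 (-(d - k)))) ?_).congr ?_
        · intro a b hab
          refine Subtype.ext (Subtype.ext (ext_of_tail (congrArg Subtype.val hab) ?_))
          have := a.2; have := b.2; omega
        · rintro ⟨a, rfl⟩
          have h1 := (hl a).2
          rw [HahnSeries.coeff_sub, HahnSeries.coeff_single_of_ne
            (by have := hn a; omega), sub_zero] at h1
          simp only [Function.comp, h1]
          congr 1; ring
      · have : IsEmpty {v : AltIdx (N + 1) 0 k // v.1 0 - v.1 1 + k = d} :=
          ⟨fun a => by have := hn a.1; have := a.2; omega⟩
        exact linIndep_of_subsingleton fun a => isEmptyElim a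
  · have hl := fun a : AltIdx (N + 1) 0 k => lead_altQuot_zero_pos h.alt_ne_zero a.2.1 hk
    have hn : ∀ a : AltIdx (N + 1) 0 k, a.1 0 - a.1 1 ≠ k := fun a he => by
      have h1 := @a.2.2.2 0 1 (by
        rw [shift_zero_zero, ← Fin.succ_zero_eq_one, shift_zero_succ, Fin.succ_zero_eq_one]; omega)
      simp at h1
    refine linIndep_of_coeff k (fun a => a.1 0 - a.1 1) hn (fun a j hj hjk => ?_) fun d => ?_
    · have := (hl a).1 j hj
      rwa [HahnSeries.coeff_sub, HahnSeries.coeff_single_of_ne hjk, sub_zero] at this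
    · by_cases hd : k - d = 0
      · have : IsEmpty {v : AltIdx (N + 1) 0 k // v.1 0 - v.1 1 = d} :=
          ⟨fun a => hn a.1 (by have := a.2; omega)⟩
        exact linIndep_of_subsingleton fun a => isEmptyElim a
      · refine ((h.quot_zero (k - d) hd).neg.comp
          (f := fun a : {v : AltIdx (N + 1) 0 k // v.1 0 - v.1 1 = d} =>
            (⟨Fin.tail a.1.1, strictAnti_tail a.1.2.1, a.1.2.2.1,
              by have h2 := injective_shift_zero_tail a.1.2.2.2
                 rwa [a.2] at h2⟩ : AltIdx N 0 (k - d))) ?_).congr ?_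
        · intro a b hab
          refine Subtype.ext (Subtype.ext (ext_of_tail (congrArg Subtype.val hab) ?_))
          have := a.2; have := b.2; omega
        · rintro ⟨a, rfl⟩
          have h1 := (hl a).2
          rw [HahnSeries.coeff_sub, HahnSeries.coeff_single_of_ne (hn a), sub_zero] at h1
          simp only [Function.comp, h1]

theorem coeff_zero_addVar (h : GenericVars φ x) {k d : ℤ} (hk : 0 < k) (hd : 0 < d) :
    LinIndep ((HahnSeries.C : K →+* LaurentSeries K).comp φ)
      fun a : AltIdx (N + 1) 0 k => altCoeff (addVar x) 0 k d a.1 := by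
  have hl := fun a : AltIdx (N + 1) 0 k => lead_altCoeff_zero h.alt_ne_zero a.2.1 hk hd
  have hn : ∀ a : AltIdx (N + 1) 0 k, a.1 0 - a.1 1 ≠ k := fun a he => by
    have h1 := @a.2.2.2 0 1 (by
      rw [shift_zero_zero, ← Fin.succ_zero_eq_one, shift_zero_succ, Fin.succ_zero_eq_one]; omega)
    simp at h1
  refine linIndep_of_coeff (k - d) (fun a => a.1 0 - a.1 1 - d)
    (fun a => by have := hn a; omega) (fun a j hj hjk => ?_) fun e => ?_
  · have := (hl a).1 j hj
    rwa [HahnSeries.coeff_sub, HahnSeries.coeff_single_of_ne hjk, sub_zero] at this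
  · by_cases he : k - (e + d) = 0
    · have : IsEmpty {v : AltIdx (N + 1) 0 k // v.1 0 - v.1 1 - d = e} :=
        ⟨fun a => hn a.1 (by have := a.2; omega)⟩
      exact linIndep_of_subsingleton fun a => isEmptyElim a
    · refine ((h.quot_zero (k - (e + d)) he).neg.comp
        (f := fun a : {v : AltIdx (N + 1) 0 k // v.1 0 - v.1 1 - d = e} =>
          (⟨Fin.tail a.1.1, strictAnti_tail a.1.2.1, a.1.2.2.1, by
            have h2 := injective_shift_zero_tail a.1.2.2.2
            rwa [show a.1.1 0 - a.1.1 1 = e + d by have := a.2; omega] at h2⟩ :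
            AltIdx N 0 (k - (e + d)))) ?_).congr ?_
      · intro a b hab
        refine Subtype.ext (Subtype.ext (ext_of_tail (congrArg Subtype.val hab) ?_))
        have := a.2; have := b.2; omega
      · rintro ⟨a, rfl⟩
        have h1 := (hl a).2
        rw [HahnSeries.coeff_sub, HahnSeries.coeff_single_of_ne
          (by have := hn a; omega), sub_zero] at h1
        simp only [Function.comp, h1, sub_add_cancel]

/-- Common to the families `quot` and `coeff` with `i ≠ 0`: they differ only in the displacement `c`
of the exponent and in the common term to be disregarded. -/
theorem linIndep_of_lead_altCoeff (h : GenericVars φ x) {j : Fin (N + 1)} {k : ℤ} (hk : 0 < k)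
    (c : ℤ) {s : ℤ} (u : AltIdx (N + 1) j.succ k → LaurentSeries K)
    (hs : ∀ a : AltIdx (N + 1) j.succ k, a.1 0 - a.1 1 - c ≠ s)
    (hu : ∀ a : AltIdx (N + 1) j.succ k, (∀ i < a.1 0 - a.1 1 - c, i ≠ s → (u a).coeff i = 0) ∧
      (u a).coeff (a.1 0 - a.1 1 - c) = altCoeff x j k (a.1 0 - a.1 1) (Fin.tail a.1)) :
    LinIndep ((HahnSeries.C : K →+* LaurentSeries K).comp φ) u := by
  have hn : ∀ a : AltIdx (N + 1) j.succ k, a.1 1 < a.1 0 := fun a => a.2.1 (by simp)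
  refine linIndep_of_coeff s (fun a => a.1 0 - a.1 1 - c) hs (fun a => (hu a).1) fun e => ?_
  by_cases he : 0 < e + c
  · refine ((h.coeff j k (e + c) hk he).comp
      (f := fun a : {v : AltIdx (N + 1) j.succ k // v.1 0 - v.1 1 - c = e} =>
        (⟨Fin.tail a.1.1, strictAnti_tail a.1.2.1, a.1.2.2.1,
          injective_shift_tail a.1.2.2.2⟩ : AltIdx N j k)) ?_).congr ?_
    · intro a b hab
      refine Subtype.ext (Subtype.ext (ext_of_tail (congrArg Subtype.val hab) ?_))
      have := a.2; have := b.2; omega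
    · rintro ⟨a, rfl⟩
      simp only [Function.comp, (hu a).2, sub_add_cancel]
  · have : IsEmpty {v : AltIdx (N + 1) j.succ k // v.1 0 - v.1 1 - c = e} :=
      ⟨fun a => by have := hn a.1; have := a.2; omega⟩
    exact linIndep_of_subsingleton fun a => isEmptyElim a

theorem genericVars_addVar (h : GenericVars φ x) :
    GenericVars ((HahnSeries.C : K →+* LaurentSeries K).comp φ) (addVar x) := by
  refine ⟨fun p => ?_, fun a ha => ?_, fun k hk => quot_zero_addVar h hk, fun i k hk => ?_,
    fun i k d hk hd => ?_⟩
  · induction p using Fin.cases with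
    | zero => exact HahnSeries.single_ne_zero one_ne_zero
    | succ p => simpa [addVar] using h.ne_zero p
  · exact (lead_alt x fun q => ha (Fin.succ_pos q)).ne_zero
      (h.alt_ne_zero _ (strictAnti_tail ha))
  · induction i using Fin.cases with
    | zero => exact quot_zero_addVar h hk.ne'
    | succ j =>
      have hn : ∀ a : AltIdx (N + 1) j.succ k, a.1 1 < a.1 0 := fun a => a.2.1 (by simp)
      -- The disregarded degree 0 carries the constant `altQuot x j k (Fin.tail a)`, which lies
      -- below the gap.
      refine linIndep_of_lead_altCoeff h hk 0 (s := 0) _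
        (fun a => by have := hn a; omega) fun a => ?_
      have hl := lead_altQuot_succ h.alt_ne_zero a.2.1 hk j
      have hn' := hn a
      refine ⟨fun i hi hi0 => ?_, ?_⟩
      · have := hl.1 i (by omega)
        rwa [HahnSeries.coeff_sub, HahnSeries.C_apply, HahnSeries.coeff_single_of_ne hi0,
          sub_zero] at this
      · have := hl.2
        rw [HahnSeries.coeff_sub, HahnSeries.C_apply, HahnSeries.coeff_single_of_ne (by omega),
          sub_zero] at this
        rw [sub_zero, this]
  · induction i using Fin.cases with
    | zero => exact coeff_zero_addVar h hk hd
    | succ j =>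
      have hn : ∀ a : AltIdx (N + 1) j.succ k, a.1 1 < a.1 0 := fun a => a.2.1 (by simp)
      -- There is no common term here; `-d` is just a degree below every exponent that occurs.
      refine linIndep_of_lead_altCoeff h hk d (s := -d) _
        (fun a => by have := hn a; omega) fun a => ?_
      have hl := lead_altCoeff_succ h.alt_ne_zero a.2.1 hk hd j
      exact ⟨fun i hi _ => hl.1 i hi, hl.2⟩

theorem exists_genericVars (k₀ : Type) [Field k₀] (N : ℕ) :
    ∃ (K : Type) (_ : Field K) (φ : k₀ →+* K) (x : Fin (N + 1) → K), GenericVars φ x := by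
  induction N with
  | zero => exact ⟨k₀, inferInstance, RingHom.id k₀, _, genericVars_one⟩
  | succ N ih =>
    obtain ⟨K, _, φ, x, h⟩ := ih
    exact ⟨LaurentSeries K, inferInstance, _, _, genericVars_addVar h⟩

end Alternant

end SuperFactor
end

/-! ### Types B and C: multiplicative independence of alternants -/

noncomputable section
open scoped Classical
namespace SuperFactor

/-! ### Alternants of the hyperoctahedral group -/

section AlternantB

variable {K : Type} [Field K]

/-- The alternant `det (x_p ^ b_q - x_p ^ (-b_q))`. -/
def altB {N : ℕ} (x : Fin N → K) (b : Fin N → ℤ) : K :=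
  (Matrix.of fun p q => x p ^ b q - x p ^ (-b q)).det

/-- Strictly decreasing sequences of positive integers. -/
def DecPos {N : ℕ} (b : Fin N → ℤ) : Prop := StrictAnti b ∧ ∀ q, 0 < b q

theorem DecPos.tail {N : ℕ} {b : Fin (N + 1) → ℤ} (hb : DecPos b) : DecPos (Fin.tail b) :=
  ⟨strictAnti_tail hb.1, fun q => hb.2 q.succ⟩

theorem DecPos.shift_zero {N : ℕ} {b : Fin (N + 1) → ℤ} (hb : DecPos b) {d : ℤ} (hd : 0 ≤ d) :
    DecPos (shift b 0 (-d)) := by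
  refine ⟨strictAnti_shift_zero hb.1 hd, fun q => ?_⟩
  induction q using Fin.cases with
  | zero => rw [shift_zero_zero]; linarith [hb.2 0]
  | succ q => rw [shift_zero_succ]; exact hb.2 _

theorem altB_addVar {N : ℕ} (x : Fin N → K) (b : Fin (N + 1) → ℤ) :
    altB (addVar x) b = ∑ q : Fin (N + 1),
      (HahnSeries.single (-(b q)) ((-1) ^ (q : ℕ) * altB x (b ∘ q.succAbove)) -
        HahnSeries.single (b q) ((-1) ^ (q : ℕ) * altB x (b ∘ q.succAbove))) := by
  rw [altB, Matrix.det_succ_row_zero]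
  refine Finset.sum_congr rfl fun q _ => ?_
  have h1 : ((Matrix.of fun p q => addVar x p ^ b q - addVar x p ^ (-b q)).submatrix
      Fin.succ q.succAbove).det = HahnSeries.C (altB x (b ∘ q.succAbove)) := by
    rw [altB, RingHom.map_det]
    congr 1
    ext1 p r
    simp only [Matrix.submatrix_apply, Matrix.of_apply, RingHom.mapMatrix_apply, Matrix.map_apply,
      addVar, Fin.cons_succ, map_sub, map_zpow₀, Function.comp]
  rw [h1]
  simp only [Matrix.of_apply, addVar, Fin.cons_zero, single_neg_one_zpow]
  have h2 : ((-1 : LaurentSeries K) ^ (q : ℕ)) = HahnSeries.C ((-1) ^ (q : ℕ)) := by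
    rw [map_pow, map_neg, map_one]
  rw [h2]
  simp only [HahnSeries.C_apply, HahnSeries.single_mul_single, mul_sub, sub_mul]
  simp

theorem lead_altB {N : ℕ} (x : Fin N → K) {b : Fin (N + 1) → ℤ} (hb : DecPos b) :
    Lead (altB (addVar x) b) (-b 0) (altB x (Fin.tail b)) := by
  rw [altB_addVar, Fin.sum_univ_succ]
  have h0 := hb.2 0
  have h1 := (lead_single (-(b 0)) ((-1) ^ ((0 : Fin (N + 1)) : ℕ) *
    altB x (b ∘ Fin.succAbove 0))).sub ((lead_single (b 0) ((-1) ^ ((0 : Fin (N + 1)) : ℕ) *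
    altB x (b ∘ Fin.succAbove 0))).of_lt (by linarith : -b 0 < b 0))
  have h2 : Lead (∑ q : Fin N, (HahnSeries.single (-(b q.succ))
      ((-1) ^ (q.succ : ℕ) * altB x (b ∘ q.succ.succAbove)) - HahnSeries.single (b q.succ)
      ((-1) ^ (q.succ : ℕ) * altB x (b ∘ q.succ.succAbove)))) (-(b 0))
      (∑ q : Fin N, ((0 : K) - 0)) :=
    Lead.sum _ fun q _ => ((lead_single _ _).of_lt (by linarith [hb.1 (Fin.succ_pos q)])).sub
      ((lead_single _ _).of_lt (by linarith [hb.2 q.succ]))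
  refine (h1.add h2).congr rfl rfl ?_
  simp only [Fin.val_zero, pow_zero, one_mul, sub_zero, Finset.sum_const_zero, add_zero]
  congr 1

/-- The monomials with positive powers of T have positive degree, whereas everything here happens at
degrees at most -b 1 < 0. Hence the hyperoctahedral alternant has the same two first terms as in
type A. -/
theorem lead_altB_rest {N : ℕ} (x : Fin (N + 1) → K) {b : Fin (N + 2) → ℤ} (hb : DecPos b) {e : ℤ}
    (h : e ≤ -b 1) :
    Lead (altB (addVar x) b - HahnSeries.single (-(b 0)) (altB x (Fin.tail b))
      + HahnSeries.single (-(b 1)) (altB x (Function.update (Fin.tail b) 0 (b 0)))) e 0 := by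
  rw [altB_addVar, Finset.sum_sub_distrib, Fin.sum_univ_succ, Fin.sum_univ_succ]
  have hb1 := hb.2 1
  have h2 : Lead (∑ q : Fin N, HahnSeries.single (-(b q.succ.succ))
      ((-1) ^ (q.succ.succ : ℕ) * altB x (b ∘ q.succ.succ.succAbove))) e (∑ q : Fin N, (0 : K)) :=
    Lead.sum _ fun q _ => (lead_single _ _).of_lt (by linarith [succ_succ_lt_one hb.1 q])
  have h3 : Lead (∑ q : Fin (N + 2), HahnSeries.single (b q)
      ((-1) ^ (q : ℕ) * altB x (b ∘ q.succAbove))) e (∑ q : Fin (N + 2), (0 : K)) :=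
    Lead.sum _ fun q _ => (lead_single _ _).of_lt (by linarith [hb.2 q])
  rw [Finset.sum_const_zero] at h2 h3
  refine (h2.sub h3).congr ?_ rfl (sub_zero 0)
  have h3 : b ∘ Fin.succAbove (0 : Fin (N + 1)).succ = Function.update (Fin.tail b) 0 (b 0) := by
    ext q
    refine Fin.cases ?_ (fun q => ?_) q
    · simp
    · simp [Function.update_of_ne, Fin.tail]
  have h4 : b ∘ Fin.succAbove 0 = Fin.tail b := by
    ext q; simp [Fin.tail]
  rw [h3, h4]
  have h5 : ((-1 : K) ^ ((0 : Fin (N + 1)).succ : ℕ)) = -1 := by simp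
  rw [h5, neg_one_mul, HahnSeries.single_neg, Fin.succ_zero_eq_one]
  simp only [Fin.val_zero, pow_zero, one_mul]
  ring

/-- The quotient of alternants `altB (b + d e_0) / altB b`. -/
def altBQuot {N : ℕ} (x : Fin (N + 1) → K) (d : ℤ) (b : Fin (N + 1) → ℤ) : K :=
  altB x (shift b 0 (-d)) / altB x b

theorem update_tail_eq_shift_neg {N : ℕ} (b : Fin (N + 2) → ℤ) :
    Function.update (Fin.tail b) 0 (b 0) = shift (Fin.tail b) 0 (-(b 0 - b 1)) := by
  have := update_tail_eq_shift b 0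
  rwa [sub_zero, zero_sub] at this

/-- This is the expansion of `lead_altQuot_zero_neg` with k = -d: the second term of the
denominator, multiplied by T^{-d}, comes first. -/
theorem lead_altBQuot {N : ℕ} {x : Fin (N + 1) → K}
    (hx : ∀ b : Fin (N + 1) → ℤ, DecPos b → altB x b ≠ 0)
    {b : Fin (N + 2) → ℤ} (hb : DecPos b) {d : ℤ} (hd : 0 < d) :
    Lead (altBQuot (addVar x) d b - HahnSeries.single (-d) 1) (b 0 - b 1 - d)
      (altBQuot x (b 0 - b 1) (Fin.tail b)) := by
  have hA := lead_altB x hb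
  have hA0 := hx _ hb.tail
  have h1 := lead_altB_rest x hb le_rfl
  have e1 : shift b 0 (-d) 1 = b 1 := shift_zero_succ b _ 0
  have h2 := lead_altB_rest x (hb.shift_zero hd.le) (e := -d - b 1) (by rw [e1]; linarith)
  rw [tail_shift_zero, shift_zero_zero, e1] at h2
  rw [update_tail_eq_shift_neg] at h1
  have h3 := (lead_single (-d) (1 : K)).mul h1
  have h4 := (lead_single (-b 1) (altB x (Function.update (Fin.tail b) 0 (b 0 - -d)))).of_lt
    (by linarith : -d - b 1 < -b 1)
  have h5 := lead_single (-d - b 1) (altB x (shift (Fin.tail b) 0 (-(b 0 - b 1))))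
  have h6 := (((h2.sub h3).sub h4).add h5).div hA hA0
  refine h6.congr ?_ (by ring) ?_
  · rw [altBQuot, eq_sub_iff_add_eq, div_add' _ _ _ (hA.ne_zero hA0)]
    congr 1
    simp only [mul_add, mul_sub, HahnSeries.single_mul_single, one_mul]
    have : -(b 0 - -d) = -d + -b 0 := by ring
    rw [this, sub_eq_add_neg (-d) (b 1)]
    ring
  · rw [altBQuot]; ring

theorem altB_addVar_fin_zero (x : Fin 0 → K) (b : Fin 1 → ℤ) :
    altB (addVar x) b = HahnSeries.single (-(b 0)) 1 - HahnSeries.single (b 0) 1 := by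
  rw [altB_addVar]; simp [altB]

/-- The quotient is T^{-d} (1 - T^{2(b + d)}) / (1 - T^{2b}), where b denotes the single entry. -/
theorem lead_altBQuot_one (x : Fin 0 → K) {b : Fin 1 → ℤ} (hb : 0 < b 0) {d : ℤ} (hd : 0 < d) :
    Lead (altBQuot (addVar x) d b - HahnSeries.single (-d) 1) (2 * b 0 - d) 1 := by
  have hA : Lead (altB (addVar x) b) (-(b 0)) 1 := by
    rw [altB_addVar_fin_zero]
    exact ((lead_single _ _).sub ((lead_single (b 0) (1 : K)).of_lt (by linarith))).congr rfl rfl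
      (sub_zero 1)
  have h1 := (lead_single (b 0 - d) (1 : K)).sub
    ((lead_single (b 0 + d) (1 : K)).of_lt (by linarith : b 0 - d < b 0 + d))
  refine (h1.div hA one_ne_zero).congr ?_ (by ring) (by simp)
  rw [altBQuot, eq_sub_iff_add_eq, div_add' _ _ _ (hA.ne_zero one_ne_zero), altB_addVar_fin_zero,
    altB_addVar_fin_zero, shift_zero_zero]
  congr 1
  simp only [mul_sub, HahnSeries.single_mul_single, one_mul]
  have e1 : -(b 0 - -d) = -d + -b 0 := by ring
  have e2 : b 0 - -d = b 0 + d := by ring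
  have e3 : b 0 - d = -d + b 0 := by ring
  rw [e1, e2, e3]
  ring

/-- The alternants in `x` are nonzero, and their quotients linearly independent. -/
structure GenericVarsB {k₀ K : Type} [Field k₀] [Field K] (φ : k₀ →+* K) {N : ℕ}
    (x : Fin (N + 1) → K) : Prop where
  ne_zero : ∀ p, x p ≠ 0
  alt_ne_zero : ∀ b, DecPos b → altB x b ≠ 0
  quot : ∀ d, 0 < d → LinIndep φ fun b : {b // DecPos b} => altBQuot x d b.1

variable {k₀ : Type} [Field k₀] {φ : k₀ →+* K}

theorem addVar_ne_zero {N : ℕ} {x : Fin N → K} (hx : ∀ p, x p ≠ 0) (p : Fin (N + 1)) :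
    addVar x p ≠ 0 := by
  induction p using Fin.cases with
  | zero => exact HahnSeries.single_ne_zero one_ne_zero
  | succ p => simpa [addVar] using hx p

theorem genericVarsB_one : GenericVarsB (HahnSeries.C : k₀ →+* LaurentSeries k₀)
    (addVar (Fin.elim0 : Fin 0 → k₀)) := by
  refine ⟨addVar_ne_zero fun p => p.elim0, fun b hb => ?_, fun d hd => ?_⟩
  · refine (lead_altB _ hb).ne_zero ?_
    simp [altB]
  · have hl := fun b : {b : Fin 1 → ℤ // DecPos b} =>
      lead_altBQuot_one (Fin.elim0 : Fin 0 → k₀) (b.2.2 0) hd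
    have hp := fun b : {b : Fin 1 → ℤ // DecPos b} => b.2.2 0
    have := linIndep_of_coeff (φ := RingHom.id k₀)
      (u := fun b : {b : Fin 1 → ℤ // DecPos b} => altBQuot (addVar Fin.elim0) d b.1) (-d)
      (fun b => 2 * b.1 0 - d) (fun b => by have := hp b; omega) (fun b j hj hjd => ?_) fun e => ?_
    · rwa [RingHom.comp_id] at this
    · have := (hl b).1 j hj
      rwa [HahnSeries.coeff_sub, HahnSeries.coeff_single_of_ne hjd, sub_zero] at this
    · have : Subsingleton {b : {b : Fin 1 → ℤ // DecPos b} // 2 * b.1 0 - d = e} :=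
        ⟨fun a b => Subtype.ext (Subtype.ext (by
          ext q
          rw [Subsingleton.elim q 0]
          have := a.2; have := b.2; omega))⟩
      refine linIndep_of_subsingleton ?_
      rintro ⟨b, rfl⟩
      have := (hl b).2
      rw [HahnSeries.coeff_sub, HahnSeries.coeff_single_of_ne
        (by have := hp b; omega), sub_zero] at this
      simp only [this]
      exact one_ne_zero

/-- Only the first entry is ever enlarged, by the gap b 0 - b 1 > 0. One family, with `d > 0`,
therefore suffices for the induction, and no condition on repeated entries appears. -/
theorem genericVarsB_addVar {N : ℕ} {x : Fin (N + 1) → K} (h : GenericVarsB φ x) :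
    GenericVarsB ((HahnSeries.C : K →+* LaurentSeries K).comp φ) (addVar x) := by
  refine ⟨addVar_ne_zero h.ne_zero,
    fun b hb => (lead_altB x hb).ne_zero (h.alt_ne_zero _ hb.tail), fun d hd => ?_⟩
  have hl := fun b : {b : Fin (N + 2) → ℤ // DecPos b} => lead_altBQuot h.alt_ne_zero b.2 hd
  have hn : ∀ b : {b : Fin (N + 2) → ℤ // DecPos b}, b.1 1 < b.1 0 := fun b => b.2.1 (by simp)
  refine linIndep_of_coeff (-d) (fun b => b.1 0 - b.1 1 - d)
    (fun b => by have := hn b; omega) (fun b j hj hjd => ?_) fun e => ?_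
  · have := (hl b).1 j hj
    rwa [HahnSeries.coeff_sub, HahnSeries.coeff_single_of_ne hjd, sub_zero] at this
  · by_cases he : 0 < e + d
    · refine ((h.quot (e + d) he).comp
        (f := fun b : {b : {b : Fin (N + 2) → ℤ // DecPos b} // b.1 0 - b.1 1 - d = e} =>
          (⟨Fin.tail b.1.1, b.1.2.tail⟩ : {b : Fin (N + 1) → ℤ // DecPos b})) ?_).congr ?_
      · intro a b hab
        refine Subtype.ext (Subtype.ext (ext_of_tail (congrArg Subtype.val hab) ?_))
        have := a.2; have := b.2; omega
      · rintro ⟨b, rfl⟩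
        have h1 := (hl b).2
        rw [HahnSeries.coeff_sub, HahnSeries.coeff_single_of_ne
          (by have := hn b; omega), sub_zero] at h1
        simp only [Function.comp, h1, sub_add_cancel]
    · have : IsEmpty {b : {b : Fin (N + 2) → ℤ // DecPos b} // b.1 0 - b.1 1 - d = e} :=
        ⟨fun b => by have := hn b.1; have := b.2; omega⟩
      exact linIndep_of_subsingleton fun b => isEmptyElim b

theorem exists_genericVarsB (k₀ : Type) [Field k₀] (N : ℕ) :
    ∃ (K : Type) (_ : Field K) (φ : k₀ →+* K) (x : Fin (N + 1) → K), GenericVarsB φ x := by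
  induction N with
  | zero => exact ⟨LaurentSeries k₀, inferInstance, _, _, genericVarsB_one⟩
  | succ N ih =>
    obtain ⟨K, _, φ, x, h⟩ := ih
    exact ⟨LaurentSeries K, inferInstance, _, _, genericVarsB_addVar h⟩

theorem prod_addVar_zpow {N : ℕ} (x : Fin N → K) (b : Fin (N + 1) → ℤ) :
    ∏ p, addVar x p ^ (-b p) =
      HahnSeries.single (b 0) (∏ p, x p ^ (-Fin.tail b p)) := by
  rw [Fin.prod_univ_succ]
  simp only [addVar, Fin.cons_zero, Fin.cons_succ, single_neg_one_zpow, neg_neg]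
  have : ∏ p : Fin N, (HahnSeries.C (x p) : LaurentSeries K) ^ (-b p.succ) =
      HahnSeries.C (∏ p, x p ^ (-Fin.tail b p)) := by
    rw [map_prod]
    refine Finset.prod_congr rfl fun p _ => ?_
    rw [map_zpow₀]; rfl
  rw [this, HahnSeries.C_apply, HahnSeries.single_mul_single, add_zero, one_mul]

/-- The normalized alternant `altB b / x ^ b`. -/
def normB {N : ℕ} (x : Fin N → K) (b : Fin N → ℤ) : K := altB x b * ∏ p, x p ^ (-b p)

theorem normB_ne_zero {N : ℕ} {x : Fin N → K} (hx : ∀ p, x p ≠ 0) {b : Fin N → ℤ}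
    (h : altB x b ≠ 0) : normB x b ≠ 0 :=
  mul_ne_zero h (Finset.prod_ne_zero_iff.2 fun p _ => zpow_ne_zero _ (hx p))

/-- In suitable variables, normalized alternants of the hyperoctahedral group are multiplicatively
independent modulo scalars. -/
theorem exists_normB_factorization (k₀ : Type) [Field k₀] [CharZero k₀] (N : ℕ) :
    ∃ (K : Type) (_ : Field K) (φ : k₀ →+* K) (x : Fin (N + 1) → K), (∀ p, x p ≠ 0) ∧
      (∀ b, DecPos b → normB x b ≠ 0) ∧
      ∀ (I : Type) (b : I → Fin (N + 1) → ℤ) (c : I → k₀), (∀ i, DecPos (b i)) →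
        Function.Injective b → (∀ i, c i ≠ 0) → ∀ s t : Multiset I,
        (s.map fun i => φ (c i) * normB x (b i)).prod =
          (t.map fun i => φ (c i) * normB x (b i)).prod → s = t := by
  cases N with
  | zero =>
    refine ⟨LaurentSeries k₀, inferInstance, HahnSeries.C, addVar Fin.elim0,
      addVar_ne_zero fun p => p.elim0, fun b hb => normB_ne_zero (addVar_ne_zero fun p => p.elim0)
        (genericVarsB_one.alt_ne_zero b hb), fun I b c hb hinj hc s t h => ?_⟩
    -- In one variable the normalized alternant is 1 - T^{2b}, and its exponent determines `b`.
    refine multiset_eq_of_prod_eq (φ := RingHom.id k₀) (o := fun _ => 0) (e := fun i => 2 * b i 0)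
      (c := c) (ρ := fun _ => -1) hc (fun i => by have := (hb i).2 0; omega) (fun i => ?_)
      (fun d => ?_) h
    · refine (lead_single (2 * b i 0) (-c i)).congr ?_ (zero_add _).symm (by ring)
      rw [normB, prod_addVar_zpow, altB_addVar_fin_zero, HahnSeries.C_apply]
      simp only [sub_mul, mul_sub, HahnSeries.single_mul_single, Finset.univ_eq_empty,
        Finset.prod_empty, neg_add_cancel, add_zero, zero_add, mul_one, HahnSeries.single_neg]
      rw [two_mul]; ring
    · have : Subsingleton {i : I // 2 * b i 0 = d} := ⟨fun i j => Subtype.ext (hinj (by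
        ext q
        rw [show q = 0 from Subsingleton.elim (α := Fin 1) _ _]
        have := i.2; have := j.2; omega))⟩
      exact linIndep_of_subsingleton fun _ => by simp
  | succ N =>
    obtain ⟨K, _, φ, x, hx⟩ := exists_genericVarsB k₀ N
    have hx' := genericVarsB_addVar hx
    refine ⟨LaurentSeries K, inferInstance, (HahnSeries.C : K →+* LaurentSeries K).comp φ,
      addVar x, hx'.ne_zero, fun b hb => normB_ne_zero hx'.ne_zero (hx'.alt_ne_zero b hb),
      fun I b c hb hinj hc s t h => ?_⟩
    have hn : ∀ i, b i 1 < b i 0 := fun i => (hb i).1 (by simp)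
    -- Expansion in the first variable gives `normB` of the tail times 1 - ρ T^n + ⋯, with n the gap
    -- b 0 - b 1 and ρ the quotient that enlarges the first entry of the tail by n. The scalars `φ
    -- (c i)` go into the leading coefficient and drop out of ρ.
    refine multiset_eq_of_prod_eq (φ := φ) (o := fun _ => 0) (e := fun i => b i 0 - b i 1)
      (c := fun i => φ (c i) * normB x (Fin.tail (b i)))
      (ρ := fun i => -altBQuot x (b i 0 - b i 1) (Fin.tail (b i)))
      (fun i => mul_ne_zero ((map_ne_zero φ).2 (hc i))
        (normB_ne_zero hx.ne_zero (hx.alt_ne_zero _ (hb i).tail)))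
      (fun i => by have := hn i; omega) (fun i => ?_) (fun d => ?_) h
    · have h1 := (lead_altB_rest x (hb i) le_rfl).sub (lead_single (-(b i 1))
        (altB x (Function.update (Fin.tail (b i)) 0 (b i 0))))
      have h2 := lead_single (b i 0) (φ (c i) * ∏ p, x p ^ (-Fin.tail (b i) p))
      refine (h2.mul h1).congr ?_ (by ring) ?_
      · rw [normB, prod_addVar_zpow, add_sub_cancel_right, mul_sub, HahnSeries.single_mul_single,
          RingHom.comp_apply, HahnSeries.C_apply, mul_left_comm, HahnSeries.single_mul_single,
          zero_add, add_neg_cancel, normB, mul_comm]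
        congr 2
        ring
      · have h3 := hx.alt_ne_zero _ (hb i).tail
        rw [update_tail_eq_shift_neg, altBQuot, normB]
        field_simp
        ring
    · by_cases hd : 0 < d
      · refine ((hx.quot d hd).neg.comp (f := fun i : {i : I // b i 0 - b i 1 = d} =>
          (⟨Fin.tail (b i), (hb i).tail⟩ : {b : Fin (N + 1) → ℤ // DecPos b})) ?_).congr ?_
        · intro i j hij
          refine Subtype.ext (hinj (ext_of_tail (congrArg Subtype.val hij) ?_))
          have := i.2; have := j.2; omega
        · rintro ⟨i, rfl⟩
          rfl
      · have : IsEmpty {i : I // b i 0 - b i 1 = d} :=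
          ⟨fun i => by have := hn i.1; have := i.2; omega⟩
        exact linIndep_of_subsingleton fun b => isEmptyElim b

end AlternantB

end SuperFactor
end

/-! ### Evaluation of exponentials and of numerators -/

noncomputable section
open scoped Classical
namespace SuperFactor

/-! ### Specialization of fractions -/

section Specialize

variable {A L K : Type} [CommRing A] [Field L] [Field K] {i : A →+* L} {ψ : A →+* K}

/-- The fraction `u` of elements of `A` specializes to `v` along `ψ`. -/
def Specializes (i : A →+* L) (ψ : A →+* K) (u : L) (v : K) : Prop :=
  ∃ a b, ψ b ≠ 0 ∧ u * i b = i a ∧ v * ψ b = ψ a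

theorem specializes_map (a : A) : Specializes i ψ (i a) (ψ a) :=
  ⟨a, 1, by simp, by simp, by simp⟩

theorem Specializes.add {u u' : L} {v v' : K} (h : Specializes i ψ u v)
    (h' : Specializes i ψ u' v') : Specializes i ψ (u + u') (v + v') := by
  obtain ⟨a, b, h1, h2, h3⟩ := h
  obtain ⟨a', b', h1', h2', h3'⟩ := h'
  refine ⟨a * b' + a' * b, b * b', by simp [h1, h1'], ?_, ?_⟩
  · simp only [map_add, map_mul, ← h2, ← h2']; ring
  · simp only [map_add, map_mul, ← h3, ← h3']; ring

theorem Specializes.mul {u u' : L} {v v' : K} (h : Specializes i ψ u v)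
    (h' : Specializes i ψ u' v') : Specializes i ψ (u * u') (v * v') := by
  obtain ⟨a, b, h1, h2, h3⟩ := h
  obtain ⟨a', b', h1', h2', h3'⟩ := h'
  refine ⟨a * a', b * b', by simp [h1, h1'], ?_, ?_⟩
  · simp only [map_mul, ← h2, ← h2']; ring
  · simp only [map_mul, ← h3, ← h3']; ring

/-- A nonzero value makes the numerator an admissible denominator. Fractions can thus be evaluated
without extending ψ to a localization. -/
theorem Specializes.inv (hi : Function.Injective i) {u : L} {v : K} (h : Specializes i ψ u v)
    (hv : v ≠ 0) : Specializes i ψ u⁻¹ v⁻¹ := by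
  obtain ⟨a, b, h1, h2, h3⟩ := h
  have ha : ψ a ≠ 0 := by rw [← h3]; exact mul_ne_zero hv h1
  have ha' : i a ≠ 0 := by
    rw [map_ne_zero_iff i hi]
    rintro rfl
    simp at ha
  have hu : u ≠ 0 := by
    rintro rfl
    rw [zero_mul] at h2
    exact ha' h2.symm
  refine ⟨b, a, ha, ?_, ?_⟩
  · rw [← h2]; field_simp
  · rw [← h3]; field_simp

theorem Specializes.div (hi : Function.Injective i) {u u' : L} {v v' : K}
    (h : Specializes i ψ u v) (h' : Specializes i ψ u' v') (hv : v' ≠ 0) :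
    Specializes i ψ (u / u') (v / v') := by
  rw [div_eq_mul_inv, div_eq_mul_inv]
  exact h.mul (h'.inv hi hv)

theorem Specializes.sum {ι : Type} (s : Finset ι) {u : ι → L} {v : ι → K}
    (h : ∀ j ∈ s, Specializes i ψ (u j) (v j)) :
    Specializes i ψ (∑ j ∈ s, u j) (∑ j ∈ s, v j) := by
  induction s using Finset.induction_on with
  | empty => simpa using specializes_map (i := i) (ψ := ψ) 0
  | insert a s ha ih =>
    rw [Finset.sum_insert ha, Finset.sum_insert ha]
    exact (h a (by simp)).add (ih fun j hj => h j (by simp [hj]))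

theorem Specializes.prod {ι : Type} (s : Finset ι) {u : ι → L} {v : ι → K}
    (h : ∀ j ∈ s, Specializes i ψ (u j) (v j)) :
    Specializes i ψ (∏ j ∈ s, u j) (∏ j ∈ s, v j) := by
  induction s using Finset.induction_on with
  | empty => simpa using specializes_map (i := i) (ψ := ψ) 1
  | insert a s ha ih =>
    rw [Finset.prod_insert ha, Finset.prod_insert ha]
    exact (h a (by simp)).mul (ih fun j hj => h j (by simp [hj]))

/-- Two representations of the same fraction agree after cross multiplication in `A`, since `i` is
injective, and ψ preserves this identity. It transports an equality of products of numerators to the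
field of Laurent series. -/
theorem Specializes.unique (hi : Function.Injective i) {u : L} {v v' : K}
    (h : Specializes i ψ u v) (h' : Specializes i ψ u v') : v = v' := by
  obtain ⟨a, b, h1, h2, h3⟩ := h
  obtain ⟨a', b', h1', h2', h3'⟩ := h'
  have e : a * b' = a' * b := hi (by rw [map_mul, map_mul, ← h2, ← h2']; ring)
  have e' := congrArg ψ e
  rw [map_mul, map_mul, ← h3, ← h3'] at e'
  have : (v - v') * (ψ b * ψ b') = 0 := by linear_combination e'
  rcases mul_eq_zero.1 this with h | h
  · exact sub_eq_zero.1 h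
  · exact absurd h (mul_ne_zero h1 h1')

end Specialize

section Monomial

variable {κ K : Type} [Fintype κ] [Field K]

/-- The monomial `X ^ z`. -/
def mon (X : κ → K) (z : κ → ℤ) : K := ∏ c, X c ^ z c

theorem mon_add {X : κ → K} (hX : ∀ c, X c ≠ 0) (z z' : κ → ℤ) :
    mon X (z + z') = mon X z * mon X z' := by
  simp only [mon, ← Finset.prod_mul_distrib, Pi.add_apply, zpow_add₀ (hX _)]

theorem mon_zero (X : κ → K) : mon X 0 = 1 := by simp [mon]

/-- Evaluation of the group algebra of `ℤ ^ κ`. -/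
def evalMon (φ : ℂ →+* K) (X : κ → K) (hX : ∀ c, X c ≠ 0) :
    AddMonoidAlgebra ℂ (κ → ℤ) →+* K :=
  AddMonoidAlgebra.liftNCRingHom φ
    { toFun := fun z => mon X z.toAdd
      map_one' := mon_zero X
      map_mul' := fun z z' => mon_add hX z.toAdd z'.toAdd } fun _ _ => Commute.all _ _

theorem evalMon_single (φ : ℂ →+* K) (X : κ → K) (hX : ∀ c, X c ≠ 0) (z : κ → ℤ) (c : ℂ) :
    evalMon φ X hX (AddMonoidAlgebra.single z c) = φ c * mon X z := by
  simp [evalMon]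

end Monomial

namespace RootDatum

variable (D : RootDatum)

/-- The lattice `h⁻¹ ℤ ^ κ` in the coordinate space. -/
def latEmb (h : ℂ) : (D.κ → ℤ) →+ D.Vec where
  toFun z c := (z c : ℂ) / h
  map_zero' := by ext; simp
  map_add' z z' := by ext; simp [add_div]

variable {D} in
theorem latEmb_apply (h : ℂ) (z : D.κ → ℤ) (c : D.κ) : D.latEmb h z c = (z c : ℂ) / h := rfl

theorem latEmb_injective {h : ℂ} (hh : h ≠ 0) : Function.Injective (D.latEmb h) := by
  intro z z' hz
  ext c
  have := congrFun hz c
  rw [latEmb_apply, latEmb_apply, div_left_inj' hh] at this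
  exact_mod_cast this

/-- The group algebra of the lattice in the field of fractions. -/
def latHom (h : ℂ) : AddMonoidAlgebra ℂ (D.κ → ℤ) →+* D.ExpField :=
  (algebraMap (AddMonoidAlgebra ℂ D.Vec) D.ExpField).comp
    (AddMonoidAlgebra.mapDomainRingHom ℂ (D.latEmb h))

theorem latHom_injective {h : ℂ} (hh : h ≠ 0) : Function.Injective (D.latHom h) :=
  (IsFractionRing.injective (AddMonoidAlgebra ℂ D.Vec) D.ExpField).comp
    (AddMonoidAlgebra.mapDomain_injective (D.latEmb_injective hh))

theorem latHom_single (h : ℂ) (z : D.κ → ℤ) :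
    D.latHom h (AddMonoidAlgebra.single z 1) = D.fexp (D.latEmb h z) := by
  simp [latHom, fexp]

theorem latHom_C (h : ℂ) (c : ℂ) (u : D.ExpField) :
    c • u = D.latHom h (AddMonoidAlgebra.single 0 c) * u := by
  rw [Algebra.smul_def, latHom, RingHom.comp_apply]
  congr 1
  rw [IsScalarTower.algebraMap_apply ℂ (AddMonoidAlgebra ℂ D.Vec) D.ExpField]
  simp

section

variable {D} {h : ℂ} {K : Type} [Field K] {φ : ℂ →+* K} {X : D.κ → K}
  {hX : ∀ c, X c ≠ 0}

theorem specializes_fexp (z : D.κ → ℤ) :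
    Specializes (D.latHom h) (evalMon φ X hX) (D.fexp (D.latEmb h z)) (mon X z) := by
  have := specializes_map (i := D.latHom h) (ψ := evalMon φ X hX) (AddMonoidAlgebra.single z 1)
  rwa [latHom_single, evalMon_single, map_one, one_mul] at this

theorem specializes_smul {u : D.ExpField} {v : K} (c : ℂ)
    (hu : Specializes (D.latHom h) (evalMon φ X hX) u v) :
    Specializes (D.latHom h) (evalMon φ X hX) (c • u) (φ c * v) := by
  have := (specializes_map (i := D.latHom h) (ψ := evalMon φ X hX)
    (AddMonoidAlgebra.single 0 c)).mul hu
  rwa [← latHom_C, evalMon_single, mon_zero, mul_one] at this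

theorem specializes_one : Specializes (D.latHom h) (evalMon φ X hX) 1 1 := by
  simpa using specializes_map (i := D.latHom h) (ψ := evalMon φ X hX) 1

theorem specializes_two : Specializes (D.latHom h) (evalMon φ X hX) 2 2 := by
  have := specializes_map (i := D.latHom h) (ψ := evalMon φ X hX) 2
  rwa [map_ofNat, map_ofNat] at this

/-- The data of a parametrization of the Weyl group, for the evaluation of the numerators of a
weight of type `γ`. -/
structure WeylParam (D : RootDatum) (h : ℂ) (γ lam : D.Vec) (Y : Type) [Fintype Y] where
  e : Y → D.weylGroup
  bij : Function.Bijective e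
  d : Y → D.κ → ℤ
  g : Y → D.κ → ℤ
  sg : Y → ℂ
  sgn_eq : ∀ y, D.sgn (e y) = sg y
  d_eq : ∀ y, (e y).1 (lam + D.rho) - (lam + D.rho) = D.latEmb h (d y)
  g_eq : ∀ y, (e y).1 γ = D.latEmb h (g y)

variable {γ lam : D.Vec} {Y : Type} [Fintype Y]

/-- Only the denominators have to survive the evaluation. The weight itself need not lie in the
lattice: differences w(λ+ρ) - (λ+ρ) and the roots wγ are all that is evaluated. -/
theorem WeylParam.specializes_ordinary (P : WeylParam D h γ lam Y) (hh : h ≠ 0)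
    (hden : ∀ y, 1 + mon X (-P.g y) ≠ 0) :
    Specializes (D.latHom h) (evalMon φ X hX) (D.ordinaryNumerator γ lam)
      (∑ y, φ (P.sg y) * (mon X (P.d y) / (1 + mon X (-P.g y)))) := by
  rw [ordinaryNumerator, ← finsum_comp_equiv (Equiv.ofBijective P.e P.bij),
    finsum_eq_sum_of_fintype]
  refine Specializes.sum _ fun y _ => ?_
  rw [Equiv.ofBijective_apply, P.sgn_eq, P.d_eq, P.g_eq, ← map_neg]
  exact specializes_smul _ ((specializes_fexp _).div (D.latHom_injective hh)
    (specializes_one.add (specializes_fexp _)) (hden y))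

theorem WeylParam.specializes_special (P : WeylParam D h γ lam Y) (hh : h ≠ 0)
    (hden : ∀ y, 1 + mon X (-P.g y) ≠ 0) :
    Specializes (D.latHom h) (evalMon φ X hX) (D.specialNumerator γ lam)
      (∑ y, φ (P.sg y / 2) *
        ((2 + mon X (-P.g y)) / (1 + mon X (-P.g y)) * mon X (P.d y))) := by
  rw [specialNumerator, ← finsum_comp_equiv (Equiv.ofBijective P.e P.bij),
    finsum_eq_sum_of_fintype]
  refine Specializes.sum _ fun y _ => ?_
  rw [Equiv.ofBijective_apply, P.sgn_eq, P.d_eq, P.g_eq, ← map_neg]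
  exact specializes_smul _ (((specializes_two.add (specializes_fexp _)).div
    (D.latHom_injective hh) (specializes_one.add (specializes_fexp _)) (hden y)).mul
    (specializes_fexp _))

end

end RootDatum

/-! ### Multisets and permutations -/

theorem exists_perm_of_multiset_eq {α β : Type} {r s : ℕ} {ν : Fin r → α} {μ : Fin s → α}
    (h : (Finset.univ.val.map ν) = (Finset.univ.val.map μ)) (f : α → β) :
    ∃ h : r = s, ∃ σ : Equiv.Perm (Fin r), ∀ k, f (ν k) = f (μ (Fin.cast h (σ k))) := by
  have hc := congrArg Multiset.card h
  simp only [Multiset.card_map, Finset.card_val, Finset.card_univ, Fintype.card_fin] at hc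
  subst hc
  refine ⟨rfl, ?_⟩
  -- Equal multisets have fibres of equal size over each value. Bijections of the fibres are glued
  -- to a permutation.
  have e : ∀ a, {k // ν k = a} ≃ {k // μ k = a} := fun a => Fintype.equivOfCardEq (by
    have := congrArg (Multiset.count a) h
    rw [Multiset.count_map, Multiset.count_map] at this
    simp only [eq_comm (a := a)] at this
    rw [Fintype.card_subtype, Fintype.card_subtype]
    exact this)
  exact ⟨Equiv.ofFiberEquiv e, fun k => congrArg f (Equiv.ofFiberEquiv_map e k).symm⟩

end SuperFactor
end

/-! ### Finite-dimensional highest weight modules -/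

noncomputable section
open scoped Classical
namespace SuperFactor

/-! ### Anticommutators -/

section Acomm

variable {A : Type} [Ring A]

/-- The anticommutator. -/
def acomm (a b : A) : A := a * b + b * a

theorem acomm_zero (a : A) : acomm a 0 = 0 := by simp [acomm]

theorem zero_acomm (a : A) : acomm 0 a = 0 := by simp [acomm]

theorem acomm_smul [Algebra ℂ A] (c : ℂ) (a b : A) : acomm a (c • b) = c • acomm a b := by
  simp [acomm, smul_add]

theorem smul_acomm [Algebra ℂ A] (c : ℂ) (a b : A) : acomm (c • a) b = c • acomm a b := by
  simp [acomm, smul_add]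

/-- This and the three following identities are the Jacobi identities for super brackets, with two
or three odd entries. They hold in every associative ring and are stated in the form in which they
rewrite nested brackets of root vectors. -/
theorem lie_acomm (a b c : A) : acomm ⁅a, b⁆ c = ⁅a, acomm b c⁆ - acomm b ⁅a, c⁆ := by
  simp only [acomm, Ring.lie_def]; noncomm_ring

theorem acomm_lie (x f y : A) : acomm x ⁅f, y⁆ = ⁅f, acomm x y⁆ + acomm ⁅x, f⁆ y := by
  simp only [acomm, Ring.lie_def]; noncomm_ring

theorem acomm_acomm_lie (a b c : A) : ⁅acomm a b, c⁆ = ⁅a, acomm b c⁆ + ⁅b, acomm a c⁆ := by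
  simp only [acomm, Ring.lie_def]; noncomm_ring

theorem lie_acomm_right (e y z : A) : ⁅e, acomm y z⁆ = acomm ⁅e, y⁆ z + acomm y ⁅e, z⁆ := by
  simp only [acomm, Ring.lie_def]; noncomm_ring

end Acomm

/-! ### Commutators in associative algebras -/

section Bracket

variable {A : Type} [Ring A]

theorem br_skew (a b : A) : -⁅b, a⁆ = ⁅a, b⁆ := by simp only [Ring.lie_def]; abel

theorem br_self (a : A) : ⁅a, a⁆ = 0 := by simp only [Ring.lie_def]; abel

theorem br_zero (a : A) : ⁅a, (0 : A)⁆ = 0 := by simp [Ring.lie_def]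

theorem zero_br (a : A) : ⁅(0 : A), a⁆ = 0 := by simp [Ring.lie_def]

theorem br_neg (a b : A) : ⁅a, -b⁆ = -⁅a, b⁆ := by simp only [Ring.lie_def]; noncomm_ring

theorem neg_br (a b : A) : ⁅-a, b⁆ = -⁅a, b⁆ := by simp only [Ring.lie_def]; noncomm_ring

theorem add_br (a b c : A) : ⁅a + b, c⁆ = ⁅a, c⁆ + ⁅b, c⁆ := by
  simp only [Ring.lie_def]; noncomm_ring

theorem br_smul [Algebra ℂ A] (c : ℂ) (a b : A) : ⁅a, c • b⁆ = c • ⁅a, b⁆ := by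
  simp [Ring.lie_def, smul_sub]

theorem smul_br [Algebra ℂ A] (c : ℂ) (a b : A) : ⁅c • a, b⁆ = c • ⁅a, b⁆ := by
  simp [Ring.lie_def, smul_sub]

theorem br_br (a b c : A) : ⁅⁅a, b⁆, c⁆ = ⁅a, ⁅b, c⁆⁆ - ⁅b, ⁅a, c⁆⁆ := by
  simp only [Ring.lie_def]; noncomm_ring

theorem br_leibniz (a b c : A) : ⁅a, ⁅b, c⁆⁆ = ⁅⁅a, b⁆, c⁆ + ⁅b, ⁅a, c⁆⁆ := by
  simp only [Ring.lie_def]; noncomm_ring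

theorem br_weight [Algebra ℂ A] {h a b : A} {α β : ℂ} (ha : ⁅h, a⁆ = α • a) (hb : ⁅h, b⁆ = β • b) :
    ⁅h, ⁅a, b⁆⁆ = (α + β) • ⁅a, b⁆ := by
  rw [br_leibniz, ha, hb, smul_br, br_smul, add_smul]

theorem br_acomm_weight [Algebra ℂ A] {h a b : A} {α β : ℂ} (ha : ⁅h, a⁆ = α • a)
    (hb : ⁅h, b⁆ = β • b) : ⁅h, acomm a b⁆ = (α + β) • acomm a b := by
  rw [lie_acomm_right, ha, hb, smul_acomm, acomm_smul, add_smul]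

theorem apply_of_br {V : Type} [AddCommGroup V] [Module ℂ V] {h f : Module.End ℂ V} {u : V}
    {μ c : ℂ} (hf : ⁅h, f⁆ = c • f) (hu : h u = μ • u) : h (f u) = (μ + c) • f u := by
  have := congrArg (fun g : Module.End ℂ V => g u) hf
  simp only [Ring.lie_def, LinearMap.sub_apply, Module.End.mul_apply, hu, map_smul,
    LinearMap.smul_apply] at this
  rw [add_smul, ← this]; abel

end Bracket

/-! ### Highest weights of finite-dimensional representations of `𝔰𝔩(2)` and `𝔬𝔰𝔭(1,2)` -/

section HighestWeight

variable {V : Type} [AddCommGroup V] [Module ℂ V]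

theorem apply_pow_of_lie {h f : Module.End ℂ V} {u : V} {μ c : ℂ} (hf : ⁅h, f⁆ = -c • f)
    (hu : h u = μ • u) (n : ℕ) : h ((f ^ n) u) = (μ - n * c) • (f ^ n) u := by
  induction n with
  | zero => simp [hu]
  | succ n ih =>
    have h1 : h * f = f * h - c • f := by
      rw [Ring.lie_def, sub_eq_iff_eq_add] at hf; rw [hf, neg_smul]; abel
    rw [pow_succ', Module.End.mul_apply, ← Module.End.mul_apply h, h1, LinearMap.sub_apply,
      Module.End.mul_apply, ih, LinearMap.smul_apply, map_smul, ← sub_smul]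
    push_cast; congr 1; ring

variable [Module.Finite ℂ V]

/-- The vectors f^n u, if all nonzero, would be eigenvectors of `h` for distinct eigenvalues, hence
linearly independent. -/
theorem exists_pow_apply_eq_zero {h f : Module.End ℂ V} {u : V} {μ c : ℂ} (hc : c ≠ 0)
    (hf : ⁅h, f⁆ = -c • f) (hu : h u = μ • u) : ∃ n, (f ^ n) u = 0 := by
  by_contra hne
  push Not at hne
  have hinj : Function.Injective fun n : ℕ => μ - n * c := by
    intro n m hnm
    have : (n : ℂ) * c = m * c := by simpa using hnm
    exact_mod_cast mul_right_cancel₀ hc this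
  have hli := Module.End.eigenvectors_linearIndependent' h (fun n : ℕ => μ - n * c) hinj
    (fun n => (f ^ n) u) fun n => ⟨Module.End.mem_eigenspace_iff.2 (apply_pow_of_lie hf hu n),
      hne n⟩
  have := hli.finite
  exact not_finite ℕ

/-- Since e f^{m+1} u = ((m+1) μ - c m(m+1)/2) f^m u, the coefficient must vanish at the last
nonzero power m = n. This gives 2μ = n c. -/
theorem exists_nat_of_sl2 {e h f : Module.End ℂ V} {u : V} {μ c : ℂ} (hc : c ≠ 0)
    (hef : ⁅e, f⁆ = h) (hf : ⁅h, f⁆ = -c • f) (hu0 : u ≠ 0) (hu : h u = μ • u) (he : e u = 0) :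
    ∃ n : ℕ, 2 * μ = n * c := by
  have hex := exists_pow_apply_eq_zero hc hf hu
  have hn := Nat.find_spec hex
  obtain ⟨n, hn'⟩ : ∃ n, Nat.find hex = n + 1 :=
    Nat.exists_eq_succ_of_ne_zero fun h0 => hu0 (by simpa [h0] using hn)
  have hne : (f ^ n) u ≠ 0 := Nat.find_min hex (by omega)
  have key : ∀ m : ℕ, e ((f ^ (m + 1)) u) =
      ((m + 1 : ℂ) * μ - c * (m * (m + 1)) / 2) • (f ^ m) u := by
    intro m
    have h1 : e * f = f * e + h := by
      rw [Ring.lie_def, sub_eq_iff_eq_add] at hef; rw [hef]; abel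
    induction m with
    | zero =>
      rw [zero_add, pow_one, ← Module.End.mul_apply, h1, LinearMap.add_apply, Module.End.mul_apply,
        he, hu]
      simp
    | succ m ih =>
      rw [pow_succ' f (m + 1), Module.End.mul_apply, ← Module.End.mul_apply e, h1,
        LinearMap.add_apply, Module.End.mul_apply, ih, map_smul, apply_pow_of_lie hf hu,
        ← Module.End.mul_apply, ← pow_succ', ← add_smul]
      push_cast; congr 1; ring
  have h2 := key n
  rw [← hn', hn, map_zero] at h2
  have h3 := (smul_eq_zero.1 h2.symm).resolve_right hne
  refine ⟨n, ?_⟩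
  have h4 : ((n : ℂ) + 1) ≠ 0 := by exact_mod_cast Nat.succ_ne_zero n
  refine mul_left_cancel₀ h4 ?_
  linear_combination 2 * h3

/-- The super analogue: `e` and `f` are odd with anticommutator `h`, and f² is not zero in general.
The first vanishing power of `f` on `u` has to be odd, say 2m + 1, and then μ = m c. -/
theorem exists_nat_of_osp {e h f : Module.End ℂ V} {u : V} {μ c : ℂ} (hc : c ≠ 0)
    (hef : acomm e f = h) (hf : ⁅h, f⁆ = -c • f) (hu0 : u ≠ 0) (hu : h u = μ • u) (he : e u = 0) :
    ∃ n : ℕ, μ = n * c := by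
  have hex := exists_pow_apply_eq_zero hc hf hu
  have hn := Nat.find_spec hex
  have h1 : e * f = h - f * e := by rw [← hef, acomm]; abel
  -- At `m = 0` the truncated exponent `2 * m - 1` is 0, which is harmless because its coefficient
  -- is 0 and e u = 0.
  have key : ∀ m : ℕ, e ((f ^ (2 * m)) u) = (-(m * c)) • (f ^ (2 * m - 1)) u ∧
      e ((f ^ (2 * m + 1)) u) = (μ - m * c) • (f ^ (2 * m)) u := by
    intro m
    have step : ∀ (k : ℕ) (a : ℂ), f (e ((f ^ k) u)) = a • (f ^ k) u →
        e ((f ^ (k + 1)) u) = (μ - k * c - a) • (f ^ k) u := by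
      intro k a hk
      rw [pow_succ' f k, Module.End.mul_apply, ← Module.End.mul_apply e, h1,
        LinearMap.sub_apply, Module.End.mul_apply, hk, apply_pow_of_lie hf hu, ← sub_smul]
    induction m with
    | zero =>
      refine ⟨by simp [he], ?_⟩
      have := step 0 0 (by simp [he])
      simpa using this
    | succ m ih =>
      have h2 : e ((f ^ (2 * (m + 1))) u) = (-((m + 1 : ℕ) * c)) • (f ^ (2 * (m + 1) - 1)) u := by
        have := step (2 * m + 1) (μ - m * c) (by
          rw [ih.2, map_smul, ← Module.End.mul_apply, ← pow_succ'])
        rw [show 2 * (m + 1) = 2 * m + 1 + 1 by ring, this, Nat.add_sub_cancel]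
        push_cast; congr 1; ring
      refine ⟨h2, ?_⟩
      have := step (2 * (m + 1)) (-((m + 1 : ℕ) * c)) (by
        rw [h2, map_smul, ← Module.End.mul_apply, ← pow_succ',
          Nat.sub_add_cancel (by omega : 1 ≤ 2 * (m + 1))])
      rw [this]; push_cast; congr 1; ring
  have hne : ∀ m < Nat.find hex, (f ^ m) u ≠ 0 := fun m hm => Nat.find_min hex hm
  rcases Nat.even_or_odd' (Nat.find hex) with ⟨m, hm | hm⟩
  · exfalso
    have hm0 : m ≠ 0 := by
      rintro rfl
      rw [hm] at hn
      exact hu0 (by simpa using hn)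
    have h2 := (key m).1
    rw [← hm, hn, map_zero] at h2
    rcases smul_eq_zero.1 h2.symm with h3 | h3
    · simp [hm0, hc] at h3
    · exact hne _ (by omega) h3
  · have h2 := (key m).2
    rw [← hm, hn, map_zero] at h2
    exact ⟨m, sub_eq_zero.1 ((smul_eq_zero.1 h2.symm).resolve_right (hne _ (by omega)))⟩

end HighestWeight

/-! ### Modules generated by a highest weight vector -/

namespace RootDatum.ChevalleyModule

variable {D : RootDatum} {V : Type} [AddCommGroup V] [Module ℂ V] (M : D.ChevalleyModule V)

/-- The span of the vectors obtained from `v` by the operators `F k` with `k ∈ S`. -/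
def wordSpan (v : V) (S : Set D.ι) : Submodule ℂ V :=
  Submodule.span ℂ {x | ∃ l : List D.ι, (∀ k ∈ l, k ∈ S) ∧ x = (l.map M.F).prod v}

variable {M} {lam : D.Vec} {v : V} {S : Set D.ι}

theorem word_mem {l : List D.ι} (hl : ∀ k ∈ l, k ∈ S) : (l.map M.F).prod v ∈ M.wordSpan v S :=
  Submodule.subset_span ⟨l, hl, rfl⟩

theorem mem_wordSpan : v ∈ M.wordSpan v S := by
  simpa using word_mem (M := M) (v := v) (S := S) (l := []) (by simp)

theorem map_wordSpan {f : Module.End ℂ V} {N : Submodule ℂ V}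
    (h : ∀ l : List D.ι, (∀ k ∈ l, k ∈ S) → f ((l.map M.F).prod v) ∈ N) {x : V}
    (hx : x ∈ M.wordSpan v S) : f x ∈ N := by
  have : M.wordSpan v S ≤ N.comap f := by
    refine Submodule.span_le.2 ?_
    rintro _ ⟨l, hl, rfl⟩
    exact h l hl
  exact this hx

theorem F_mem_wordSpan {k : D.ι} (hk : k ∈ S) {x : V} (hx : x ∈ M.wordSpan v S) :
    M.F k x ∈ M.wordSpan v S := by
  refine map_wordSpan (fun l hl => ?_) hx
  have := word_mem (M := M) (v := v) (S := S) (l := k :: l)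
    (by simpa using ⟨hk, hl⟩)
  simpa using this

theorem H_word (hv : M.IsHighestWeightVector lam v) (j : D.ι) (l : List D.ι) :
    ∃ c : ℂ, M.H j ((l.map M.F).prod v) = c • (l.map M.F).prod v := by
  induction l with
  | nil => exact ⟨_, by simpa using (hv.2 j).2⟩
  | cons k l ih =>
    obtain ⟨c, hc⟩ := ih
    have h1 : M.H j * M.F k = M.F k * M.H j + -D.form (D.simple j) (D.simple k) • M.F k := by
      rw [← M.H_F j k]; abel
    refine ⟨c - D.form (D.simple j) (D.simple k), ?_⟩
    rw [List.map_cons, List.prod_cons, Module.End.mul_apply, ← Module.End.mul_apply, h1,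
      LinearMap.add_apply, Module.End.mul_apply, hc, map_smul, LinearMap.smul_apply, ← add_smul,
      sub_eq_add_neg]

theorem H_mem_wordSpan (hv : M.IsHighestWeightVector lam v) (j : D.ι) {x : V}
    (hx : x ∈ M.wordSpan v S) : M.H j x ∈ M.wordSpan v S := by
  refine map_wordSpan (fun l hl => ?_) hx
  obtain ⟨c, hc⟩ := H_word hv j l
  rw [hc]
  exact Submodule.smul_mem _ _ (word_mem hl)

theorem E_mul_F (j k : D.ι) : M.E j * M.F k =
    (-1 : ℂ) ^ (D.parity j * D.parity k) • (M.F k * M.E j) + if j = k then M.H j else 0 := by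
  rw [← M.E_F j k]; abel

theorem E_word_mem (hv : M.IsHighestWeightVector lam v) (j : D.ι) {l : List D.ι}
    (hl : ∀ k ∈ l, k ∈ S) : M.E j ((l.map M.F).prod v) ∈ M.wordSpan v S := by
  induction l with
  | nil => simp [(hv.2 j).1]
  | cons k l ih =>
    have hl' : ∀ k ∈ l, k ∈ S := fun k hk => hl k (by simp [hk])
    rw [List.map_cons, List.prod_cons, Module.End.mul_apply, ← Module.End.mul_apply, E_mul_F,
      LinearMap.add_apply, LinearMap.smul_apply, Module.End.mul_apply]
    refine Submodule.add_mem _ (Submodule.smul_mem _ _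
      (F_mem_wordSpan (hl k (by simp)) (ih hl'))) ?_
    split_ifs
    · exact H_mem_wordSpan hv j (word_mem hl')
    · simp

theorem E_mem_wordSpan (hv : M.IsHighestWeightVector lam v) (j : D.ι) {x : V}
    (hx : x ∈ M.wordSpan v S) : M.E j x ∈ M.wordSpan v S :=
  map_wordSpan (fun _ hl => E_word_mem hv j hl) hx

/-- `E j` commutes up to sign with every `F k`, k ≠ j, and so can be moved through a word to the
vector `v`, which it kills. Words in part of the `F k` thus provide highest weight vectors for
larger subalgebras. -/
theorem E_apply_eq_zero (hv : M.IsHighestWeightVector lam v) {j : D.ι} (hj : j ∉ S) {x : V}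
    (hx : x ∈ M.wordSpan v S) : M.E j x = 0 := by
  rw [← Submodule.mem_bot ℂ]
  refine map_wordSpan (fun l hl => ?_) hx
  rw [Submodule.mem_bot]
  induction l with
  | nil => simpa using (hv.2 j).1
  | cons k l ih =>
    have hne : j ≠ k := fun h => hj (h ▸ hl k (by simp))
    rw [List.map_cons, List.prod_cons, Module.End.mul_apply, ← Module.End.mul_apply, E_mul_F,
      if_neg hne, add_zero, LinearMap.smul_apply, Module.End.mul_apply,
      ih fun k hk => hl k (by simp [hk]), map_zero, smul_zero]

/-- If v + par v is nonzero it is an even highest weight vector of the same weight; otherwise `v`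
itself is odd. Homogeneity is needed because irreducibility refers only to graded submodules. -/
theorem exists_homogeneous (hv : M.IsHighestWeightVector lam v) :
    ∃ w, M.IsHighestWeightVector lam w ∧ ∃ ε : ℂ, M.par w = ε • w := by
  have hpp : ∀ x, M.par (M.par x) = x := fun x => by
    rw [← Module.End.mul_apply, M.par_sq, Module.End.one_apply]
  have hE : ∀ i, M.E i (M.par v) = 0 := fun i => by
    have h1 := congrArg (fun f : Module.End ℂ V => f v) (M.par_E i)
    simp only [Module.End.mul_apply, LinearMap.smul_apply, (hv.2 i).1, map_zero] at h1
    exact (smul_eq_zero.1 h1.symm).resolve_left (by simp)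
  have hH : ∀ i, M.H i (M.par v) = D.form lam (D.simple i) • M.par v := fun i => by
    rw [← Module.End.mul_apply, ← M.par_H i, Module.End.mul_apply, (hv.2 i).2, map_smul]
  by_cases h0 : v + M.par v = 0
  · exact ⟨v, hv, -1, by rw [neg_one_smul]; exact (neg_eq_of_add_eq_zero_right h0).symm⟩
  · refine ⟨v + M.par v, ⟨h0, fun i => ⟨?_, ?_⟩⟩, 1, ?_⟩
    · rw [map_add, hE, (hv.2 i).1, add_zero]
    · rw [map_add, hH, (hv.2 i).2, smul_add]
    · rw [map_add, hpp, one_smul, add_comm]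

theorem wordSpan_univ (hM : M.IsIrreducible) (hv : M.IsHighestWeightVector lam v) {ε : ℂ}
    (hε : M.par v = ε • v) : M.wordSpan v Set.univ = ⊤ := by
  refine (hM.2 _ fun x hx => ⟨?_, fun i => ⟨E_mem_wordSpan hv i hx,
    F_mem_wordSpan (Set.mem_univ i) hx, H_mem_wordSpan hv i hx⟩⟩).resolve_left ?_
  · refine map_wordSpan (fun l _ => ?_) hx
    have : ∃ c : ℂ, M.par ((l.map M.F).prod v) = c • (l.map M.F).prod v := by
      induction l with
      | nil => exact ⟨ε, by simpa using hε⟩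
      | cons k l ih =>
        obtain ⟨c, hc⟩ := ih (fun _ _ => Set.mem_univ _)
        refine ⟨(-1 : ℂ) ^ D.parity k * c, ?_⟩
        rw [List.map_cons, List.prod_cons, Module.End.mul_apply, ← Module.End.mul_apply, M.par_F,
          LinearMap.smul_apply, Module.End.mul_apply, hc, map_smul, mul_smul]
    obtain ⟨c, hc⟩ := this
    rw [hc]
    exact Submodule.smul_mem _ _ (word_mem fun _ _ => Set.mem_univ _)
  · intro h
    have := mem_wordSpan (M := M) (v := v) (S := Set.univ)
    rw [h, Submodule.mem_bot] at this
    exact hv.1 this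

/-- An operator that commutes up to scalars with the `F k` and kills the generator is zero. -/
theorem eq_zero_of_commute (htop : M.wordSpan v Set.univ = ⊤) {z : Module.End ℂ V} (hz : z v = 0)
    (h : ∀ k, ∃ c : ℂ, z * M.F k = c • (M.F k * z)) : z = 0 := by
  ext x
  have hx : x ∈ M.wordSpan v Set.univ := htop ▸ Submodule.mem_top
  rw [LinearMap.zero_apply, ← Submodule.mem_bot ℂ]
  refine map_wordSpan (fun l _ => ?_) hx
  rw [Submodule.mem_bot]
  induction l with
  | nil => simpa using hz
  | cons k l ih =>
    obtain ⟨c, hc⟩ := h k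
    rw [List.map_cons, List.prod_cons, Module.End.mul_apply, ← Module.End.mul_apply, hc,
      LinearMap.smul_apply, Module.End.mul_apply, ih fun _ _ => Set.mem_univ _, map_zero,
      smul_zero]

/-- The Serre relation for orthogonal simple roots, one of which is even. -/
theorem lie_E_eq_zero (htop : M.wordSpan v Set.univ = ⊤) (hv : M.IsHighestWeightVector lam v)
    {a b : D.ι} (hab : a ≠ b) (ha : D.parity a = 0)
    (h : D.form (D.simple a) (D.simple b) = 0) (h' : D.form (D.simple b) (D.simple a) = 0) :
    ⁅M.E a, M.E b⁆ = 0 := by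
  -- The bracket commutes up to sign with each `F k`: the contributions `H a` and `H b` act on the
  -- other generator with weight 0. On the irreducible module this replaces a Serre relation.
  refine eq_zero_of_commute htop ?_ fun k => ⟨(-1 : ℂ) ^ (D.parity b * D.parity k), ?_⟩
  · simp [Ring.lie_def, (hv.2 a).1, (hv.2 b).1]
  · have h1 := E_mul_F (M := M) a k
    have h2 := E_mul_F (M := M) b k
    have h3 := M.H_E a b
    have h4 := M.H_E b a
    rw [ha, zero_mul, pow_zero, one_smul] at h1
    rw [h, zero_smul, sub_eq_zero] at h3
    rw [h', zero_smul, sub_eq_zero] at h4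
    rw [Ring.lie_def, sub_mul, mul_assoc, mul_assoc, h1, h2, mul_add, mul_add, mul_smul_comm,
      ← mul_assoc, ← mul_assoc, h1, h2, add_mul, add_mul, smul_mul_assoc, mul_sub, smul_sub,
      smul_add]
    by_cases hak : a = k
    · subst hak
      rw [if_pos rfl, if_neg (Ne.symm hab), ha, mul_zero, pow_zero]
      simp only [one_smul, mul_zero, zero_mul, add_zero, h3, mul_assoc]
      abel
    · by_cases hbk : b = k
      · subst hbk
        rw [if_pos rfl, if_neg hab]
        simp only [mul_zero, zero_mul, add_zero, h4, mul_assoc, smul_zero]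
        abel
      · rw [if_neg hak, if_neg hbk]
        simp only [mul_zero, zero_mul, add_zero, mul_assoc, smul_zero]

end RootDatum.ChevalleyModule

theorem RootDatum.exists_nat_of_even {D : RootDatum} {V : Type} [AddCommGroup V] [Module ℂ V]
    [Module.Finite ℂ V] {M : D.ChevalleyModule V} {lam : D.Vec} {v : V}
    (hv : M.IsHighestWeightVector lam v) {i : D.ι} (hi : D.parity i = 0)
    (hne : D.form (D.simple i) (D.simple i) ≠ 0) :
    ∃ n : ℕ, 2 * D.form lam (D.simple i) = n * D.form (D.simple i) (D.simple i) := by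
  refine exists_nat_of_sl2 (e := M.E i) (f := M.F i) (h := M.H i) hne ?_ ?_ hv.1 (hv.2 i).2
    (hv.2 i).1
  · have := M.E_F i i
    rwa [hi, zero_mul, pow_zero, one_smul, if_pos rfl] at this
  · exact M.H_F i i

theorem RootDatum.DominantIntegral.exists_nat {D : RootDatum} {lam : D.Vec}
    (h : D.DominantIntegral lam) {i : D.ι} (hi : D.parity i = 0)
    (hne : D.form (D.simple i) (D.simple i) ≠ 0) :
    ∃ n : ℕ, 2 * D.form lam (D.simple i) = n * D.form (D.simple i) (D.simple i) := by
  obtain ⟨_, V, _, _, M, _, _, v, hv⟩ := h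
  exact RootDatum.exists_nat_of_even hv hi hne

end SuperFactor
end

/-! ### Necessary conditions for dominance in G(3) and F(4) -/

noncomputable section
open scoped Classical
namespace SuperFactor

/-! ### The highest weights of `G(3)` -/

theorem g3_form (x y : Fin 3 → ℂ) : g3Datum.form x y =
    2 * x 0 * y 0 - x 0 * y 1 - x 1 * y 0 + 2 * x 1 * y 1 - 2 * x 2 * y 2 := by
  have : g3Datum.form x y = ∑ a : Fin 3, ∑ b : Fin 3,
      x a * (!![2, -1, 0; -1, 2, 0; 0, 0, -2] : Matrix (Fin 3) (Fin 3) ℂ) a b * y b := rfl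
  rw [this]
  simp [Fin.sum_univ_three]
  ring

section G3

variable {A : Type} [Ring A] [Algebra ℂ A]

/-- The relations among Chevalley generators of `G(3)` that are used below. -/
structure G3Relations (E₁ E₂ E₀ F₁ F₂ F₀ H₁ H₂ H₀ : A) : Prop where
  e11 : ⁅E₁, F₁⁆ = H₁
  e22 : ⁅E₂, F₂⁆ = H₂
  e00 : acomm E₀ F₀ = H₀
  e12 : ⁅E₁, F₂⁆ = 0
  e10 : ⁅E₁, F₀⁆ = 0
  e21 : ⁅E₂, F₁⁆ = 0
  e20 : ⁅E₂, F₀⁆ = 0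
  e01 : ⁅E₀, F₁⁆ = 0
  e02 : ⁅E₀, F₂⁆ = 0
  h11 : ⁅H₁, E₁⁆ = (2 : ℂ) • E₁
  h12 : ⁅H₁, E₂⁆ = (-3 : ℂ) • E₂
  h10 : ⁅H₁, E₀⁆ = (-1 : ℂ) • E₀
  h21 : ⁅H₂, E₁⁆ = (-3 : ℂ) • E₁
  h20 : ⁅H₂, E₀⁆ = 0
  h01 : ⁅H₀, E₁⁆ = (-1 : ℂ) • E₁
  serre : ⁅E₂, E₀⁆ = 0

variable {E₁ E₂ E₀ F₁ F₂ F₀ H₁ H₂ H₀ : A}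

/-- The root of ⁅E₁, ⁅E₂, ⁅E₁, E₀⁆⁆⁆ is 2α₁ + α₂ + α₀ = δ, an odd root that is not isotropic. With
the opposite vector it generates osp(1,2), whose Cartan element is proportional to h_δ = H₀ + 2H₁ +
H₂. The products are computed upwards from the simple root vectors: `a`, `b`, `c` are the brackets
of x with F₀, F₁, F₂, `d` those with the H's, and `p` pairs x's with y's. -/
theorem G3Relations.acomm_root_vectors (r : G3Relations E₁ E₂ E₀ F₁ F₂ F₀ H₁ H₂ H₀) :
    acomm ⁅E₁, E₀⁆ F₀ = E₁ ∧
    acomm ⁅E₁, E₀⁆ ⁅F₁, F₀⁆ = (-1 : ℂ) • (H₁ + H₀) ∧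
    acomm ⁅E₁, ⁅E₂, ⁅E₁, E₀⁆⁆⁆ ⁅F₁, ⁅F₂, ⁅F₁, F₀⁆⁆⁆ =
      (-6 : ℂ) • (H₀ + (2 : ℂ) • H₁ + H₂) := by
  have f11 : ⁅F₁, E₁⁆ = -H₁ := by rw [← br_skew, r.e11]
  have f22 : ⁅F₂, E₂⁆ = -H₂ := by rw [← br_skew, r.e22]
  have f12 : ⁅F₁, E₂⁆ = 0 := by rw [← br_skew, r.e21, neg_zero]
  have f21 : ⁅F₂, E₁⁆ = 0 := by rw [← br_skew, r.e12, neg_zero]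
  have k01 : ⁅E₁, H₀⁆ = E₁ := by rw [← br_skew, r.h01]; module
  have k12 : ⁅E₂, H₁⁆ = (3 : ℂ) • E₂ := by rw [← br_skew, r.h12]; module
  set x₁ := ⁅E₁, E₀⁆ with hx₁
  set x₂ := ⁅E₂, x₁⁆ with hx₂
  set x₃ := ⁅E₁, x₂⁆ with hx₃
  set y₁ := ⁅F₁, F₀⁆ with hy₁
  set y₂ := ⁅F₂, y₁⁆ with hy₂
  have a1 : acomm x₁ F₀ = E₁ := by
    rw [hx₁, lie_acomm, r.e00, r.e10, acomm_zero, k01, sub_zero]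
  have b1 : ⁅x₁, F₁⁆ = (-1 : ℂ) • E₀ := by
    rw [hx₁, br_br, r.e01, br_zero, r.e11, ← br_skew, r.h10]; module
  have c1 : ⁅x₁, F₂⁆ = 0 := by
    rw [hx₁, br_br, r.e02, br_zero, r.e12, br_zero, sub_zero]
  have d1 : ⁅H₁, x₁⁆ = x₁ := by
    rw [hx₁, br_leibniz, r.h11, r.h10, smul_br, br_smul]; module
  have d2 : ⁅H₂, x₁⁆ = (-3 : ℂ) • x₁ := by
    rw [hx₁, br_leibniz, r.h21, r.h20, smul_br, br_zero]; module
  have a2 : acomm x₂ F₀ = ⁅E₂, E₁⁆ := by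
    rw [hx₂, lie_acomm, a1, r.e20, acomm_zero, sub_zero]
  have b2 : ⁅x₂, F₁⁆ = 0 := by
    rw [hx₂, br_br, b1, r.e21, br_zero, br_smul, r.serre, smul_zero, sub_zero]
  have c2 : ⁅x₂, F₂⁆ = (-3 : ℂ) • x₁ := by
    rw [hx₂, br_br, c1, r.e22, br_zero, ← br_skew, d2]; module
  have d3 : ⁅H₁, x₂⁆ = (-2 : ℂ) • x₂ := by
    rw [hx₂, br_leibniz, d1, r.h12, smul_br]; module
  have a3 : acomm x₃ F₀ = ⁅E₁, ⁅E₂, E₁⁆⁆ := by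
    rw [hx₃, lie_acomm, a2, r.e10, acomm_zero, sub_zero]
  have b3 : ⁅x₃, F₁⁆ = (-2 : ℂ) • x₂ := by
    rw [hx₃, br_br, b2, r.e11, br_zero, ← br_skew, d3]; module
  have c3 : ⁅x₃, F₂⁆ = (-3 : ℂ) • ⁅E₁, x₁⁆ := by
    rw [hx₃, br_br, c2, r.e12, br_zero, br_smul, sub_zero]
  have p11 : acomm x₁ y₁ = (-1 : ℂ) • (H₁ + H₀) := by
    rw [hy₁, acomm_lie, a1, b1, f11, smul_acomm, r.e00]; module
  have p21 : acomm x₂ y₁ = (-3 : ℂ) • E₂ := by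
    rw [hy₁, acomm_lie, a2, b2, zero_acomm, br_leibniz, f12, f11, zero_br, br_neg, k12]; module
  have p22 : acomm x₂ y₂ = (3 : ℂ) • (H₀ + H₁ + H₂) := by
    rw [hy₂, acomm_lie, p21, c2, smul_acomm, p11, br_smul, f22]; module
  have p31 : acomm x₃ y₁ = (2 : ℂ) • ⁅E₂, E₁⁆ := by
    have h1 : ⁅H₁, ⁅E₂, E₁⁆⁆ = (-1 : ℂ) • ⁅E₂, E₁⁆ := by
      rw [br_leibniz, r.h12, r.h11, smul_br, br_smul]; module
    rw [hy₁, acomm_lie, a3, b3, smul_acomm, a2, br_leibniz, f11, br_leibniz F₁ E₂, f12, f11,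
      zero_br, neg_br, h1, br_neg, k12, zero_add, br_neg, br_smul, ← br_skew E₁ E₂]; module
  have q : acomm ⁅E₁, x₁⁆ y₁ = 0 := by
    rw [hy₁, acomm_lie, lie_acomm, a1, r.e10, acomm_zero, br_self, br_br, b1, r.e11,
      ← br_skew x₁ H₁, d1, br_smul, ← hx₁, sub_zero, br_zero, zero_add]
    rw [show (-1 : ℂ) • x₁ - -x₁ = 0 by module, zero_acomm]
  have p32 : acomm x₃ y₂ = (6 : ℂ) • E₁ := by
    have h1 : ⁅H₂, E₁⁆ = (-3 : ℂ) • E₁ := r.h21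
    rw [hy₂, acomm_lie, p31, c3, smul_acomm, q, br_smul, br_leibniz, f22, f21, neg_br, h1,
      br_zero]; module
  refine ⟨a1, p11, ?_⟩
  rw [acomm_lie, p32, b3, smul_acomm, p22, br_smul, f11]; module

end G3

section G3Module

open RootDatum ChevalleyModule

/-- The Cartan matrix of `G(3)`, in a root datum with numbered simple roots. -/
structure G3Cartan (D : RootDatum) (i : Fin 3 → D.ι) : Prop where
  inj : Function.Injective i
  par : ∀ a, D.parity (i a) = (![0, 0, 1] : Fin 3 → ℕ) a
  form : ∀ a b, D.form (D.simple (i a)) (D.simple (i b)) =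
    (!![2, -3, -1; -3, 6, 0; -1, 0, 0] : Matrix (Fin 3) (Fin 3) ℂ) a b

variable {D : RootDatum} {i : Fin 3 → D.ι} {V : Type} [AddCommGroup V] [Module ℂ V]

theorem G3Cartan.relations (hi : G3Cartan D i) {M : D.ChevalleyModule V} (hM : M.IsIrreducible)
    {lam : D.Vec} {v : V} (hv : M.IsHighestWeightVector lam v) {ε : ℂ} (hε : M.par v = ε • v) :
    G3Relations (M.E (i 0)) (M.E (i 1)) (M.E (i 2)) (M.F (i 0)) (M.F (i 1)) (M.F (i 2))
      (M.H (i 0)) (M.H (i 1)) (M.H (i 2)) := by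
  have htop := wordSpan_univ hM hv hε
  have hEF : ∀ a b : Fin 3, (![0, 0, 1] : Fin 3 → ℕ) a * (![0, 0, 1] : Fin 3 → ℕ) b = 0 →
      ⁅M.E (i a), M.F (i b)⁆ = if a = b then M.H (i a) else 0 := by
    intro a b h
    have := M.E_F (i a) (i b)
    rw [Ring.lie_def]
    simpa only [hi.par, h, pow_zero, one_smul, hi.inj.eq_iff] using this
  have hHE : ∀ a b : Fin 3, ⁅M.H (i a), M.E (i b)⁆ =
      ((!![2, -3, -1; -3, 6, 0; -1, 0, 0] : Matrix (Fin 3) (Fin 3) ℂ) a b) • M.E (i b) := by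
    intro a b
    rw [← hi.form]; exact M.H_E _ _
  refine ⟨?_, ?_, ?_, ?_, ?_, ?_, ?_, ?_, ?_, ?_, ?_, ?_, ?_, ?_, ?_, ?_⟩
  · exact hEF 0 0 rfl
  · exact hEF 1 1 rfl
  · have := M.E_F (i 2) (i 2)
    simpa [hi.par, acomm] using this
  · exact hEF 0 1 rfl
  · exact hEF 0 2 rfl
  · exact hEF 1 0 rfl
  · exact hEF 1 2 rfl
  · exact hEF 2 0 rfl
  · exact hEF 2 1 rfl
  · exact hHE 0 0
  · exact hHE 0 1
  · exact hHE 0 2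
  · exact hHE 1 0
  · exact (hHE 1 2).trans (by simp)
  · exact hHE 2 0
  · exact lie_E_eq_zero htop hv (hi.inj.ne (by simp)) (hi.par 1) (hi.form 1 2) (hi.form 2 1)

/-- Here `n` is the coefficient of δ in the weight, an integer n ≥ 0 by the osp(1,2) attached to δ.
Each factor F₀ lowers it by 1, and a nonzero vector killed by the raising operator cannot have value
-1. So F₀ v = 0 if n = 0, and y₁ F₀ v = 0 if n = 1; applying the opposite root vectors turns these
into the stated equations. -/
theorem G3Cartan.dominantIntegral (hi : G3Cartan D i) {lam : D.Vec} {l : Fin 3 → ℂ}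
    (hl : ∀ a, D.form lam (D.simple (i a)) = l a) (h : D.DominantIntegral lam) :
    ∃ n : ℕ, l 2 + 2 * l 0 + l 1 = -2 * n ∧ (n = 0 → l 2 = 0) ∧
      (n = 1 → l 2 = 0 ∨ l 2 + l 0 + 1 = 0) := by
  obtain ⟨_, V, _, _, M, _, hM, v₀, hv₀⟩ := h
  obtain ⟨v, hv, ε, hε⟩ := exists_homogeneous hv₀
  have r := hi.relations hM hv hε
  obtain ⟨q1, q2, q3⟩ := r.acomm_root_vectors
  set y₁ := ⁅M.F (i 0), M.F (i 2)⁆ with hy₁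
  set y₃ := ⁅M.F (i 0), ⁅M.F (i 1), y₁⁆⁆ with hy₃
  set x₁ := ⁅M.E (i 0), M.E (i 2)⁆ with hx₁
  set x₃ := ⁅M.E (i 0), ⁅M.E (i 1), x₁⁆⁆ with hx₃
  set S : Set D.ι := {i 0, i 2} with hS
  set h' := (-6 : ℂ) • (M.H (i 2) + (2 : ℂ) • M.H (i 0) + M.H (i 1)) with hh'
  have hEv : ∀ a, M.E (i a) v = 0 := fun a => (hv.2 _).1
  have hHv : ∀ a, M.H (i a) v = l a • v := fun a => by rw [(hv.2 _).2, hl]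
  have hHF : ∀ a b : Fin 3, ⁅M.H (i a), M.F (i b)⁆ =
      (-(!![2, -3, -1; -3, 6, 0; -1, 0, 0] : Matrix (Fin 3) (Fin 3) ℂ) a b) • M.F (i b) := by
    intro a b
    rw [← hi.form]; exact M.H_F _ _
  have hh : ∀ b : Fin 3, ⁅h', M.F (i b)⁆ = ((![0, 0, -12] : Fin 3 → ℂ) b) • M.F (i b) := by
    intro b
    rw [hh', smul_br, add_br, add_br, smul_br, hHF, hHF, hHF]
    fin_cases b <;> simp <;> module
  have h1 : ⁅h', y₁⁆ = (-12 : ℂ) • y₁ := by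
    rw [hy₁, br_weight (hh 0) (hh 2)]; simp
  have h3 : ⁅h', y₃⁆ = -(12 : ℂ) • y₃ := by
    rw [hy₃, br_weight (hh 0) (br_weight (hh 1) h1)]; simp
  -- The span of words without `F (i 1)` is stable under all `E`'s and annihilated by `E (i 1)`,
  -- which occurs in every term of x₃.
  have hx : ∀ x ∈ M.wordSpan v S, x₃ x = 0 := by
    intro x hx
    have k0 : ∀ z ∈ M.wordSpan v S, M.E (i 1) z = 0 := fun z hz =>
      E_apply_eq_zero hv (by simp [hS, hi.inj.eq_iff]) hz
    have k1 : ∀ a, ∀ z ∈ M.wordSpan v S, M.E (i a) z ∈ M.wordSpan v S := fun a z hz =>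
      E_mem_wordSpan hv _ hz
    have k2 : ∀ z ∈ M.wordSpan v S, x₁ z ∈ M.wordSpan v S := fun z hz => by
      rw [hx₁, Ring.lie_def]
      exact Submodule.sub_mem _ (k1 _ _ (k1 _ _ hz)) (k1 _ _ (k1 _ _ hz))
    simp [hx₃, Ring.lie_def, k0 _ hx, k0 _ (k2 _ hx), k0 _ (k1 0 _ hx), k0 _ (k2 _ (k1 0 _ hx))]
  have hw : h' v = (-6 * (l 2 + 2 * l 0 + l 1)) • v := by
    simp only [hh', LinearMap.smul_apply, LinearMap.add_apply, hHv]; module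
  have key : ∀ u ∈ M.wordSpan v S, u ≠ 0 → ∀ μ : ℂ, h' u = μ • u → ∃ n : ℕ, μ = n * 12 :=
    fun u hu hu0 μ hμ => exists_nat_of_osp (by norm_num) q3 h3 hu0 hμ (hx u hu)
  obtain ⟨n, hn⟩ := key v mem_wordSpan hv.1 _ hw
  have hm0 : M.F (i 2) v ∈ M.wordSpan v S := F_mem_wordSpan (by simp [hS]) mem_wordSpan
  have hm1 : y₁ (M.F (i 2) v) ∈ M.wordSpan v S := by
    rw [hy₁, Ring.lie_def]
    exact Submodule.sub_mem _
      (F_mem_wordSpan (by simp [hS]) (F_mem_wordSpan (by simp [hS]) hm0))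
      (F_mem_wordSpan (by simp [hS]) (F_mem_wordSpan (by simp [hS]) hm0))
  have hw0 : h' (M.F (i 2) v) = ((n - 1 : ℂ) * 12) • M.F (i 2) v := by
    rw [apply_of_br (hh 2) hw, hn]; congr 1; simp; ring
  have hw1 : h' (y₁ (M.F (i 2) v)) = ((n - 2 : ℂ) * 12) • y₁ (M.F (i 2) v) := by
    rw [apply_of_br h1 hw0]; congr 1; ring
  have hF0 : M.F (i 2) v = 0 → l 2 = 0 := by
    intro h0
    have := congrArg (fun f : Module.End ℂ V => f v) r.e00
    simp only [acomm, LinearMap.add_apply, Module.End.mul_apply, h0, hEv, map_zero, add_zero,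
      hHv] at this
    exact (smul_eq_zero.1 this.symm).resolve_right hv.1
  refine ⟨n, by linear_combination (-1 / 6 : ℂ) * hn, ?_, ?_⟩
  · rintro rfl
    by_contra hne
    obtain ⟨k, hk⟩ := key _ hm0 (fun h0 => hne (hF0 h0)) _ hw0
    have : ((k + 1 : ℕ) : ℂ) = 0 := by push_cast; push_cast at hk; linear_combination -hk / 12
    exact absurd this (by exact_mod_cast Nat.succ_ne_zero k)
  · rintro rfl
    by_contra hne
    push Not at hne
    have hne0 : M.F (i 2) v ≠ 0 := fun h0 => hne.1 (hF0 h0)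
    have hz : y₁ (M.F (i 2) v) = 0 := by
      by_contra h0
      obtain ⟨k, hk⟩ := key _ hm1 h0 _ hw1
      have : ((k + 1 : ℕ) : ℂ) = 0 := by push_cast; push_cast at hk; linear_combination -hk / 12
      exact absurd this (by exact_mod_cast Nat.succ_ne_zero k)
    have hx1v : x₁ v = 0 := by simp [hx₁, Ring.lie_def, hEv]
    have hx1 : x₁ (M.F (i 2) v) = 0 := by
      have := congrArg (fun f : Module.End ℂ V => f v) q1
      simpa [acomm, hx1v, hEv] using this
    have := congrArg (fun f : Module.End ℂ V => f (M.F (i 2) v)) q2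
    simp only [acomm, LinearMap.add_apply, Module.End.mul_apply, hz, hx1, map_zero, add_zero,
      LinearMap.smul_apply, apply_of_br (hHF 0 2) (hHv 0), apply_of_br (hHF 2 2) (hHv 2),
      ← add_smul, smul_smul] at this
    have := (smul_eq_zero.1 this.symm).resolve_right hne0
    simp at this
    exact hne.2 (by linear_combination -this)

end G3Module

end SuperFactor
end

noncomputable section
open scoped Classical
namespace SuperFactor

/-! ### The highest weights of `F(4)` -/

theorem acomm_comm {A : Type} [Ring A] (a b : A) : acomm a b = acomm b a := add_comm _ _

section F4

variable {A : Type} [Ring A] [Algebra ℂ A]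

/-- The relations among Chevalley generators of `F(4)` that are used below. -/
structure F4Relations (E₁ E₂ E₃ E₀ F₁ F₂ F₃ F₀ H₁ H₂ H₃ H₀ : A) : Prop where
  e11 : ⁅E₁, F₁⁆ = H₁
  e22 : ⁅E₂, F₂⁆ = H₂
  e33 : ⁅E₃, F₃⁆ = H₃
  e00 : acomm E₀ F₀ = H₀
  e12 : ⁅E₁, F₂⁆ = 0
  e13 : ⁅E₁, F₃⁆ = 0
  e10 : ⁅E₁, F₀⁆ = 0
  e21 : ⁅E₂, F₁⁆ = 0
  e23 : ⁅E₂, F₃⁆ = 0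
  e20 : ⁅E₂, F₀⁆ = 0
  e31 : ⁅E₃, F₁⁆ = 0
  e32 : ⁅E₃, F₂⁆ = 0
  e30 : ⁅E₃, F₀⁆ = 0
  e01 : ⁅E₀, F₁⁆ = 0
  e02 : ⁅E₀, F₂⁆ = 0
  e03 : ⁅E₀, F₃⁆ = 0
  h1 : ⁅H₁, E₁⁆ = (2 : ℂ) • E₁ ∧ ⁅H₁, E₂⁆ = (-1 : ℂ) • E₂ ∧ ⁅H₁, E₃⁆ = (0 : ℂ) • E₃ ∧
    ⁅H₁, E₀⁆ = (0 : ℂ) • E₀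
  h2 : ⁅H₂, E₁⁆ = (-1 : ℂ) • E₁ ∧ ⁅H₂, E₂⁆ = (2 : ℂ) • E₂ ∧ ⁅H₂, E₃⁆ = (-1 : ℂ) • E₃ ∧
    ⁅H₂, E₀⁆ = (0 : ℂ) • E₀
  h3 : ⁅H₃, E₁⁆ = (0 : ℂ) • E₁ ∧ ⁅H₃, E₂⁆ = (-1 : ℂ) • E₂ ∧ ⁅H₃, E₃⁆ = (1 : ℂ) • E₃ ∧
    ⁅H₃, E₀⁆ = (-1 / 2 : ℂ) • E₀
  h0 : ⁅H₀, E₁⁆ = (0 : ℂ) • E₁ ∧ ⁅H₀, E₂⁆ = (0 : ℂ) • E₂ ∧ ⁅H₀, E₃⁆ = (-1 / 2 : ℂ) • E₃ ∧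
    ⁅H₀, E₀⁆ = (0 : ℂ) • E₀
  serre13 : ⁅E₁, E₃⁆ = 0
  serre10 : ⁅E₁, E₀⁆ = 0
  serre20 : ⁅E₂, E₀⁆ = 0

variable {E₁ E₂ E₃ E₀ F₁ F₂ F₃ F₀ H₁ H₂ H₃ H₀ : A}

/-- The odd vectors x₄ and x₅ have the roots (ε₁ - ε₂ - ε₃ + δ)/2 and (-ε₁ + ε₂ + ε₃ + δ)/2, with
sum δ. So their anticommutator is a root vector of the even root δ, and with the opposite one it
spans an sl(2) whose Cartan element is proportional to h_δ = H₁ + 2H₂ + 3H₃ + 2H₀. -/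
theorem F4Relations.acomm_root_vectors
    (r : F4Relations E₁ E₂ E₃ E₀ F₁ F₂ F₃ F₀ H₁ H₂ H₃ H₀) :
    acomm ⁅E₃, E₀⁆ F₀ = (1 / 2 : ℂ) • E₃ ∧
    acomm ⁅E₃, E₀⁆ ⁅F₃, F₀⁆ = (-1 / 2 : ℂ) • (H₃ + H₀) ∧
    acomm ⁅E₂, ⁅E₃, E₀⁆⁆ F₀ = (1 / 2 : ℂ) • ⁅E₂, E₃⁆ ∧
    acomm ⁅E₂, ⁅E₃, E₀⁆⁆ ⁅F₃, F₀⁆ = (-1 / 2 : ℂ) • E₂ ∧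
    acomm ⁅E₂, ⁅E₃, E₀⁆⁆ ⁅F₂, ⁅F₃, F₀⁆⁆ = (1 / 2 : ℂ) • (H₂ + H₃ + H₀) ∧
    ⁅acomm ⁅E₁, ⁅E₂, ⁅E₃, E₀⁆⁆⁆ ⁅E₃, ⁅E₂, ⁅E₃, E₀⁆⁆⁆,
      acomm ⁅F₁, ⁅F₂, ⁅F₃, F₀⁆⁆⁆ ⁅F₃, ⁅F₂, ⁅F₃, F₀⁆⁆⁆⁆ =
      (3 / 16 : ℂ) • (H₁ + (2 : ℂ) • H₂ + (3 : ℂ) • H₃ + (2 : ℂ) • H₀) := by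
  obtain ⟨h11, h12, h13, h10⟩ := r.h1
  obtain ⟨h21, h22, h23, h20⟩ := r.h2
  obtain ⟨h31, h32, h33, h30⟩ := r.h3
  obtain ⟨h01, h02, h03, h00⟩ := r.h0
  have f11 : ⁅F₁, E₁⁆ = -H₁ := by rw [← br_skew, r.e11]
  have f22 : ⁅F₂, E₂⁆ = -H₂ := by rw [← br_skew, r.e22]
  have f33 : ⁅F₃, E₃⁆ = -H₃ := by rw [← br_skew, r.e33]
  have f13 : ⁅F₁, E₃⁆ = 0 := by rw [← br_skew, r.e31, neg_zero]
  have f21 : ⁅F₂, E₁⁆ = 0 := by rw [← br_skew, r.e12, neg_zero]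
  have f23 : ⁅F₂, E₃⁆ = 0 := by rw [← br_skew, r.e32, neg_zero]
  have f31 : ⁅F₃, E₁⁆ = 0 := by rw [← br_skew, r.e13, neg_zero]
  have f32 : ⁅F₃, E₂⁆ = 0 := by rw [← br_skew, r.e23, neg_zero]
  have k23 : ⁅E₂, H₃⁆ = E₂ := by rw [← br_skew, h32]; module
  set x₁ := ⁅E₃, E₀⁆ with hx₁
  set x₂ := ⁅E₂, x₁⁆ with hx₂
  set x₄ := ⁅E₁, x₂⁆ with hx₄
  set x₅ := ⁅E₃, x₂⁆ with hx₅
  set y₁ := ⁅F₃, F₀⁆ with hy₁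
  set y₂ := ⁅F₂, y₁⁆ with hy₂
  set y₄ := ⁅F₁, y₂⁆ with hy₄
  set y₅ := ⁅F₃, y₂⁆ with hy₅
  have a1 : acomm x₁ F₀ = (1 / 2 : ℂ) • E₃ := by
    rw [hx₁, lie_acomm, r.e00, r.e30, acomm_zero, ← br_skew, h03]; module
  have b13 : ⁅x₁, F₃⁆ = (-1 / 2 : ℂ) • E₀ := by
    rw [hx₁, br_br, r.e03, br_zero, r.e33, ← br_skew, h30]; module
  have b12 : ⁅x₁, F₂⁆ = 0 := by
    rw [hx₁, br_br, r.e02, br_zero, r.e32, br_zero, sub_zero]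
  have b11 : ⁅x₁, F₁⁆ = 0 := by
    rw [hx₁, br_br, r.e01, br_zero, r.e31, br_zero, sub_zero]
  have d12 : ⁅H₂, x₁⁆ = (-1 + 0 : ℂ) • x₁ := br_weight h23 h20
  have a2 : acomm x₂ F₀ = (1 / 2 : ℂ) • ⁅E₂, E₃⁆ := by
    rw [hx₂, lie_acomm, a1, r.e20, acomm_zero, br_smul, sub_zero]
  have b23 : ⁅x₂, F₃⁆ = 0 := by
    rw [hx₂, br_br, b13, r.e23, br_zero, br_smul, r.serre20, smul_zero, sub_zero]
  have b22 : ⁅x₂, F₂⁆ = (-1 : ℂ) • x₁ := by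
    rw [hx₂, br_br, b12, r.e22, br_zero, ← br_skew x₁, d12]; module
  have b21 : ⁅x₂, F₁⁆ = 0 := by
    rw [hx₂, br_br, b11, r.e21, br_zero, br_zero, sub_zero]
  have d21 : ⁅H₁, x₂⁆ = (-1 + (0 + 0) : ℂ) • x₂ := br_weight h12 (br_weight h13 h10)
  have d22 : ⁅H₂, x₂⁆ = (2 + (-1 + 0) : ℂ) • x₂ := br_weight h22 d12
  have d23 : ⁅H₃, x₂⁆ = (-1 + (1 + -1 / 2) : ℂ) • x₂ := br_weight h32 (br_weight h33 h30)
  have d20 : ⁅H₀, x₂⁆ = (0 + (-1 / 2 + 0) : ℂ) • x₂ := br_weight h02 (br_weight h03 h00)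
  have p11 : acomm x₁ y₁ = (-1 / 2 : ℂ) • (H₃ + H₀) := by
    rw [hy₁, acomm_lie, a1, b13, smul_acomm, r.e00, br_smul, f33]; module
  have p21 : acomm x₂ y₁ = (-1 / 2 : ℂ) • E₂ := by
    rw [hy₁, acomm_lie, a2, b23, zero_acomm, br_smul, br_leibniz, f32, zero_br, f33, br_neg, k23]
    module
  have p22 : acomm x₂ y₂ = (1 / 2 : ℂ) • (H₂ + H₃ + H₀) := by
    rw [hy₂, acomm_lie, p21, b22, smul_acomm, p11, br_smul, f22]; module
  have b43 : ⁅x₄, F₃⁆ = 0 := by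
    rw [hx₄, br_br, b23, r.e13, br_zero, br_zero, sub_zero]
  have b42 : ⁅x₄, F₂⁆ = 0 := by
    rw [hx₄, br_br, b22, r.e12, br_zero, sub_zero, br_smul, hx₁, br_leibniz, r.serre13,
      r.serre10, zero_br, br_zero, add_zero, smul_zero]
  have b41 : ⁅x₄, F₁⁆ = (-1 : ℂ) • x₂ := by
    rw [hx₄, br_br, b21, r.e11, br_zero, ← br_skew x₂, d21]; module
  have p41 : acomm x₄ y₁ = (-1 / 2 : ℂ) • ⁅E₁, E₂⁆ := by
    rw [hy₁, acomm_lie, b43, zero_acomm, hx₄, lie_acomm, a2, r.e10, acomm_zero, sub_zero,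
      br_smul, br_smul, br_leibniz, f31, zero_br, br_leibniz F₃, f32, zero_br, f33, br_neg, k23,
      zero_add, zero_add, add_zero, br_neg]; module
  have p42 : acomm x₄ y₂ = (1 / 2 : ℂ) • E₁ := by
    rw [hy₂, acomm_lie, p41, b42, zero_acomm, br_smul, br_leibniz, f21, zero_br, f22, br_neg,
      ← br_skew E₁ H₂, h21]; module
  have p44 : acomm x₄ y₄ = (-1 / 2 : ℂ) • (H₁ + H₂ + H₃ + H₀) := by
    rw [hy₄, acomm_lie, p42, b41, smul_acomm, p22, br_smul, f11]; module
  have p45 : acomm x₄ y₅ = 0 := by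
    rw [hy₅, acomm_lie, p42, b43, zero_acomm, br_smul, f31, smul_zero, add_zero]
  have b53 : ⁅x₅, F₃⁆ = (-1 / 2 : ℂ) • x₂ := by
    rw [hx₅, br_br, b23, r.e33, br_zero, ← br_skew x₂, d23]; module
  have b52 : ⁅x₅, F₂⁆ = (-1 : ℂ) • ⁅E₃, x₁⁆ := by
    rw [hx₅, br_br, b22, r.e32, br_zero, sub_zero, br_smul]
  have b51 : ⁅x₅, F₁⁆ = 0 := by
    rw [hx₅, br_br, b21, r.e31, br_zero, br_zero, sub_zero]
  have p51 : acomm x₅ y₁ = (1 / 4 : ℂ) • ⁅E₂, E₃⁆ := by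
    have e1 : ⁅H₃, ⁅E₂, E₃⁆⁆ = (-1 + 1 : ℂ) • ⁅E₂, E₃⁆ := br_weight h32 h33
    rw [hy₁, acomm_lie, b53, smul_acomm, a2, hx₅, lie_acomm, a2, r.e30, acomm_zero, sub_zero,
      br_smul, br_smul, br_leibniz, f33, neg_br, e1, br_leibniz F₃, f32, zero_br, f33, br_neg, k23,
      zero_add, br_neg, ← br_skew E₃ E₂]; module
  have q : acomm ⁅E₃, x₁⁆ y₁ = 0 := by
    have e1 : ⁅H₃, x₁⁆ = (1 + -1 / 2 : ℂ) • x₁ := br_weight h33 h30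
    rw [hy₁, acomm_lie, lie_acomm, a1, r.e30, acomm_zero, br_smul, br_self, br_br, b13, r.e33,
      ← br_skew x₁ H₃, e1, br_smul, ← hx₁, smul_zero, sub_zero, br_zero, zero_add]
    rw [show (-1 / 2 : ℂ) • x₁ - -((1 + -1 / 2 : ℂ) • x₁) = 0 by module, zero_acomm]
  have p52 : acomm x₅ y₂ = (1 / 4 : ℂ) • E₃ := by
    rw [hy₂, acomm_lie, p51, b52, smul_acomm, q, br_smul, br_leibniz, f22, f23, br_zero, neg_br,
      h23]; module
  have p54 : acomm x₅ y₄ = 0 := by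
    rw [hy₄, acomm_lie, p52, b51, zero_acomm, br_smul, f13, smul_zero, add_zero]
  have p55 : acomm x₅ y₅ = (-1 / 4 : ℂ) • (H₀ + H₂ + (2 : ℂ) • H₃) := by
    rw [hy₅, acomm_lie, p52, b53, smul_acomm, p22, br_smul, f33]; module
  -- The raising operator of δ sends y₄ and y₅ to multiples of x₅ and x₄. The bracket with the
  -- lowering operator thereby reduces to the anticommutators already known.
  have c4 : ⁅acomm x₄ x₅, y₄⁆ = (-3 / 4 : ℂ) • x₅ := by
    rw [acomm_acomm_lie, p54, p44, br_zero, br_smul, ← br_skew x₅, add_br, add_br, add_br,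
      br_weight h13 d21, br_weight h23 d22, br_weight h33 d23, br_weight h03 d20]; module
  have c5 : ⁅acomm x₄ x₅, y₅⁆ = (-3 / 8 : ℂ) • x₄ := by
    rw [acomm_acomm_lie, p55, p45, br_zero, br_smul, ← br_skew x₄, add_br, add_br, smul_br,
      br_weight h21 d22, br_weight h31 d23, br_weight h01 d20]; module
  refine ⟨a1, p11, a2, p21, p22, ?_⟩
  rw [lie_acomm_right, c4, c5, smul_acomm, acomm_smul, p55, acomm_comm y₄, p44]; module

end F4

section F4Module

open RootDatum ChevalleyModule

/-- The Cartan matrix of `F(4)`. -/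
def f4Cartan : Matrix (Fin 4) (Fin 4) ℂ :=
  !![2, -1, 0, 0; -1, 2, -1, 0; 0, -1, 1, -1 / 2; 0, 0, -1 / 2, 0]

/-- The simple roots of a root datum, suitably numbered, have the Cartan matrix of `F(4)`. -/
structure F4Cartan (D : RootDatum) (i : Fin 4 → D.ι) : Prop where
  inj : Function.Injective i
  par : ∀ a, D.parity (i a) = (![0, 0, 0, 1] : Fin 4 → ℕ) a
  form : ∀ a b, D.form (D.simple (i a)) (D.simple (i b)) = f4Cartan a b

variable {D : RootDatum} {i : Fin 4 → D.ι} {V : Type} [AddCommGroup V] [Module ℂ V]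

theorem F4Cartan.relations (hi : F4Cartan D i) {M : D.ChevalleyModule V} (hM : M.IsIrreducible)
    {lam : D.Vec} {v : V} (hv : M.IsHighestWeightVector lam v) {ε : ℂ} (hε : M.par v = ε • v) :
    F4Relations (M.E (i 0)) (M.E (i 1)) (M.E (i 2)) (M.E (i 3)) (M.F (i 0)) (M.F (i 1))
      (M.F (i 2)) (M.F (i 3)) (M.H (i 0)) (M.H (i 1)) (M.H (i 2)) (M.H (i 3)) := by
  have htop := wordSpan_univ hM hv hε
  have hEF : ∀ a b : Fin 4, (![0, 0, 0, 1] : Fin 4 → ℕ) a * (![0, 0, 0, 1] : Fin 4 → ℕ) b = 0 →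
      ⁅M.E (i a), M.F (i b)⁆ = if a = b then M.H (i a) else 0 := by
    intro a b h
    have := M.E_F (i a) (i b)
    rw [Ring.lie_def]
    simpa only [hi.par, h, pow_zero, one_smul, hi.inj.eq_iff] using this
  have hHE : ∀ a b : Fin 4, ⁅M.H (i a), M.E (i b)⁆ = f4Cartan a b • M.E (i b) := by
    intro a b
    rw [← hi.form]; exact M.H_E _ _
  refine ⟨hEF 0 0 rfl, hEF 1 1 rfl, hEF 2 2 rfl, ?_, hEF 0 1 rfl, hEF 0 2 rfl, hEF 0 3 rfl,
    hEF 1 0 rfl, hEF 1 2 rfl, hEF 1 3 rfl, hEF 2 0 rfl, hEF 2 1 rfl, hEF 2 3 rfl, hEF 3 0 rfl,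
    hEF 3 1 rfl, hEF 3 2 rfl, ⟨hHE 0 0, hHE 0 1, hHE 0 2, hHE 0 3⟩,
    ⟨hHE 1 0, hHE 1 1, hHE 1 2, hHE 1 3⟩, ⟨hHE 2 0, hHE 2 1, hHE 2 2, hHE 2 3⟩,
    ⟨hHE 3 0, hHE 3 1, hHE 3 2, hHE 3 3⟩, ?_, ?_, ?_⟩
  · have := M.E_F (i 3) (i 3)
    simpa [hi.par, acomm] using this
  · exact lie_E_eq_zero htop hv (hi.inj.ne (by simp)) (hi.par 0) (hi.form 0 2) (hi.form 2 0)
  · exact lie_E_eq_zero htop hv (hi.inj.ne (by simp)) (hi.par 0) (hi.form 0 3) (hi.form 3 0)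
  · exact lie_E_eq_zero htop hv (hi.inj.ne (by simp)) (hi.par 1) (hi.form 1 3) (hi.form 3 1)

/-- Here `n` is twice the coefficient of δ in the weight, an integer n ≥ 0 by the sl(2) attached to
δ. Each of F₀, y₁, y₂ lowers it by 1, so that F₀ v, y₁ F₀ v or y₂ y₁ F₀ v vanishes if n = 0, 1 or 2.
The three alternatives say at which step of this chain the vector becomes zero. -/
theorem F4Cartan.dominantIntegral (hi : F4Cartan D i) {lam : D.Vec} {l : Fin 4 → ℂ}
    (hl : ∀ a, D.form lam (D.simple (i a)) = l a) (h : D.DominantIntegral lam) :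
    ∃ n : ℕ, l 0 + 2 * l 1 + 3 * l 2 + 2 * l 3 = -(3 / 2) * n ∧ (n = 0 → l 3 = 0) ∧
      (n = 1 → l 3 = 0 ∨ l 2 + l 3 + 1 / 2 = 0) ∧
      (n = 2 → l 3 = 0 ∨ l 2 + l 3 + 1 / 2 = 0 ∨ l 1 + l 2 + l 3 + 3 / 2 = 0) := by
  obtain ⟨_, V, _, _, M, _, hM, v₀, hv₀⟩ := h
  obtain ⟨v, hv, ε, hε⟩ := exists_homogeneous hv₀
  have r := hi.relations hM hv hε
  obtain ⟨q1, q2, q3, q4, q5, q6⟩ := r.acomm_root_vectors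
  set y₁ := ⁅M.F (i 2), M.F (i 3)⁆ with hy₁
  set y₂ := ⁅M.F (i 1), y₁⁆ with hy₂
  set x₁ := ⁅M.E (i 2), M.E (i 3)⁆ with hx₁
  set x₂ := ⁅M.E (i 1), x₁⁆ with hx₂
  set f := acomm ⁅M.F (i 0), y₂⁆ ⁅M.F (i 2), y₂⁆ with hf
  set e := acomm ⁅M.E (i 0), x₂⁆ ⁅M.E (i 2), x₂⁆ with he
  set S : Set D.ι := {i 1, i 2, i 3} with hS
  set h' := (3 / 16 : ℂ) • (M.H (i 0) + (2 : ℂ) • M.H (i 1) + (3 : ℂ) • M.H (i 2) +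
    (2 : ℂ) • M.H (i 3)) with hh'
  have hEv : ∀ a, M.E (i a) v = 0 := fun a => (hv.2 _).1
  have hHv : ∀ a, M.H (i a) v = l a • v := fun a => by rw [(hv.2 _).2, hl]
  have hHF : ∀ a b : Fin 4, ⁅M.H (i a), M.F (i b)⁆ = (-f4Cartan a b) • M.F (i b) := by
    intro a b
    rw [← hi.form]; exact M.H_F _ _
  have hh : ∀ b : Fin 4, ⁅h', M.F (i b)⁆ = ((![0, 0, 0, 9 / 32] : Fin 4 → ℂ) b) • M.F (i b) := by
    intro b
    rw [hh', smul_br, add_br, add_br, add_br, smul_br, smul_br, smul_br, hHF, hHF, hHF, hHF]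
    fin_cases b <;> simp [f4Cartan] <;> module
  have h1 : ⁅h', y₁⁆ = (9 / 32 : ℂ) • y₁ := by
    rw [hy₁, br_weight (hh 2) (hh 3)]; simp
  have h2 : ⁅h', y₂⁆ = (9 / 32 : ℂ) • y₂ := by
    rw [hy₂, br_weight (hh 1) h1]; simp
  have h3 : ⁅h', f⁆ = -(-9 / 16 : ℂ) • f := by
    rw [hf, br_acomm_weight (br_weight (hh 0) h2) (br_weight (hh 2) h2)]
    congr 1; simp; norm_num
  -- Words without `F (i 0)` span a space stable under the `E`'s and annihilated by `E (i 0)`. Hence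
  -- ⁅E₁, x₂⁆ vanishes on it, and so does its anticommutator `e` with ⁅E₃, x₂⁆.
  have hx : ∀ x ∈ M.wordSpan v S, e x = 0 := by
    have k0 : ∀ z ∈ M.wordSpan v S, M.E (i 0) z = 0 := fun z hz =>
      E_apply_eq_zero hv (by simp [hS, hi.inj.eq_iff]) hz
    have k1 : ∀ a, ∀ z ∈ M.wordSpan v S, M.E (i a) z ∈ M.wordSpan v S := fun a z hz =>
      E_mem_wordSpan hv _ hz
    have kb : ∀ {a b : Module.End ℂ V}, (∀ z ∈ M.wordSpan v S, a z ∈ M.wordSpan v S) →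
        (∀ z ∈ M.wordSpan v S, b z ∈ M.wordSpan v S) →
        ∀ z ∈ M.wordSpan v S, ⁅a, b⁆ z ∈ M.wordSpan v S := fun ha hb z hz => by
      rw [Ring.lie_def]
      exact Submodule.sub_mem _ (ha _ (hb _ hz)) (hb _ (ha _ hz))
    have k2 : ∀ z ∈ M.wordSpan v S, x₂ z ∈ M.wordSpan v S := kb (k1 1) (kb (k1 2) (k1 3))
    have k3 : ∀ z ∈ M.wordSpan v S, ⁅M.E (i 2), x₂⁆ z ∈ M.wordSpan v S := kb (k1 2) k2
    have k4 : ∀ z ∈ M.wordSpan v S, ⁅M.E (i 0), x₂⁆ z = 0 := fun z hz => by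
      simp [Ring.lie_def, k0 _ hz, k0 _ (k2 z hz)]
    intro x hx
    simp [he, acomm, k4 _ hx, k4 _ (k3 x hx)]
  have hw : h' v = (3 / 16 * (l 0 + 2 * l 1 + 3 * l 2 + 2 * l 3)) • v := by
    simp only [hh', LinearMap.smul_apply, LinearMap.add_apply, hHv]; module
  have key : ∀ u ∈ M.wordSpan v S, u ≠ 0 → ∀ μ : ℂ, h' u = μ • u →
      ∃ n : ℕ, μ = -n * (9 / 32) := by
    intro u hu hu0 μ hμ
    obtain ⟨n, hn⟩ := exists_nat_of_sl2 (by norm_num) q6 h3 hu0 hμ (hx u hu)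
    exact ⟨n, by linear_combination hn / 2⟩
  obtain ⟨n, hn⟩ := key v mem_wordSpan hv.1 _ hw
  have kF : ∀ z ∈ M.wordSpan v S, ∀ a : Fin 4, a ≠ 0 → M.F (i a) z ∈ M.wordSpan v S := by
    intro z hz a ha
    refine F_mem_wordSpan ?_ hz
    fin_cases a <;> simp [hS] at ha ⊢
  have ky : ∀ z ∈ M.wordSpan v S, y₁ z ∈ M.wordSpan v S := by
    intro z hz
    rw [hy₁, Ring.lie_def]
    exact Submodule.sub_mem _ (kF _ (kF _ hz _ (by simp)) _ (by simp))
      (kF _ (kF _ hz _ (by simp)) _ (by simp))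
  have hm0 : M.F (i 3) v ∈ M.wordSpan v S := kF _ mem_wordSpan _ (by simp)
  have hm1 : y₁ (M.F (i 3) v) ∈ M.wordSpan v S := ky _ hm0
  have hm2 : y₂ (y₁ (M.F (i 3) v)) ∈ M.wordSpan v S := by
    rw [hy₂, Ring.lie_def]
    exact Submodule.sub_mem _ (kF _ (ky _ hm1) _ (by simp)) (ky _ (kF _ hm1 _ (by simp)))
  have hw0 : h' (M.F (i 3) v) = (-(n - 1 : ℂ) * (9 / 32)) • M.F (i 3) v := by
    rw [apply_of_br (hh 3) hw, hn]; congr 1; simp; ring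
  have hw1 : h' (y₁ (M.F (i 3) v)) = (-(n - 2 : ℂ) * (9 / 32)) • y₁ (M.F (i 3) v) := by
    rw [apply_of_br h1 hw0]; congr 1; ring
  have hw2 : h' (y₂ (y₁ (M.F (i 3) v))) =
      (-(n - 3 : ℂ) * (9 / 32)) • y₂ (y₁ (M.F (i 3) v)) := by
    rw [apply_of_br h2 hw1]; congr 1; ring
  -- The eigenvalue is the one for n = -1, which `key` forbids for nonzero vectors.
  have kill : ∀ u ∈ M.wordSpan v S, h' u = (-(-1) * (9 / 32) : ℂ) • u → u = 0 := by
    intro u hu hμ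
    by_contra h0
    obtain ⟨k, hk⟩ := key _ hu h0 _ hμ
    have : ((k + 1 : ℕ) : ℂ) = 0 := by push_cast; linear_combination (32 / 9 : ℂ) * hk
    exact absurd this (by exact_mod_cast Nat.succ_ne_zero k)
  have hF0 : M.F (i 3) v = 0 → l 3 = 0 := by
    intro h0
    have := congrArg (fun f : Module.End ℂ V => f v) r.e00
    simp only [acomm, LinearMap.add_apply, Module.End.mul_apply, h0, hEv, map_zero, add_zero,
      hHv] at this
    exact (smul_eq_zero.1 this.symm).resolve_right hv.1
  have hx1v : x₁ v = 0 := by simp [hx₁, Ring.lie_def, hEv]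
  have hx2v : x₂ v = 0 := by simp [hx₂, Ring.lie_def, hEv, hx1v]
  have hx1 : x₁ (M.F (i 3) v) = 0 := by
    have := congrArg (fun f : Module.End ℂ V => f v) q1
    simpa [acomm, hx1v, hEv] using this
  have hF1 : y₁ (M.F (i 3) v) = 0 → l 3 = 0 ∨ l 2 + l 3 + 1 / 2 = 0 := by
    intro h0
    have := congrArg (fun f : Module.End ℂ V => f (M.F (i 3) v)) q2
    simp only [acomm, LinearMap.add_apply, Module.End.mul_apply, h0, hx1, map_zero, add_zero,
      LinearMap.smul_apply, apply_of_br (hHF 2 3) (hHv 2), apply_of_br (hHF 3 3) (hHv 3),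
      ← add_smul, smul_smul] at this
    rcases smul_eq_zero.1 this.symm with h4 | h4
    · right
      simp [f4Cartan] at h4
      linear_combination h4
    · exact Or.inl (hF0 h4)
  have hx2 : x₂ (M.F (i 3) v) = 0 := by
    have := congrArg (fun f : Module.End ℂ V => f v) q3
    simpa [acomm, hx2v, hEv, Ring.lie_def] using this
  have hx21 : x₂ (y₁ (M.F (i 3) v)) = 0 := by
    have h4 := congrArg (fun f : Module.End ℂ V => f (M.F (i 3) v)) q4
    have h5 := congrArg (fun f : Module.End ℂ V => f v) r.e20
    simp only [Ring.lie_def, LinearMap.sub_apply, Module.End.mul_apply, hEv, map_zero, sub_zero,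
      LinearMap.zero_apply] at h5
    simpa [acomm, hx2, h5] using h4
  have hF2 : y₂ (y₁ (M.F (i 3) v)) = 0 →
      l 3 = 0 ∨ l 2 + l 3 + 1 / 2 = 0 ∨ l 1 + l 2 + l 3 + 3 / 2 = 0 := by
    intro h0
    have := congrArg (fun f : Module.End ℂ V => f (y₁ (M.F (i 3) v))) q5
    have hH : ∀ a, M.H (i a) (y₁ (M.F (i 3) v)) = _ := fun a =>
      apply_of_br (br_weight (hHF a 2) (hHF a 3)) (apply_of_br (hHF a 3) (hHv a))
    simp only [acomm, LinearMap.add_apply, Module.End.mul_apply, h0, hx21, map_zero, add_zero,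
      LinearMap.smul_apply, hH, ← add_smul, smul_smul] at this
    rcases smul_eq_zero.1 this.symm with h4 | h4
    · right; right
      simp [f4Cartan] at h4
      linear_combination h4
    · exact (hF1 h4).imp_right Or.inl
  refine ⟨n, by linear_combination (16 / 3 : ℂ) * hn, ?_, ?_, ?_⟩
  · rintro rfl
    exact hF0 (kill _ hm0 (by rw [hw0]; congr 1; push_cast; ring))
  · rintro rfl
    exact hF1 (kill _ hm1 (by rw [hw1]; congr 1; push_cast; ring))
  · rintro rfl
    exact hF2 (kill _ hm2 (by rw [hw2]; congr 1; push_cast; ring))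

end F4Module

end SuperFactor
end

/-! ### Leading terms for W' × {±1}, and type G₂ -/

noncomputable section
open scoped Classical
namespace SuperFactor

/-! ### Expansion of geometric series -/

section Geometric

variable {K : Type} [Field K]

theorem inv_one_add_single (z : K) : (1 + HahnSeries.single (1 : ℤ) z : LaurentSeries K)⁻¹ =
    HahnSeries.ofPowerSeries ℤ K (PowerSeries.mk fun n => (-z) ^ n) := by
  refine inv_eq_of_mul_eq_one_right ?_
  have h1 : (1 + HahnSeries.single (1 : ℤ) z : LaurentSeries K) =
      HahnSeries.ofPowerSeries ℤ K (1 + PowerSeries.C z * PowerSeries.X) := by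
    rw [map_add, map_one, map_mul, HahnSeries.ofPowerSeries_C, HahnSeries.ofPowerSeries_X,
      HahnSeries.C_apply, HahnSeries.single_mul_single, zero_add, mul_one]
  rw [h1, ← map_mul]
  have h2 : (1 + PowerSeries.C z * PowerSeries.X) * PowerSeries.mk (fun n => (-z) ^ n) = 1 := by
    ext n
    rw [add_mul, one_mul, mul_assoc, map_add, PowerSeries.coeff_C_mul, PowerSeries.coeff_mk]
    cases n with
    | zero => simp
    | succ n =>
      rw [PowerSeries.coeff_succ_X_mul, PowerSeries.coeff_mk, PowerSeries.coeff_one,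
        if_neg (Nat.succ_ne_zero n)]
      ring
  rw [h2, map_one]

theorem coeff_inv_one_add_single (z : K) (j : ℤ) :
    ((1 + HahnSeries.single (1 : ℤ) z : LaurentSeries K)⁻¹).coeff j =
      if j < 0 then 0 else (-z) ^ j.toNat := by
  rw [inv_one_add_single, PowerSeries.coeff_coe]
  split_ifs with h
  · rfl
  · rw [PowerSeries.coeff_mk, show j.natAbs = j.toNat by omega]

theorem one_add_single_ne_zero (z : K) : (1 + HahnSeries.single (1 : ℤ) z : LaurentSeries K) ≠ 0 :=
  (lead_one.add ((lead_single 1 z).of_lt one_pos)).ne_zero (by simp)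

theorem lead_inv_one_add_single (z : K) :
    Lead (1 + HahnSeries.single (1 : ℤ) z : LaurentSeries K)⁻¹ 0 1 :=
  ((lead_one.add ((lead_single 1 z).of_lt one_pos)).inv (by simp)).congr rfl (by simp) (by simp)

theorem one_add_single_neg {z : K} (hz : z ≠ 0) :
    (1 + HahnSeries.single (-1 : ℤ) z⁻¹ : LaurentSeries K) =
      HahnSeries.single (-1 : ℤ) z⁻¹ * (1 + HahnSeries.single (1 : ℤ) z) := by
  rw [mul_add, mul_one, HahnSeries.single_mul_single, inv_mul_cancel₀ hz, neg_add_cancel,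
    add_comm]
  rfl

theorem one_add_single_neg_ne_zero {z : K} (hz : z ≠ 0) :
    (1 + HahnSeries.single (-1 : ℤ) z⁻¹ : LaurentSeries K) ≠ 0 := by
  rw [one_add_single_neg hz]
  exact mul_ne_zero (HahnSeries.single_ne_zero (inv_ne_zero hz)) (one_add_single_ne_zero z)

/-- The identity 1/(1 + u⁻¹) = 1 - 1/(1 + u) replaces a denominator with negative exponent by a
geometric series in T. -/
theorem inv_one_add_single_neg {z : K} (hz : z ≠ 0) :
    (1 + HahnSeries.single (-1 : ℤ) z⁻¹ : LaurentSeries K)⁻¹ =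
      1 - (1 + HahnSeries.single (1 : ℤ) z)⁻¹ := by
  have h := one_add_single_ne_zero z
  have h1 : (HahnSeries.single (-1 : ℤ) z⁻¹ : LaurentSeries K) * HahnSeries.single (1 : ℤ) z = 1 := by
    rw [HahnSeries.single_mul_single, inv_mul_cancel₀ hz, neg_add_cancel]; rfl
  refine inv_eq_of_mul_eq_one_right ?_
  rw [one_add_single_neg hz, mul_sub, mul_one, mul_assoc, mul_inv_cancel₀ h, mul_one, mul_add, h1]
  ring

end Geometric

/-! ### Leading terms for a Weyl group with a sign change as direct factor -/

section Exceptional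

variable {K Y : Type} [Field K] [Fintype Y]

/-- Expansion of the ordinary numerator; `T` is the exponential of `-δ`, or of `-δ / 2`. -/
def ordSum (a z : Y → K) (M : ℤ) : LaurentSeries K :=
  ∑ y, (HahnSeries.C (a y) * (1 + HahnSeries.single (1 : ℤ) (z y)⁻¹)⁻¹ -
    HahnSeries.single M (a y) * (1 + HahnSeries.single (-1 : ℤ) (z y)⁻¹)⁻¹)

/-- Expansion of the special numerator. -/
def spSum (a z : Y → K) (M : ℤ) : LaurentSeries K :=
  ∑ y, (HahnSeries.C (a y / 2) * (1 + (1 + HahnSeries.single (1 : ℤ) (z y)⁻¹)⁻¹) -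
    HahnSeries.single M (a y / 2) * (1 + (1 + HahnSeries.single (-1 : ℤ) (z y)⁻¹)⁻¹))

variable {a z : Y → K}

theorem ordSum_eq (hz : ∀ y, z y ≠ 0) (M : ℤ) : ordSum a z M =
    ∑ y, HahnSeries.C (a y) * (1 + HahnSeries.single (1 : ℤ) (z y)⁻¹)⁻¹ -
    HahnSeries.single M 1 *
      ∑ y, HahnSeries.C (a y) * (1 - (1 + HahnSeries.single (1 : ℤ) (z y))⁻¹) := by
  rw [ordSum, Finset.sum_sub_distrib, Finset.mul_sum]
  congr 1
  refine Finset.sum_congr rfl fun y _ => ?_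
  rw [inv_one_add_single_neg (hz y), ← mul_assoc, HahnSeries.C_apply,
    HahnSeries.single_mul_single, add_zero, one_mul]

/-- From (2 + u)/(1 + u) = 1 + 1/(1 + u). The special numerator is half the ordinary one plus half
the alternating sum without denominators. -/
theorem spSum_eq [CharZero K] (M : ℤ) : spSum a z M =
    HahnSeries.C (1 / 2) * ((1 - HahnSeries.single M 1) * HahnSeries.C (∑ y, a y) +
      ordSum a z M) := by
  rw [spSum, ordSum, map_sum, Finset.mul_sum, ← Finset.sum_add_distrib, Finset.mul_sum]
  refine Finset.sum_congr rfl fun y _ => ?_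
  have h1 : (HahnSeries.C (a y / 2) : LaurentSeries K) =
      HahnSeries.C (1 / 2) * HahnSeries.C (a y) := by
    rw [← map_mul]; congr 1; ring
  have h2 : (HahnSeries.single M (a y / 2) : LaurentSeries K) =
      HahnSeries.C (1 / 2) * (HahnSeries.single M 1 * HahnSeries.C (a y)) := by
    rw [HahnSeries.C_apply, HahnSeries.C_apply, HahnSeries.single_mul_single,
      HahnSeries.single_mul_single]
    congr 1
    · ring
    · ring
  have h3 : (HahnSeries.single M (a y) : LaurentSeries K) =
      HahnSeries.single M 1 * HahnSeries.C (a y) := by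
    rw [HahnSeries.C_apply, HahnSeries.single_mul_single, add_zero, one_mul]
  rw [h1, h2, h3]
  ring

theorem lead_sum_inv (a z : Y → K) :
    Lead (∑ y, HahnSeries.C (a y) * (1 + HahnSeries.single (1 : ℤ) (z y))⁻¹ : LaurentSeries K) 0
      (∑ y, a y) :=
  Lead.sum _ fun y _ => ((lead_C (a y)).mul (lead_inv_one_add_single (z y))).congr rfl (by simp)
    (by simp)

theorem coeff_sum_inv (a z : Y → K) (k : ℕ) :
    (∑ y, HahnSeries.C (a y) * (1 + HahnSeries.single (1 : ℤ) (z y))⁻¹ : LaurentSeries K).coeff k =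
      (-1) ^ k * ∑ y, a y * z y ^ k := by
  rw [HahnSeries.coeff_sum, Finset.mul_sum]
  refine Finset.sum_congr rfl fun y _ => ?_
  rw [HahnSeries.C_apply, HahnSeries.coeff_single_zero_mul, coeff_inv_one_add_single,
    if_neg (by omega), Int.toNat_natCast, neg_pow]
  ring

/-- The coefficient of T^k is, up to sign, the power sum Σ a z^k. In the applications it is an
alternant of the group W' at b + kσ, with σ the W'-part of γ, and it vanishes when that vector is
singular. -/
theorem lead_sum_sub_inv {M : ℕ} (hM : 0 < M)
    (h0 : ∀ k : ℕ, 0 < k → k < M → ∑ y, a y * z y ^ k = 0) :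
    Lead (∑ y, HahnSeries.C (a y) * (1 - (1 + HahnSeries.single (1 : ℤ) (z y))⁻¹) :
      LaurentSeries K) M (-((-1) ^ M * ∑ y, a y * z y ^ M)) := by
  have h1 : (∑ y, HahnSeries.C (a y) * (1 - (1 + HahnSeries.single (1 : ℤ) (z y))⁻¹) :
      LaurentSeries K) = HahnSeries.single 0 (∑ y, a y) -
      ∑ y, HahnSeries.C (a y) * (1 + HahnSeries.single (1 : ℤ) (z y))⁻¹ := by
    rw [← HahnSeries.C_apply, map_sum, ← Finset.sum_sub_distrib]
    refine Finset.sum_congr rfl fun y _ => ?_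
    ring
  rw [h1]
  constructor
  · intro j hj
    rw [HahnSeries.coeff_sub]
    rcases lt_trichotomy j 0 with h | rfl | h
    · rw [HahnSeries.coeff_single_of_ne h.ne, (lead_sum_inv a z).coeff_of_lt h, sub_zero]
    · rw [HahnSeries.coeff_single_same, (lead_sum_inv a z).coeff, sub_self]
    · lift j to ℕ using h.le
      rw [HahnSeries.coeff_single_of_ne h.ne', coeff_sum_inv, h0 j (by omega) (by omega), mul_zero,
        sub_zero]
  · rw [HahnSeries.coeff_sub, HahnSeries.coeff_single_of_ne (by omega), coeff_sum_inv, zero_sub]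

theorem lead_ordSum_pos (hz : ∀ y, z y ≠ 0) {M : ℤ} (hM : 0 < M) :
    Lead (ordSum a z M) 0 (∑ y, a y) := by
  rw [ordSum_eq hz]
  have h1 := lead_sum_inv a fun y => (z y)⁻¹
  have h2 := (lead_single (K := K) M 1).mul
    (lead_sum_sub_inv (a := a) (z := z) one_pos fun k h0 h1 => absurd h1 (by omega))
  exact (h1.sub (h2.of_lt (by push_cast; omega))).congr rfl rfl (sub_zero _)

theorem lead_spSum_pos [CharZero K] (hz : ∀ y, z y ≠ 0) {M : ℤ} (hM : 0 < M) :
    Lead (spSum a z M) 0 (∑ y, a y) := by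
  rw [spSum_eq]
  have h1 := (lead_one (K := K)).sub ((lead_single (K := K) M 1).of_lt hM)
  have h2 := (h1.mul (lead_C (∑ y, a y))).add
    ((lead_ordSum_pos (a := a) hz hM).congr rfl (add_zero 0).symm rfl)
  exact ((lead_C (1 / 2 : K)).mul h2).congr rfl (by simp) (by ring)

/-- The second half of the sum is multiplied by T^{-M}, but its terms of degree below `M` vanish by
`h0`. The first surviving term lands in degree 0 and by `h1` doubles the contribution of the first
half. -/
theorem lead_ordSum_neg (hz : ∀ y, z y ≠ 0) {M : ℕ} (hM : 0 < M)
    (h0 : ∀ k : ℕ, 0 < k → k < M → ∑ y, a y * z y ^ k = 0)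
    (h1 : (-1) ^ M * ∑ y, a y * z y ^ M = ∑ y, a y) :
    Lead (ordSum a z (-M)) 0 (2 * ∑ y, a y) := by
  rw [ordSum_eq hz]
  have h2 := lead_sum_inv a fun y => (z y)⁻¹
  have h3 := (lead_single (K := K) (-M) 1).mul (lead_sum_sub_inv hM h0)
  exact (h2.sub (h3.congr rfl (by omega) rfl)).congr rfl rfl (by rw [h1]; ring)

/-- In the special formula the term T^{-M} Σ a is not compensated, and it dominates the ordinary
part, which starts in degree 0. -/
theorem lead_spSum_neg [CharZero K] (hz : ∀ y, z y ≠ 0) {M : ℕ} (hM : 0 < M)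
    (h0 : ∀ k : ℕ, 0 < k → k < M → ∑ y, a y * z y ^ k = 0)
    (h1 : (-1) ^ M * ∑ y, a y * z y ^ M = ∑ y, a y) :
    Lead (spSum a z (-M)) (-M) (-(1 / 2) * ∑ y, a y) := by
  rw [spSum_eq]
  have hM' : (-M : ℤ) < 0 := by omega
  have h2 := ((lead_one (K := K)).of_lt hM').sub (lead_single (K := K) (-M) 1)
  have h3 := (h2.mul (lead_C (∑ y, a y))).add
    (((lead_ordSum_neg hz hM h0 h1).of_lt hM').congr rfl (add_zero _).symm rfl)
  exact ((lead_C (1 / 2 : K)).mul h3).congr rfl (by simp) (by ring)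

end Exceptional

/-! ### Alternants of the Weyl group of type `G₂` -/

section G2

variable {K : Type} [Field K]

/-- The exponentials of the three short weights with sum zero; `x` is the exponential of `-α` for the
short simple root, and the variable of the series that for the long one. -/
def g2Var (x : K) : Fin 3 → LaurentSeries K :=
  ![HahnSeries.C x⁻¹, HahnSeries.single (-1) x⁻¹, HahnSeries.single 1 (x ^ 2)]

theorem single_one_zpow (k : ℤ) :
    (HahnSeries.single (1 : ℤ) (1 : K) : LaurentSeries K) ^ k = HahnSeries.single k 1 := by
  have h : (HahnSeries.single (1 : ℤ) (1 : K) : LaurentSeries K) =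
      (HahnSeries.single (-1 : ℤ) (1 : K))⁻¹ := by
    refine (inv_eq_of_mul_eq_one_right ?_).symm
    rw [HahnSeries.single_mul_single]; simp
  rw [h, inv_zpow', single_neg_one_zpow, neg_neg]

theorem single_zpow (j : ℤ) (c : K) (k : ℤ) :
    (HahnSeries.single j c : LaurentSeries K) ^ k = HahnSeries.single (j * k) (c ^ k) := by
  have h : (HahnSeries.single j c : LaurentSeries K) =
      HahnSeries.C c * HahnSeries.single (1 : ℤ) 1 ^ j := by
    rw [single_one_zpow, HahnSeries.C_apply, HahnSeries.single_mul_single, zero_add, mul_one]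
  rw [h, mul_zpow, ← zpow_mul, single_one_zpow, ← map_zpow₀, HahnSeries.C_apply,
    HahnSeries.single_mul_single, zero_add, mul_one]

/-- The normalized alternant of type `G₂`. -/
def normG (x : K) (b : Fin 3 → ℤ) : LaurentSeries K :=
  (alt (g2Var x) b + alt (g2Var x) (-b)) * ∏ p, g2Var x p ^ (-b p)

theorem g2Var_ne_zero {x : K} (hx : x ≠ 0) (p : Fin 3) : g2Var x p ≠ 0 := by
  fin_cases p
  · exact HahnSeries.single_ne_zero (inv_ne_zero hx)
  · exact HahnSeries.single_ne_zero (inv_ne_zero hx)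
  · exact HahnSeries.single_ne_zero (pow_ne_zero 2 hx)

theorem g2Var_prod {x : K} (hx : x ≠ 0) (i j k : ℤ) :
    g2Var x 0 ^ i * g2Var x 1 ^ j * g2Var x 2 ^ k =
      HahnSeries.single (k - j) (x ^ (2 * k - i - j)) := by
  have h0 : g2Var x 0 = HahnSeries.single (0 : ℤ) x⁻¹ := rfl
  have h1 : g2Var x 1 = HahnSeries.single (-1 : ℤ) x⁻¹ := rfl
  have h2 : g2Var x 2 = HahnSeries.single (1 : ℤ) (x ^ 2) := rfl
  rw [h0, h1, h2, single_zpow, single_zpow, single_zpow, HahnSeries.single_mul_single,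
    HahnSeries.single_mul_single]
  congr 1
  · ring
  · rw [show (2 * k - i - j : ℤ) = -i + -j + (2 : ℕ) * k by push_cast; ring, zpow_add₀ hx,
      zpow_add₀ hx, zpow_mul, zpow_natCast, inv_zpow', inv_zpow']

theorem alt_g2Var {x : K} (hx : x ≠ 0) (b : Fin 3 → ℤ) : alt (g2Var x) b =
    HahnSeries.single (b 2 - b 1) (x ^ (2 * b 2 - b 0 - b 1)) -
    HahnSeries.single (b 1 - b 2) (x ^ (2 * b 1 - b 0 - b 2)) -
    HahnSeries.single (b 2 - b 0) (x ^ (2 * b 2 - b 1 - b 0)) +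
    HahnSeries.single (b 0 - b 2) (x ^ (2 * b 0 - b 1 - b 2)) +
    HahnSeries.single (b 1 - b 0) (x ^ (2 * b 1 - b 2 - b 0)) -
    HahnSeries.single (b 0 - b 1) (x ^ (2 * b 0 - b 2 - b 1)) := by
  simp only [← g2Var_prod hx]
  rw [alt, Matrix.det_fin_three]
  simp only [Matrix.of_apply]

/-- The numbers `p` and `q` are the values of b on the coroots of the short and the long simple
root. The elements 1 and the short simple reflection give the constant term in T. The next lowest
terms, in degree `q`, again form a pair. -/
theorem lead_normG {x : K} (hx : x ≠ 0) {b : Fin 3 → ℤ} {p q : ℤ} (hp : 0 < p) (hq : 0 < q)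
    (hb0 : b 0 = p + q) (hb1 : b 1 = p + 2 * q) (hb2 : b 2 = 0) :
    Lead (normG x b - HahnSeries.single 0 (1 - x ^ p)) q (-(1 - x ^ (p + 3 * q))) := by
  have h : normG x b - HahnSeries.single 0 (1 - x ^ p) =
      HahnSeries.single q (-(1 - x ^ (p + 3 * q))) +
      (-HahnSeries.single (p + q) (x ^ (3 * (p + q)))
        - HahnSeries.single (2 * (p + 2 * q)) (x ^ (3 * (p + 2 * q)))
        + HahnSeries.single (2 * p + 3 * q) (x ^ (3 * (p + q)))
        + HahnSeries.single (p + 3 * q) (x ^ (3 * (p + 2 * q)))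
        + HahnSeries.single (2 * (p + 2 * q)) (x ^ (2 * (2 * p + 3 * q)))
        - HahnSeries.single (2 * p + 3 * q) (x ^ (2 * (2 * p + 3 * q)))
        - HahnSeries.single (p + 3 * q) (x ^ (p + 3 * q))
        + HahnSeries.single (p + q) (x ^ p)) := by
    rw [normG, Fin.prod_univ_three, g2Var_prod hx, alt_g2Var hx, alt_g2Var hx]
    simp only [Pi.neg_apply, hb0, hb1, hb2, sub_mul, add_mul, HahnSeries.single_mul_single,
      ← zpow_add₀ hx, HahnSeries.single_sub, HahnSeries.single_neg, mul_one]
    ring_nf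
    simp only [zpow_zero]
    ring
  have hs : ∀ (j : ℤ) (c : K), q < j → Lead (HahnSeries.single j c : LaurentSeries K) q 0 :=
    fun j c hj => (lead_single j c).of_lt hj
  rw [h]
  refine ((lead_single q _).add ((((((((hs _ _ ?_).neg.sub (hs _ _ ?_)).add (hs _ _ ?_)).add
    (hs _ _ ?_)).add (hs _ _ ?_)).sub (hs _ _ ?_)).sub (hs _ _ ?_)).add (hs _ _ ?_))).congr rfl rfl
    (by simp)
  all_goals linarith

/-- In suitable variables, normalized alternants of type `G₂` are multiplicatively independent modulo
scalars. -/
theorem exists_normG_factorization (k₀ : Type) [Field k₀] [CharZero k₀] :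
    ∃ (K : Type) (_ : Field K) (φ : k₀ →+* LaurentSeries K) (x : K), x ≠ 0 ∧
      (∀ b : Fin 3 → ℤ, b 1 < 2 * b 0 → b 0 < b 1 → b 2 = 0 → normG x b ≠ 0) ∧
      ∀ (I : Type) (b : I → Fin 3 → ℤ) (c : I → k₀), (∀ i, b i 1 < 2 * b i 0) →
        (∀ i, b i 0 < b i 1) → (∀ i, b i 2 = 0) →
        Function.Injective b → (∀ i, c i ≠ 0) → ∀ s t : Multiset I,
        (s.map fun i => φ (c i) * normG x (b i)).prod =
          (t.map fun i => φ (c i) * normG x (b i)).prod → s = t := by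
  set x : LaurentSeries k₀ := HahnSeries.single (1 : ℤ) 1 with hxdef
  have hx : x ≠ 0 := HahnSeries.single_ne_zero one_ne_zero
  have hlead : ∀ p : ℤ, 0 < p → Lead (1 - x ^ p) 0 1 := fun p hp => by
    rw [hxdef, single_one_zpow]
    exact (lead_one.sub ((lead_single p 1).of_lt hp)).congr rfl rfl (by simp)
  have hne : ∀ p : ℤ, 0 < p → 1 - x ^ p ≠ 0 := fun p hp => (hlead p hp).ne_zero one_ne_zero
  have hquot : ∀ p q : ℤ, 0 < p → 0 < q →
      Lead ((1 - x ^ (p + 3 * q)) / (1 - x ^ p) - 1) p 1 := fun p q hp hq => by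
    have h1 : Lead (x ^ p - x ^ (p + 3 * q)) p 1 := by
      rw [hxdef, single_one_zpow, single_one_zpow]
      exact ((lead_single p 1).sub ((lead_single _ 1).of_lt (by omega))).congr rfl rfl (by simp)
    refine (h1.div (hlead p hp) one_ne_zero).congr ?_ (by ring) (by simp)
    have := hne p hp
    field_simp
    ring
  have hl : ∀ b : Fin 3 → ℤ, b 1 < 2 * b 0 → b 0 < b 1 → b 2 = 0 →
      Lead (normG x b - HahnSeries.single 0 (1 - x ^ (2 * b 0 - b 1))) (b 1 - b 0)
        (-(1 - x ^ (2 * b 0 - b 1 + 3 * (b 1 - b 0)))) := fun b h0 h1 h2 =>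
    lead_normG hx (by omega) (by omega) (by ring) (by ring) h2
  refine ⟨LaurentSeries k₀, inferInstance, (HahnSeries.C).comp HahnSeries.C, x, hx,
    fun b h0 h1 h2 => ?_, fun I b c h0 h1 h2 hinj hc s t h => ?_⟩
  · have h3 := (lead_single 0 (1 - x ^ (2 * b 0 - b 1))).add
      ((hl b h0 h1 h2).of_lt (by omega : 0 < b 1 - b 0))
    rw [add_sub_cancel, add_zero] at h3
    exact h3.ne_zero (hne _ (by omega))
  · refine multiset_eq_of_prod_eq (φ := HahnSeries.C) (o := fun _ => 0)
      (e := fun i => b i 1 - b i 0)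
      (c := fun i => HahnSeries.C (c i) * (1 - x ^ (2 * b i 0 - b i 1)))
      (ρ := fun i => -((1 - x ^ (2 * b i 0 - b i 1 + 3 * (b i 1 - b i 0))) /
        (1 - x ^ (2 * b i 0 - b i 1))))
      (fun i => mul_ne_zero ((map_ne_zero _).2 (hc i)) (hne _ (by have := h0 i; omega)))
      (fun i => by have := h1 i; omega) (fun i => ?_) (fun d => LinIndep.neg ?_) h
    · have h3 := hne _ (by have := h0 i; omega : 0 < 2 * b i 0 - b i 1)
      refine ((lead_C (HahnSeries.C (c i))).mul (hl (b i) (h0 i) (h1 i) (h2 i))).congr ?_ rfl ?_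
      · rw [mul_sub, RingHom.comp_apply, HahnSeries.C_apply (HahnSeries.C (c i)),
          HahnSeries.single_mul_single, add_zero]
      · field_simp
    · refine linIndep_of_coeff (φ := RingHom.id k₀) 0 (fun i => 2 * b i.1 0 - b i.1 1)
        (fun i => by have := h0 i.1; omega) (fun i j hj hj0 => ?_) fun p => ?_
      · have h3 := (hquot (2 * b i.1 0 - b i.1 1) (b i.1 1 - b i.1 0) (by have := h0 i.1; omega)
          (by have := h1 i.1; omega)).1 j hj
        rwa [HahnSeries.coeff_sub, HahnSeries.coeff_one, if_neg hj0, sub_zero] at h3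
      · have : Subsingleton {i : {i // b i 1 - b i 0 = d} // 2 * b i.1 0 - b i.1 1 = p} :=
          ⟨fun i j => Subtype.ext (Subtype.ext (hinj (by
            have e1 := i.2; have e2 := j.2; have e3 := i.1.2; have e4 := j.1.2
            have e5 := h2 i.1.1; have e6 := h2 j.1.1
            ext a
            fin_cases a <;> simp only [Fin.zero_eta, Fin.mk_one, Fin.reduceFinMk] <;> omega)))⟩
        refine linIndep_of_subsingleton fun i => ?_
        obtain ⟨i, rfl⟩ := i
        have hp : 0 < 2 * b i.1 0 - b i.1 1 := by have := h0 i.1; omega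
        have h3 := (hquot (2 * b i.1 0 - b i.1 1) (b i.1 1 - b i.1 0) hp
          (by have := h1 i.1; omega)).2
        rw [HahnSeries.coeff_sub, HahnSeries.coeff_one, if_neg hp.ne', sub_zero] at h3
        rw [h3]
        exact one_ne_zero

end G2

end SuperFactor
end

/-! ### Weyl groups as explicit finite groups -/

noncomputable section
open scoped Classical
namespace SuperFactor

/-! ### Models of the Weyl group -/

namespace RootDatum

variable {D : RootDatum}

/-- The linear form `(·, α)`. -/
def formLeft (D : RootDatum) (α : D.Vec) : Module.Dual ℂ D.Vec where
  toFun v := D.form v α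
  map_add' x y := by simp [form, add_mul, Finset.sum_add_distrib]
  map_smul' c x := by simp [form, mul_assoc, Finset.mul_sum]

theorem form_add_left (x y z : D.Vec) : D.form (x + y) z = D.form x z + D.form y z :=
  (D.formLeft z).map_add x y

/-- A reflection is v ↦ v + f(v) α with f(α) = -2, and such a map has determinant 1 + f(α). -/
theorem det_reflection {α : D.Vec} (hα : D.form α α ≠ 0) {f : Module.End ℂ D.Vec}
    (hf : ∀ v, f v = v - (2 * D.form v α / D.form α α) • α) : LinearMap.det f = -1 := by
  have h : f = LinearMap.transvection ((-2 / D.form α α) • D.formLeft α) α := by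
    refine LinearMap.ext fun v => ?_
    rw [hf, LinearMap.transvection.apply, LinearMap.smul_apply, sub_eq_add_neg, ← neg_smul]
    congr 2
    change _ = (-2 / D.form α α) * D.form v α
    ring
  rw [h, LinearMap.transvection.det]
  change 1 + (-2 / D.form α α) * D.form α α = -1
  field_simp
  norm_num

/-- A finite group `Y` acting on the coordinate space as the Weyl group. -/
structure WeylModel (D : RootDatum) (h : ℂ) (Y : Type) [Group Y] where
  act : Y →* Module.End ℂ D.Vec
  actZ : Y → (D.κ → ℤ) → D.κ → ℤ
  act_lat : ∀ y z, act y (D.latEmb h z) = D.latEmb h (actZ y z)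
  inj : Function.Injective act
  sign : Y →* ℂ
  R : Set Y
  closure_R : Subgroup.closure R = ⊤
  sign_R : ∀ y ∈ R, sign y = -1
  reflection : ∀ y ∈ R, ∃ α ∈ D.evenPos, ∀ v, act y v = v - (2 * D.form v α / D.form α α) • α
  exists_reflection : ∀ α ∈ D.evenPos, ∃ y ∈ R, ∀ v,
    act y v = v - (2 * D.form v α / D.form α α) • α
  nondeg : ∀ α ∈ D.evenPos, D.form α α ≠ 0

namespace WeylModel

variable {h : ℂ} {Y : Type} [Group Y] (Q : WeylModel D h Y)

/-- Both sides are homomorphisms, and they agree on the generating reflections. -/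
theorem det_act (y : Y) : LinearMap.det (Q.act y) = Q.sign y := by
  have : (LinearMap.det.comp Q.act : Y →* ℂ) = Q.sign := by
    refine MonoidHom.eq_of_eqOn_dense Q.closure_R fun y hy => ?_
    obtain ⟨α, hα, hr⟩ := Q.reflection y hy
    rw [Q.sign_R y hy]
    exact det_reflection (Q.nondeg α hα) hr
  exact DFunLike.congr_fun this y

/-- The action by linear equivalences. -/
def equivHom : Y →* (D.Vec ≃ₗ[ℂ] D.Vec) :=
  (LinearMap.GeneralLinearGroup.generalLinearEquiv ℂ D.Vec).toMonoidHom.comp Q.act.toHomUnits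

theorem equivHom_apply (y : Y) (v : D.Vec) : Q.equivHom y v = Q.act y v := rfl

theorem equivHom_mem (y : Y) : Q.equivHom y ∈ D.weylGroup := by
  have h1 : Subgroup.closure Q.R ≤ D.weylGroup.comap Q.equivHom := by
    rw [Subgroup.closure_le]
    intro y hy
    obtain ⟨α, hα, hr⟩ := Q.reflection y hy
    exact Subgroup.subset_closure ⟨α, hα, hr⟩
  exact h1 (Q.closure_R ▸ Subgroup.mem_top y)

/-- The element of the Weyl group. -/
def toWeyl (y : Y) : D.weylGroup := ⟨Q.equivHom y, Q.equivHom_mem y⟩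

/-- Surjectivity needs only that each generating reflection of the Weyl group is hit, since the
range is a subgroup. -/
theorem toWeyl_bijective : Function.Bijective Q.toWeyl := by
  constructor
  · intro y y' hy
    refine Q.inj (LinearMap.ext fun v => ?_)
    exact DFunLike.congr_fun (congrArg Subtype.val hy) v
  · rintro ⟨w, hw⟩
    have h1 : D.weylGroup ≤ Q.equivHom.range := by
      rw [weylGroup, Subgroup.closure_le]
      rintro s ⟨α, hα, hs⟩
      obtain ⟨y, -, hr⟩ := Q.exists_reflection α hα
      exact ⟨y, LinearEquiv.ext fun v => by rw [hs, equivHom_apply, hr]⟩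
    obtain ⟨y, hy⟩ := h1 hw
    exact ⟨y, Subtype.ext hy⟩

variable [Fintype Y]

/-- The numerators of a weight that differs from a lattice vector by an invariant vector. -/
def param {γ lam v₀ : D.Vec} {z g : D.κ → ℤ} (hv₀ : ∀ y, Q.act y v₀ = v₀)
    (hz : lam + D.rho = v₀ + D.latEmb h z) (hg : γ = D.latEmb h g) : WeylParam D h γ lam Y where
  e := Q.toWeyl
  bij := Q.toWeyl_bijective
  d y := Q.actZ y z - z
  g y := Q.actZ y g
  sg := Q.sign
  sgn_eq y := Q.det_act y
  d_eq y := by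
    change Q.act y (lam + D.rho) - (lam + D.rho) = _
    rw [hz, map_add, hv₀, Q.act_lat, map_sub]
    abel
  g_eq y := by
    change Q.act y γ = _
    rw [hg, Q.act_lat]

variable {K : Type} [Field K]

end WeylModel

/-! ### Weyl groups with a sign change as direct factor -/

namespace WeylParam

variable {h : ℂ} {γ lam : D.Vec} {Y K : Type} [Fintype Y] [Field K]

/-- A Laurent expansion of the exponentials that turns the numerators into `ordSum` and `spSum`. -/
structure IsSplit (P : WeylParam D h γ lam (Y × ℤˣ)) (X : D.κ → LaurentSeries K) (s : Y → ℂ)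
    (m z : Y → K) (M : ℤ) : Prop where
  z_ne : ∀ y, z y ≠ 0
  d_one : ∀ y, mon X (P.d (y, 1)) = HahnSeries.C (m y)
  d_neg : ∀ y, mon X (P.d (y, -1)) = HahnSeries.single M (m y)
  g_one : ∀ y, mon X (-P.g (y, 1)) = HahnSeries.single 1 (z y)⁻¹
  g_neg : ∀ y, mon X (-P.g (y, -1)) = HahnSeries.single (-1) (z y)⁻¹
  s_one : ∀ y, P.sg (y, 1) = s y
  s_neg : ∀ y, P.sg (y, -1) = -s y

variable {P : WeylParam D h γ lam (Y × ℤˣ)} {X : D.κ → LaurentSeries K} {s : Y → ℂ} {m z : Y → K}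
  {M : ℤ} (φ : ℂ →+* K) {hX : ∀ c, X c ≠ 0}

theorem sum_units {A : Type} [AddCommMonoid A] (f : Y × ℤˣ → A) :
    ∑ p, f p = ∑ y, (f (y, 1) + f (y, -1)) := by
  rw [Fintype.sum_prod_type]
  refine Finset.sum_congr rfl fun y _ => ?_
  rw [UnitsInt.univ, Finset.sum_pair (by decide)]

theorem IsSplit.den_ne_zero (hP : P.IsSplit X s m z M) (p : Y × ℤˣ) : 1 + mon X (-P.g p) ≠ 0 := by
  obtain ⟨y, e⟩ := p
  rcases Int.units_eq_one_or e with rfl | rfl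
  · rw [hP.g_one]; exact one_add_single_ne_zero _
  · rw [hP.g_neg]; exact one_add_single_neg_ne_zero (hP.z_ne y)

theorem IsSplit.specializes_ordinary (hP : P.IsSplit X s m z M) (hh : h ≠ 0) :
    Specializes (D.latHom h) (evalMon (HahnSeries.C.comp φ) X hX) (D.ordinaryNumerator γ lam)
      (ordSum (fun y => φ (s y) * m y) z M) := by
  have := P.specializes_ordinary (φ := HahnSeries.C.comp φ) (X := X) (hX := hX) hh hP.den_ne_zero
  rw [sum_units] at this
  convert this using 1
  refine Finset.sum_congr rfl fun y _ => ?_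
  rw [hP.d_one, hP.d_neg, hP.g_one, hP.g_neg, hP.s_one, hP.s_neg, RingHom.comp_apply,
    RingHom.comp_apply, map_neg, map_neg, map_mul, div_eq_mul_inv, div_eq_mul_inv, neg_mul,
    ← sub_eq_add_neg, ← mul_assoc, ← mul_assoc, HahnSeries.C_apply (φ (s y)),
    HahnSeries.single_mul_single, zero_add]

theorem IsSplit.specializes_special (hP : P.IsSplit X s m z M) (hh : h ≠ 0) :
    Specializes (D.latHom h) (evalMon (HahnSeries.C.comp φ) X hX) (D.specialNumerator γ lam)
      (spSum (fun y => φ (s y) * m y) z M) := by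
  have := P.specializes_special (φ := HahnSeries.C.comp φ) (X := X) (hX := hX) hh hP.den_ne_zero
  rw [sum_units] at this
  convert this using 1
  refine Finset.sum_congr rfl fun y _ => ?_
  have h1 := hP.den_ne_zero (y, 1)
  have h2 := hP.den_ne_zero (y, -1)
  rw [hP.g_one] at h1
  rw [hP.g_neg] at h2
  have e : ∀ w : LaurentSeries K, 1 + w ≠ 0 → (2 + w) / (1 + w) = 1 + (1 + w)⁻¹ := by
    intro w hw
    field_simp
    ring
  rw [hP.d_one, hP.d_neg, hP.g_one, hP.g_neg, hP.s_one, hP.s_neg, e _ h1, e _ h2, neg_div, map_neg,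
    RingHom.comp_apply, map_div₀ φ, map_ofNat φ]
  have e1 : (HahnSeries.C (φ (s y) * m y / 2) : LaurentSeries K) =
      HahnSeries.C (φ (s y) / 2) * HahnSeries.C (m y) := by
    rw [← map_mul]; congr 1; ring
  have e2 : (HahnSeries.single M (φ (s y) * m y / 2) : LaurentSeries K) =
      HahnSeries.C (φ (s y) / 2) * HahnSeries.single M (m y) := by
    rw [HahnSeries.C_apply, HahnSeries.single_mul_single, zero_add]; congr 1; ring
  rw [e1, e2]
  ring

end WeylParam

end RootDatum

/-! ### From multisets of weights to permutations -/

/-- It is enough to show that the values of the numerators determine the multiset of weights; the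
equality of the numerators is then a consequence of the equality of the weights. -/
theorem exists_perm_of_specializes {g : SuperType} {special : Set g.datum.Vec} {γ : g.datum.Vec}
    {h : ℂ} (hh : h ≠ 0) {K : Type} [Field K] {φ : ℂ →+* K} {X : g.datum.κ → K}
    {hX : ∀ c, X c ≠ 0}
    (val : {lam // g.datum.DominantIntegral lam ∧ g.datum.SinglyAtypical γ lam} → K)
    (hval : ∀ lam, Specializes (g.datum.latHom h) (evalMon φ X hX) (U g special γ lam.1) (val lam))
    (hinj : ∀ s t : Multiset {lam // g.datum.DominantIntegral lam ∧ g.datum.SinglyAtypical γ lam},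
      (s.map val).prod = (t.map val).prod → s = t)
    {r s : ℕ} {ν : Fin r → g.datum.Vec} {μ : Fin s → g.datum.Vec}
    (hν : ∀ i, g.datum.DominantIntegral (ν i) ∧ g.datum.SinglyAtypical γ (ν i))
    (hμ : ∀ j, g.datum.DominantIntegral (μ j) ∧ g.datum.SinglyAtypical γ (μ j))
    (hU : ∏ i, U g special γ (ν i) = ∏ j, U g special γ (μ j)) :
    ∃ h : r = s, ∃ σ : Equiv.Perm (Fin r),
      ∀ k, U g special γ (ν k) = U g special γ (μ (Fin.cast h (σ k))) := by
  have h1 := Specializes.prod Finset.univ fun i _ => hval ⟨ν i, hν i⟩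
  have h2 := Specializes.prod Finset.univ fun j _ => hval ⟨μ j, hμ j⟩
  rw [← hU] at h2
  have h3 := h1.unique (g.datum.latHom_injective hh) h2
  have h4 := hinj (Finset.univ.val.map fun i => ⟨ν i, hν i⟩)
    (Finset.univ.val.map fun j => ⟨μ j, hμ j⟩) (by rw [Multiset.map_map, Multiset.map_map]; exact h3)
  exact exists_perm_of_multiset_eq h4 fun lam => U g special γ lam.1

/-- Comparison of leading coefficients. -/
theorem multiset_eq_of_lead {K I : Type} [Field K] {u : I → LaurentSeries K} {o : I → ℤ}
    {c : I → K} (hu : ∀ i, Lead (u i) (o i) (c i)) (hc : ∀ i, c i ≠ 0)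
    (hinj : ∀ s t : Multiset I, (s.map c).prod = (t.map c).prod → s = t) {s t : Multiset I}
    (h : (s.map u).prod = (t.map u).prod) : s = t := by
  have hne : ∀ s : Multiset I, (s.map c).prod ≠ 0 := fun s => by
    refine Multiset.prod_ne_zero fun h0 => ?_
    obtain ⟨i, -, hi⟩ := Multiset.mem_map.1 h0
    exact hc i hi
  have h1 := lead_multiset_prod s fun i _ => hu i
  rw [h] at h1
  exact hinj s t (h1.unique (lead_multiset_prod t fun i _ => hu i) (hne s) (hne t)).2

end SuperFactor
end

noncomputable section
open scoped Classical
namespace SuperFactor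

/-! ### Reflections for diagonal forms -/

namespace RootDatum

variable {D : RootDatum} {d : D.κ → ℂ}

theorem form_of_diagonal (hd : D.gram = Matrix.diagonal d) (x y : D.Vec) :
    D.form x y = ∑ c, d c * x c * y c := by
  rw [form, hd]
  refine Finset.sum_congr rfl fun a _ => ?_
  rw [Finset.sum_eq_single a]
  · rw [Matrix.diagonal_apply_eq]; ring
  · intro b _ hb
    rw [Matrix.diagonal_apply_ne _ hb.symm]; ring
  · simp

theorem form_smul_single (hd : D.gram = Matrix.diagonal d) (v : D.Vec) (k : ℂ) (c : D.κ) :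
    D.form v (k • Pi.single c 1) = k * d c * v c := by
  rw [form_of_diagonal hd, Finset.sum_eq_single c]
  · simp; ring
  · intro b _ hb
    simp [hb]
  · simp

theorem form_add_right (x y z : D.Vec) : D.form x (y + z) = D.form x y + D.form x z := by
  simp [form, mul_add, Finset.sum_add_distrib]

theorem form_pair (hd : D.gram = Matrix.diagonal d) (v : D.Vec) (k : ℂ) (c c' : D.κ) :
    D.form v (Pi.single c 1 + k • Pi.single c' 1) = d c * v c + k * d c' * v c' := by
  have h1 := form_smul_single hd v 1 c
  rw [one_smul, one_mul] at h1
  rw [form_add_right, h1, form_smul_single hd]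

/-- This and `eq_reflection_pair` recognize a sign change or a (signed) transposition of coordinates
as the reflection in a given root, from its effect on coordinates alone. -/
theorem eq_reflection_single (hd : D.gram = Matrix.diagonal d) {k : ℂ} (hk : k ≠ 0) {c : D.κ}
    (hc : d c ≠ 0) {α : D.Vec} (hα : α = k • Pi.single c 1) {v w : D.Vec} (h1 : w c = -v c)
    (h2 : ∀ x, x ≠ c → w x = v x) : w = v - (2 * D.form v α / D.form α α) • α := by
  rw [hα, form_smul_single hd, form_smul_single hd]
  ext x
  by_cases hx : x = c
  · subst hx
    simp [h1]
    field_simp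
    ring
  · simp [hx, h2]

theorem form_single_self (hd : D.gram = Matrix.diagonal d) {k : ℂ} (c : D.κ) :
    D.form (k • Pi.single c 1) (k • Pi.single c 1) = k * k * d c := by
  rw [form_smul_single hd]
  simp
  ring

theorem form_pair_self (hd : D.gram = Matrix.diagonal d) {k : ℂ} {c c' : D.κ} (hne : c ≠ c')
    (hk : k * k = 1) (hc : d c' = d c) :
    D.form (Pi.single c 1 + k • Pi.single c' 1) (Pi.single c 1 + k • Pi.single c' 1) =
      2 * d c := by
  rw [form_pair hd]
  simp [hne, hne.symm, hc]
  linear_combination d c * hk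

theorem eq_reflection_pair (hd : D.gram = Matrix.diagonal d) {k : ℂ} (hk : k * k = 1) {c c' : D.κ}
    (hne : c ≠ c') (hc : d c ≠ 0) (hc' : d c' = d c) {α : D.Vec}
    (hα : α = Pi.single c 1 + k • Pi.single c' 1) {v w : D.Vec} (h1 : w c = -k * v c')
    (h2 : w c' = -k * v c) (h3 : ∀ x, x ≠ c → x ≠ c' → w x = v x) :
    w = v - (2 * D.form v α / D.form α α) • α := by
  rw [hα, form_pair_self hd hne hk hc', form_pair hd, hc']
  ext x
  by_cases hx : x = c
  · subst hx
    simp [hne, h1]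
    field_simp
    ring
  · by_cases hx' : x = c'
    · subst hx'
      simp [hx, h2]
      field_simp
      linear_combination v x * hk
    · simp [hx, hx', h3]

end RootDatum

/-! ### Signed permutations -/

/-- Signed permutations of `N` coordinates. -/
def SPerm (N : ℕ) : Type := (Fin N → ℤˣ) × Equiv.Perm (Fin N)

namespace SPerm

variable {N : ℕ}

instance : Fintype (SPerm N) := inferInstanceAs (Fintype ((Fin N → ℤˣ) × Equiv.Perm (Fin N)))

instance : Mul (SPerm N) := ⟨fun y y' => (fun p => y.1 p * y'.1 (y.2⁻¹ p), y.2 * y'.2)⟩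

instance : One (SPerm N) := ⟨((1 : Fin N → ℤˣ), (1 : Equiv.Perm (Fin N)))⟩

instance : Inv (SPerm N) := ⟨fun y => (fun p => (y.1 (y.2 p))⁻¹, y.2⁻¹)⟩

theorem mul_fst (y y' : SPerm N) (p : Fin N) : (y * y').1 p = y.1 p * y'.1 (y.2⁻¹ p) := rfl

theorem mul_snd (y y' : SPerm N) : (y * y').2 = y.2 * y'.2 := rfl

theorem one_fst (p : Fin N) : (1 : SPerm N).1 p = 1 := rfl

theorem one_snd : (1 : SPerm N).2 = 1 := rfl

theorem ext {y y' : SPerm N} (h : ∀ p, y.1 p = y'.1 p) (h' : y.2 = y'.2) : y = y' :=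
  Prod.ext (funext h) h'

instance : Group (SPerm N) :=
  Group.ofLeftAxioms
    (fun a b c => SPerm.ext (fun p => by simp [mul_fst, mul_snd, mul_assoc]) (mul_assoc _ _ _))
    (fun a => SPerm.ext (fun p => by simp [mul_fst, one_fst, one_snd]) (one_mul _))
    (fun a => SPerm.ext (fun p => by
      rw [mul_fst]
      change (a.1 (a.2 p))⁻¹ * a.1 ((a.2⁻¹)⁻¹ p) = 1
      rw [inv_inv, inv_mul_cancel]) (inv_mul_cancel _))

/-- The determinant of a signed permutation. -/
def sign : SPerm N →* ℤˣ where
  toFun y := Equiv.Perm.sign y.2 * ∏ p, y.1 p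
  map_one' := by simp [one_fst, one_snd]
  map_mul' y y' := by
    simp only [mul_fst, mul_snd, Finset.prod_mul_distrib, map_mul]
    rw [Equiv.prod_comp y.2⁻¹ y'.1]
    exact mul_mul_mul_comm _ _ _ _

/-- The sign change of one coordinate. -/
def flip (p : Fin N) : SPerm N := (Pi.mulSingle p (-1), (1 : Equiv.Perm (Fin N)))

/-- The transposition of two coordinates. -/
def swp (p q : Fin N) : SPerm N := ((1 : Fin N → ℤˣ), Equiv.swap p q)

/-- The transposition of two coordinates with a change of both signs. -/
def nswp (p q : Fin N) : SPerm N :=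
  (Pi.mulSingle p (-1) * Pi.mulSingle q (-1), Equiv.swap p q)

theorem sign_flip (p : Fin N) : sign (flip p) = -1 := by
  simp [sign, flip]

theorem sign_swp {p q : Fin N} (h : p ≠ q) : sign (swp p q) = -1 := by
  simp [sign, swp, Equiv.Perm.sign_swap h]

theorem sign_nswp {p q : Fin N} (h : p ≠ q) : sign (nswp p q) = -1 := by
  simp [sign, nswp, Equiv.Perm.sign_swap h, Finset.prod_mul_distrib]

/-- The reflections among signed permutations. -/
def reflections (N : ℕ) : Set (SPerm N) :=
  {y | (∃ p, y = flip p) ∨ ∃ p q, p < q ∧ (y = swp p q ∨ y = nswp p q)}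

theorem sign_of_mem {y : SPerm N} (h : y ∈ reflections N) : sign y = -1 := by
  rcases h with ⟨p, rfl⟩ | ⟨p, q, hpq, rfl | rfl⟩
  · exact sign_flip p
  · exact sign_swp hpq.ne
  · exact sign_nswp hpq.ne

theorem closure_reflections (N : ℕ) : Subgroup.closure (reflections N) = ⊤ := by
  rw [eq_top_iff]
  intro y _
  let i₁ : Equiv.Perm (Fin N) →* SPerm N :=
    { toFun := fun σ => ((1 : Fin N → ℤˣ), σ)
      map_one' := rfl
      map_mul' := fun σ τ => SPerm.ext (fun p => (mul_one 1).symm) rfl }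
  let i₂ : (Fin N → ℤˣ) →* SPerm N :=
    { toFun := fun s => (s, (1 : Equiv.Perm (Fin N)))
      map_one' := rfl
      map_mul' := fun σ τ => SPerm.ext (fun p => rfl) (mul_one 1).symm }
  have hy : y = i₂ y.1 * i₁ y.2 := SPerm.ext (fun p => (mul_one (y.1 p)).symm) (one_mul y.2).symm
  rw [hy]
  refine mul_mem ?_ ?_
  · have : ∀ s, i₂ s ∈ Subgroup.closure (reflections N) := by
      intro s
      rw [← Subgroup.mem_comap, ← Finset.univ_prod_mulSingle s]
      refine Subgroup.prod_mem _ fun p _ => ?_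
      rw [Subgroup.mem_comap]
      rcases Int.units_eq_one_or (s p) with h | h
      · rw [h, Pi.mulSingle_one, map_one]; exact one_mem _
      · rw [h]; exact Subgroup.subset_closure (Or.inl ⟨p, rfl⟩)
    exact this _
  · have h1 : ∀ p q : Fin N, p ≠ q → i₁ (Equiv.swap p q) ∈ Subgroup.closure (reflections N) := by
      intro p q hpq
      rcases lt_or_gt_of_ne hpq with h | h
      · exact Subgroup.subset_closure (Or.inr ⟨p, q, h, Or.inl rfl⟩)
      · rw [Equiv.swap_comm]
        exact Subgroup.subset_closure (Or.inr ⟨q, p, h, Or.inl rfl⟩)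
    have h2 : ∀ σ, i₁ σ ∈ Subgroup.closure (reflections N) := by
      intro σ
      induction σ using Equiv.Perm.swap_induction_on with
      | one => rw [map_one]; exact one_mem _
      | swap_mul f x y hxy ih => rw [map_mul]; exact mul_mem (h1 x y hxy) ih
    exact h2 _

/-- The action on the coordinates. -/
def act {R : Type} [CommRing R] (y : SPerm N) (v : Fin N → R) (p : Fin N) : R :=
  ((y.1 p : ℤ) : R) * v (y.2⁻¹ p)

variable {R : Type} [CommRing R]

theorem act_one (v : Fin N → R) : act 1 v = v := by
  funext p; simp [act, one_fst, one_snd]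

theorem act_mul (y y' : SPerm N) (v : Fin N → R) : act (y * y') v = act y (act y' v) := by
  funext p
  simp only [act, mul_fst, mul_snd, mul_inv_rev, Equiv.Perm.mul_apply, Units.val_mul, Int.cast_mul]
  ring

theorem act_flip (p : Fin N) (v : Fin N → R) (x : Fin N) :
    act (flip p) v x = if x = p then -v p else v x := by
  by_cases hx : x = p
  · subst hx; simp [act, flip]
  · simp [act, flip, hx]

theorem act_swp (p q : Fin N) (v : Fin N → R) (x : Fin N) :
    act (swp p q) v x = if x = p then v q else if x = q then v p else v x := by
  simp only [act, swp, Equiv.swap_inv, Equiv.swap_apply_def]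
  simp only [Pi.one_apply, Units.val_one, Int.cast_one, one_mul]
  split_ifs <;> rfl

theorem act_nswp {p q : Fin N} (hpq : p ≠ q) (v : Fin N → R) (x : Fin N) :
    act (nswp p q) v x = if x = p then -v q else if x = q then -v p else v x := by
  simp only [act, nswp, Equiv.swap_inv, Equiv.swap_apply_def]
  by_cases hx : x = p
  · subst hx; simp [hpq]
  · by_cases hx' : x = q
    · subst hx'; simp [hx]
    · simp [hx, hx']

theorem act_add (y : SPerm N) (v w : Fin N → R) : act y (v + w) = act y v + act y w := by
  funext p; simp [act, mul_add]

theorem act_smul (y : SPerm N) (c : R) (v : Fin N → R) : act y (c • v) = c • act y v := by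
  funext p; simp [act]; ring

theorem cast_act (y : SPerm N) (v : Fin N → ℤ) (p : Fin N) :
    ((act y v p : ℤ) : R) = act y (fun q => (v q : R)) p := by
  simp [act]

theorem eq_of_act {y y' : SPerm N} (h : ∀ v : Fin N → ℤ, act y v = act y' v) : y = y' := by
  have h1 : ∀ p, y.1 p = y'.1 p ∧ y.2⁻¹ p = y'.2⁻¹ p := by
    intro p
    -- The entries of the test vector are positive and distinct, so one coordinate of the image
    -- reveals both the sign and the position.
    have := congrFun (h fun p => (p : ℤ) + 1) p
    simp only [act] at this
    rcases Int.units_eq_one_or (y.1 p) with h1 | h1 <;>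
    rcases Int.units_eq_one_or (y'.1 p) with h2 | h2 <;>
    rw [h1, h2] at this ⊢ <;> simp at this ⊢ <;> omega
  exact SPerm.ext (fun p => (h1 p).1) (inv_injective (Equiv.ext fun p => (h1 p).2))

end SPerm

end SuperFactor
end

noncomputable section
open scoped Classical
namespace SuperFactor

open RootDatum

/-! ### The Weyl group of `𝔬𝔰𝔭(2,2n)` -/

section Osp

variable {n : ℕ} {R : Type} [CommRing R]

/-- Signed permutations acting on the coordinates `δ`. -/
def ospAct (y : SPerm n) (v : Unit ⊕ Fin n → R) : Unit ⊕ Fin n → R :=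
  Sum.elim (fun _ => v (Sum.inl ())) (SPerm.act y fun p => v (Sum.inr p))

theorem mem_osp_evenPos (hn : 0 < n) {α : Unit ⊕ Fin n → ℂ} :
    α ∈ (ospDatum n hn).evenPos ↔ (∃ p, α = (2 : ℂ) • Pi.single (Sum.inr p) 1) ∨
      ∃ p q, p < q ∧ (α = Pi.single (Sum.inr p) 1 + (-1 : ℂ) • Pi.single (Sum.inr q) 1 ∨
        α = Pi.single (Sum.inr p) 1 + (1 : ℂ) • Pi.single (Sum.inr q) 1) := by
  refine Finset.mem_union.trans ?_
  simp only [Finset.mem_union, Finset.mem_image, Finset.mem_univ, true_and,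
    Finset.mem_filter, Prod.exists, neg_one_smul, one_smul, ← sub_eq_add_neg, ospDel]
  constructor
  · rintro ((⟨p, rfl⟩ | ⟨p, q, h, rfl⟩) | ⟨p, q, h, rfl⟩)
    · exact Or.inl ⟨p, rfl⟩
    · exact Or.inr ⟨p, q, h, Or.inl rfl⟩
    · exact Or.inr ⟨p, q, h, Or.inr rfl⟩
  · rintro (⟨p, rfl⟩ | ⟨p, q, h, rfl | rfl⟩)
    · exact Or.inl (Or.inl ⟨p, rfl⟩)
    · exact Or.inl (Or.inr ⟨p, q, h, rfl⟩)
    · exact Or.inr ⟨p, q, h, rfl⟩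

theorem ospAct_flip (hn : 0 < n) (p : Fin n) {α : (ospDatum n hn).Vec}
    (hα : α = (2 : ℂ) • Pi.single (Sum.inr p) 1) (v : (ospDatum n hn).Vec) :
    ospAct (SPerm.flip p) v = v - (2 * (ospDatum n hn).form v α / (ospDatum n hn).form α α) • α := by
  refine eq_reflection_single (D := ospDatum n hn) (d := Sum.elim (fun _ => 1) (fun _ => -1)) rfl
    two_ne_zero (c := Sum.inr p) (by simp) hα ?_ ?_
  · exact (SPerm.act_flip p (fun q => (v (Sum.inr q) : ℂ)) _).trans (if_pos rfl)
  · rintro (x | x) hx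
    · rfl
    · exact (SPerm.act_flip p (fun q => (v (Sum.inr q) : ℂ)) _).trans (if_neg fun h => hx (congrArg Sum.inr h))

theorem ospAct_swp (hn : 0 < n) {p q : Fin n} (hpq : p < q) {α : (ospDatum n hn).Vec}
    (hα : α = Pi.single (Sum.inr p) 1 + (-1 : ℂ) • Pi.single (Sum.inr q) 1)
    (v : (ospDatum n hn).Vec) :
    ospAct (SPerm.swp p q) v =
      v - (2 * (ospDatum n hn).form v α / (ospDatum n hn).form α α) • α := by
  refine eq_reflection_pair (D := ospDatum n hn) (d := Sum.elim (fun _ => 1) (fun _ => -1)) rfl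
    (by norm_num) (c := Sum.inr p) (c' := Sum.inr q) (fun h => hpq.ne (Sum.inr_injective h))
    (by simp) rfl hα ?_ ?_ ?_
  · exact (SPerm.act_swp p q (fun q => (v (Sum.inr q) : ℂ)) _).trans ((if_pos rfl).trans (by simp))
  · exact (SPerm.act_swp p q (fun q => (v (Sum.inr q) : ℂ)) _).trans ((if_neg hpq.ne').trans ((if_pos rfl).trans (by simp)))
  · rintro (x | x) hx hx'
    · rfl
    · exact (SPerm.act_swp p q (fun q => (v (Sum.inr q) : ℂ)) _).trans ((if_neg fun h => hx (congrArg Sum.inr h)).trans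
        (if_neg fun h => hx' (congrArg Sum.inr h)))

theorem ospAct_nswp (hn : 0 < n) {p q : Fin n} (hpq : p < q) {α : (ospDatum n hn).Vec}
    (hα : α = Pi.single (Sum.inr p) 1 + (1 : ℂ) • Pi.single (Sum.inr q) 1)
    (v : (ospDatum n hn).Vec) :
    ospAct (SPerm.nswp p q) v =
      v - (2 * (ospDatum n hn).form v α / (ospDatum n hn).form α α) • α := by
  refine eq_reflection_pair (D := ospDatum n hn) (d := Sum.elim (fun _ => 1) (fun _ => -1)) rfl
    (by norm_num) (c := Sum.inr p) (c' := Sum.inr q) (fun h => hpq.ne (Sum.inr_injective h))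
    (by simp) rfl hα ?_ ?_ ?_
  · exact (SPerm.act_nswp hpq.ne (fun q => (v (Sum.inr q) : ℂ)) _).trans ((if_pos rfl).trans (by simp))
  · exact (SPerm.act_nswp hpq.ne (fun q => (v (Sum.inr q) : ℂ)) _).trans ((if_neg hpq.ne').trans ((if_pos rfl).trans (by simp)))
  · rintro (x | x) hx hx'
    · rfl
    · exact (SPerm.act_nswp hpq.ne (fun q => (v (Sum.inr q) : ℂ)) _).trans ((if_neg fun h => hx (congrArg Sum.inr h)).trans
        (if_neg fun h => hx' (congrArg Sum.inr h)))

/-- The sign of a signed permutation as a complex number. -/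
def SPerm.signC (n : ℕ) : SPerm n →* ℂ :=
  ((Int.castRingHom ℂ : ℤ →* ℂ).comp (Units.coeHom ℤ)).comp SPerm.sign

theorem SPerm.signC_apply (y : SPerm n) : SPerm.signC n y = ((SPerm.sign y : ℤ) : ℂ) := rfl

/-- The representation of signed permutations on the coordinate space. -/
def ospRep (n : ℕ) : SPerm n →* Module.End ℂ (Unit ⊕ Fin n → ℂ) where
  toFun y :=
    { toFun := ospAct y
      map_add' := fun v w => by
        funext x
        rcases x with x | x
        · rfl
        · exact congrFun (SPerm.act_add y (fun q => v (Sum.inr q)) fun q => w (Sum.inr q)) x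
      map_smul' := fun c v => by
        funext x
        rcases x with x | x
        · rfl
        · exact congrFun (SPerm.act_smul y c fun q => v (Sum.inr q)) x }
  map_one' := LinearMap.ext fun v => funext fun x => by
    rcases x with x | x
    · rfl
    · exact congrFun (SPerm.act_one fun q => v (Sum.inr q)) x
  map_mul' y y' := LinearMap.ext fun v => funext fun x => by
    rcases x with x | x
    · rfl
    · exact congrFun (SPerm.act_mul y y' fun q => v (Sum.inr q)) x

/-- The Weyl group of `𝔬𝔰𝔭(2,2n)`. -/
def ospModel (n : ℕ) (hn : 0 < n) : WeylModel (ospDatum n hn) 1 (SPerm n) where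
  act := ospRep n
  actZ := ospAct
  act_lat y z := funext fun x => by
    rcases x with x | x
    · rfl
    · change SPerm.act y (fun p => ((z (Sum.inr p) : ℤ) : ℂ) / 1) x =
        ((SPerm.act y (fun p => z (Sum.inr p)) x : ℤ) : ℂ) / 1
      rw [SPerm.cast_act]
      simp only [div_one]
  inj y y' h := SPerm.eq_of_act fun v => funext fun p => by
    have h1 := congrFun (DFunLike.congr_fun h
      (Sum.elim (fun _ => (0 : ℂ)) fun q => (v q : ℂ))) (Sum.inr p)
    have h2 : SPerm.act y (fun q => (v q : ℂ)) p = SPerm.act y' (fun q => (v q : ℂ)) p := h1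
    rw [← SPerm.cast_act, ← SPerm.cast_act] at h2
    exact_mod_cast h2
  sign := SPerm.signC n
  R := SPerm.reflections n
  closure_R := SPerm.closure_reflections n
  sign_R y hy := by rw [SPerm.signC_apply, SPerm.sign_of_mem hy]; simp
  reflection y hy := by
    rcases hy with ⟨p, rfl⟩ | ⟨p, q, hpq, rfl | rfl⟩
    · exact ⟨_, (mem_osp_evenPos hn).2 (Or.inl ⟨p, rfl⟩), ospAct_flip hn p rfl⟩
    · exact ⟨_, (mem_osp_evenPos hn).2 (Or.inr ⟨p, q, hpq, Or.inl rfl⟩), ospAct_swp hn hpq rfl⟩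
    · exact ⟨_, (mem_osp_evenPos hn).2 (Or.inr ⟨p, q, hpq, Or.inr rfl⟩), ospAct_nswp hn hpq rfl⟩
  exists_reflection α hα := by
    rcases (mem_osp_evenPos hn).1 hα with ⟨p, hp⟩ | ⟨p, q, hpq, hp | hp⟩
    · exact ⟨SPerm.flip p, Or.inl ⟨p, rfl⟩, ospAct_flip hn p hp⟩
    · exact ⟨SPerm.swp p q, Or.inr ⟨p, q, hpq, Or.inl rfl⟩, ospAct_swp hn hpq hp⟩
    · exact ⟨SPerm.nswp p q, Or.inr ⟨p, q, hpq, Or.inr rfl⟩, ospAct_nswp hn hpq hp⟩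
  nondeg α hα := by
    have hd : (ospDatum n hn).gram = Matrix.diagonal (Sum.elim (fun _ => 1) (fun _ => -1)) := rfl
    rcases (mem_osp_evenPos hn).1 hα with ⟨p, rfl⟩ | ⟨p, q, hpq, rfl | rfl⟩
    · exact fun h => absurd ((form_single_self hd (Sum.inr p)).symm.trans h) (by simp)
    · exact fun h => absurd ((form_pair_self (c := Sum.inr p) (c' := Sum.inr q) hd
        (fun h => hpq.ne (Sum.inr_injective h)) (by norm_num) rfl).symm.trans h) (by simp)
    · exact fun h => absurd ((form_pair_self (c := Sum.inr p) (c' := Sum.inr q) hd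
        (fun h => hpq.ne (Sum.inr_injective h)) (by norm_num) rfl).symm.trans h) (by simp)

end Osp

end SuperFactor
end

noncomputable section
open scoped Classical
namespace SuperFactor

open RootDatum

/-- Signs as complex numbers. -/
def unitsC : ℤˣ →* ℂ := (Int.castRingHom ℂ : ℤ →* ℂ).comp (Units.coeHom ℤ)

theorem unitsC_apply (e : ℤˣ) : unitsC e = ((e : ℤ) : ℂ) := rfl

theorem closure_prod_eq_top {G H : Type} [Group G] [Group H] {S : Set G} {T : Set H}
    (hS : Subgroup.closure S = ⊤) (hT : Subgroup.closure T = ⊤) :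
    Subgroup.closure ({y : G × H | (y.1 ∈ S ∧ y.2 = 1) ∨ (y.1 = 1 ∧ y.2 ∈ T)}) = ⊤ := by
  rw [eq_top_iff]
  rintro ⟨a, b⟩ -
  have h1 : Subgroup.closure S ≤ (Subgroup.closure
      ({y : G × H | (y.1 ∈ S ∧ y.2 = 1) ∨ (y.1 = 1 ∧ y.2 ∈ T)})).comap (MonoidHom.inl G H) := by
    rw [Subgroup.closure_le]
    exact fun x hx => Subgroup.subset_closure (Or.inl ⟨hx, rfl⟩)
  have h2 : Subgroup.closure T ≤ (Subgroup.closure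
      ({y : G × H | (y.1 ∈ S ∧ y.2 = 1) ∨ (y.1 = 1 ∧ y.2 ∈ T)})).comap (MonoidHom.inr G H) := by
    rw [Subgroup.closure_le]
    exact fun x hx => Subgroup.subset_closure (Or.inr ⟨rfl, hx⟩)
  rw [show (a, b) = MonoidHom.inl G H a * MonoidHom.inr G H b by simp]
  exact mul_mem (h1 (hS ▸ Subgroup.mem_top a)) (h2 (hT ▸ Subgroup.mem_top b))

theorem closure_neg_one : Subgroup.closure ({-1} : Set ℤˣ) = ⊤ := by
  rw [eq_top_iff]
  intro e _
  rcases Int.units_eq_one_or e with rfl | rfl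
  · exact one_mem _
  · exact Subgroup.subset_closure rfl

/-! ### The Weyl group of `F(4)` -/

section F4

variable {R : Type} [CommRing R]

/-- Signed permutations of the coordinates `ε` and sign changes of `δ`. -/
def f4Act (y : SPerm 3 × ℤˣ) (v : Fin 4 → R) : Fin 4 → R :=
  Fin.snoc (α := fun _ => R) (SPerm.act y.1 fun p => v p.castSucc)
    (((y.2 : ℤ) : R) * v (Fin.last 3))

theorem f4Act_castSucc (y : SPerm 3 × ℤˣ) (v : Fin 4 → R) (p : Fin 3) :
    f4Act y v p.castSucc = SPerm.act y.1 (fun p => v p.castSucc) p :=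
  Fin.snoc_castSucc (α := fun _ => R) ..

theorem f4Act_last (y : SPerm 3 × ℤˣ) (v : Fin 4 → R) :
    f4Act y v (Fin.last 3) = ((y.2 : ℤ) : R) * v (Fin.last 3) :=
  Fin.snoc_last (α := fun _ => R) ..

/-- The diagonal entries of the form of `F(4)`. -/
def f4Diag : Fin 4 → ℂ := ![1, 1, 1, -3]

theorem f4Diag_castSucc (p : Fin 3) : f4Diag p.castSucc = 1 := by
  fin_cases p <;> rfl

theorem mem_f4_evenPos {α : Fin 4 → ℂ} :
    α ∈ f4Datum.evenPos ↔ (∃ p : Fin 3, α = (1 : ℂ) • Pi.single p.castSucc 1) ∨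
      (∃ p q : Fin 3, p < q ∧
        (α = Pi.single p.castSucc 1 + (-1 : ℂ) • Pi.single q.castSucc 1 ∨
          α = Pi.single p.castSucc 1 + (1 : ℂ) • Pi.single q.castSucc 1)) ∨
      α = (1 : ℂ) • Pi.single (Fin.last 3) 1 := by
  refine Finset.mem_insert.trans ?_
  simp only [Finset.mem_insert, Finset.mem_singleton]
  constructor
  · have e : ∀ β β' : Fin 4 → ℂ, β = β' ↔ β 0 = β' 0 ∧ β 1 = β' 1 ∧ β 2 = β' 2 ∧ β 3 = β' 3 := by
      intro β β'
      rw [funext_iff, Fin.forall_fin_succ, Fin.forall_fin_succ, Fin.forall_fin_succ,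
        Fin.forall_fin_one]
      rfl
    rintro (rfl | rfl | rfl | rfl | rfl | rfl | rfl | rfl | rfl | rfl)
    · exact Or.inl ⟨0, by rw [e]; simp [Pi.single_apply]⟩
    · exact Or.inl ⟨1, by rw [e]; simp [Pi.single_apply]⟩
    · exact Or.inl ⟨2, by rw [e]; simp [Pi.single_apply]⟩
    · exact Or.inr (Or.inl ⟨0, 1, by simp, Or.inl (by rw [e]; simp [Pi.single_apply])⟩)
    · exact Or.inr (Or.inl ⟨0, 1, by simp, Or.inr (by rw [e]; simp [Pi.single_apply])⟩)
    · exact Or.inr (Or.inl ⟨0, 2, by simp, Or.inl (by rw [e]; simp [Pi.single_apply])⟩)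
    · exact Or.inr (Or.inl ⟨0, 2, by simp, Or.inr (by rw [e]; simp [Pi.single_apply])⟩)
    · exact Or.inr (Or.inl ⟨1, 2, by simp, Or.inl (by rw [e]; simp [Pi.single_apply])⟩)
    · exact Or.inr (Or.inl ⟨1, 2, by simp, Or.inr (by rw [e]; simp [Pi.single_apply])⟩)
    · exact Or.inr (Or.inr (by rw [e]; simp [Pi.single_apply]))
  · have e : ∀ β β' : Fin 4 → ℂ, β = β' ↔ β 0 = β' 0 ∧ β 1 = β' 1 ∧ β 2 = β' 2 ∧ β 3 = β' 3 := by
      intro β β'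
      rw [funext_iff, Fin.forall_fin_succ, Fin.forall_fin_succ, Fin.forall_fin_succ,
        Fin.forall_fin_one]
      rfl
    rintro (⟨p, rfl⟩ | ⟨p, q, hpq, rfl | rfl⟩ | rfl)
    · fin_cases p <;> simp [e, Pi.single_apply]
    · fin_cases p <;> fin_cases q <;> simp at hpq <;> simp [e, Pi.single_apply]
    · fin_cases p <;> fin_cases q <;> simp at hpq <;> simp [e, Pi.single_apply]
    · simp [e, Pi.single_apply]

theorem castSucc_injective : Function.Injective (Fin.castSucc : Fin 3 → Fin 4) :=
  Fin.castSucc_injective 3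

theorem f4Act_flip (p : Fin 3) {α : f4Datum.Vec}
    (hα : α = (1 : ℂ) • Pi.single (Fin.castSucc p : Fin 4) 1) (v : f4Datum.Vec) :
    f4Act (SPerm.flip p, 1) v = v - (2 * f4Datum.form v α / f4Datum.form α α) • α := by
  refine eq_reflection_single (D := f4Datum) (d := f4Diag) rfl
    one_ne_zero (c := (p.castSucc : Fin 4)) (by rw [f4Diag_castSucc]; exact one_ne_zero) hα ?_ ?_
  · exact (f4Act_castSucc _ _ _).trans ((SPerm.act_flip p (fun q : Fin 3 => v q.castSucc) _).trans
      (if_pos rfl))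
  · intro (x : Fin 4) hx
    induction x using Fin.lastCases with
    | last => exact (f4Act_last _ _).trans (by simp)
    | cast x =>
      exact (f4Act_castSucc _ _ _).trans ((SPerm.act_flip p (fun q : Fin 3 => v q.castSucc) _).trans
        (if_neg fun h => hx (congrArg Fin.castSucc h)))

theorem f4Act_last_neg {α : f4Datum.Vec}
    (hα : α = (1 : ℂ) • Pi.single (Fin.last 3 : Fin 4) 1) (v : f4Datum.Vec) :
    f4Act (1, -1) v = v - (2 * f4Datum.form v α / f4Datum.form α α) • α := by
  refine eq_reflection_single (D := f4Datum) (d := f4Diag) rfl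
    one_ne_zero (c := (Fin.last 3 : Fin 4)) (by simp [f4Diag, Fin.last]) hα ?_ ?_
  · exact (f4Act_last _ _).trans (by simp)
  · intro (x : Fin 4) hx
    induction x using Fin.lastCases with
    | last => exact absurd rfl hx
    | cast x =>
      exact (f4Act_castSucc _ _ _).trans (congrFun (SPerm.act_one fun q : Fin 3 => v q.castSucc) x)

theorem f4Act_swp {p q : Fin 3} (hpq : p < q) {α : f4Datum.Vec}
    (hα : α = Pi.single (p.castSucc : Fin 4) 1 + (-1 : ℂ) • Pi.single (q.castSucc : Fin 4) 1)
    (v : f4Datum.Vec) :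
    f4Act (SPerm.swp p q, 1) v = v - (2 * f4Datum.form v α / f4Datum.form α α) • α := by
  refine eq_reflection_pair (D := f4Datum) (d := f4Diag) rfl
    (by norm_num) (c := (p.castSucc : Fin 4)) (c' := (q.castSucc : Fin 4))
    (fun h => hpq.ne (castSucc_injective h)) (by rw [f4Diag_castSucc]; exact one_ne_zero)
    ((f4Diag_castSucc q).trans (f4Diag_castSucc p).symm) hα ?_ ?_ ?_
  · exact (f4Act_castSucc _ _ _).trans ((SPerm.act_swp p q (fun q : Fin 3 => v q.castSucc) _).trans
      ((if_pos rfl).trans (by simp)))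
  · exact (f4Act_castSucc _ _ _).trans ((SPerm.act_swp p q (fun q : Fin 3 => v q.castSucc) _).trans
      ((if_neg hpq.ne').trans ((if_pos rfl).trans (by simp))))
  · intro (x : Fin 4) hx hx'
    induction x using Fin.lastCases with
    | last => exact (f4Act_last _ _).trans (by simp)
    | cast x =>
      exact (f4Act_castSucc _ _ _).trans ((SPerm.act_swp p q (fun q : Fin 3 => v q.castSucc) _).trans
        ((if_neg fun h => hx (congrArg Fin.castSucc h)).trans
          (if_neg fun h => hx' (congrArg Fin.castSucc h))))

theorem f4Act_nswp {p q : Fin 3} (hpq : p < q) {α : f4Datum.Vec}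
    (hα : α = Pi.single (p.castSucc : Fin 4) 1 + (1 : ℂ) • Pi.single (q.castSucc : Fin 4) 1)
    (v : f4Datum.Vec) :
    f4Act (SPerm.nswp p q, 1) v = v - (2 * f4Datum.form v α / f4Datum.form α α) • α := by
  refine eq_reflection_pair (D := f4Datum) (d := f4Diag) rfl
    (by norm_num) (c := (p.castSucc : Fin 4)) (c' := (q.castSucc : Fin 4))
    (fun h => hpq.ne (castSucc_injective h)) (by rw [f4Diag_castSucc]; exact one_ne_zero)
    ((f4Diag_castSucc q).trans (f4Diag_castSucc p).symm) hα ?_ ?_ ?_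
  · exact (f4Act_castSucc _ _ _).trans
      ((SPerm.act_nswp hpq.ne (fun q : Fin 3 => v q.castSucc) _).trans
      ((if_pos rfl).trans (by simp)))
  · exact (f4Act_castSucc _ _ _).trans
      ((SPerm.act_nswp hpq.ne (fun q : Fin 3 => v q.castSucc) _).trans
      ((if_neg hpq.ne').trans ((if_pos rfl).trans (by simp))))
  · intro (x : Fin 4) hx hx'
    induction x using Fin.lastCases with
    | last => exact (f4Act_last _ _).trans (by simp)
    | cast x =>
      exact (f4Act_castSucc _ _ _).trans
        ((SPerm.act_nswp hpq.ne (fun q : Fin 3 => v q.castSucc) _).trans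
        ((if_neg fun h => hx (congrArg Fin.castSucc h)).trans
          (if_neg fun h => hx' (congrArg Fin.castSucc h))))

/-- The representation of the Weyl group of `F(4)`. -/
def f4Rep : SPerm 3 × ℤˣ →* Module.End ℂ (Fin 4 → ℂ) where
  toFun y :=
    { toFun := f4Act y
      map_add' := fun v w => by
        funext x
        induction x using Fin.lastCases with
        | last => simp only [f4Act_last, Pi.add_apply, mul_add]
        | cast x =>
          rw [Pi.add_apply, f4Act_castSucc, f4Act_castSucc, f4Act_castSucc]
          exact congrFun (SPerm.act_add y.1 (fun q => v q.castSucc) fun q => w q.castSucc) x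
      map_smul' := fun c v => by
        funext x
        induction x using Fin.lastCases with
        | last =>
          simp only [f4Act_last, Pi.smul_apply, smul_eq_mul, RingHom.id_apply]
          ring
        | cast x =>
          rw [Pi.smul_apply, f4Act_castSucc, f4Act_castSucc]
          exact congrFun (SPerm.act_smul y.1 c fun q => v q.castSucc) x }
  map_one' := LinearMap.ext fun v => funext fun x => by
    induction x using Fin.lastCases with
    | last => exact (f4Act_last _ _).trans (by simp)
    | cast x => exact (f4Act_castSucc _ _ _).trans (congrFun (SPerm.act_one fun q => v q.castSucc) x)
  map_mul' y y' := LinearMap.ext fun v => funext fun x => by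
    change f4Act (y * y') v x = f4Act y (f4Act y' v) x
    induction x using Fin.lastCases with
    | last =>
      simp only [f4Act_last, Prod.snd_mul, Units.val_mul, Int.cast_mul]
      ring
    | cast x =>
      rw [f4Act_castSucc, f4Act_castSucc, Prod.fst_mul, SPerm.act_mul]
      simp only [f4Act_castSucc]

theorem f4Act_div (y : SPerm 3 × ℤˣ) (z : Fin 4 → ℤ) :
    f4Act y (fun c => (z c : ℂ) / 2) = fun c => ((f4Act y z c : ℤ) : ℂ) / 2 := by
  funext x
  induction x using Fin.lastCases with
  | last =>
    rw [f4Act_last, f4Act_last]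
    push_cast
    ring
  | cast x =>
    rw [f4Act_castSucc, f4Act_castSucc, SPerm.cast_act]
    simp only [SPerm.act]
    ring

/-- The Weyl group of `F(4)`. -/
def f4Model : WeylModel f4Datum 2 (SPerm 3 × ℤˣ) where
  act := f4Rep
  actZ := f4Act
  act_lat y z := f4Act_div y z
  inj y y' h := by
    refine Prod.ext (SPerm.eq_of_act fun v => funext fun p => ?_) ?_
    · have h1 := congrFun (DFunLike.congr_fun h
        (Fin.snoc (α := fun _ => ℂ) (fun q => (v q : ℂ)) 0)) p.castSucc
      have h2 := ((f4Act_castSucc _ _ _).symm.trans h1).trans (f4Act_castSucc _ _ _)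
      simp only [Fin.snoc_castSucc] at h2
      rw [← SPerm.cast_act, ← SPerm.cast_act] at h2
      exact_mod_cast h2
    · have h1 := congrFun (DFunLike.congr_fun h fun _ => (1 : ℂ)) (Fin.last 3)
      have h2 := ((f4Act_last y fun _ => (1 : ℂ)).symm.trans h1).trans
        (f4Act_last y' fun _ => (1 : ℂ))
      simp only [mul_one] at h2
      exact Units.ext (by exact_mod_cast h2)
  sign := ((SPerm.signC 3).comp (MonoidHom.fst _ _)) * unitsC.comp (MonoidHom.snd _ _)
  R := {y | (y.1 ∈ SPerm.reflections 3 ∧ y.2 = 1) ∨ (y.1 = 1 ∧ y.2 ∈ ({-1} : Set ℤˣ))}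
  closure_R := closure_prod_eq_top (SPerm.closure_reflections 3) closure_neg_one
  sign_R := by
    rintro ⟨y, e⟩ (⟨hy, he⟩ | ⟨hy, he⟩)
    · obtain rfl : e = 1 := he
      have : SPerm.signC 3 y * unitsC 1 = -1 := by
        rw [map_one, mul_one, SPerm.signC_apply, SPerm.sign_of_mem hy]; simp
      exact this
    · obtain rfl : y = 1 := hy
      obtain rfl : e = -1 := he
      have : SPerm.signC 3 1 * unitsC (-1) = -1 := by
        rw [map_one, one_mul, unitsC_apply]; simp
      exact this
  reflection := by
    rintro ⟨y, e⟩ (⟨hy, he⟩ | ⟨hy, he⟩)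
    · obtain rfl : e = 1 := he
      rcases hy with ⟨p, hp⟩ | ⟨p, q, hpq, hp | hp⟩
      · obtain rfl : y = _ := hp
        exact ⟨_, mem_f4_evenPos.2 (Or.inl ⟨p, rfl⟩), f4Act_flip p rfl⟩
      · obtain rfl : y = _ := hp
        exact ⟨_, mem_f4_evenPos.2 (Or.inr (Or.inl ⟨p, q, hpq, Or.inl rfl⟩)), f4Act_swp hpq rfl⟩
      · obtain rfl : y = _ := hp
        exact ⟨_, mem_f4_evenPos.2 (Or.inr (Or.inl ⟨p, q, hpq, Or.inr rfl⟩)), f4Act_nswp hpq rfl⟩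
    · obtain rfl : y = 1 := hy
      obtain rfl : e = -1 := he
      exact ⟨_, mem_f4_evenPos.2 (Or.inr (Or.inr rfl)), f4Act_last_neg rfl⟩
  exists_reflection α hα := by
    rcases mem_f4_evenPos.1 hα with ⟨p, hp⟩ | ⟨p, q, hpq, hp | hp⟩ | hp
    · exact ⟨(SPerm.flip p, 1), Or.inl ⟨Or.inl ⟨p, rfl⟩, rfl⟩, f4Act_flip p hp⟩
    · exact ⟨(SPerm.swp p q, 1), Or.inl ⟨Or.inr ⟨p, q, hpq, Or.inl rfl⟩, rfl⟩, f4Act_swp hpq hp⟩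
    · exact ⟨(SPerm.nswp p q, 1), Or.inl ⟨Or.inr ⟨p, q, hpq, Or.inr rfl⟩, rfl⟩, f4Act_nswp hpq hp⟩
    · exact ⟨(1, -1), Or.inr ⟨rfl, rfl⟩, f4Act_last_neg hp⟩
  nondeg α hα := by
    have hd : f4Datum.gram = Matrix.diagonal f4Diag := rfl
    rcases mem_f4_evenPos.1 hα with ⟨p, rfl⟩ | ⟨p, q, hpq, rfl | rfl⟩ | rfl
    · exact fun h => absurd ((form_single_self hd (p.castSucc : Fin 4)).symm.trans h)
        (by simp [f4Diag_castSucc])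
    · exact fun h => absurd ((form_pair_self (c := (p.castSucc : Fin 4))
        (c' := (q.castSucc : Fin 4)) hd (fun h => hpq.ne (castSucc_injective h)) (by norm_num)
        ((f4Diag_castSucc q).trans (f4Diag_castSucc p).symm)).symm.trans h)
        (by simp [f4Diag_castSucc])
    · exact fun h => absurd ((form_pair_self (c := (p.castSucc : Fin 4))
        (c' := (q.castSucc : Fin 4)) hd (fun h => hpq.ne (castSucc_injective h)) (by norm_num)
        ((f4Diag_castSucc q).trans (f4Diag_castSucc p).symm)).symm.trans h)
        (by simp [f4Diag_castSucc])
    · exact fun h => absurd ((form_single_self hd (Fin.last 3 : Fin 4)).symm.trans h)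
        (by simp [f4Diag, Fin.last])

end F4

end SuperFactor
end

noncomputable section
open scoped Classical
namespace SuperFactor

open RootDatum

/-- The transpositions. -/
def swaps (N : ℕ) : Set (Equiv.Perm (Fin N)) := {σ | ∃ p q, p < q ∧ σ = Equiv.swap p q}

theorem closure_swaps (N : ℕ) : Subgroup.closure (swaps N) = ⊤ := by
  rw [← Equiv.Perm.closure_isSwap]
  congr 1
  ext σ
  constructor
  · rintro ⟨p, q, h, rfl⟩
    exact ⟨p, q, h.ne, rfl⟩
  · rintro ⟨p, q, h, rfl⟩
    rcases lt_or_gt_of_ne h with h | h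
    · exact ⟨p, q, h, rfl⟩
    · exact ⟨q, p, h, Equiv.swap_comm _ _⟩

/-! ### The Weyl group of `𝔰𝔩(m+1,n+1)` -/

section Sl

variable {m n : ℕ} {R : Type} [CommRing R]

/-- Permutations of the coordinates `ε` and of the coordinates `δ`. -/
def slAct (y : Equiv.Perm (Fin (m + 1)) × Equiv.Perm (Fin (n + 1)))
    (v : Fin (m + 1) ⊕ Fin (n + 1) → R) : Fin (m + 1) ⊕ Fin (n + 1) → R :=
  Sum.elim (fun p => v (Sum.inl (y.1⁻¹ p))) fun q => v (Sum.inr (y.2⁻¹ q))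

theorem mem_sl_evenPos {α : Fin (m + 1) ⊕ Fin (n + 1) → ℂ} :
    α ∈ (slDatum m n).evenPos ↔
      (∃ p q, p < q ∧ α = Pi.single (Sum.inl p) 1 + (-1 : ℂ) • Pi.single (Sum.inl q) 1) ∨
      ∃ p q, p < q ∧ α = Pi.single (Sum.inr p) 1 + (-1 : ℂ) • Pi.single (Sum.inr q) 1 := by
  refine Finset.mem_union.trans ?_
  simp only [Finset.mem_image, Finset.mem_univ, true_and,
    Finset.mem_filter, Prod.exists, neg_one_smul, ← sub_eq_add_neg, slDel, slEps]
  constructor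
  · rintro (⟨p, q, h, rfl⟩ | ⟨p, q, h, rfl⟩)
    · exact Or.inl ⟨p, q, h, rfl⟩
    · exact Or.inr ⟨p, q, h, rfl⟩
  · rintro (⟨p, q, h, rfl⟩ | ⟨p, q, h, rfl⟩)
    · exact Or.inl ⟨p, q, h, rfl⟩
    · exact Or.inr ⟨p, q, h, rfl⟩

theorem slAct_swap_inl {p q : Fin (m + 1)} (hpq : p < q) {α : (slDatum m n).Vec}
    (hα : α = Pi.single (Sum.inl p) 1 + (-1 : ℂ) • Pi.single (Sum.inl q) 1)
    (v : (slDatum m n).Vec) : slAct (Equiv.swap p q, 1) v =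
      v - (2 * (slDatum m n).form v α / (slDatum m n).form α α) • α := by
  refine eq_reflection_pair (D := slDatum m n) (d := Sum.elim (fun _ => 1) (fun _ => -1)) rfl
    (by norm_num) (c := Sum.inl p) (c' := Sum.inl q) (fun h => hpq.ne (Sum.inl_injective h))
    (by simp) rfl hα ?_ ?_ ?_
  · change v (Sum.inl ((Equiv.swap p q)⁻¹ p)) = _
    rw [Equiv.swap_inv, Equiv.swap_apply_left]; simp
  · change v (Sum.inl ((Equiv.swap p q)⁻¹ q)) = _
    rw [Equiv.swap_inv, Equiv.swap_apply_right]; simp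
  · rintro (x | x) hx hx'
    · change v (Sum.inl ((Equiv.swap p q)⁻¹ x)) = _
      rw [Equiv.swap_inv, Equiv.swap_apply_of_ne_of_ne (fun h => hx (congrArg Sum.inl h))
        fun h => hx' (congrArg Sum.inl h)]
    · rfl

theorem slAct_swap_inr {p q : Fin (n + 1)} (hpq : p < q) {α : (slDatum m n).Vec}
    (hα : α = Pi.single (Sum.inr p) 1 + (-1 : ℂ) • Pi.single (Sum.inr q) 1)
    (v : (slDatum m n).Vec) : slAct (1, Equiv.swap p q) v =
      v - (2 * (slDatum m n).form v α / (slDatum m n).form α α) • α := by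
  refine eq_reflection_pair (D := slDatum m n) (d := Sum.elim (fun _ => 1) (fun _ => -1)) rfl
    (by norm_num) (c := Sum.inr p) (c' := Sum.inr q) (fun h => hpq.ne (Sum.inr_injective h))
    (by simp) rfl hα ?_ ?_ ?_
  · change v (Sum.inr ((Equiv.swap p q)⁻¹ p)) = _
    rw [Equiv.swap_inv, Equiv.swap_apply_left]; simp
  · change v (Sum.inr ((Equiv.swap p q)⁻¹ q)) = _
    rw [Equiv.swap_inv, Equiv.swap_apply_right]; simp
  · rintro (x | x) hx hx'
    · rfl
    · change v (Sum.inr ((Equiv.swap p q)⁻¹ x)) = _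
      rw [Equiv.swap_inv, Equiv.swap_apply_of_ne_of_ne (fun h => hx (congrArg Sum.inr h))
        fun h => hx' (congrArg Sum.inr h)]

/-- The representation of the Weyl group of `𝔰𝔩(m+1,n+1)`. -/
def slRep (m n : ℕ) : Equiv.Perm (Fin (m + 1)) × Equiv.Perm (Fin (n + 1)) →*
    Module.End ℂ (Fin (m + 1) ⊕ Fin (n + 1) → ℂ) where
  toFun y :=
    { toFun := slAct y
      map_add' := fun v w => by funext x; rcases x with x | x <;> rfl
      map_smul' := fun c v => by funext x; rcases x with x | x <;> rfl }
  map_one' := LinearMap.ext fun v => by funext x; rcases x with x | x <;> rfl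
  map_mul' y y' := LinearMap.ext fun v => by
    funext x
    rcases x with x | x
    · change v (Sum.inl ((y.1 * y'.1)⁻¹ x)) = v (Sum.inl (y'.1⁻¹ (y.1⁻¹ x)))
      rw [mul_inv_rev, Equiv.Perm.mul_apply]
    · change v (Sum.inr ((y.2 * y'.2)⁻¹ x)) = v (Sum.inr (y'.2⁻¹ (y.2⁻¹ x)))
      rw [mul_inv_rev, Equiv.Perm.mul_apply]

/-- The Weyl group of `𝔰𝔩(m+1,n+1)`. -/
def slModel (m n : ℕ) :
    WeylModel (slDatum m n) 1 (Equiv.Perm (Fin (m + 1)) × Equiv.Perm (Fin (n + 1))) where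
  act := slRep m n
  actZ := slAct
  act_lat y z := funext fun x => by rcases x with x | x <;> rfl
  inj y y' h := by
    have h1 := fun x => congrFun (DFunLike.congr_fun h
      (Sum.elim (fun p : Fin (m + 1) => ((p : ℕ) : ℂ)) fun q : Fin (n + 1) => ((q : ℕ) : ℂ))) x
    refine Prod.ext (inv_injective (Equiv.ext fun p => Fin.ext ?_))
      (inv_injective (Equiv.ext fun p => Fin.ext ?_))
    · have h2 : (((y.1⁻¹ p : Fin (m + 1)) : ℕ) : ℂ) = ((y'.1⁻¹ p : Fin (m + 1)) : ℕ) :=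
        h1 (Sum.inl p)
      exact_mod_cast h2
    · have h2 : (((y.2⁻¹ p : Fin (n + 1)) : ℕ) : ℂ) = ((y'.2⁻¹ p : Fin (n + 1)) : ℕ) :=
        h1 (Sum.inr p)
      exact_mod_cast h2
  sign := unitsC.comp ((Equiv.Perm.sign.comp (MonoidHom.fst _ _)) *
    Equiv.Perm.sign.comp (MonoidHom.snd _ _))
  R := {y | (y.1 ∈ swaps (m + 1) ∧ y.2 = 1) ∨
    (y.1 = 1 ∧ y.2 ∈ swaps (n + 1))}
  closure_R := closure_prod_eq_top (closure_swaps _) (closure_swaps _)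
  sign_R := by
    rintro ⟨σ, τ⟩ (⟨⟨p, q, hpq, h⟩, h'⟩ | ⟨h', ⟨p, q, hpq, h⟩⟩)
    · obtain rfl : σ = _ := h
      obtain rfl : τ = 1 := h'
      simp [Equiv.Perm.sign_swap hpq.ne, unitsC_apply]
    · obtain rfl : τ = _ := h
      obtain rfl : σ = 1 := h'
      simp [Equiv.Perm.sign_swap hpq.ne, unitsC_apply]
  reflection := by
    rintro ⟨σ, τ⟩ (⟨⟨p, q, hpq, h⟩, h'⟩ | ⟨h', ⟨p, q, hpq, h⟩⟩)
    · obtain rfl : σ = _ := h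
      obtain rfl : τ = 1 := h'
      exact ⟨_, mem_sl_evenPos.2 (Or.inl ⟨p, q, hpq, rfl⟩), slAct_swap_inl hpq rfl⟩
    · obtain rfl : τ = _ := h
      obtain rfl : σ = 1 := h'
      exact ⟨_, mem_sl_evenPos.2 (Or.inr ⟨p, q, hpq, rfl⟩), slAct_swap_inr hpq rfl⟩
  exists_reflection α hα := by
    rcases mem_sl_evenPos.1 hα with ⟨p, q, hpq, h⟩ | ⟨p, q, hpq, h⟩
    · exact ⟨_, Or.inl ⟨⟨p, q, hpq, rfl⟩, rfl⟩, slAct_swap_inl hpq h⟩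
    · exact ⟨_, Or.inr ⟨rfl, ⟨p, q, hpq, rfl⟩⟩, slAct_swap_inr hpq h⟩
  nondeg α hα := by
    have hd : (slDatum m n).gram = Matrix.diagonal (Sum.elim (fun _ => 1) (fun _ => -1)) := rfl
    rcases mem_sl_evenPos.1 hα with ⟨p, q, hpq, rfl⟩ | ⟨p, q, hpq, rfl⟩
    · exact fun h => absurd ((form_pair_self (c := Sum.inl p) (c' := Sum.inl q) hd
        (fun h => hpq.ne (Sum.inl_injective h)) (by norm_num) rfl).symm.trans h) (by simp)
    · exact fun h => absurd ((form_pair_self (c := Sum.inr p) (c' := Sum.inr q) hd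
        (fun h => hpq.ne (Sum.inr_injective h)) (by norm_num) rfl).symm.trans h) (by simp)

end Sl

/-! ### The Weyl group of `G(3)` -/

section G3

variable {R : Type} [CommRing R]

/-- The coordinates with respect to `ε₁, ε₂, ε₃`. -/
def g3Triple (v : Fin 3 → R) : Fin 3 → R := ![v 0, v 1, 0]

/-- Permutations of `ε₁, ε₂, ε₃`, their change of sign, and sign changes of `δ`. -/
def g3Act (y : (Equiv.Perm (Fin 3) × ℤˣ) × ℤˣ) (v : Fin 3 → R) : Fin 3 → R :=
  ![((y.1.2 : ℤ) : R) * (g3Triple v (y.1.1⁻¹ 0) - g3Triple v (y.1.1⁻¹ 2)),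
    ((y.1.2 : ℤ) : R) * (g3Triple v (y.1.1⁻¹ 1) - g3Triple v (y.1.1⁻¹ 2)),
    ((y.2 : ℤ) : R) * v 2]

/-- Triples of coefficients of ε₁, ε₂, ε₃ count modulo (1,1,1), because the three vectors have sum
zero. Subtracting the third entry restores the normalization after a permutation. -/
theorem g3Triple_g3Act (y : (Equiv.Perm (Fin 3) × ℤˣ) × ℤˣ) (v : Fin 3 → R) (p : Fin 3) :
    g3Triple (g3Act y v) p =
      ((y.1.2 : ℤ) : R) * (g3Triple v (y.1.1⁻¹ p) - g3Triple v (y.1.1⁻¹ 2)) := by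
  fin_cases p
  · rfl
  · rfl
  · change (0 : R) = ((y.1.2 : ℤ) : R) * (g3Triple v (y.1.1⁻¹ 2) - g3Triple v (y.1.1⁻¹ 2))
    rw [sub_self, mul_zero]

theorem eq_of_fin_three {a b : Fin 3 → R} (h0 : a 0 = b 0) (h1 : a 1 = b 1) (h2 : a 2 = b 2) :
    a = b := by
  funext x
  fin_cases x
  · exact h0
  · exact h1
  · exact h2

theorem g3Act_mul (y y' : (Equiv.Perm (Fin 3) × ℤˣ) × ℤˣ) (v : Fin 3 → R) :
    g3Act (y * y') v = g3Act y (g3Act y' v) := by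
  have h : ∀ p : Fin 3, (((y * y').1.2 : ℤ) : R) * (g3Triple v ((y * y').1.1⁻¹ p) -
      g3Triple v ((y * y').1.1⁻¹ 2)) = ((y.1.2 : ℤ) : R) * (g3Triple (g3Act y' v) (y.1.1⁻¹ p) -
      g3Triple (g3Act y' v) (y.1.1⁻¹ 2)) := by
    intro p
    simp only [g3Triple_g3Act, Prod.fst_mul, Prod.snd_mul, mul_inv_rev, Equiv.Perm.mul_apply,
      Units.val_mul, Int.cast_mul]
    ring
  refine eq_of_fin_three (h 0) (h 1) ?_
  change (((y * y').2 : ℤ) : R) * v 2 = ((y.2 : ℤ) : R) * (((y'.2 : ℤ) : R) * v 2)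
  rw [Prod.snd_mul, Units.val_mul, Int.cast_mul, mul_assoc]

theorem g3Act_one (v : Fin 3 → R) : g3Act 1 v = v := by
  refine eq_of_fin_three ?_ ?_ ?_ <;> simp [g3Act, g3Triple]

theorem g3Triple_add (v w : Fin 3 → R) (p : Fin 3) :
    g3Triple (v + w) p = g3Triple v p + g3Triple w p := by
  fin_cases p <;> simp [g3Triple]

theorem g3Triple_smul (c : R) (v : Fin 3 → R) (p : Fin 3) :
    g3Triple (c • v) p = c * g3Triple v p := by
  fin_cases p <;> simp [g3Triple]

/-- The representation of the Weyl group of `G(3)`. -/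
def g3Rep : (Equiv.Perm (Fin 3) × ℤˣ) × ℤˣ →* Module.End ℂ (Fin 3 → ℂ) where
  toFun y :=
    { toFun := g3Act y
      map_add' := fun v w => by
        refine eq_of_fin_three ?_ ?_ ?_ <;> simp [g3Act, g3Triple_add] <;> ring
      map_smul' := fun c v => by
        refine eq_of_fin_three ?_ ?_ ?_ <;> simp [g3Act, g3Triple_smul] <;> ring }
  map_one' := LinearMap.ext fun v => g3Act_one v
  map_mul' y y' := LinearMap.ext fun v => g3Act_mul y y' v

theorem g3_reflection {v w α : Fin 3 → ℂ} {c k : ℂ}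
    (hc : 2 * v 0 * α 0 - v 0 * α 1 - v 1 * α 0 + 2 * v 1 * α 1 - 2 * v 2 * α 2 = c)
    (hk : 2 * α 0 * α 0 - α 0 * α 1 - α 1 * α 0 + 2 * α 1 * α 1 - 2 * α 2 * α 2 = k)
    (h : ∀ p, w p = v p - 2 * c / k * α p) :
    w = v - (2 * g3Datum.form v α / g3Datum.form α α) • α := by
  have h1 := (g3_form v α).trans hc
  have h2 := (g3_form α α).trans hk
  funext p
  refine (h p).trans ?_
  change _ = v p - (2 * g3Datum.form v α / g3Datum.form α α) * α p
  exact congrArg₂ (fun a b => v p - 2 * a / b * α p) h1.symm h2.symm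

/-- The root of the reflection that permutes two of `ε₁, ε₂, ε₃`, up to sign. -/
def g3Root (p q : Fin 3) (e : ℤˣ) : Fin 3 → ℂ :=
  if e = 1 then (if q = 1 then ![-1, 1, 0] else if p = 0 then ![2, 1, 0] else ![1, 2, 0])
  else (if q = 1 then ![1, 1, 0] else if p = 0 then ![0, 1, 0] else ![1, 0, 0])

theorem mem_g3_evenPos {α : Fin 3 → ℂ} : α ∈ g3Datum.evenPos ↔
    (∃ p q : Fin 3, p < q ∧ ∃ e, α = g3Root p q e) ∨ α = ![0, 0, 2] := by
  refine Finset.mem_insert.trans ?_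
  simp only [Finset.mem_insert, Finset.mem_singleton]
  constructor
  · rintro (rfl | rfl | rfl | rfl | rfl | rfl | rfl)
    · exact Or.inl ⟨1, 2, by simp, -1, by simp [g3Root]⟩
    · exact Or.inl ⟨0, 2, by simp, -1, by simp [g3Root]⟩
    · exact Or.inl ⟨0, 1, by simp, -1, by simp [g3Root]⟩
    · exact Or.inl ⟨0, 1, by simp, 1, by simp [g3Root]⟩
    · exact Or.inl ⟨0, 2, by simp, 1, by simp [g3Root]⟩
    · exact Or.inl ⟨1, 2, by simp, 1, by simp [g3Root]⟩
    · exact Or.inr rfl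
  · rintro (⟨p, q, hpq, e, rfl⟩ | rfl)
    · rcases Int.units_eq_one_or e with rfl | rfl <;> fin_cases p <;> fin_cases q <;>
        simp at hpq <;> simp [g3Root]
    · simp

theorem swap_fin_three {p q : Fin 3} (h : p < q) :
    (p = 0 ∧ q = 1) ∨ (p = 0 ∧ q = 2) ∨ (p = 1 ∧ q = 2) := by omega

theorem g3Act_swap {p q : Fin 3} (hpq : p < q) (e : ℤˣ) {α : Fin 3 → ℂ} (hα : α = g3Root p q e)
    (v : Fin 3 → ℂ) : g3Act ((Equiv.swap p q, e), 1) v =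
      v - (2 * g3Datum.form v α / g3Datum.form α α) • α := by
  subst hα
  have s1 : Equiv.swap (0 : Fin 3) 1 2 = 2 := by decide
  have s2 : Equiv.swap (0 : Fin 3) 2 1 = 1 := by decide
  have s3 : Equiv.swap (1 : Fin 3) 2 0 = 0 := by decide
  rcases swap_fin_three hpq with ⟨rfl, rfl⟩ | ⟨rfl, rfl⟩ | ⟨rfl, rfl⟩ <;>
  rcases Int.units_eq_one_or e with rfl | rfl <;>
  refine g3_reflection rfl rfl fun p => ?_ <;>
  fin_cases p <;> simp [g3Act, g3Root, g3Triple, s1, s2, s3] <;> ring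

theorem g3Act_neg {α : Fin 3 → ℂ} (hα : α = ![0, 0, 2]) (v : Fin 3 → ℂ) :
    g3Act (1, -1) v = v - (2 * g3Datum.form v α / g3Datum.form α α) • α := by
  subst hα
  refine g3_reflection rfl rfl fun p => ?_
  fin_cases p <;> simp [g3Act, g3Triple] <;> ring

/-- Transpositions with sign +1 generate the permutations. One transposition with either sign then
provides the sign change. -/
theorem g3_closure : Subgroup.closure {y : Equiv.Perm (Fin 3) × ℤˣ |
    ∃ p q, p < q ∧ y.1 = Equiv.swap p q} = ⊤ := by
  rw [eq_top_iff]
  have h1 : ∀ σ : Equiv.Perm (Fin 3), (σ, (1 : ℤˣ)) ∈ Subgroup.closure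
      {y : Equiv.Perm (Fin 3) × ℤˣ | ∃ p q, p < q ∧ y.1 = Equiv.swap p q} := by
    have h2 : Subgroup.closure (swaps 3) ≤
        (Subgroup.closure {y : Equiv.Perm (Fin 3) × ℤˣ |
          ∃ p q, p < q ∧ y.1 = Equiv.swap p q}).comap (MonoidHom.inl _ _) := by
      rw [Subgroup.closure_le]
      exact fun σ hσ => Subgroup.subset_closure hσ
    exact fun σ => h2 (closure_swaps 3 ▸ Subgroup.mem_top σ)
  rintro ⟨σ, e⟩ -
  have h2 : ((Equiv.swap 0 1 : Equiv.Perm (Fin 3)), e) ∈ Subgroup.closure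
      {y : Equiv.Perm (Fin 3) × ℤˣ | ∃ p q, p < q ∧ y.1 = Equiv.swap p q} :=
    Subgroup.subset_closure ⟨0, 1, by simp, rfl⟩
  have h3 := mul_mem h2 (h1 ((Equiv.swap 0 1)⁻¹ * σ))
  rwa [Prod.mk_mul_mk, mul_inv_cancel_left, mul_one] at h3

theorem g3Act_cast (y : (Equiv.Perm (Fin 3) × ℤˣ) × ℤˣ) (z : Fin 3 → ℤ) :
    g3Act y (fun c => (z c : ℂ) / 1) = fun c => ((g3Act y z c : ℤ) : ℂ) / 1 := by
  have h : ∀ p, g3Triple (fun c => (z c : ℂ) / 1) p = ((g3Triple z p : ℤ) : ℂ) := by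
    intro p
    fin_cases p <;> simp [g3Triple]
  refine eq_of_fin_three ?_ ?_ ?_ <;> simp only [g3Act, h] <;> simp

theorem g3_eq_of_act {y y' : (Equiv.Perm (Fin 3) × ℤˣ) × ℤˣ}
    (h : g3Act y (![2, 3, 1] : Fin 3 → ℂ) = g3Act y' ![2, 3, 1]) : y = y' := by
  obtain ⟨⟨σ, e⟩, d⟩ := y
  obtain ⟨⟨σ', e'⟩, d'⟩ := y'
  have hd : d = d' := by
    have h1 : ((d : ℤ) : ℂ) * 1 = ((d' : ℤ) : ℂ) * 1 := congrFun h 2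
    rw [mul_one, mul_one] at h1
    exact Units.ext (by exact_mod_cast h1)
  set t : Fin 3 → ℂ := g3Triple ![2, 3, 1] with ht
  have h1 : ∀ p, ((e : ℤ) : ℂ) * (t (σ⁻¹ p) - t (σ⁻¹ 2)) =
      ((e' : ℤ) : ℂ) * (t (σ'⁻¹ p) - t (σ'⁻¹ 2)) := fun p => by
    have := congrArg (fun v => g3Triple v p) h
    simpa only [g3Triple_g3Act] using this
  have h2 : ∀ τ : Equiv.Perm (Fin 3), t (τ⁻¹ 0) + t (τ⁻¹ 1) + t (τ⁻¹ 2) = 5 := by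
    intro τ
    rw [← Fin.sum_univ_three (fun p => t (τ⁻¹ p)), Equiv.sum_comp τ⁻¹ t, Fin.sum_univ_three, ht]
    simp [g3Triple]
    norm_num
  -- Replacing t by 3t - 5 removes the ambiguity modulo (1,1,1), since the entries of t have sum 5.
  -- The values become 1, 4, -5: distinct, and no two of them opposite, so that the sign and the
  -- permutation can both be read off.
  have h3 : ∀ p, ((e : ℤ) : ℂ) * (3 * t (σ⁻¹ p) - 5) = ((e' : ℤ) : ℂ) * (3 * t (σ'⁻¹ p) - 5) := by
    intro p
    linear_combination 3 * h1 p - h1 0 - h1 1 + (e : ℂ) * h2 σ - (e' : ℂ) * h2 σ'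
  have h4 : ∀ a b : Fin 3, ((e : ℤ) : ℂ) * (3 * t a - 5) = ((e' : ℤ) : ℂ) * (3 * t b - 5) →
      a = b ∧ e = e' := by
    intro a b hab
    rcases Int.units_eq_one_or e with rfl | rfl <;> rcases Int.units_eq_one_or e' with rfl | rfl <;>
      fin_cases a <;> fin_cases b <;> simp [ht, g3Triple] at hab ⊢ <;> norm_num at hab
  obtain rfl : e = e' := (h4 _ _ (h3 0)).2
  obtain rfl : σ = σ' := inv_injective (Equiv.ext fun p => (h4 _ _ (h3 p)).1)
  rw [hd]

/-- The Weyl group of `G(3)`. -/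
def g3Model : WeylModel g3Datum 1 ((Equiv.Perm (Fin 3) × ℤˣ) × ℤˣ) where
  act := g3Rep
  actZ := g3Act
  act_lat y z := g3Act_cast y z
  inj y y' h := by
    have h1 : g3Act y (![2, 3, 1] : Fin 3 → ℂ) = g3Act y' ![2, 3, 1] := DFunLike.congr_fun h _
    exact g3_eq_of_act h1
  sign := unitsC.comp ((Equiv.Perm.sign.comp ((MonoidHom.fst _ _).comp (MonoidHom.fst _ _))) *
    (MonoidHom.snd _ _))
  R := {y | (y.1 ∈ {y : Equiv.Perm (Fin 3) × ℤˣ | ∃ p q, p < q ∧ y.1 = Equiv.swap p q} ∧ y.2 = 1) ∨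
    (y.1 = 1 ∧ y.2 ∈ ({-1} : Set ℤˣ))}
  closure_R := closure_prod_eq_top g3_closure closure_neg_one
  sign_R := by
    rintro ⟨⟨σ, e'⟩, e⟩ (⟨⟨p, q, hpq, h⟩, he⟩ | ⟨hy, he⟩)
    · obtain rfl : e = 1 := he
      obtain rfl : σ = _ := h
      simp [Equiv.Perm.sign_swap hpq.ne, unitsC_apply]
    · obtain ⟨rfl, rfl⟩ : σ = 1 ∧ e' = 1 := Prod.ext_iff.1 hy
      obtain rfl : e = -1 := he
      simp [unitsC_apply]
  reflection := by
    rintro ⟨⟨σ, e'⟩, e⟩ (⟨⟨p, q, hpq, h⟩, he⟩ | ⟨hy, he⟩)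
    · obtain rfl : e = 1 := he
      obtain rfl : σ = _ := h
      exact ⟨_, mem_g3_evenPos.2 (Or.inl ⟨p, q, hpq, e', rfl⟩), g3Act_swap hpq e' rfl⟩
    · obtain ⟨rfl, rfl⟩ : σ = 1 ∧ e' = 1 := Prod.ext_iff.1 hy
      obtain rfl : e = -1 := he
      exact ⟨_, mem_g3_evenPos.2 (Or.inr rfl), g3Act_neg rfl⟩
  exists_reflection α hα := by
    rcases mem_g3_evenPos.1 hα with ⟨p, q, hpq, e, h⟩ | h
    · exact ⟨((Equiv.swap p q, e), 1), Or.inl ⟨⟨p, q, hpq, rfl⟩, rfl⟩, g3Act_swap hpq e h⟩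
    · exact ⟨(1, -1), Or.inr ⟨rfl, rfl⟩, g3Act_neg h⟩
  nondeg α hα := by
    rcases mem_g3_evenPos.1 hα with ⟨p, q, hpq, e, rfl⟩ | rfl
    · refine fun h => absurd ((g3_form _ _).symm.trans h) ?_
      rcases swap_fin_three hpq with ⟨rfl, rfl⟩ | ⟨rfl, rfl⟩ | ⟨rfl, rfl⟩ <;>
      rcases Int.units_eq_one_or e with rfl | rfl <;> simp [g3Root] <;> norm_num
    · exact fun h => absurd ((g3_form _ _).symm.trans h) (by simp)

end G3

end SuperFactor
end

/-! ### Strict dominance of λ + ρ -/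

noncomputable section
open scoped Classical
namespace SuperFactor

namespace RootDatum

variable {D : RootDatum}

/-! ### The Weyl vector -/

/-- The reflection in α permutes the other positive even roots and the positive odd roots, so it
sends ρ to ρ - α. The form `f` is there to exclude that -α is a positive root. -/
theorem two_form_rho {α : D.Vec} (hα : α ∈ D.evenPos) (hne : D.form α α ≠ 0)
    (f : D.Vec →ₗ[ℂ] ℂ) (hf : ∀ β ∈ D.evenPos, 0 < (f β).re) (s : Module.End ℂ D.Vec)
    (hs : ∀ v, s v = v - (2 * D.form v α / D.form α α) • α)
    (he : ∀ β ∈ D.evenPos, β ≠ α → s β ∈ D.evenPos) (ho : ∀ β ∈ D.oddPos, s β ∈ D.oddPos) :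
    2 * D.form D.rho α = D.form α α := by
  have hsα : s α = -α := by
    rw [hs, mul_div_assoc, div_self hne, mul_one, two_smul]; abel
  have hss : ∀ v, s (s v) = v := fun v => by
    have h1 := hs v
    rw [h1, map_sub, map_smul, hsα, h1]
    simp
  have hα0 : α ≠ 0 := fun h => by
    have := hf α hα
    simp [h] at this
  have h1 : ∑ β ∈ D.evenPos.erase α, s β = ∑ β ∈ D.evenPos.erase α, β := by
    have hmem : ∀ β ∈ D.evenPos.erase α, s β ∈ D.evenPos.erase α := by
      intro β hβ
      rw [Finset.mem_erase] at hβ ⊢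
      refine ⟨fun h => ?_, he β hβ.2 hβ.1⟩
      have h2 : β = -α := by rw [← hss β, h, hsα]
      have h3 := hf β hβ.2
      rw [h2, map_neg, Complex.neg_re] at h3
      linarith [hf α hα]
    exact Finset.sum_nbij' s s hmem hmem (fun β _ => hss β) (fun β _ => hss β) fun β _ => rfl
  have h2 : ∑ β ∈ D.oddPos, s β = ∑ β ∈ D.oddPos, β :=
    Finset.sum_nbij' s s ho ho (fun β _ => hss β) (fun β _ => hss β) fun β _ => rfl
  have h3 : s D.rho = D.rho - α := by
    rw [rho, map_sub, map_smul, map_smul, map_sum, map_sum, h2, ← Finset.add_sum_erase _ _ hα,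
      ← Finset.add_sum_erase _ _ hα, h1, hsα]
    module
  rw [hs] at h3
  have h4 : (2 * D.form D.rho α / D.form α α - 1) • α = 0 := by
    rw [sub_smul, one_smul, sub_eq_zero]
    exact sub_right_injective h3
  have h5 := (smul_eq_zero.1 h4).resolve_right hα0
  field_simp at h5
  linear_combination h5

/-- The shift by ρ adds 1 to the Dynkin label of an even simple root, which makes it strictly
positive. -/
theorem DominantIntegral.exists_pos {lam : D.Vec} (h : D.DominantIntegral lam) {i : D.ι}
    (hi : D.parity i = 0) (hne : D.form (D.simple i) (D.simple i) ≠ 0)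
    (hρ : 2 * D.form D.rho (D.simple i) = D.form (D.simple i) (D.simple i)) :
    ∃ n : ℤ, 0 < n ∧
      2 * D.form (lam + D.rho) (D.simple i) = n * D.form (D.simple i) (D.simple i) := by
  obtain ⟨n, hn⟩ := h.exists_nat hi hne
  refine ⟨n + 1, by positivity, ?_⟩
  rw [form_add_left]
  push_cast
  linear_combination hn + hρ

end RootDatum

/-! ### Alternants of the hyperoctahedral group -/

/-- For a fixed permutation the sum over the signs is a product of factors x^b - x^{-b}; the
remaining sum is the Leibniz formula. -/
theorem sum_SPerm {K : Type} [Field K] {N : ℕ} (φ : ℂ →+* K) (x : Fin N → K) (b : Fin N → ℤ) :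
    ∑ y : SPerm N, φ (SPerm.signC N y) * ∏ p, x p ^ SPerm.act y b p = altB x b := by
  have h1 : ∑ y : SPerm N, φ (SPerm.signC N y) * ∏ p, x p ^ SPerm.act y b p =
      ∑ s : Fin N → ℤˣ, ∑ π : Equiv.Perm (Fin N), ((Equiv.Perm.sign π : ℤ) : K) *
        ∏ p, ((s p : ℤ) : K) * x p ^ ((s p : ℤ) * b (π⁻¹ p)) := by
    rw [← Fintype.sum_prod_type']
    refine Finset.sum_congr rfl fun y _ => ?_
    rw [SPerm.signC_apply, map_intCast, SPerm.sign]
    simp only [MonoidHom.coe_mk, OneHom.coe_mk, Units.val_mul, Units.coe_prod, Int.cast_mul,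
      Int.cast_prod, Finset.prod_mul_distrib, SPerm.act, Int.cast_id]
    ring
  rw [h1, Finset.sum_comm, altB, Matrix.det_apply']
  refine Finset.sum_congr rfl fun π _ => ?_
  rw [← Finset.mul_sum, ← Equiv.prod_comp π⁻¹]
  congr 1
  have h2 : ∀ p, (Matrix.of (fun p q => x p ^ b q - x p ^ (-b q))) (π (π⁻¹ p)) (π⁻¹ p) =
      ∑ e : ℤˣ, ((e : ℤ) : K) * x p ^ ((e : ℤ) * b (π⁻¹ p)) := by
    intro p
    rw [UnitsInt.univ, Finset.sum_pair (by decide)]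
    simp [sub_eq_add_neg]
  simp only [h2]
  rw [Finset.prod_univ_sum, Fintype.piFinset_univ]

end SuperFactor
end

/-! ### Unique factorization for the series osp -/

noncomputable section
open scoped Classical
namespace SuperFactor

open RootDatum

/-! ### `𝔬𝔰𝔭(2,2n)` -/

section Osp

variable {n : ℕ}

theorem mem_osp_oddPos (hn : 0 < n) {α : Unit ⊕ Fin n → ℂ} :
    α ∈ (ospDatum n hn).oddPos ↔ ∃ p, α = Pi.single (Sum.inl ()) 1 + (-1 : ℂ) • Pi.single (Sum.inr p) 1 ∨
        α = Pi.single (Sum.inl ()) 1 + (1 : ℂ) • Pi.single (Sum.inr p) 1 := by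
  refine Finset.mem_union.trans ?_
  simp only [Finset.mem_image, Finset.mem_univ, true_and, neg_one_smul, one_smul,
    ← sub_eq_add_neg, ospDel, ospEps, ← exists_or, eq_comm]

theorem ospRep_inl (y : SPerm n) :
    ospRep n y (Pi.single (Sum.inl ()) 1) = Pi.single (Sum.inl ()) 1 := by
  funext x
  rcases x with x | x
  · rfl
  · change SPerm.act y (fun p => (Pi.single (Sum.inl ()) 1 : Unit ⊕ Fin n → ℂ) (Sum.inr p)) x = _
    simp [SPerm.act]

theorem ospRep_swp (p q r : Fin n) : ospRep n (SPerm.swp p q) (Pi.single (Sum.inr r) 1) =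
    Pi.single (Sum.inr (Equiv.swap p q r)) 1 := by
  funext x
  rcases x with x | x
  · change (Pi.single (Sum.inr r) 1 : Unit ⊕ Fin n → ℂ) (Sum.inl ()) = _
    simp
  · change SPerm.act (SPerm.swp p q) (fun p => (Pi.single (Sum.inr r) 1 : Unit ⊕ Fin n → ℂ) (Sum.inr p)) x = _
    simp only [SPerm.act, SPerm.swp, Equiv.swap_inv, Pi.single_apply, Sum.inr.injEq]
    simp [Equiv.swap_apply_eq_iff]

theorem ospRep_flip (p r : Fin n) : ospRep n (SPerm.flip p) (Pi.single (Sum.inr r) 1) =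
    (if r = p then (-1 : ℂ) else 1) • Pi.single (Sum.inr r) 1 := by
  funext x
  rcases x with x | x
  · change (Pi.single (Sum.inr r) 1 : Unit ⊕ Fin n → ℂ) (Sum.inl ()) = _
    simp
  · refine (SPerm.act_flip p (fun p => (Pi.single (Sum.inr r) 1 : Unit ⊕ Fin n → ℂ) (Sum.inr p)) x).trans ?_
    by_cases h : r = p
    · subst h
      by_cases hx : x = r
      · subst hx; simp
      · simp [hx]
    · by_cases hx : x = p
      · subst hx; simp [h, Ne.symm h]
      · simp [hx, h]

/-- A linear form that is positive on the positive even roots. -/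
def ospHeight (n : ℕ) : (Unit ⊕ Fin n → ℂ) →ₗ[ℂ] ℂ :=
  ∑ p : Fin n, ((n : ℂ) - (p : ℕ)) • LinearMap.proj (Sum.inr p)

theorem ospHeight_single (r : Fin n) :
    ospHeight n (Pi.single (Sum.inr r) 1) = ((n : ℝ) - (r : ℕ) : ℝ) := by
  simp [ospHeight, Pi.single_apply, LinearMap.sum_apply]

theorem ospHeight_pos (hn : 0 < n) (β : (ospDatum n hn).Vec) (hβ : β ∈ (ospDatum n hn).evenPos) :
    0 < (ospHeight n β).re := by
  have h0 : ∀ p : Fin n, (p : ℝ) < n := fun p => by exact_mod_cast p.2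
  rcases (mem_osp_evenPos hn).1 hβ with ⟨p, rfl⟩ | ⟨p, q, hpq, rfl | rfl⟩
  · rw [map_smul, ospHeight_single]
    simpa using h0 p
  · rw [map_add, map_smul, ospHeight_single, ospHeight_single]
    simpa using hpq
  · rw [map_add, map_smul, ospHeight_single, ospHeight_single]
    simp
    linarith [h0 p, h0 q]

theorem osp_gram (hn : 0 < n) :
    (ospDatum n hn).gram = Matrix.diagonal (Sum.elim (fun _ => 1) (fun _ => -1)) := rfl

/-- A transposition of neighbours preserves the order of every pair of indices except the pair
itself. -/
theorem osp_two_form_rho_swp (hn : 0 < n) {p q : Fin n} (hpq : (q : ℕ) = p + 1)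
    {α : (ospDatum n hn).Vec} (hα : α = Pi.single (Sum.inr p) 1 + (-1 : ℂ) • Pi.single (Sum.inr q) 1) :
    2 * (ospDatum n hn).form (ospDatum n hn).rho α = (ospDatum n hn).form α α := by
  have hlt : p < q := by rw [Fin.lt_def]; omega
  have hm := (mem_osp_evenPos hn (α := α)).2 (Or.inr ⟨p, q, hlt, Or.inl hα⟩)
  refine two_form_rho hm ((ospModel n hn).nondeg α hm) (ospHeight n) (ospHeight_pos hn)
    (ospRep n (SPerm.swp p q)) (ospAct_swp hn hlt hα) ?_ ?_
  · intro β hβ hne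
    refine (mem_osp_evenPos hn).2 ?_
    rcases (mem_osp_evenPos hn).1 hβ with ⟨a, rfl⟩ | ⟨a, b, hab, rfl | rfl⟩
    · exact Or.inl ⟨_, (map_smul _ _ _).trans (congrArg _ (ospRep_swp p q a))⟩
    · refine Or.inr ⟨_, _, ?_, Or.inl <| (map_add _ _ _).trans (congrArg₂ _ (ospRep_swp p q a)
        ((map_smul _ _ _).trans (congrArg _ (ospRep_swp p q b))))⟩
      have h1 : ¬ (a = p ∧ b = q) := by
        rintro ⟨rfl, rfl⟩
        exact hne hα.symm
      simp only [Equiv.swap_apply_def, Fin.ext_iff, Fin.lt_def] at h1 hab ⊢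
      split_ifs <;> omega
    · have h2 := (map_add (ospRep n (SPerm.swp p q)) _ _).trans (congrArg₂ _ (ospRep_swp p q a)
        ((map_smul _ (1 : ℂ) _).trans (congrArg _ (ospRep_swp p q b))))
      rcases lt_or_gt_of_ne ((Equiv.swap p q).injective.ne hab.ne) with h | h
      · exact Or.inr ⟨_, _, h, Or.inr h2⟩
      · refine Or.inr ⟨_, _, h, Or.inr (h2.trans ?_)⟩
        rw [one_smul, one_smul, add_comm]
  · intro β hβ
    refine (mem_osp_oddPos hn).2 ?_
    rcases (mem_osp_oddPos hn).1 hβ with ⟨a, rfl | rfl⟩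
    · exact ⟨_, Or.inl <| (map_add _ _ _).trans (congrArg₂ _ (ospRep_inl _)
        ((map_smul _ _ _).trans (congrArg _ (ospRep_swp p q a))))⟩
    · exact ⟨_, Or.inr <| (map_add _ _ _).trans (congrArg₂ _ (ospRep_inl _)
        ((map_smul _ _ _).trans (congrArg _ (ospRep_swp p q a))))⟩

theorem osp_two_form_rho_flip (hn : 0 < n) {p : Fin n} (hp : (p : ℕ) + 1 = n)
    {α : (ospDatum n hn).Vec} (hα : α = (2 : ℂ) • Pi.single (Sum.inr p) 1) :
    2 * (ospDatum n hn).form (ospDatum n hn).rho α = (ospDatum n hn).form α α := by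
  have hm := (mem_osp_evenPos hn (α := α)).2 (Or.inl ⟨p, hα⟩)
  have hlast : ∀ a b : Fin n, a < b → a ≠ p := by
    rintro a b hab rfl
    rw [Fin.lt_def] at hab
    omega
  refine two_form_rho hm ((ospModel n hn).nondeg α hm) (ospHeight n) (ospHeight_pos hn)
    (ospRep n (SPerm.flip p)) (ospAct_flip hn p hα) ?_ ?_
  · intro β hβ hne
    refine (mem_osp_evenPos hn).2 ?_
    rcases (mem_osp_evenPos hn).1 hβ with ⟨a, rfl⟩ | ⟨a, b, hab, rfl | rfl⟩
    · refine Or.inl ⟨a, (map_smul _ _ _).trans (congrArg _ ((ospRep_flip p a).trans ?_))⟩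
      rw [if_neg, one_smul]
      rintro rfl
      exact hne hα.symm
    · have h2 := (map_add (ospRep n (SPerm.flip p)) _ _).trans (congrArg₂ _ (ospRep_flip p a)
        ((map_smul _ (-1 : ℂ) _).trans (congrArg _ (ospRep_flip p b))))
      rw [if_neg (hlast a b hab), one_smul] at h2
      refine Or.inr ⟨a, b, hab, ?_⟩
      by_cases hb : b = p
      · refine Or.inr (h2.trans ?_)
        rw [if_pos hb, smul_smul, neg_one_mul, neg_neg]
      · refine Or.inl (h2.trans ?_)
        rw [if_neg hb, one_smul]
    · have h2 := (map_add (ospRep n (SPerm.flip p)) _ _).trans (congrArg₂ _ (ospRep_flip p a)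
        ((map_smul _ (1 : ℂ) _).trans (congrArg _ (ospRep_flip p b))))
      rw [if_neg (hlast a b hab), one_smul ℂ (Pi.single (Sum.inr a) 1)] at h2
      refine Or.inr ⟨a, b, hab, ?_⟩
      by_cases hb : b = p
      · refine Or.inl (h2.trans ?_)
        rw [if_pos hb, one_smul]
      · refine Or.inr (h2.trans ?_)
        rw [if_neg hb, one_smul]
  · intro β hβ
    refine (mem_osp_oddPos hn).2 ?_
    rcases (mem_osp_oddPos hn).1 hβ with ⟨a, rfl | rfl⟩
    · have h2 := (map_add (ospRep n (SPerm.flip p)) _ _).trans (congrArg₂ _ (ospRep_inl _)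
        ((map_smul _ (-1 : ℂ) _).trans (congrArg _ (ospRep_flip p a))))
      refine ⟨a, ?_⟩
      by_cases hb : a = p
      · refine Or.inr (h2.trans ?_)
        rw [if_pos hb, smul_smul, neg_one_mul, neg_neg]
      · refine Or.inl (h2.trans ?_)
        rw [if_neg hb, one_smul]
    · have h2 := (map_add (ospRep n (SPerm.flip p)) _ _).trans (congrArg₂ _ (ospRep_inl _)
        ((map_smul _ (1 : ℂ) _).trans (congrArg _ (ospRep_flip p a))))
      refine ⟨a, ?_⟩
      by_cases hb : a = p
      · refine Or.inl (h2.trans ?_)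
        rw [if_pos hb, one_smul]
      · refine Or.inr (h2.trans ?_)
        rw [if_neg hb, one_smul]

theorem osp_simple_castSucc {N : ℕ} (j : Fin N) :
    (ospDatum (N + 1) N.succ_pos).simple (Sum.inr j.castSucc) =
      (Pi.single (Sum.inr j.castSucc) 1 + (-1 : ℂ) • Pi.single (Sum.inr j.succ) 1 :
        Unit ⊕ Fin (N + 1) → ℂ) := by
  have h : (if hj : j.castSucc.val + 1 < N + 1 then ospDel (N + 1) j.castSucc -
        ospDel (N + 1) ⟨j.castSucc.val + 1, hj⟩ else (2 : ℂ) • ospDel (N + 1) j.castSucc) =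
      Pi.single (Sum.inr j.castSucc) 1 + (-1 : ℂ) • Pi.single (Sum.inr j.succ) 1 := by
    rw [dif_pos (by simp), neg_one_smul]
    exact sub_eq_add_neg _ _
  exact h

theorem osp_simple_last (N : ℕ) :
    (ospDatum (N + 1) N.succ_pos).simple (Sum.inr (Fin.last N)) =
      ((2 : ℂ) • Pi.single (Sum.inr (Fin.last N)) 1 : Unit ⊕ Fin (N + 1) → ℂ) := by
  have h : (if hj : (Fin.last N).val + 1 < N + 1 then ospDel (N + 1) (Fin.last N) -
        ospDel (N + 1) ⟨(Fin.last N).val + 1, hj⟩ else (2 : ℂ) • ospDel (N + 1) (Fin.last N)) =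
      (2 : ℂ) • Pi.single (Sum.inr (Fin.last N)) 1 := by
    rw [dif_neg (by simp)]
    rfl
  exact h

/-- The coordinates of a dominant integral weight. -/
theorem osp_exists_decPos {N : ℕ} {lam : (ospDatum (N + 1) N.succ_pos).Vec}
    (h : (ospDatum (N + 1) N.succ_pos).DominantIntegral lam) :
    ∃ b : Fin (N + 1) → ℤ, DecPos b ∧
      ∀ p, (lam + (ospDatum (N + 1) N.succ_pos).rho) (Sum.inr p) = b p := by
  set v := lam + (ospDatum (N + 1) N.succ_pos).rho with hv
  have h1 : ∀ j : Fin N, ∃ k : ℤ, 0 < k ∧ v (Sum.inr j.castSucc) - v (Sum.inr j.succ) = k := by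
    intro j
    have hs := osp_simple_castSucc j
    have hne := form_pair_self (osp_gram N.succ_pos) (k := -1) (c := Sum.inr j.castSucc)
      (c' := Sum.inr j.succ) (fun h => (Fin.castSucc_lt_succ (i := j)).ne (Sum.inr_injective h))
      (by norm_num) rfl
    obtain ⟨k, hk, h2⟩ := h.exists_pos (i := Sum.inr j.castSucc) rfl (by
      rw [hs]; exact fun h0 => absurd (hne.symm.trans h0) (by simp))
      (osp_two_form_rho_swp N.succ_pos (p := j.castSucc) (q := j.succ) (by simp) hs)
    refine ⟨k, hk, ?_⟩
    have h3 := form_pair (osp_gram N.succ_pos) v (-1) (Sum.inr j.castSucc) (Sum.inr j.succ)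
    rw [hs, ← hv] at h2
    have h4 := (congrArg (2 * ·) h3).symm.trans (h2.trans (congrArg ((k : ℂ) * ·) hne))
    simp only [Sum.elim_inr] at h4
    linear_combination -(1 / 2) * h4
  have h2 : ∃ k : ℤ, 0 < k ∧ v (Sum.inr (Fin.last N)) = k := by
    have hs := osp_simple_last N
    have hne := form_single_self (osp_gram N.succ_pos) (k := 2) (Sum.inr (Fin.last N))
    obtain ⟨k, hk, h2⟩ := h.exists_pos (i := Sum.inr (Fin.last N)) rfl (by
      rw [hs]; exact fun h0 => absurd (hne.symm.trans h0) (by simp))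
      (osp_two_form_rho_flip N.succ_pos (p := Fin.last N) (by simp) hs)
    refine ⟨k, hk, ?_⟩
    have h3 := form_smul_single (osp_gram N.succ_pos) v 2 (Sum.inr (Fin.last N))
    rw [hs, ← hv] at h2
    have h4 := (congrArg (2 * ·) h3).symm.trans (h2.trans (congrArg ((k : ℂ) * ·) hne))
    simp only [Sum.elim_inr] at h4
    linear_combination -(1 / 4) * h4
  have h3 : ∀ p, ∃ k : ℤ, 0 < k ∧ v (Sum.inr p) = k := by
    intro p
    induction p using Fin.reverseInduction with
    | last => exact h2
    | cast j ih =>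
      obtain ⟨k, hk, e⟩ := ih
      obtain ⟨k', hk', e'⟩ := h1 j
      exact ⟨k + k', by omega, by push_cast; linear_combination e + e'⟩
  choose b hb hb' using h3
  refine ⟨b, ⟨Fin.strictAnti_iff_succ_lt.2 fun j => ?_, hb⟩, hb'⟩
  obtain ⟨k, hk, e⟩ := h1 j
  rw [hb', hb'] at e
  have e' : b j.castSucc - b j.succ = k := by exact_mod_cast e
  omega

/-- The Laurent expansion in `e^{-ε_1}`. -/
def ospVar {K : Type} [Field K] (x : Fin n → K) : Unit ⊕ Fin n → LaurentSeries K :=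
  Sum.elim (fun _ => HahnSeries.single (-1) 1) fun p => HahnSeries.C (x p)

theorem ospVar_ne_zero {K : Type} [Field K] {x : Fin n → K} (hx : ∀ p, x p ≠ 0)
    (c : Unit ⊕ Fin n) : ospVar x c ≠ 0 := by
  rcases c with c | c
  · exact HahnSeries.single_ne_zero one_ne_zero
  · exact (map_ne_zero_iff _ HahnSeries.C_injective).2 (hx c)

theorem mon_ospVar {K : Type} [Field K] (x : Fin n → K) (z : Unit ⊕ Fin n → ℤ) :
    mon (ospVar x) z =
      HahnSeries.single (-z (Sum.inl ())) (∏ p, x p ^ z (Sum.inr p)) := by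
  rw [mon, Fintype.prod_sum_type, Fintype.prod_unique]
  simp only [ospVar, Sum.elim_inl, Sum.elim_inr, ← map_zpow₀, ← map_prod]
  rw [single_zpow, one_zpow, HahnSeries.C_apply, HahnSeries.single_mul_single, one_mul]
  simp

theorem normB_eq_sum {K : Type} [Field K] (φ : ℂ →+* K) {x : Fin n → K} (hx : ∀ p, x p ≠ 0)
    (b : Fin n → ℤ) :
    ∑ y : SPerm n, φ (SPerm.signC n y) * ∏ p, x p ^ (SPerm.act y b p - b p) = normB x b := by
  rw [normB, ← sum_SPerm φ x b, Finset.sum_mul]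
  refine Finset.sum_congr rfl fun y _ => ?_
  rw [mul_assoc, ← Finset.prod_mul_distrib]
  congr 1
  exact Finset.prod_congr rfl fun p _ => by rw [sub_eq_add_neg, zpow_add₀ (hx p)]

/-- The Weyl group fixes ε₁, so e^{w(λ+ρ)-(λ+ρ)} does not involve T, while e^{-wγ} is T times a
unit. Every denominator is 1 + O(T), and the leading coefficient is the alternating sum of the
numerators. -/
theorem osp_exists_lead (hn : 0 < n) {K : Type} [Field K] (φ : ℂ →+* K) {x : Fin n → K}
    (hx : ∀ p, x p ≠ 0) {γ lam : (ospDatum n hn).Vec} (hγ : γ ∈ (ospDatum n hn).oddPos)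
    {b : Fin n → ℤ} (hb : ∀ p, (lam + (ospDatum n hn).rho) (Sum.inr p) = b p) :
    ∃ u, Specializes ((ospDatum n hn).latHom 1)
      (evalMon (HahnSeries.C.comp φ) (ospVar x) (ospVar_ne_zero hx))
      ((ospDatum n hn).ordinaryNumerator γ lam) u ∧ Lead u 0 (normB x b) := by
  have hg : ∃ g : Unit ⊕ Fin n → ℤ, g (Sum.inl ()) = 1 ∧ γ = (ospDatum n hn).latEmb 1 g := by
    have h1 : ∃ e : ℤ, ∃ p, γ = (Pi.single (Sum.inl ()) 1 + (e : ℂ) • Pi.single (Sum.inr p) 1 :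
        Unit ⊕ Fin n → ℂ) := by
      obtain ⟨p, hp | hp⟩ := (mem_osp_oddPos hn).1 hγ
      · exact ⟨-1, p, hp.trans (by rw [Int.cast_neg, Int.cast_one])⟩
      · exact ⟨1, p, hp.trans (by rw [Int.cast_one])⟩
    obtain ⟨e, p, rfl⟩ := h1
    refine ⟨Pi.single (Sum.inl ()) 1 + e • Pi.single (Sum.inr p) 1, by simp, ?_⟩
    have h2 : ∀ c, (Pi.single (Sum.inl ()) 1 + (e : ℂ) • Pi.single (Sum.inr p) 1 :
        Unit ⊕ Fin n → ℂ) c = (((Pi.single (Sum.inl ()) 1 + e • Pi.single (Sum.inr p) 1 :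
          Unit ⊕ Fin n → ℤ) c : ℤ) : ℂ) / 1 := by
      intro c
      simp [Pi.single_apply, apply_ite (Int.cast : ℤ → ℂ)]
    exact funext h2
  obtain ⟨g, hg1, hg⟩ := hg
  -- The ε₁-coordinate may be any complex number, but it is invariant and cancels in the
  -- differences.
  obtain ⟨v₀, hv₀⟩ : ∃ v₀ : (ospDatum n hn).Vec, v₀ =
      (Sum.elim (fun _ => (lam + (ospDatum n hn).rho) (Sum.inl ())) fun _ => 0 :
        Unit ⊕ Fin n → ℂ) := ⟨_, rfl⟩
  have hz : lam + (ospDatum n hn).rho =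
      v₀ + (ospDatum n hn).latEmb 1 (Sum.elim (fun _ => 0) b) := by
    subst hv₀
    refine funext fun c => ?_
    rcases c with c | c
    · change _ = (lam + (ospDatum n hn).rho) (Sum.inl ()) + ((0 : ℤ) : ℂ) / 1
      simp
    · refine (hb c).trans ?_
      change _ = 0 + (b c : ℂ) / 1
      simp
  have hinv : ∀ y, (ospModel n hn).act y v₀ = v₀ := by
    intro y
    subst hv₀
    refine funext fun c => ?_
    rcases c with c | c
    · rfl
    · exact mul_zero _
  let P := (ospModel n hn).param hinv hz hg
  have hd : ∀ y, mon (κ := (ospDatum n hn).κ) (ospVar x) (P.d y) =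
      HahnSeries.C (∏ p, x p ^ (SPerm.act y b p - b p)) := fun y => (mon_ospVar x _).trans rfl
  have hgy : ∀ y, mon (κ := (ospDatum n hn).κ) (ospVar x) (-P.g y) = HahnSeries.single 1
      (∏ p, x p ^ (-SPerm.act y (fun p => g (Sum.inr p)) p)) := fun y => by
    refine (mon_ospVar x _).trans ?_
    change HahnSeries.single (- -g (Sum.inl ())) _ = _
    rw [hg1, neg_neg]
    rfl
  refine ⟨_, P.specializes_ordinary one_ne_zero fun y => ?_, ?_⟩
  · rw [hgy]; exact one_add_single_ne_zero _
  · have h1 := lead_sum_inv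
      (fun y => φ (SPerm.signC n y) * ∏ p, x p ^ (SPerm.act y b p - b p))
      fun y => ∏ p, x p ^ (-SPerm.act y (fun p => g (Sum.inr p)) p)
    rw [normB_eq_sum φ hx] at h1
    convert h1 using 1
    refine Finset.sum_congr rfl fun y _ => ?_
    rw [hd, hgy, map_mul, div_eq_mul_inv, mul_assoc]
    rfl

theorem osp_unique_factorization (hn : 0 < n) (special : Set (SuperType.osp n hn).datum.Vec)
    (γ : (SuperType.osp n hn).datum.Vec) (r s : ℕ) (ν : Fin r → (SuperType.osp n hn).datum.Vec)
    (μ : Fin s → (SuperType.osp n hn).datum.Vec)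
    (hν : ∀ i, (SuperType.osp n hn).datum.DominantIntegral (ν i) ∧
      (SuperType.osp n hn).datum.SinglyAtypical γ (ν i))
    (hμ : ∀ j, (SuperType.osp n hn).datum.DominantIntegral (μ j) ∧
      (SuperType.osp n hn).datum.SinglyAtypical γ (μ j))
    (hU : ∏ i, U (.osp n hn) special γ (ν i) = ∏ j, U (.osp n hn) special γ (μ j)) :
    ∃ h : r = s, ∃ σ : Equiv.Perm (Fin r),
      ∀ k, U (.osp n hn) special γ (ν k) = U (.osp n hn) special γ (μ (Fin.cast h (σ k))) := by
  obtain ⟨N, rfl⟩ : ∃ N, n = N + 1 := ⟨n - 1, by omega⟩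
  obtain ⟨K, _, φ, x, hx, hne, hfac⟩ := exists_normB_factorization ℂ N
  have hb := fun lam : {lam // (ospDatum (N + 1) hn).DominantIntegral lam ∧
    (ospDatum (N + 1) hn).SinglyAtypical γ lam} => osp_exists_decPos lam.2.1
  choose b hb hb' using hb
  have hbi : Function.Injective b := by
    intro lam lam' h
    have h1 : ∀ p, (lam.1 + (ospDatum (N + 1) hn).rho) (Sum.inr p) =
        (lam'.1 + (ospDatum (N + 1) hn).rho) (Sum.inr p) := fun p =>
      (hb' lam p).trans ((congrArg (fun b : Fin (N + 1) → ℤ => (b p : ℂ)) h).trans (hb' lam' p).symm)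
    -- The ε₁-coordinate is recovered from atypicality: it equals a δ-coordinate up to a sign
    -- determined by γ.
    have h2 : (lam.1 + (ospDatum (N + 1) hn).rho) (Sum.inl ()) =
        (lam'.1 + (ospDatum (N + 1) hn).rho) (Sum.inl ()) := by
      have e1 := lam.2.2.2.1
      have e2 := lam'.2.2.2.1
      obtain ⟨p, hp | hp⟩ := (mem_osp_oddPos hn).1 lam.2.2.1
      · have e1 := (form_pair (osp_gram hn) _ (-1) (Sum.inl ()) (Sum.inr p)).symm.trans
          ((congrArg _ hp.symm).trans e1)
        have e2 := (form_pair (osp_gram hn) _ (-1) (Sum.inl ()) (Sum.inr p)).symm.trans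
          ((congrArg _ hp.symm).trans e2)
        have e3 := h1 p
        simp only [Sum.elim_inl, Sum.elim_inr] at e1 e2
        linear_combination e1 - e2 - e3
      · have e1 := (form_pair (osp_gram hn) _ 1 (Sum.inl ()) (Sum.inr p)).symm.trans
          ((congrArg _ hp.symm).trans e1)
        have e2 := (form_pair (osp_gram hn) _ 1 (Sum.inl ()) (Sum.inr p)).symm.trans
          ((congrArg _ hp.symm).trans e2)
        have e3 := h1 p
        simp only [Sum.elim_inl, Sum.elim_inr] at e1 e2
        linear_combination e1 - e2 + e3
    refine Subtype.ext (add_right_cancel (b := (ospDatum (N + 1) hn).rho) (funext fun c => ?_))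
    rcases c with c | c
    · exact h2
    · exact h1 c
  have hu := fun lam : {lam // (ospDatum (N + 1) hn).DominantIntegral lam ∧
    (ospDatum (N + 1) hn).SinglyAtypical γ lam} =>
      osp_exists_lead hn φ hx lam.2.2.1 (hb' lam)
  choose u hu hl using hu
  refine exists_perm_of_specializes (g := .osp (N + 1) hn) one_ne_zero (φ := HahnSeries.C.comp φ) (X := ospVar x)
    (hX := ospVar_ne_zero hx) u (fun lam => ?_) (fun s t h => ?_) hν hμ hU
  · have e : U (.osp (N + 1) hn) special γ lam.1 =
        (ospDatum (N + 1) hn).ordinaryNumerator γ lam.1 := if_neg fun h => h.1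
    rw [e]
    exact hu lam
  · refine multiset_eq_of_lead hl (fun lam => hne _ (hb lam)) (fun s t h => ?_) h
    refine hfac _ b (fun _ => 1) hb hbi (fun _ => one_ne_zero) s t ?_
    simpa using h

end Osp

end SuperFactor
end

/-! ### Unique factorization for F(4) -/

noncomputable section
open scoped Classical
namespace SuperFactor
open RootDatum

/-! ### `F(4)` -/

theorem f4_sum_even : ∑ α ∈ f4Datum.evenPos, α = (![5, 3, 1, 1] : Fin 4 → ℂ) := by
  have h : ∑ α ∈ ({![1, 0, 0, 0], ![0, 1, 0, 0], ![0, 0, 1, 0], ![1, -1, 0, 0], ![1, 1, 0, 0],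
    ![1, 0, -1, 0], ![1, 0, 1, 0], ![0, 1, -1, 0], ![0, 1, 1, 0], ![0, 0, 0, 1]} :
      Finset (Fin 4 → ℂ)), α = ![5, 3, 1, 1] := by
    have e : (1 : ℂ) ≠ -1 := by norm_num
    have e' : (-1 : ℂ) ≠ 1 := by norm_num
    repeat rw [Finset.sum_insert (by simp [e, e'])]
    rw [Finset.sum_singleton]
    ext c
    fin_cases c <;> norm_num
  exact h

theorem f4_sum_odd : ∑ α ∈ f4Datum.oddPos, α = (![0, 0, 0, 4] : Fin 4 → ℂ) := by
  have h : ∑ α ∈ Finset.univ.image (fun s : Fin 3 → ℤˣ =>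
    (![((s 0 : ℤ) : ℂ) / 2, ((s 1 : ℤ) : ℂ) / 2, ((s 2 : ℤ) : ℂ) / 2, 1 / 2] : Fin 4 → ℂ)), α =
      ![0, 0, 0, 4] := by
    rw [Finset.sum_image]
    · have e : ∀ i : Fin 3, ∑ s : Fin 3 → ℤˣ, ((s i : ℤ) : ℂ) = 0 := by
        intro i
        have : ∀ i : Fin 3, ∑ s : Fin 3 → ℤˣ, (s i : ℤ) = 0 := by decide
        exact_mod_cast this i
      ext c
      rw [Finset.sum_apply]
      fin_cases c
      · change ∑ s : Fin 3 → ℤˣ, ((s 0 : ℤ) : ℂ) / 2 = 0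
        rw [← Finset.sum_div, e, zero_div]
      · change ∑ s : Fin 3 → ℤˣ, ((s 1 : ℤ) : ℂ) / 2 = 0
        rw [← Finset.sum_div, e, zero_div]
      · change ∑ s : Fin 3 → ℤˣ, ((s 2 : ℤ) : ℂ) / 2 = 0
        rw [← Finset.sum_div, e, zero_div]
      · change ∑ s : Fin 3 → ℤˣ, (1 / 2 : ℂ) = 4
        rw [Finset.sum_const, Finset.card_univ, Fintype.card_fun]
        simp
        norm_num
    · intro s _ t _ h
      have h0 := congrFun h 0
      have h1 := congrFun h 1
      have h2 := congrFun h 2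
      simp at h0 h1 h2
      funext c
      fin_cases c
      exacts [Units.ext h0, Units.ext h1, Units.ext h2]
  exact h

theorem f4_rho : f4Datum.rho = (![5 / 2, 3 / 2, 1 / 2, -3 / 2] : Fin 4 → ℂ) := by
  have h : (1 / 2 : ℂ) • (![5, 3, 1, 1] : Fin 4 → ℂ) - (1 / 2 : ℂ) • (![0, 0, 0, 4] : Fin 4 → ℂ) =
      ![5 / 2, 3 / 2, 1 / 2, -3 / 2] := by
    ext c
    fin_cases c <;> norm_num
  rw [← h, ← f4_sum_even, ← f4_sum_odd]
  rfl

theorem f4_form (x y : Fin 4 → ℂ) :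
    f4Datum.form x y = x 0 * y 0 + x 1 * y 1 + x 2 * y 2 - 3 * x 3 * y 3 := by
  refine (form_of_diagonal (D := f4Datum) (d := f4Diag) rfl x y).trans ?_
  refine (Fin.sum_univ_four (fun c : Fin 4 => f4Diag c * x c * y c)).trans ?_
  simp [f4Diag]
  ring

theorem f4_cartan : F4Cartan f4Datum (id : Fin 4 → Fin 4) where
  inj := Function.injective_id
  par a := rfl
  form a b := by
    have h : ∀ a b : Fin 4, f4Datum.form
        ((![![1, -1, 0, 0], ![0, 1, -1, 0], ![0, 0, 1, 0], ![-1 / 2, -1 / 2, -1 / 2, 1 / 2]] :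
          Fin 4 → Fin 4 → ℂ) a)
        ((![![1, -1, 0, 0], ![0, 1, -1, 0], ![0, 0, 1, 0], ![-1 / 2, -1 / 2, -1 / 2, 1 / 2]] :
          Fin 4 → Fin 4 → ℂ) b) = f4Cartan a b := by
      intro a b
      rw [f4_form]
      fin_cases a <;> fin_cases b <;> simp [f4Cartan] <;> norm_num
    exact h a b

/-- The positive odd roots of `F(4)`. -/
def f4Odd (s : Fin 3 → ℤˣ) : Fin 4 → ℂ :=
  ![((s 0 : ℤ) : ℂ) / 2, ((s 1 : ℤ) : ℂ) / 2, ((s 2 : ℤ) : ℂ) / 2, 1 / 2]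

theorem mem_f4_oddPos {α : Fin 4 → ℂ} : α ∈ f4Datum.oddPos ↔ ∃ s, α = f4Odd s := by
  refine Finset.mem_image.trans ?_
  simp only [Finset.mem_univ, true_and, eq_comm]
  rfl

theorem f4Odd_injective : Function.Injective f4Odd := by
  intro s t h
  have h0 := congrFun h 0
  have h1 := congrFun h 1
  have h2 := congrFun h 2
  simp [f4Odd] at h0 h1 h2
  funext c
  fin_cases c
  exacts [Units.ext h0, Units.ext h1, Units.ext h2]

/-- The lattice vector of a weight of `F(4)`. -/
def f4Lat (b : Fin 3 → ℤ) (k : ℤ) : Fin 4 → ℤ := Fin.snoc (α := fun _ => ℤ) b k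

theorem f4Lat_castSucc (b : Fin 3 → ℤ) (k : ℤ) (p : Fin 3) : f4Lat b k p.castSucc = b p :=
  Fin.snoc_castSucc (α := fun _ => ℤ) ..

theorem f4Lat_last (b : Fin 3 → ℤ) (k : ℤ) : f4Lat b k (Fin.last 3) = k :=
  Fin.snoc_last (α := fun _ => ℤ) ..

theorem f4Odd_eq (s : Fin 3 → ℤˣ) : f4Odd s = f4Datum.latEmb 2 (f4Lat (fun p => s p) 1) := by
  have h : ∀ c : Fin 4, f4Odd s c = ((f4Lat (fun p => s p) 1 c : ℤ) : ℂ) / 2 := by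
    intro c
    fin_cases c
    exacts [rfl, rfl, rfl, by simp [f4Odd, f4Lat, Fin.snoc]]
  exact funext h

theorem f4_form_odd (b : Fin 3 → ℤ) (k : ℤ) (s : Fin 3 → ℤˣ) :
    f4Datum.form (f4Datum.latEmb 2 (f4Lat b k)) (f4Odd s) =
      ((s 0 * b 0 + s 1 * b 1 + s 2 * b 2 - 3 * k : ℤ) : ℂ) / 4 := by
  refine (f4_form _ _).trans ?_
  change (b 0 : ℂ) / 2 * (((s 0 : ℤ) : ℂ) / 2) + (b 1 : ℂ) / 2 * (((s 1 : ℤ) : ℂ) / 2) +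
    (b 2 : ℂ) / 2 * (((s 2 : ℤ) : ℂ) / 2) - 3 * ((k : ℂ) / 2) * (1 / 2) = _
  push_cast
  ring

/-- The dominant integral weights. -/
theorem f4_exists_lat {lam : f4Datum.Vec} (h : f4Datum.DominantIntegral lam) :
    ∃ a b c n : ℕ, lam + f4Datum.rho =
        f4Datum.latEmb 2 (f4Lat ![2 * a + 2 * b + c + 5, 2 * b + c + 3, c + 1] (n - 3)) ∧
      (n = 0 → a = 0 ∧ b = 0 ∧ c = 0) ∧ n ≠ 1 ∧ (n = 2 → a = 0 ∧ c = 0) := by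
  obtain ⟨l, hl⟩ : ∃ l : Fin 4 → ℂ, ∀ c, l c = lam c := ⟨lam, fun _ => rfl⟩
  have hform : ∀ w : Fin 4 → ℂ, f4Datum.form lam w =
      l 0 * w 0 + l 1 * w 1 + l 2 * w 2 - 3 * l 3 * w 3 := by
    intro w
    rw [hl, hl, hl, hl]
    exact f4_form lam w
  have hs : ∀ a : Fin 4, f4Datum.form lam (f4Datum.simple a) =
      (![l 0 - l 1, l 1 - l 2, l 2, -(l 0 + l 1 + l 2 + 3 * l 3) / 2] : Fin 4 → ℂ) a := by
    intro a
    have : ∀ a : Fin 4, f4Datum.form lam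
        ((![![1, -1, 0, 0], ![0, 1, -1, 0], ![0, 0, 1, 0], ![-1 / 2, -1 / 2, -1 / 2, 1 / 2]] :
          Fin 4 → Fin 4 → ℂ) a) = 
        (![l 0 - l 1, l 1 - l 2, l 2, -(l 0 + l 1 + l 2 + 3 * l 3) / 2] : Fin 4 → ℂ) a := by
      intro a
      rw [hform]
      fin_cases a <;> simp <;> ring
    exact this a
  -- The number `n` is twice the δ-coordinate of λ, and `a`, `b`, `c` below are the Dynkin labels
  -- for so(7). Each alternative in `h2`, `h3`, `h4` becomes an equation stating that a combination
  -- of them with nonnegative coefficients is zero.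
  obtain ⟨n, h1, h2, h3, h4⟩ := f4_cartan.dominantIntegral hs h
  have hnat : ∀ i : Fin 4, (![0, 0, 0, 1] : Fin 4 → ℕ) i = 0 → f4Cartan i i ≠ 0 → ∃ m : ℕ,
      2 * (![l 0 - l 1, l 1 - l 2, l 2, -(l 0 + l 1 + l 2 + 3 * l 3) / 2] : Fin 4 → ℂ) i =
        m * f4Cartan i i := by
    intro i hi hi'
    obtain ⟨m, hm⟩ := h.exists_nat (i := i) hi (fun h0 => hi' ((f4_cartan.form i i).symm.trans h0))
    exact ⟨m, (congrArg (2 * ·) (hs i)).symm.trans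
      (hm.trans (congrArg ((m : ℂ) * ·) (f4_cartan.form i i)))⟩
  obtain ⟨a, ha⟩ := hnat 0 rfl (by simp [f4Cartan])
  obtain ⟨b, hb⟩ := hnat 1 rfl (by simp [f4Cartan])
  obtain ⟨c, hc⟩ := hnat 2 rfl (by simp [f4Cartan])
  simp [f4Cartan] at ha hb hc
  replace h1 : l 0 - l 1 + 2 * (l 1 - l 2) + 3 * l 2 +
    2 * (-(l 0 + l 1 + l 2 + 3 * l 3) / 2) = -(3 / 2) * n := h1
  replace h2 : n = 0 → -(l 0 + l 1 + l 2 + 3 * l 3) / 2 = 0 := h2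
  replace h3 : n = 1 → -(l 0 + l 1 + l 2 + 3 * l 3) / 2 = 0 ∨
    l 2 + -(l 0 + l 1 + l 2 + 3 * l 3) / 2 + 1 / 2 = 0 := h3
  replace h4 : n = 2 → -(l 0 + l 1 + l 2 + 3 * l 3) / 2 = 0 ∨
    l 2 + -(l 0 + l 1 + l 2 + 3 * l 3) / 2 + 1 / 2 = 0 ∨
    l 1 - l 2 + l 2 + -(l 0 + l 1 + l 2 + 3 * l 3) / 2 + 3 / 2 = 0 := h4
  have e2 : l 2 = c / 2 := by linear_combination (1 / 2) * hc
  have e1 : l 1 = b + c / 2 := by linear_combination (1 / 2) * hb + e2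
  have e0 : l 0 = a + b + c / 2 := by linear_combination (1 / 2) * ha + e1
  have e3 : l 3 = n / 2 := by linear_combination -(1 / 3) * h1
  have hz : ∀ m : ℕ, (m : ℂ) = 0 → m = 0 := fun m hm => by exact_mod_cast hm
  refine ⟨a, b, c, n, ?_, ?_, ?_, ?_⟩
  · rw [f4_rho]
    have : ∀ i : Fin 4, l i + (![5 / 2, 3 / 2, 1 / 2, -3 / 2] : Fin 4 → ℂ) i =
        ((f4Lat ![2 * a + 2 * b + c + 5, 2 * b + c + 3, c + 1] (n - 3) i : ℤ) : ℂ) / 2 := by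
      intro i
      fin_cases i
      · change l 0 + 5 / 2 = ((2 * a + 2 * b + c + 5 : ℤ) : ℂ) / 2
        rw [e0]; push_cast; ring
      · change l 1 + 3 / 2 = ((2 * b + c + 3 : ℤ) : ℂ) / 2
        rw [e1]; push_cast; ring
      · change l 2 + 1 / 2 = ((c + 1 : ℤ) : ℂ) / 2
        rw [e2]; push_cast; ring
      · change l 3 + -3 / 2 = ((n - 3 : ℤ) : ℂ) / 2
        rw [e3]; push_cast; ring
    exact funext fun i => (congrArg (· + _) (hl i).symm).trans (this i)
  · rintro rfl
    have h5 := hz (2 * a + 4 * b + 3 * c) (by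
      push_cast
      have := h2 rfl
      rw [e0, e1, e2, e3] at this
      push_cast at this
      linear_combination -4 * this)
    omega
  · rintro rfl
    rcases h3 rfl with h5 | h5
    · have h5 := hz (2 * a + 4 * b + 3 * c + 3) (by
        push_cast
        rw [e0, e1, e2, e3] at h5
        push_cast at h5
        linear_combination -4 * h5)
      omega
    · have h5 := hz (2 * a + 4 * b + c + 1) (by
        push_cast
        rw [e0, e1, e2, e3] at h5
        push_cast at h5
        linear_combination -4 * h5)
      omega
  · rintro rfl
    rcases h4 rfl with h5 | h5 | h5
    · have h5 := hz (2 * a + 4 * b + 3 * c + 6) (by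
        push_cast
        rw [e0, e1, e2, e3] at h5
        push_cast at h5
        linear_combination -4 * h5)
      omega
    · have h5 := hz (2 * a + 4 * b + c + 4) (by
        push_cast
        rw [e0, e1, e2, e3] at h5
        push_cast at h5
        linear_combination -4 * h5)
      omega
    · have h5 := hz (2 * a + c) (by
        push_cast
        rw [e0, e1, e2, e3] at h5
        push_cast at h5
        linear_combination -4 * h5)
      omega

/-- The singly atypical weights. -/
theorem f4_cases {γ lam : f4Datum.Vec} (h : f4Datum.DominantIntegral lam)
    (ha : f4Datum.SinglyAtypical γ lam) : ∃ (b : Fin 3 → ℤ) (s : Fin 3 → ℤˣ) (k : ℤ), DecPos b ∧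
      lam + f4Datum.rho = f4Datum.latEmb 2 (f4Lat b k) ∧ γ = f4Odd s ∧
      (0 < k ∨ (k = -3 ∧ b = ![5, 3, 1] ∧ s = ![-1, -1, -1]) ∨
        (k = -1 ∧ ∃ c, b = ![c + 2, c, 1] ∧ s = ![-1, 1, -1])) := by
  obtain ⟨a, b, c, n, hv, h0, h1, h2⟩ := f4_exists_lat h
  obtain ⟨s, hs⟩ := mem_f4_oddPos.1 ha.1
  have hat : ∀ t : Fin 3 → ℤˣ, f4Datum.form (lam + f4Datum.rho) (f4Odd t) = 0 → t = s :=
    fun t ht => f4Odd_injective ((ha.2.2 _ (mem_f4_oddPos.2 ⟨t, rfl⟩) ht).trans hs)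
  have hat0 : f4Datum.form (lam + f4Datum.rho) (f4Odd s) = 0 := (congrArg _ hs.symm).trans ha.2.1
  rw [hv] at hat0 hat
  simp only [f4_form_odd] at hat hat0
  refine ⟨_, s, _, ⟨?_, ?_⟩, hv, hs, ?_⟩
  · rw [Fin.strictAnti_iff_succ_lt]
    intro i
    fin_cases i <;> simp <;> omega
  · intro i
    fin_cases i <;> simp <;> omega
  -- The lattice δ-coordinate is k = n - 3. For n = 0 and n = 2 an odd root orthogonal to λ + ρ can
  -- be written down, and uniqueness identifies it with γ. For n = 3 the condition does not involve
  -- δ and is symmetric under s ↦ -s, which contradicts single atypicality.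
  · obtain rfl | rfl | rfl | hn : n = 0 ∨ n = 2 ∨ n = 3 ∨ 3 < n := by omega
    · obtain ⟨rfl, rfl, rfl⟩ := h0 rfl
      exact Or.inr (Or.inl ⟨by simp, by simp, (hat ![-1, -1, -1] (by simp)).symm⟩)
    · obtain ⟨rfl, rfl⟩ := h2 rfl
      refine Or.inr (Or.inr ⟨by norm_num, 2 * b + 3, ?_, (hat ![-1, 1, -1] ?_).symm⟩)
      · simp; ring
      · simp
    · exfalso
      have h3 := hat (-s) (by
        rw [div_eq_zero_iff] at hat0 ⊢
        left
        have := hat0.resolve_right (by norm_num)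
        push_cast [Pi.neg_apply, Units.val_neg] at this ⊢
        linear_combination -this)
      have h4 := congrFun h3 0
      rcases Int.units_eq_one_or (s 0) with h5 | h5 <;> simp [h5] at h4
    · left; omega

/-! ### Leading terms of the numerators of exceptional type -/

/-- The four cases give the scalars 1, 1, 2 and -1/2. They may vary from weight to weight, which is
why independence is required modulo scalars. -/
theorem RootDatum.WeylParam.IsSplit.exists_lead {D : RootDatum} {h : ℂ} {γ lam : D.Vec}
    {Y K : Type} [Fintype Y] [Field K] [CharZero K] {P : WeylParam D h γ lam (Y × ℤˣ)}
    {X : D.κ → LaurentSeries K} {s : Y → ℂ} {m z : Y → K} {M : ℤ} (hP : P.IsSplit X s m z M)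
    (φ : ℂ →+* K) (hX : ∀ c, X c ≠ 0) (hh : h ≠ 0)
    (hM : 0 < M ∨ ∃ M' : ℕ, 0 < M' ∧ M = -M' ∧
      (∀ k : ℕ, 0 < k → k < M' → ∑ y, φ (s y) * m y * z y ^ k = 0) ∧
      (-1) ^ M' * ∑ y, φ (s y) * m y * z y ^ M' = ∑ y, φ (s y) * m y) (p : Prop)
    [Decidable p] :
    ∃ u o c, Specializes (D.latHom h) (evalMon (HahnSeries.C.comp φ) X hX)
      (if p then D.specialNumerator γ lam else D.ordinaryNumerator γ lam) u ∧ c ≠ 0 ∧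
      Lead u o (φ c * ∑ y, φ (s y) * m y) := by
  by_cases hp : p
  · rw [if_pos hp]
    rcases hM with hM | ⟨M', h1, rfl, h2, h3⟩
    · exact ⟨_, 0, 1, hP.specializes_special φ hh, one_ne_zero,
        (lead_spSum_pos hP.z_ne hM).congr rfl rfl (by simp)⟩
    · exact ⟨_, -M', -(1 / 2), hP.specializes_special φ hh, by norm_num,
        (lead_spSum_neg hP.z_ne h1 h2 h3).congr rfl rfl
          (by rw [map_neg, map_div₀, map_one, map_ofNat])⟩
  · rw [if_neg hp]
    rcases hM with hM | ⟨M', h1, rfl, h2, h3⟩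
    · exact ⟨_, 0, 1, hP.specializes_ordinary φ hh, one_ne_zero,
        (lead_ordSum_pos hP.z_ne hM).congr rfl rfl (by simp)⟩
    · exact ⟨_, 0, 2, hP.specializes_ordinary φ hh, by norm_num,
        (lead_ordSum_neg hP.z_ne h1 h2 h3).congr rfl rfl (by rw [map_ofNat])⟩

section F4Lead

variable {K : Type} [Field K]

/-- The Laurent expansion in `e^{-δ/2}`. -/
def f4Var (x : Fin 3 → K) : Fin 4 → LaurentSeries K :=
  Fin.snoc (α := fun _ => LaurentSeries K) (fun p => HahnSeries.C (x p)) (HahnSeries.single (-1) 1)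

theorem f4Var_ne_zero {x : Fin 3 → K} (hx : ∀ p, x p ≠ 0) (c : Fin 4) : f4Var x c ≠ 0 := by
  induction c using Fin.lastCases with
  | last =>
    rw [f4Var, Fin.snoc_last]
    exact HahnSeries.single_ne_zero one_ne_zero
  | cast c =>
    rw [f4Var, Fin.snoc_castSucc]
    exact (map_ne_zero_iff _ HahnSeries.C_injective).2 (hx c)

theorem mon_f4Var (x : Fin 3 → K) (z : Fin 4 → ℤ) : mon (f4Var x) z =
    HahnSeries.single (-z (Fin.last 3)) (∏ p : Fin 3, x p ^ z p.castSucc) := by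
  rw [mon, Fin.prod_univ_castSucc]
  simp only [f4Var, Fin.snoc_castSucc, Fin.snoc_last, ← map_zpow₀, ← map_prod]
  rw [single_zpow, one_zpow, HahnSeries.C_apply, HahnSeries.single_mul_single, mul_one]
  simp

theorem altB_three (x : Fin 3 → K) (b : Fin 3 → ℤ) {F : Fin 3 → ℤ → K}
    (hF : ∀ p k, F p k = x p ^ k - x p ^ (-k)) : altB x b =
    F 0 (b 0) * F 1 (b 1) * F 2 (b 2) - F 0 (b 0) * F 1 (b 2) * F 2 (b 1) -
      F 0 (b 1) * F 1 (b 0) * F 2 (b 2) + F 0 (b 1) * F 1 (b 2) * F 2 (b 0) +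
      F 0 (b 2) * F 1 (b 0) * F 2 (b 1) - F 0 (b 2) * F 1 (b 1) * F 2 (b 0) := by
  simp only [altB, Matrix.det_fin_three, Matrix.of_apply, hF]

/-- The vector (5,3,1) - k(1,1,1) with 0 < k < 6 has a zero entry or two opposite entries, hence is
singular. For k = 6 it arises from (5,3,1) by reversal and three sign changes, an element of
determinant 1. -/
theorem altB_shift_first (x : Fin 3 → K) :
    (∀ k : ℕ, 0 < k → k < 6 → altB x ![5 - k, 3 - k, 1 - k] = 0) ∧
      altB x ![-1, -3, -5] = altB x ![5, 3, 1] := by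
  obtain ⟨F, hF⟩ : ∃ F : Fin 3 → ℤ → K, ∀ p k, F p k = x p ^ k - x p ^ (-k) := ⟨_, fun _ _ => rfl⟩
  have h0 : ∀ p, F p 0 = 0 := fun p => by simp [hF]
  have hneg : ∀ p k, F p (-k) = -F p k := fun p k => by simp [hF]
  constructor
  · intro k hk hk'
    rw [altB_three x _ hF]
    interval_cases k <;> simp [h0, hneg]
  · rw [altB_three x _ hF, altB_three x _ hF]
    simp [hneg]
    ring

/-- For k = 1 two entries coincide. For k = 2 the vector differs from the original by a
transposition and one sign change, so the signs compensate. -/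
theorem altB_shift_third (x : Fin 3 → K) (c : ℤ) :
    altB x ![c + 1, c + 1, 0] = 0 ∧ altB x ![c, c + 2, -1] = altB x ![c + 2, c, 1] := by
  obtain ⟨F, hF⟩ : ∃ F : Fin 3 → ℤ → K, ∀ p k, F p k = x p ^ k - x p ^ (-k) := ⟨_, fun _ _ => rfl⟩
  have h0 : ∀ p, F p 0 = 0 := fun p => by simp [hF]
  have hneg : ∀ p k, F p (-k) = -F p k := fun p k => by simp [hF]
  constructor
  · rw [altB_three x _ hF]
    simp [h0]
  · rw [altB_three x _ hF, altB_three x _ hF]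
    simp [hneg]
    ring

/-- A power z^k of the exponential of `s` translates the weight `b` by `k s`. The coefficients of
the geometric series are therefore alternants again. -/
theorem sum_SPerm_mul_pow (φ : ℂ →+* K) {x : Fin 3 → K} (hx : ∀ p, x p ≠ 0) (b s : Fin 3 → ℤ)
    (k : ℕ) : ∑ y : SPerm 3, φ (SPerm.signC 3 y) * (∏ p, x p ^ (SPerm.act y b p - b p)) *
      (∏ p, x p ^ SPerm.act y s p) ^ k = altB x (b + (k : ℤ) • s) * ∏ p, x p ^ (-b p) := by
  rw [← sum_SPerm φ, Finset.sum_mul]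
  refine Finset.sum_congr rfl fun y _ => ?_
  rw [mul_assoc, mul_assoc, ← Finset.prod_pow, ← Finset.prod_mul_distrib, ← Finset.prod_mul_distrib]
  congr 1
  refine Finset.prod_congr rfl fun p _ => ?_
  rw [SPerm.act_add, SPerm.act_smul, ← zpow_natCast, ← zpow_mul, ← zpow_add₀ (hx p),
    ← zpow_add₀ (hx p)]
  congr 1
  simp only [Pi.add_apply, Pi.smul_apply, smul_eq_mul]
  ring

/-- Changing the sign of the lattice δ-coordinate `k` produces T^{2k}. This explains the exponents 6
and 2 in the cases k = -3 and k = -1. -/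
theorem f4_exists_lead [CharZero K] (φ : ℂ →+* K) {x : Fin 3 → K} (hx : ∀ p, x p ≠ 0)
    {γ lam : f4Datum.Vec} {b : Fin 3 → ℤ} {s : Fin 3 → ℤˣ} {k : ℤ}
    (hv : lam + f4Datum.rho = f4Datum.latEmb 2 (f4Lat b k)) (hγ : γ = f4Odd s)
    (hk : 0 < k ∨ (k = -3 ∧ b = ![5, 3, 1] ∧ s = ![-1, -1, -1]) ∨
        (k = -1 ∧ ∃ c, b = ![c + 2, c, 1] ∧ s = ![-1, 1, -1])) (p : Prop)
    [Decidable p] :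
    ∃ u o c, Specializes (f4Datum.latHom 2)
      (evalMon (HahnSeries.C.comp φ) (f4Var x) (f4Var_ne_zero hx))
      (if p then f4Datum.specialNumerator γ lam else f4Datum.ordinaryNumerator γ lam) u ∧ c ≠ 0 ∧
      Lead u o (φ c * normB x b) := by
  have hinv : ∀ y, f4Model.act y 0 = 0 := fun y => map_zero _
  let P := f4Model.param hinv (hv.trans (zero_add _).symm) (hγ.trans (f4Odd_eq s))
  have hP : P.IsSplit (f4Var x) (fun y => SPerm.signC 3 y)
      (fun y => ∏ p, x p ^ (SPerm.act y b p - b p))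
      (fun y => ∏ p, x p ^ SPerm.act y (fun p => (s p : ℤ)) p) (2 * k) := by
    have hd : ∀ y e, mon (κ := f4Datum.κ) (f4Var x) (P.d (y, e)) = HahnSeries.single (k - e * k)
        (∏ p, x p ^ (SPerm.act y b p - b p)) := by
      intro y e
      refine (mon_f4Var x (f4Act (y, e) (f4Lat b k) - f4Lat b k)).trans ?_
      simp only [Pi.sub_apply, f4Act_last, f4Act_castSucc, f4Lat_last, f4Lat_castSucc]
      simp
    have hg : ∀ y e, mon (κ := f4Datum.κ) (f4Var x) (-P.g (y, e)) = HahnSeries.single (e : ℤ)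
        (∏ p, x p ^ SPerm.act y (fun p => (s p : ℤ)) p)⁻¹ := by
      intro y e
      refine (mon_f4Var x (-f4Act (y, e) (f4Lat (fun p => s p) 1))).trans ?_
      simp only [Pi.neg_apply, f4Act_last, f4Act_castSucc, f4Lat_last, f4Lat_castSucc]
      simp [Finset.prod_inv_distrib]
    constructor
    · exact fun y => Finset.prod_ne_zero_iff.2 fun p _ => zpow_ne_zero _ (hx p)
    · intro y
      rw [hd, HahnSeries.C_apply]
      simp
    · intro y
      rw [hd]
      congr 1
      simp
      ring
    · exact fun y => hg y 1
    · exact fun y => hg y (-1)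
    · intro y
      change SPerm.signC 3 y * unitsC 1 = SPerm.signC 3 y
      simp
    · intro y
      change SPerm.signC 3 y * unitsC (-1) = -SPerm.signC 3 y
      simp [unitsC_apply]
  have h := hP.exists_lead φ (f4Var_ne_zero hx) two_ne_zero ?_ p
  · rwa [normB_eq_sum φ hx] at h
  simp only [sum_SPerm_mul_pow φ hx, normB_eq_sum φ hx]
  rcases hk with hk | ⟨rfl, rfl, rfl⟩ | ⟨rfl, c, rfl, rfl⟩
  · left; omega
  · refine Or.inr ⟨6, by norm_num, by norm_num, fun k h0 h1 => ?_, ?_⟩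
    · have e : (![5, 3, 1] + (k : ℤ) • fun p => (((![-1, -1, -1] : Fin 3 → ℤˣ) p : ℤˣ) : ℤ)) =
          ![5 - (k : ℤ), 3 - k, 1 - k] := by
        funext p; fin_cases p <;> simp <;> ring
      rw [e, (altB_shift_first x).1 k h0 h1, zero_mul]
    · have e : (![5, 3, 1] + ((6 : ℕ) : ℤ) • fun p => (((![-1, -1, -1] : Fin 3 → ℤˣ) p : ℤˣ) : ℤ)) =
          ![-1, -3, -5] := by
        funext p; fin_cases p <;> simp
      rw [e, (altB_shift_first x).2, normB]
      norm_num
  · refine Or.inr ⟨2, by norm_num, by norm_num, fun k h0 h1 => ?_, ?_⟩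
    · obtain rfl : k = 1 := by omega
      have e : (![c + 2, c, 1] + ((1 : ℕ) : ℤ) • fun p => (((![-1, 1, -1] : Fin 3 → ℤˣ) p : ℤˣ) : ℤ)) =
          ![c + 1, c + 1, 0] := by
        funext p; fin_cases p <;> simp <;> ring
      rw [e, (altB_shift_third x c).1, zero_mul]
    · have e : (![c + 2, c, 1] + ((2 : ℕ) : ℤ) • fun p => (((![-1, 1, -1] : Fin 3 → ℤˣ) p : ℤˣ) : ℤ)) =
          ![c, c + 2, -1] := by
        funext p; fin_cases p <;> simp
      rw [e, (altB_shift_third x c).2, normB]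
      norm_num

end F4Lead

theorem f4_unique_factorization (special : Set SuperType.F4.datum.Vec)
    (γ : SuperType.F4.datum.Vec) (r s : ℕ) (ν : Fin r → SuperType.F4.datum.Vec)
    (μ : Fin s → SuperType.F4.datum.Vec)
    (hν : ∀ i, SuperType.F4.datum.DominantIntegral (ν i) ∧
      SuperType.F4.datum.SinglyAtypical γ (ν i))
    (hμ : ∀ j, SuperType.F4.datum.DominantIntegral (μ j) ∧
      SuperType.F4.datum.SinglyAtypical γ (μ j))
    (hU : ∏ i, U .F4 special γ (ν i) = ∏ j, U .F4 special γ (μ j)) :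
    ∃ h : r = s, ∃ σ : Equiv.Perm (Fin r),
      ∀ k, U .F4 special γ (ν k) = U .F4 special γ (μ (Fin.cast h (σ k))) := by
  obtain ⟨K, _, φ, x, hx, hne, hfac⟩ := exists_normB_factorization ℂ 2
  have hK : CharZero K := charZero_of_injective_ringHom φ.injective
  have hb := fun lam : {lam // f4Datum.DominantIntegral lam ∧ f4Datum.SinglyAtypical γ lam} =>
    f4_cases lam.2.1 lam.2.2
  choose b t k hb hv hγ hk using hb
  -- The root γ is common to all weights, so atypicality determines `k` from `b`.
  have hbi : Function.Injective b := by
    intro lam lam' h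
    have e1 := (congrArg₂ f4Datum.form (hv lam).symm (hγ lam).symm).trans lam.2.2.2.1
    have e2 := (congrArg₂ f4Datum.form (hv lam').symm (hγ lam').symm).trans lam'.2.2.2.1
    have et : t lam = t lam' := f4Odd_injective ((hγ lam).symm.trans (hγ lam'))
    rw [f4_form_odd] at e1 e2
    rw [← et, ← h] at e2
    have ek : k lam = k lam' := by
      rw [div_eq_zero_iff] at e1 e2
      have e1 := e1.resolve_right (by norm_num)
      have e2 := e2.resolve_right (by norm_num)
      have e3 := e1.trans e2.symm
      rw [Int.cast_inj] at e3
      omega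
    refine Subtype.ext (add_right_cancel (b := f4Datum.rho) ?_)
    rw [hv, hv, h, ek]
  have hu := fun lam : {lam // f4Datum.DominantIntegral lam ∧ f4Datum.SinglyAtypical γ lam} =>
    f4_exists_lead φ hx (hv lam) (hγ lam) (hk lam) (SuperType.F4.IsExceptional ∧ lam.1 ∈ special)
  choose u o c hu hc hl using hu
  refine exists_perm_of_specializes (g := .F4) two_ne_zero (φ := HahnSeries.C.comp φ)
    (X := f4Var x) (hX := f4Var_ne_zero hx) u (fun lam => ?_) (fun s t h => ?_) hν hμ hU
  · have e : U .F4 special γ lam.1 = if SuperType.F4.IsExceptional ∧ lam.1 ∈ special then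
        f4Datum.specialNumerator γ lam.1 else f4Datum.ordinaryNumerator γ lam.1 := rfl
    rw [e]
    exact hu lam
  · exact multiset_eq_of_lead hl
      (fun lam => mul_ne_zero ((map_ne_zero φ).2 (hc lam)) (hne _ (hb lam)))
      (fun s t h => hfac _ b c hb hbi hc s t h) h

end SuperFactor
end

/-! ### Unique factorization for G(3) -/

noncomputable section
open scoped Classical
namespace SuperFactor

open RootDatum

/-! ### `G(3)` -/

theorem g3_rho : g3Datum.rho = (![2, 3, -5 / 2] : Fin 3 → ℂ) := by
  have e : (1 : ℂ) ≠ -1 := by norm_num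
  have e' : (-1 : ℂ) ≠ 1 := by norm_num
  have h1 : ∑ α ∈ ({![1, 0, 0], ![0, 1, 0], ![1, 1, 0], ![-1, 1, 0], ![2, 1, 0], ![1, 2, 0],
      ![0, 0, 2]} : Finset (Fin 3 → ℂ)), α = ![4, 6, 2] := by
    repeat rw [Finset.sum_insert (by simp <;> norm_num)]
    rw [Finset.sum_singleton]
    ext c
    fin_cases c <;> norm_num
  have h2 : ∑ α ∈ ({![0, 0, 1], ![1, 0, 1], ![-1, 0, 1], ![0, 1, 1], ![0, -1, 1], ![-1, -1, 1],
      ![1, 1, 1]} : Finset (Fin 3 → ℂ)), α = ![0, 0, 7] := by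
    repeat rw [Finset.sum_insert (by simp [e, e'])]
    rw [Finset.sum_singleton]
    ext c
    fin_cases c <;> norm_num
  have h3 : (1 / 2 : ℂ) • (![4, 6, 2] : Fin 3 → ℂ) - (1 / 2 : ℂ) • (![0, 0, 7] : Fin 3 → ℂ) =
      ![2, 3, -5 / 2] := by
    ext c
    fin_cases c <;> norm_num
  rw [← h3, ← h1, ← h2]
  rfl

/-- The simple roots of `G(3)`. -/
theorem g3_form_simple (v : Fin 3 → ℂ) (a : Fin 3) : g3Datum.form v (g3Datum.simple a) =
    (![2 * v 0 - v 1, 3 * v 1 - 3 * v 0, -v 0 - v 1 - 2 * v 2] : Fin 3 → ℂ) a := by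
  have : ∀ a : Fin 3, g3Datum.form v
      ((![![1, 0, 0], ![-1, 1, 0], ![-1, -1, 1]] : Fin 3 → Fin 3 → ℂ) a) =
      (![2 * v 0 - v 1, 3 * v 1 - 3 * v 0, -v 0 - v 1 - 2 * v 2] : Fin 3 → ℂ) a := by
    intro a
    rw [g3_form]
    fin_cases a <;> simp <;> ring
  exact this a

theorem g3_cartan : G3Cartan g3Datum (id : Fin 3 → Fin 3) where
  inj := Function.injective_id
  par a := rfl
  form a b := by
    refine (g3_form_simple _ b).trans ?_
    have h : ∀ a b : Fin 3,
        (![2 * (![![1, 0, 0], ![-1, 1, 0], ![-1, -1, 1]] : Fin 3 → Fin 3 → ℂ) a 0 -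
            (![![1, 0, 0], ![-1, 1, 0], ![-1, -1, 1]] : Fin 3 → Fin 3 → ℂ) a 1,
          3 * (![![1, 0, 0], ![-1, 1, 0], ![-1, -1, 1]] : Fin 3 → Fin 3 → ℂ) a 1 -
            3 * (![![1, 0, 0], ![-1, 1, 0], ![-1, -1, 1]] : Fin 3 → Fin 3 → ℂ) a 0,
          -(![![1, 0, 0], ![-1, 1, 0], ![-1, -1, 1]] : Fin 3 → Fin 3 → ℂ) a 0 -
            (![![1, 0, 0], ![-1, 1, 0], ![-1, -1, 1]] : Fin 3 → Fin 3 → ℂ) a 1 -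
            2 * (![![1, 0, 0], ![-1, 1, 0], ![-1, -1, 1]] : Fin 3 → Fin 3 → ℂ) a 2] :
          Fin 3 → ℂ) b = (!![2, -3, -1; -3, 6, 0; -1, 0, 0] : Matrix (Fin 3) (Fin 3) ℂ) a b := by
      intro a b
      fin_cases a <;> fin_cases b <;> simp <;> norm_num
    exact h a b

/-- The dominant integral weights. -/
theorem g3_exists_nat {lam : g3Datum.Vec} (h : g3Datum.DominantIntegral lam) :
    ∃ a b n : ℕ, lam + g3Datum.rho =
        (![((a + b + 2 : ℤ) : ℂ), ((a + 2 * b + 3 : ℤ) : ℂ), ((2 * n - 5 : ℤ) : ℂ) / 2] :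
          Fin 3 → ℂ) ∧ (n = 0 → a = 0 ∧ b = 0) ∧ n ≠ 1 := by
  obtain ⟨l, hl⟩ : ∃ l : Fin 3 → ℂ, l = lam := ⟨lam, rfl⟩
  have hs : ∀ a : Fin 3, g3Datum.form lam (g3Datum.simple a) =
      (![2 * l 0 - l 1, 3 * l 1 - 3 * l 0, -l 0 - l 1 - 2 * l 2] : Fin 3 → ℂ) a := by
    intro a
    rw [hl]
    exact g3_form_simple lam a
  -- The number `n` is the δ-coordinate of λ, and `a`, `b` below are the Dynkin labels for G₂. For n
  -- = 1 both alternatives would make a positive integer zero.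
  obtain ⟨n, h1, h2, h3⟩ := g3_cartan.dominantIntegral hs h
  obtain ⟨a, ha⟩ := h.exists_nat (i := (0 : Fin 3)) rfl
    (fun h0 => absurd ((g3_cartan.form 0 0).symm.trans h0) (by simp))
  obtain ⟨b, hb⟩ := h.exists_nat (i := (1 : Fin 3)) rfl
    (fun h0 => absurd ((g3_cartan.form 1 1).symm.trans h0) (by simp))
  replace ha : 2 * (2 * l 0 - l 1) = a * 2 := (congrArg (2 * ·) (hs 0)).symm.trans
      (ha.trans (congrArg ((a : ℂ) * ·) (g3_cartan.form 0 0)))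
  replace hb : 2 * (3 * l 1 - 3 * l 0) = b * 6 := (congrArg (2 * ·) (hs 1)).symm.trans
      (hb.trans (congrArg ((b : ℂ) * ·) (g3_cartan.form 1 1)))
  replace h1 : -l 0 - l 1 - 2 * l 2 + 2 * (2 * l 0 - l 1) + (3 * l 1 - 3 * l 0) = -2 * n := h1
  replace h2 : n = 0 → -l 0 - l 1 - 2 * l 2 = 0 := h2
  replace h3 : n = 1 → -l 0 - l 1 - 2 * l 2 = 0 ∨
    -l 0 - l 1 - 2 * l 2 + (2 * l 0 - l 1) + 1 = 0 := h3
  have e0 : l 0 = a + b := by linear_combination (1 / 2) * ha + (1 / 6) * hb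
  have e1 : l 1 = a + 2 * b := by linear_combination (1 / 2) * ha + (1 / 3) * hb
  have e2 : l 2 = n := by linear_combination -(1 / 2) * h1
  have hz : ∀ m : ℕ, (m : ℂ) = 0 → m = 0 := fun m hm => by exact_mod_cast hm
  refine ⟨a, b, n, ?_, ?_, ?_⟩
  · rw [g3_rho]
    have : ∀ i : Fin 3, l i + (![2, 3, -5 / 2] : Fin 3 → ℂ) i =
        (![((a + b + 2 : ℤ) : ℂ), ((a + 2 * b + 3 : ℤ) : ℂ), ((2 * n - 5 : ℤ) : ℂ) / 2] :
          Fin 3 → ℂ) i := by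
      intro i
      fin_cases i
      · change l 0 + 2 = ((a + b + 2 : ℤ) : ℂ)
        rw [e0]; push_cast; ring
      · change l 1 + 3 = ((a + 2 * b + 3 : ℤ) : ℂ)
        rw [e1]; push_cast; ring
      · change l 2 + -5 / 2 = ((2 * n - 5 : ℤ) : ℂ) / 2
        rw [e2]; push_cast; ring
    subst hl
    exact funext this
  · rintro rfl
    have h5 := hz (2 * a + 3 * b) (by
      push_cast
      have := h2 rfl
      rw [e0, e1, e2] at this
      push_cast at this
      linear_combination -this)
    omega
  · rintro rfl
    rcases h3 rfl with h5 | h5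
    · have h5 := hz (2 * a + 3 * b + 2) (by
        push_cast
        rw [e0, e1, e2] at h5
        push_cast at h5
        linear_combination -h5)
      omega
    · have h5 := hz (a + 3 * b + 1) (by
        push_cast
        rw [e0, e1, e2] at h5
        push_cast at h5
        linear_combination -h5)
      omega

theorem mem_g3_oddPos {α : Fin 3 → ℂ} : α ∈ g3Datum.oddPos ↔
    ∃ s t : ℤ, (s, t) ∈ ({(0, 0), (1, 0), (-1, 0), (0, 1), (0, -1), (-1, -1), (1, 1)} :
      Finset (ℤ × ℤ)) ∧ α = ![(s : ℂ), (t : ℂ), 1] := by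
  refine Finset.mem_insert.trans ?_
  simp only [Finset.mem_insert, Finset.mem_singleton]
  constructor
  · rintro (rfl | rfl | rfl | rfl | rfl | rfl | rfl)
    exacts [⟨0, 0, by simp⟩, ⟨1, 0, by simp⟩, ⟨-1, 0, by simp⟩, ⟨0, 1, by simp⟩, ⟨0, -1, by simp⟩,
      ⟨-1, -1, by simp⟩, ⟨1, 1, by simp⟩]
  · rintro ⟨s, t, h, rfl⟩
    simp only [Prod.mk.injEq] at h
    rcases h with ⟨rfl, rfl⟩ | ⟨rfl, rfl⟩ | ⟨rfl, rfl⟩ | ⟨rfl, rfl⟩ | ⟨rfl, rfl⟩ | ⟨rfl, rfl⟩ |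
      ⟨rfl, rfl⟩ <;> simp

theorem g3_form_odd (p q k s t : ℤ) :
    g3Datum.form (![(p : ℂ), (q : ℂ), (k : ℂ) / 2] : Fin 3 → ℂ) (![(s : ℂ), (t : ℂ), 1] : Fin 3 → ℂ) =
      ((s * (2 * p - q) + t * (2 * q - p) - k : ℤ) : ℂ) := by
  refine (g3_form _ _).trans ?_
  simp
  ring

/-- The singly atypical weights. -/
theorem g3_cases {γ lam : g3Datum.Vec} (h : g3Datum.DominantIntegral lam)
    (ha : g3Datum.SinglyAtypical γ lam) : ∃ p q k s t : ℤ, q < 2 * p ∧ p < q ∧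
      lam + g3Datum.rho = (![(p : ℂ), (q : ℂ), (k : ℂ) / 2] : Fin 3 → ℂ) ∧
      γ = (![(s : ℂ), (t : ℂ), 1] : Fin 3 → ℂ) ∧ s * (2 * p - q) + t * (2 * q - p) = k ∧
      (0 < k ∨ (k = -5 ∧ p = 2 ∧ q = 3 ∧ s = -1 ∧ t = -1) ∨
        (k = -1 ∧ q = 2 * p - 1 ∧ s = -1 ∧ t = 0)) := by
  obtain ⟨a, b, n, hv, h0, h1⟩ := g3_exists_nat h
  obtain ⟨s, t, hst, hγ⟩ := mem_g3_oddPos.1 ha.1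
  have hat := (congrArg₂ g3Datum.form hv.symm hγ.symm).trans ha.2.1
  rw [g3_form_odd] at hat
  replace hat : (s * (2 * (a + b + 2) - (a + 2 * b + 3)) +
    t * (2 * (a + 2 * b + 3) - (a + b + 2)) - (2 * n - 5) : ℤ) = 0 := by exact_mod_cast hat
  refine ⟨_, _, _, s, t, ?_, ?_, hv, hγ, by linarith, ?_⟩
  · omega
  · omega
  -- Twice the δ-coordinate of λ + ρ is k = 2n - 5, which is negative only for n = 0 and n = 2.
  -- There the strict inequalities for p and q leave a single odd root orthogonal to λ + ρ.
  · obtain rfl | rfl | hn : n = 0 ∨ n = 2 ∨ 2 < n := by omega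
    · obtain ⟨rfl, rfl⟩ := h0 rfl
      simp only [Finset.mem_insert, Finset.mem_singleton, Prod.mk.injEq] at hst
      right; left
      rcases hst with ⟨rfl, rfl⟩ | ⟨rfl, rfl⟩ | ⟨rfl, rfl⟩ | ⟨rfl, rfl⟩ | ⟨rfl, rfl⟩ | ⟨rfl, rfl⟩ |
        ⟨rfl, rfl⟩ <;> omega
    · simp only [Finset.mem_insert, Finset.mem_singleton, Prod.mk.injEq] at hst
      right; right
      rcases hst with ⟨rfl, rfl⟩ | ⟨rfl, rfl⟩ | ⟨rfl, rfl⟩ | ⟨rfl, rfl⟩ | ⟨rfl, rfl⟩ | ⟨rfl, rfl⟩ |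
        ⟨rfl, rfl⟩ <;> omega
    · left; omega

section G3Lead

variable {K : Type} [Field K]

/-- The exponential of `z 0 ε₁ + z 1 ε₂`. -/
def g2Mon (x : K) (z : Fin 3 → ℤ) : LaurentSeries K := g2Var x 0 ^ z 0 * g2Var x 1 ^ z 1

theorem g2Mon_ne_zero {x : K} (hx : x ≠ 0) (z : Fin 3 → ℤ) : g2Mon x z ≠ 0 :=
  mul_ne_zero (zpow_ne_zero _ (g2Var_ne_zero hx 0)) (zpow_ne_zero _ (g2Var_ne_zero hx 1))

theorem g2Mon_add {x : K} (hx : x ≠ 0) (z w : Fin 3 → ℤ) :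
    g2Mon x (z + w) = g2Mon x z * g2Mon x w := by
  simp only [g2Mon, Pi.add_apply, zpow_add₀ (g2Var_ne_zero hx _)]
  ring

theorem g2Mon_neg {x : K} (z : Fin 3 → ℤ) : g2Mon x (-z) = (g2Mon x z)⁻¹ := by
  simp only [g2Mon, Pi.neg_apply, zpow_neg, mul_inv]

theorem g2Mon_add_last (x : K) (z : Fin 3 → ℤ) (k : ℤ) :
    g2Mon x (z + ![0, 0, k]) = g2Mon x z := by
  have h0 : (![0, 0, k] : Fin 3 → ℤ) 0 = 0 := rfl
  have h1 : (![0, 0, k] : Fin 3 → ℤ) 1 = 0 := rfl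
  rw [g2Mon, Pi.add_apply, Pi.add_apply, h0, h1, add_zero, add_zero, g2Mon]

/-- The three variables have product 1, so a common summand of the three exponents does not matter.
-/
theorem g2Mon_g3Act {x : K} (hx : x ≠ 0) (y : (Equiv.Perm (Fin 3) × ℤˣ) × ℤˣ) (z : Fin 3 → ℤ) :
    g2Mon x (g3Act y z) = ∏ p, g2Var x p ^ ((y.1.2 : ℤ) * g3Triple z (y.1.1⁻¹ p)) := by
  have h1 := g2Var_prod hx ((y.1.2 : ℤ) * g3Triple z (y.1.1⁻¹ 2))
    ((y.1.2 : ℤ) * g3Triple z (y.1.1⁻¹ 2)) ((y.1.2 : ℤ) * g3Triple z (y.1.1⁻¹ 2))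
  rw [show ∀ c : ℤ, c - c = 0 from fun c => by ring, show ∀ c : ℤ, 2 * c - c - c = 0 from
    fun c => by ring, zpow_zero] at h1
  replace h1 : _ = (1 : LaurentSeries K) := h1
  have h2 : g2Mon x (g3Act y z) =
      g2Var x 0 ^ ((y.1.2 : ℤ) * (g3Triple z (y.1.1⁻¹ 0) - g3Triple z (y.1.1⁻¹ 2))) *
      g2Var x 1 ^ ((y.1.2 : ℤ) * (g3Triple z (y.1.1⁻¹ 1) - g3Triple z (y.1.1⁻¹ 2))) := rfl
  rw [h2, ← mul_one (_ * _), ← h1, Fin.prod_univ_three, mul_sub, mul_sub,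
    zpow_sub₀ (g2Var_ne_zero hx 0), zpow_sub₀ (g2Var_ne_zero hx 1)]
  have := zpow_ne_zero ((y.1.2 : ℤ) * g3Triple z (y.1.1⁻¹ 2)) (g2Var_ne_zero hx 0)
  have := zpow_ne_zero ((y.1.2 : ℤ) * g3Triple z (y.1.1⁻¹ 2)) (g2Var_ne_zero hx 1)
  field_simp

theorem sum_perm_eq_alt {K : Type} [Field K] (φ : ℂ →+* K) {N : ℕ} (x : Fin N → K)
    (t : Fin N → ℤ) : ∑ σ : Equiv.Perm (Fin N), φ (unitsC (Equiv.Perm.sign σ)) *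
      ∏ p, x p ^ t (σ⁻¹ p) = alt x t := by
  rw [alt, Matrix.det_apply']
  refine Finset.sum_congr rfl fun σ _ => ?_
  rw [unitsC_apply, map_intCast, ← Equiv.prod_comp σ]
  simp

/-- The Weyl group of G₂ is S₃ × {±1}, and -1 has determinant 1 on the plane. The sum is hence an
S₃-alternant plus its value at the opposite exponents. -/
theorem sum_g2Mon (φ : ℂ →+* LaurentSeries K) {x : K} (hx : x ≠ 0) (z : Fin 3 → ℤ) :
    ∑ y : Equiv.Perm (Fin 3) × ℤˣ, φ (unitsC (Equiv.Perm.sign y.1)) * g2Mon x (g3Act (y, 1) z) =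
      alt (g2Var x) (g3Triple z) + alt (g2Var x) (-g3Triple z) := by
  rw [← sum_perm_eq_alt φ, ← sum_perm_eq_alt φ, WeylParam.sum_units, Finset.sum_add_distrib]
  simp only [g2Mon_g3Act hx]
  simp

/-- The Laurent expansion in `e^{-δ}`. -/
def g3Var (x : K) : Fin 3 → LaurentSeries (LaurentSeries K) :=
  ![HahnSeries.C (g2Var x 0), HahnSeries.C (g2Var x 1), HahnSeries.single (-1) 1]

theorem g3Var_ne_zero {x : K} (hx : x ≠ 0) (c : Fin 3) : g3Var x c ≠ 0 := by
  fin_cases c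
  · exact (map_ne_zero_iff _ HahnSeries.C_injective).2 (g2Var_ne_zero hx 0)
  · exact (map_ne_zero_iff _ HahnSeries.C_injective).2 (g2Var_ne_zero hx 1)
  · exact HahnSeries.single_ne_zero one_ne_zero

theorem mon_g3Var (x : K) (z : Fin 3 → ℤ) :
    mon (g3Var x) z = HahnSeries.single (-z 2) (g2Mon x z) := by
  rw [mon, Fin.prod_univ_three]
  change HahnSeries.C (g2Var x 0) ^ z 0 * HahnSeries.C (g2Var x 1) ^ z 1 *
    HahnSeries.single (-1) 1 ^ z 2 = _
  rw [single_zpow, one_zpow, ← map_zpow₀, ← map_zpow₀, ← map_mul, HahnSeries.C_apply,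
    HahnSeries.single_mul_single, mul_one, zero_add, neg_one_mul]
  rfl

/-- The twelve monomials are written through an opaque function `G`, so that identities between
alternants reduce to a cancellation of atoms. -/
theorem alt_g2Var_add_neg {x : K} (hx : x ≠ 0) (p q : ℤ) {G : ℤ → ℤ → LaurentSeries K}
    (hG : ∀ i j, G i j = HahnSeries.single i (x ^ j)) :
    alt (g2Var x) ![p, q, 0] + alt (g2Var x) (-![p, q, 0]) =
      G (-q) (-p - q) - G q (2 * q - p) - G (-p) (-q - p) + G p (2 * p - q) +
      G (q - p) (2 * q - p) - G (p - q) (2 * p - q) + G q (p + q) - G (-q) (p - 2 * q) -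
      G p (q + p) + G (-p) (q - 2 * p) + G (p - q) (p - 2 * q) - G (q - p) (q - 2 * p) := by
  have h0 : (![p, q, 0] : Fin 3 → ℤ) 0 = p := rfl
  have h1 : (![p, q, 0] : Fin 3 → ℤ) 1 = q := rfl
  have h2 : (![p, q, 0] : Fin 3 → ℤ) 2 = 0 := rfl
  rw [alt_g2Var hx, alt_g2Var hx]
  simp only [← hG, Pi.neg_apply, h0, h1, h2]
  ring_nf

/-- The vectors (2 - k, 3 - k) with 0 < k < 5 are singular. For k = 5 the result is (-3, -2), which
arises from (2, 3) by an interchange and the factor -1, an element of determinant -1. -/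
theorem g2_shift_first {x : K} (hx : x ≠ 0) :
    (∀ k : ℕ, 0 < k → k < 5 → alt (g2Var x) ![2 - k, 3 - k, 0] +
      alt (g2Var x) (-![2 - (k : ℤ), 3 - k, 0]) = 0) ∧
    -(alt (g2Var x) ![-3, -2, 0] + alt (g2Var x) (-![-3, -2, 0])) =
      alt (g2Var x) ![2, 3, 0] + alt (g2Var x) (-![2, 3, 0]) := by
  obtain ⟨G, hG⟩ : ∃ G : ℤ → ℤ → LaurentSeries K, ∀ i j, G i j = HahnSeries.single i (x ^ j) :=
    ⟨_, fun _ _ => rfl⟩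
  constructor
  · intro k hk hk'
    rw [alt_g2Var_add_neg hx _ _ hG]
    interval_cases k <;> norm_num <;> ring
  · rw [alt_g2Var_add_neg hx _ _ hG, alt_g2Var_add_neg hx _ _ hG]
    norm_num
    ring

/-- With q = 2p - 1 the weight has value 1 on the coroot of ε₁, so subtracting ε₁ is the simple
reflection in ε₁. -/
theorem g2_shift_second {x : K} (hx : x ≠ 0) (p : ℤ) :
    -(alt (g2Var x) ![p - 1, 2 * p - 1, 0] + alt (g2Var x) (-![p - 1, 2 * p - 1, 0])) =
      alt (g2Var x) ![p, 2 * p - 1, 0] + alt (g2Var x) (-![p, 2 * p - 1, 0]) := by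
  obtain ⟨G, hG⟩ : ∃ G : ℤ → ℤ → LaurentSeries K, ∀ i j, G i j = HahnSeries.single i (x ^ j) :=
    ⟨_, fun _ _ => rfl⟩
  rw [alt_g2Var_add_neg hx _ _ hG, alt_g2Var_add_neg hx _ _ hG]
  ring_nf

theorem g3Act_add_smul (y : (Equiv.Perm (Fin 3) × ℤˣ) × ℤˣ) (z w : Fin 3 → ℤ) (k : ℤ) :
    g3Act y (z + k • w) = g3Act y z + k • g3Act y w := by
  refine eq_of_fin_three ?_ ?_ ?_ <;> simp [-zsmul_eq_mul, g3Act, g3Triple_add, g3Triple_smul] <;> ring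

theorem sum_g2Mon_mul_pow (φ : ℂ →+* LaurentSeries K) {x : K} (hx : x ≠ 0) (p q s t : ℤ) (k : ℕ) :
    ∑ y : Equiv.Perm (Fin 3) × ℤˣ, φ (unitsC (Equiv.Perm.sign y.1)) *
      g2Mon x (g3Act (y, 1) ![p, q, 0] - ![p, q, 0]) * g2Mon x (g3Act (y, 1) ![s, t, 1]) ^ k =
      (alt (g2Var x) ![p + k * s, q + k * t, 0] + alt (g2Var x) (-![p + k * s, q + k * t, 0])) *
        g2Mon x (-![p, q, 0]) := by
  have e : g3Triple (![p, q, 0] + (k : ℤ) • ![s, t, 1]) = ![p + k * s, q + k * t, 0] := by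
    refine eq_of_fin_three ?_ ?_ ?_ <;> simp [g3Triple]
  rw [← e, ← sum_g2Mon φ hx, Finset.sum_mul]
  refine Finset.sum_congr rfl fun y _ => ?_
  rw [g3Act_add_smul, sub_eq_add_neg, g2Mon_add hx, g2Mon_add hx]
  have : ∀ (k : ℕ) (w : Fin 3 → ℤ), g2Mon x ((k : ℤ) • w) = g2Mon x w ^ k := by
    intro k w
    have h : ∀ (u : LaurentSeries K) (n : ℤ), u ^ ((k : ℤ) * n) = (u ^ n) ^ k := fun u n => by
      rw [mul_comm, zpow_mul, zpow_natCast]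
    simp only [g2Mon, Pi.smul_apply, smul_eq_mul, h, mul_pow]
  rw [this]
  ring

theorem normG_eq (x : K) (p q : ℤ) : normG x ![p, q, 0] =
    (alt (g2Var x) ![p, q, 0] + alt (g2Var x) (-![p, q, 0])) * g2Mon x (-![p, q, 0]) := by
  rw [normG, Fin.prod_univ_three, g2Mon]
  simp

theorem g3_exists_lead (φ : ℂ →+* LaurentSeries K) {x : K} (hx : x ≠ 0)
    {γ lam : g3Datum.Vec} {p q k s t : ℤ}
    (hv : lam + g3Datum.rho = (![(p : ℂ), (q : ℂ), (k : ℂ) / 2] : Fin 3 → ℂ))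
    (hγ : γ = (![(s : ℂ), (t : ℂ), 1] : Fin 3 → ℂ))
    (hk : 0 < k ∨ (k = -5 ∧ p = 2 ∧ q = 3 ∧ s = -1 ∧ t = -1) ∨
        (k = -1 ∧ q = 2 * p - 1 ∧ s = -1 ∧ t = 0)) (c : Prop) [Decidable c] :
    ∃ u o a, Specializes (g3Datum.latHom 1)
      (evalMon (HahnSeries.C.comp φ) (g3Var x) (g3Var_ne_zero hx))
      (if c then g3Datum.specialNumerator γ lam else g3Datum.ordinaryNumerator γ lam) u ∧ a ≠ 0 ∧
      Lead u o (φ a * normG x ![p, q, 0]) := by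
  have hK : CharZero (LaurentSeries K) := charZero_of_injective_ringHom φ.injective
  have hg : γ = g3Datum.latEmb 1 (![s, t, 1] : Fin 3 → ℤ) := by
    refine hγ.trans ?_
    have : ∀ i : Fin 3, (![(s : ℂ), (t : ℂ), 1] : Fin 3 → ℂ) i =
        (((![s, t, 1] : Fin 3 → ℤ) i : ℤ) : ℂ) / 1 := by
      intro i
      fin_cases i <;> simp
    exact funext this
  -- The δ-coordinate k/2 of λ + ρ need not be integral, so the parametrization is built directly
  -- and not from a lattice vector. Only the difference under the sign change of δ enters, and it is
  -- the integer -k.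
  let d : (Equiv.Perm (Fin 3) × ℤˣ) × ℤˣ → Fin 3 → ℤ := fun y =>
    g3Act (y.1, 1) ![p, q, 0] - ![p, q, 0] + ![0, 0, if y.2 = 1 then 0 else -k]
  let P : WeylParam g3Datum 1 γ lam ((Equiv.Perm (Fin 3) × ℤˣ) × ℤˣ) :=
    { e := g3Model.toWeyl
      bij := g3Model.toWeyl_bijective
      d := d
      g := fun y => g3Act y ![s, t, 1]
      sg := g3Model.sign
      sgn_eq := g3Model.det_act
      d_eq := fun y => by
        refine (congrArg (fun v : Fin 3 → ℂ => g3Act y v - v) hv).trans ?_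
        have : ∀ i : Fin 3, (g3Act y (![(p : ℂ), (q : ℂ), (k : ℂ) / 2] : Fin 3 → ℂ) -
            ![(p : ℂ), (q : ℂ), (k : ℂ) / 2]) i = ((d y i : ℤ) : ℂ) / 1 := by
          have hT : ∀ j : Fin 3, g3Triple (![(p : ℂ), (q : ℂ), (k : ℂ) / 2] : Fin 3 → ℂ) j =
              ((g3Triple ![p, q, 0] j : ℤ) : ℂ) := by
            intro j
            fin_cases j <;> simp [g3Triple]
          intro i
          fin_cases i
          · simp [d, g3Act, hT]
          · simp [d, g3Act, hT]
          · rcases Int.units_eq_one_or y.2 with h | h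
            · simp [d, g3Act, h]
            · simp [d, g3Act, h]
              ring
        exact funext this
      g_eq := fun y =>
        (congrArg (g3Model.act y) hg).trans (g3Model.act_lat y _) }
  have hP : P.IsSplit (g3Var x) (fun y => unitsC (Equiv.Perm.sign y.1))
      (fun y => g2Mon x (g3Act (y, 1) ![p, q, 0] - ![p, q, 0]))
      (fun y => g2Mon x (g3Act (y, 1) ![s, t, 1])) k := by
    have hd : ∀ y e, mon (κ := g3Datum.κ) (g3Var x) (P.d (y, e)) =
        HahnSeries.single (if e = 1 then 0 else k)
        (g2Mon x (g3Act (y, 1) ![p, q, 0] - ![p, q, 0])) := by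
      intro y e
      refine (mon_g3Var x (d (y, e))).trans ?_
      have h1 : g2Mon x (d (y, e)) = g2Mon x (g3Act (y, 1) ![p, q, 0] - ![p, q, 0]) :=
        g2Mon_add_last x _ _
      rw [h1]
      congr 1
      rcases Int.units_eq_one_or e with rfl | rfl <;> simp [d, g3Act]
    have hgm : ∀ y e, mon (κ := g3Datum.κ) (g3Var x) (-P.g (y, e)) = HahnSeries.single (e : ℤ)
        (g2Mon x (g3Act (y, 1) ![s, t, 1]))⁻¹ := by
      intro y e
      refine (mon_g3Var x (-g3Act (y, e) ![s, t, 1])).trans ?_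
      rw [g2Mon_neg]
      have h1 : g2Mon x (g3Act (y, e) ![s, t, 1]) = g2Mon x (g3Act (y, 1) ![s, t, 1]) := rfl
      rw [h1]
      congr 1
      simp [g3Act]
    constructor
    · exact fun y => g2Mon_ne_zero hx _
    · intro y
      rw [hd, if_pos rfl, HahnSeries.C_apply]
    · intro y
      rw [hd, if_neg (by decide)]
    · exact fun y => hgm y 1
    · exact fun y => hgm y (-1)
    · intro y
      change unitsC (Equiv.Perm.sign y.1 * 1) = _
      rw [mul_one]
    · intro y
      change unitsC (Equiv.Perm.sign y.1 * (-1)) = _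
      rw [map_mul]
      simp [unitsC_apply (-1)]
  have hsum : ∑ y : Equiv.Perm (Fin 3) × ℤˣ, φ (unitsC (Equiv.Perm.sign y.1)) *
      g2Mon x (g3Act (y, 1) ![p, q, 0] - ![p, q, 0]) = normG x ![p, q, 0] := by
    have := sum_g2Mon_mul_pow φ hx p q s t 0
    simpa [normG_eq] using this
  have h := hP.exists_lead φ (g3Var_ne_zero hx) one_ne_zero ?_ c
  · rwa [hsum] at h
  simp only [sum_g2Mon_mul_pow φ hx, hsum, normG_eq]
  rcases hk with hk | ⟨rfl, rfl, rfl, rfl, rfl⟩ | ⟨rfl, rfl, rfl, rfl⟩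
  · exact Or.inl hk
  · refine Or.inr ⟨5, by norm_num, by norm_num, fun k h0 h1 => ?_, ?_⟩
    · rw [mul_neg_one, ← sub_eq_add_neg, ← sub_eq_add_neg, (g2_shift_first hx).1 k h0 h1, zero_mul]
    · rw [← (g2_shift_first hx).2]
      norm_num
      ring
  · refine Or.inr ⟨1, by norm_num, by norm_num, fun k h0 h1 => by omega, ?_⟩
    rw [← g2_shift_second hx]
    norm_num [← sub_eq_add_neg]
    ring

end G3Lead

theorem g3_unique_factorization (special : Set SuperType.G3.datum.Vec)
    (γ : SuperType.G3.datum.Vec) (r s : ℕ) (ν : Fin r → SuperType.G3.datum.Vec)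
    (μ : Fin s → SuperType.G3.datum.Vec)
    (hν : ∀ i, SuperType.G3.datum.DominantIntegral (ν i) ∧
      SuperType.G3.datum.SinglyAtypical γ (ν i))
    (hμ : ∀ j, SuperType.G3.datum.DominantIntegral (μ j) ∧
      SuperType.G3.datum.SinglyAtypical γ (μ j))
    (hU : ∏ i, U .G3 special γ (ν i) = ∏ j, U .G3 special γ (μ j)) :
    ∃ h : r = s, ∃ σ : Equiv.Perm (Fin r),
      ∀ k, U .G3 special γ (ν k) = U .G3 special γ (μ (Fin.cast h (σ k))) := by
  obtain ⟨K, _, φ, x, hx, hne, hfac⟩ := exists_normG_factorization ℂ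
  have hb := fun lam : {lam // g3Datum.DominantIntegral lam ∧ g3Datum.SinglyAtypical γ lam} =>
    g3_cases lam.2.1 lam.2.2
  choose p q k s' t hp hq hv hγ hat hk using hb
  -- Since γ is fixed, `s'` and `t` are the same for all weights, and `hat` expresses `k` through
  -- `p` and `q`.
  have hbi : Function.Injective fun lam => (![p lam, q lam, 0] : Fin 3 → ℤ) := by
    intro lam lam' h
    have ep : p lam = p lam' := congrFun h 0
    have eq : q lam = q lam' := congrFun h 1
    have e := (hγ lam).symm.trans (hγ lam')
    have es : s' lam = s' lam' := by
      have : ((s' lam : ℤ) : ℂ) = s' lam' := congrFun e 0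
      exact_mod_cast this
    have et : t lam = t lam' := by
      have : ((t lam : ℤ) : ℂ) = t lam' := congrFun e 1
      exact_mod_cast this
    have ek : k lam = k lam' := by rw [← hat, ← hat, ep, eq, es, et]
    exact Subtype.ext (add_right_cancel (b := g3Datum.rho)
      ((hv lam).trans (Eq.trans (by rw [ep, eq, ek]) (hv lam').symm)))
  have hu := fun lam : {lam // g3Datum.DominantIntegral lam ∧ g3Datum.SinglyAtypical γ lam} =>
    g3_exists_lead φ hx (hv lam) (hγ lam) (hk lam) (SuperType.G3.IsExceptional ∧ lam.1 ∈ special)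
  choose u o c hu hc hl using hu
  refine exists_perm_of_specializes (g := .G3) one_ne_zero (φ := HahnSeries.C.comp φ)
    (X := g3Var x) (hX := g3Var_ne_zero hx) u (fun lam => ?_) (fun s t h => ?_) hν hμ hU
  · have e : U .G3 special γ lam.1 = if SuperType.G3.IsExceptional ∧ lam.1 ∈ special then
        g3Datum.specialNumerator γ lam.1 else g3Datum.ordinaryNumerator γ lam.1 := rfl
    rw [e]
    exact hu lam
  · exact multiset_eq_of_lead hl
      (fun lam => mul_ne_zero ((map_ne_zero φ).2 (hc lam)) (hne _ (hp lam) (hq lam) rfl))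
      (fun s t h => hfac _ (fun lam => ![p lam, q lam, 0]) c hp hq (fun _ => rfl) hbi hc s t h) h

end SuperFactor
end

/-! ### Unique factorization for the series sl -/

noncomputable section
open scoped Classical
namespace SuperFactor

open RootDatum

/-! ### `𝔰𝔩(m+1,n+1)` -/

section Sl

variable {m n : ℕ}

theorem mem_sl_oddPos {α : Fin (m + 1) ⊕ Fin (n + 1) → ℂ} :
    α ∈ (slDatum m n).oddPos ↔
      ∃ p q, α = Pi.single (Sum.inl p) 1 + (-1 : ℂ) • Pi.single (Sum.inr q) 1 := by
  refine Finset.mem_image.trans ?_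
  simp only [Finset.mem_univ, true_and, neg_one_smul, ← sub_eq_add_neg, slDel, slEps, Prod.exists,
    eq_comm]

theorem slRep_inl (y : Equiv.Perm (Fin (m + 1)) × Equiv.Perm (Fin (n + 1))) (p : Fin (m + 1)) :
    slRep m n y (Pi.single (Sum.inl p) 1) = Pi.single (Sum.inl (y.1 p)) 1 := by
  funext x
  rcases x with x | x
  · change (Pi.single (Sum.inl p) 1 : Fin (m + 1) ⊕ Fin (n + 1) → ℂ) (Sum.inl (y.1⁻¹ x)) = _
    simp only [Pi.single_apply, Sum.inl.injEq, Equiv.Perm.inv_eq_iff_eq]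
  · change (Pi.single (Sum.inl p) 1 : Fin (m + 1) ⊕ Fin (n + 1) → ℂ) (Sum.inr (y.2⁻¹ x)) = _
    simp

theorem slRep_inr (y : Equiv.Perm (Fin (m + 1)) × Equiv.Perm (Fin (n + 1))) (p : Fin (n + 1)) :
    slRep m n y (Pi.single (Sum.inr p) 1) = Pi.single (Sum.inr (y.2 p)) 1 := by
  funext x
  rcases x with x | x
  · change (Pi.single (Sum.inr p) 1 : Fin (m + 1) ⊕ Fin (n + 1) → ℂ) (Sum.inl (y.1⁻¹ x)) = _
    simp
  · change (Pi.single (Sum.inr p) 1 : Fin (m + 1) ⊕ Fin (n + 1) → ℂ) (Sum.inr (y.2⁻¹ x)) = _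
    simp only [Pi.single_apply, Sum.inr.injEq, Equiv.Perm.inv_eq_iff_eq]

theorem slRep_sub (y : Equiv.Perm (Fin (m + 1)) × Equiv.Perm (Fin (n + 1)))
    {u v u' v' : Fin (m + 1) ⊕ Fin (n + 1) → ℂ} (hu : slRep m n y u = u') (hv : slRep m n y v = v') :
    slRep m n y (u + (-1 : ℂ) • v) = u' + (-1 : ℂ) • v' := by
  rw [map_add, map_smul, hu, hv]

/-- A linear form that is positive on the positive even roots. -/
def slHeight (m n : ℕ) : (Fin (m + 1) ⊕ Fin (n + 1) → ℂ) →ₗ[ℂ] ℂ :=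
  ∑ p : Fin (m + 1), (-((p : ℕ) : ℂ)) • LinearMap.proj (Sum.inl p) +
    ∑ q : Fin (n + 1), (-((q : ℕ) : ℂ)) • LinearMap.proj (Sum.inr q)

theorem slHeight_inl (p : Fin (m + 1)) :
    slHeight m n (Pi.single (Sum.inl p) 1) = ((-(p : ℕ) : ℝ) : ℂ) := by
  simp [slHeight, Pi.single_apply, LinearMap.sum_apply]

theorem slHeight_inr (q : Fin (n + 1)) :
    slHeight m n (Pi.single (Sum.inr q) 1) = ((-(q : ℕ) : ℝ) : ℂ) := by
  simp [slHeight, Pi.single_apply, LinearMap.sum_apply]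

theorem slHeight_pos (β : (slDatum m n).Vec) (hβ : β ∈ (slDatum m n).evenPos) :
    0 < (slHeight m n β).re := by
  rcases mem_sl_evenPos.1 hβ with ⟨p, q, hpq, rfl⟩ | ⟨p, q, hpq, rfl⟩
  · rw [map_add, map_smul, slHeight_inl, slHeight_inl]
    simpa using hpq
  · rw [map_add, map_smul, slHeight_inr, slHeight_inr]
    simpa using hpq

theorem sl_gram : (slDatum m n).gram = Matrix.diagonal (Sum.elim (fun _ => 1) (fun _ => -1)) := rfl

theorem swap_lt_swap {N : ℕ} {p q a b : Fin N} (hpq : (q : ℕ) = p + 1) (hab : a < b)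
    (h : ¬ (a = p ∧ b = q)) : Equiv.swap p q a < Equiv.swap p q b := by
  simp only [Equiv.swap_apply_def, Fin.ext_iff, Fin.lt_def] at h hab ⊢
  split_ifs <;> omega

theorem slRep_oddPos (y : Equiv.Perm (Fin (m + 1)) × Equiv.Perm (Fin (n + 1)))
    (β : (slDatum m n).Vec) (hβ : β ∈ (slDatum m n).oddPos) :
    slRep m n y β ∈ (slDatum m n).oddPos := by
  obtain ⟨a, b, rfl⟩ := mem_sl_oddPos.1 hβ
  exact mem_sl_oddPos.2 ⟨_, _, slRep_sub y (slRep_inl y a) (slRep_inr y b)⟩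

theorem sl_two_form_rho_inl {p q : Fin (m + 1)} (hpq : (q : ℕ) = p + 1) {α : (slDatum m n).Vec}
    (hα : α = Pi.single (Sum.inl p) 1 + (-1 : ℂ) • Pi.single (Sum.inl q) 1) :
    2 * (slDatum m n).form (slDatum m n).rho α = (slDatum m n).form α α := by
  have hlt : p < q := by rw [Fin.lt_def]; omega
  have hm := (mem_sl_evenPos (α := α)).2 (Or.inl ⟨p, q, hlt, hα⟩)
  refine two_form_rho hm ((slModel m n).nondeg α hm) (slHeight m n) slHeight_pos
    (slRep m n (Equiv.swap p q, 1)) (slAct_swap_inl hlt hα) (fun β hβ hne => ?_) (slRep_oddPos _)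
  refine mem_sl_evenPos.2 ?_
  rcases mem_sl_evenPos.1 hβ with ⟨a, b, hab, rfl⟩ | ⟨a, b, hab, rfl⟩
  · refine Or.inl ⟨_, _, swap_lt_swap hpq hab ?_, slRep_sub _ (slRep_inl _ a) (slRep_inl _ b)⟩
    rintro ⟨rfl, rfl⟩
    exact hne hα.symm
  · exact Or.inr ⟨_, _, hab, slRep_sub _ (slRep_inr _ a) (slRep_inr _ b)⟩

theorem sl_two_form_rho_inr {p q : Fin (n + 1)} (hpq : (q : ℕ) = p + 1) {α : (slDatum m n).Vec}
    (hα : α = Pi.single (Sum.inr p) 1 + (-1 : ℂ) • Pi.single (Sum.inr q) 1) :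
    2 * (slDatum m n).form (slDatum m n).rho α = (slDatum m n).form α α := by
  have hlt : p < q := by rw [Fin.lt_def]; omega
  have hm := (mem_sl_evenPos (α := α)).2 (Or.inr ⟨p, q, hlt, hα⟩)
  refine two_form_rho hm ((slModel m n).nondeg α hm) (slHeight m n) slHeight_pos
    (slRep m n (1, Equiv.swap p q)) (slAct_swap_inr hlt hα) (fun β hβ hne => ?_) (slRep_oddPos _)
  refine mem_sl_evenPos.2 ?_
  rcases mem_sl_evenPos.1 hβ with ⟨a, b, hab, rfl⟩ | ⟨a, b, hab, rfl⟩
  · exact Or.inl ⟨_, _, hab, slRep_sub _ (slRep_inl _ a) (slRep_inl _ b)⟩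
  · refine Or.inr ⟨_, _, swap_lt_swap hpq hab ?_, slRep_sub _ (slRep_inr _ a) (slRep_inr _ b)⟩
    rintro ⟨rfl, rfl⟩
    exact hne hα.symm

theorem sl_simple_inl (j : Fin m) : (slDatum m n).simple (Sum.inl j) =
    (Pi.single (Sum.inl j.castSucc) 1 + (-1 : ℂ) • Pi.single (Sum.inl j.succ) 1 :
      Fin (m + 1) ⊕ Fin (n + 1) → ℂ) := by
  have h : slEps m n j.castSucc - slEps m n j.succ =
      Pi.single (Sum.inl j.castSucc) 1 + (-1 : ℂ) • Pi.single (Sum.inl j.succ) 1 := by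
    rw [neg_one_smul]
    exact sub_eq_add_neg _ _
  exact h

theorem sl_simple_inr (j : Fin n) : (slDatum m n).simple (Sum.inr (Sum.inr j)) =
    (Pi.single (Sum.inr j.castSucc) 1 + (-1 : ℂ) • Pi.single (Sum.inr j.succ) 1 :
      Fin (m + 1) ⊕ Fin (n + 1) → ℂ) := by
  have h : slDel m n j.castSucc - slDel m n j.succ =
      Pi.single (Sum.inr j.castSucc) 1 + (-1 : ℂ) • Pi.single (Sum.inr j.succ) 1 := by
    rw [neg_one_smul]
    exact sub_eq_add_neg _ _
  exact h

theorem sl_exists_inl {lam : (slDatum m n).Vec} (h : (slDatum m n).DominantIntegral lam)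
    (j : Fin m) : ∃ k : ℤ, 0 < k ∧ (lam + (slDatum m n).rho) (Sum.inl j.castSucc) -
      (lam + (slDatum m n).rho) (Sum.inl j.succ) = k := by
  have hs := sl_simple_inl (n := n) j
  have hne := form_pair_self (D := slDatum m n) sl_gram (k := -1) (c := Sum.inl j.castSucc)
    (c' := Sum.inl j.succ) (fun h => (Fin.castSucc_lt_succ (i := j)).ne (Sum.inl_injective h))
    (by norm_num) rfl
  obtain ⟨k, hk, h2⟩ := h.exists_pos (i := Sum.inl j) rfl (by
    rw [hs]; exact fun h0 => absurd (hne.symm.trans h0) (by simp))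
    (sl_two_form_rho_inl (p := j.castSucc) (q := j.succ) (by simp) hs)
  refine ⟨k, hk, ?_⟩
  have h3 := form_pair (D := slDatum m n) sl_gram (lam + (slDatum m n).rho) (-1)
    (Sum.inl j.castSucc) (Sum.inl j.succ)
  rw [hs] at h2
  have h4 := (congrArg (2 * ·) h3).symm.trans (h2.trans (congrArg ((k : ℂ) * ·) hne))
  simp only [Sum.elim_inl] at h4
  linear_combination (1 / 2) * h4

theorem sl_exists_inr {lam : (slDatum m n).Vec} (h : (slDatum m n).DominantIntegral lam)
    (j : Fin n) : ∃ k : ℤ, 0 < k ∧ (lam + (slDatum m n).rho) (Sum.inr j.castSucc) -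
      (lam + (slDatum m n).rho) (Sum.inr j.succ) = k := by
  have hs := sl_simple_inr (m := m) j
  have hne := form_pair_self (D := slDatum m n) sl_gram (k := -1) (c := Sum.inr j.castSucc)
    (c' := Sum.inr j.succ) (fun h => (Fin.castSucc_lt_succ (i := j)).ne (Sum.inr_injective h))
    (by norm_num) rfl
  obtain ⟨k, hk, h2⟩ := h.exists_pos (i := Sum.inr (Sum.inr j)) rfl (by
    rw [hs]; exact fun h0 => absurd (hne.symm.trans h0) (by simp))
    (sl_two_form_rho_inr (p := j.castSucc) (q := j.succ) (by simp) hs)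
  refine ⟨k, hk, ?_⟩
  have h3 := form_pair (D := slDatum m n) sl_gram (lam + (slDatum m n).rho) (-1)
    (Sum.inr j.castSucc) (Sum.inr j.succ)
  rw [hs] at h2
  have h4 := (congrArg (2 * ·) h3).symm.trans (h2.trans (congrArg ((k : ℂ) * ·) hne))
  simp only [Sum.elim_inr] at h4
  linear_combination -(1 / 2) * h4

/-- The coordinates are integral only up to a common constant, which is fixed by prescribing the
place `c` of the zero entry. The last place is taken for ε and the first for δ. -/
theorem exists_strictAnti {N : ℕ} {f : Fin (N + 1) → ℂ}
    (h : ∀ j : Fin N, ∃ k : ℤ, 0 < k ∧ f j.castSucc - f j.succ = k) (c : Fin (N + 1)) :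
    ∃ a : Fin (N + 1) → ℤ, StrictAnti a ∧ a c = 0 ∧ ∀ p, f p = f c + a p := by
  have h1 : ∀ p, ∃ k : ℤ, f p = f (Fin.last N) + k := by
    intro p
    induction p using Fin.reverseInduction with
    | last => exact ⟨0, by simp⟩
    | cast j ih =>
      obtain ⟨k, e⟩ := ih
      obtain ⟨k', -, e'⟩ := h j
      exact ⟨k + k', by push_cast; linear_combination e + e'⟩
  choose a ha using h1
  refine ⟨fun p => a p - a c, ?_, sub_self _, fun p => ?_⟩
  · rw [Fin.strictAnti_iff_succ_lt]
    intro j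
    obtain ⟨k, hk, e⟩ := h j
    rw [ha, ha j.succ] at e
    have e' : a j.castSucc - a j.succ = k := by
      have : ((a j.castSucc - a j.succ : ℤ) : ℂ) = k := by push_cast; linear_combination e
      exact_mod_cast this
    change a j.succ - a c < a j.castSucc - a c
    omega
  · push_cast
    linear_combination ha p - ha c

theorem sum_eq_zero_of_mem_hStar {v : Fin (m + 1) ⊕ Fin (n + 1) → ℂ}
    (hv : v ∈ (slDatum m n).hStar) : ∑ c, v c = 0 := by
  have h : (slDatum m n).hStar ≤
      LinearMap.ker (∑ c, LinearMap.proj c : (Fin (m + 1) ⊕ Fin (n + 1) → ℂ) →ₗ[ℂ] ℂ) := by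
    refine Submodule.span_le.2 ?_
    have hp : ∀ c c', (Pi.single c 1 + (-1 : ℂ) • Pi.single c' 1 : Fin (m + 1) ⊕ Fin (n + 1) → ℂ) ∈
        LinearMap.ker (∑ c, LinearMap.proj c : (Fin (m + 1) ⊕ Fin (n + 1) → ℂ) →ₗ[ℂ] ℂ) := by
      intro c c'
      rw [LinearMap.mem_ker, LinearMap.sum_apply]
      simp only [LinearMap.proj_apply, Pi.add_apply, Pi.smul_apply, Finset.sum_add_distrib,
        ← Finset.smul_sum, Finset.sum_pi_single']
      simp
    rintro α (hα | hα)
    · rcases mem_sl_evenPos.1 hα with ⟨p, q, -, rfl⟩ | ⟨p, q, -, rfl⟩ <;> exact hp _ _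
    · obtain ⟨p, q, rfl⟩ := mem_sl_oddPos.1 hα
      exact hp _ _
  have h1 : (∑ c, LinearMap.proj c : (Fin (m + 1) ⊕ Fin (n + 1) → ℂ) →ₗ[ℂ] ℂ) v = 0 := h hv
  rwa [LinearMap.sum_apply] at h1

theorem RootDatum.rho_mem_hStar (D : RootDatum) : D.rho ∈ D.hStar :=
  Submodule.sub_mem _
    (Submodule.smul_mem _ _ (Submodule.sum_mem _ fun _ hα =>
      Submodule.subset_span (Or.inl hα)))
    (Submodule.smul_mem _ _ (Submodule.sum_mem _ fun _ hα =>
      Submodule.subset_span (Or.inr hα)))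

theorem alt_eq_zero {K : Type} [Field K] {N : ℕ} (x : Fin N → K) {t : Fin N → ℤ}
    (h : ¬ Function.Injective t) : alt x t = 0 := by
  rw [Function.Injective] at h
  push Not at h
  obtain ⟨p, q, hpq, hne⟩ := h
  exact Matrix.det_zero_of_column_eq hne fun r => by simp [hpq]

theorem map_alt {K L : Type} [Field K] [Field L] (ψ : K →+* L) {N : ℕ} (x : Fin N → K)
    (t : Fin N → ℤ) : alt (fun p => ψ (x p)) t = ψ (alt x t) := by
  rw [alt, alt, RingHom.map_det]
  congr 1
  ext p q
  simp [map_zpow₀]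

/-- Inverting the variables and reversing their order turns a decreasing sequence into the
decreasing sequence of its reversed negatives, and an increase of an entry into a decrease. -/
theorem alt_inv_rev {K : Type} [Field K] {N : ℕ} (x : Fin N → K) (t : Fin N → ℤ) :
    alt (fun q => (x q.rev)⁻¹) t = alt x fun q => -t q.rev := by
  rw [alt, alt, ← Matrix.det_submatrix_equiv_self Fin.revPerm]
  congr 1
  ext p q
  simp

/-- A decrease by more than the total spread puts the entry `i` below all others. -/
theorem exists_injective_shift {N : ℕ} {a : Fin (N + 1) → ℤ} (ha : StrictAnti a) (i : Fin (N + 1))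
    {k : ℤ} (hk : a 0 - a (Fin.last N) < k) : Function.Injective (shift a i k) := by
  have h : ∀ q, q ≠ i → shift a i k i < shift a i k q := by
    intro q hq
    rw [shift, Function.update_self, Function.update_of_ne hq]
    have h1 := ha.antitone (Fin.zero_le i)
    have h2 := ha.antitone (Fin.le_last q)
    omega
  intro p q hpq
  by_contra hne
  by_cases hp : p = i
  · subst hp
    exact (h q (Ne.symm hne)).ne hpq
  · by_cases hq : q = i
    · subst hq
      exact (h p hp).ne hpq.symm
    · rw [shift, Function.update_of_ne hp, Function.update_of_ne hq] at hpq
      exact hne (ha.injective hpq)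

section Lead

variable {K : Type} [Field K]

/-- The Laurent expansion of the exponentials. -/
def slVar (x : Fin (m + 1) → K) (w : Fin (n + 1) → K) :
    Fin (m + 1) ⊕ Fin (n + 1) → LaurentSeries K :=
  Sum.elim (fun p => HahnSeries.single (-1) (x p)) fun q => HahnSeries.C (w q)

theorem slVar_ne_zero {x : Fin (m + 1) → K} {w : Fin (n + 1) → K} (hx : ∀ p, x p ≠ 0)
    (hw : ∀ q, w q ≠ 0) (c : Fin (m + 1) ⊕ Fin (n + 1)) : slVar x w c ≠ 0 := by
  rcases c with c | c
  · exact HahnSeries.single_ne_zero (hx c)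
  · exact (map_ne_zero_iff _ HahnSeries.C_injective).2 (hw c)

theorem prod_single {I : Type} (s : Finset I) (f : I → ℤ) (c : I → K) :
    ∏ p ∈ s, (HahnSeries.single (f p) (c p) : LaurentSeries K) =
      HahnSeries.single (∑ p ∈ s, f p) (∏ p ∈ s, c p) := by
  induction s using Finset.induction_on with
  | empty => rfl
  | insert a s ha ih =>
    rw [Finset.prod_insert ha, Finset.prod_insert ha, Finset.sum_insert ha, ih,
      HahnSeries.single_mul_single]

theorem mon_slVar (x : Fin (m + 1) → K) (w : Fin (n + 1) → K)
    (z : Fin (m + 1) ⊕ Fin (n + 1) → ℤ) : mon (slVar x w) z =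
      HahnSeries.single (-∑ p, z (Sum.inl p))
        ((∏ p, x p ^ z (Sum.inl p)) * ∏ q, w q ^ z (Sum.inr q)) := by
  rw [mon, Fintype.prod_sum_type]
  simp only [slVar, Sum.elim_inl, Sum.elim_inr, single_zpow, prod_single, ← map_zpow₀, ← map_prod]
  rw [HahnSeries.C_apply, HahnSeries.single_mul_single, add_zero]
  congr 1
  simp

/-- The coefficients of the expansion of a numerator. -/
theorem sl_sum_mul_pow (φ : ℂ →+* K) {x : Fin (m + 1) → K} {w : Fin (n + 1) → K}
    (hx : ∀ p, x p ≠ 0) (hw : ∀ q, w q ≠ 0) (z g : Fin (m + 1) ⊕ Fin (n + 1) → ℤ) (k : ℕ) :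
    ∑ y : Equiv.Perm (Fin (m + 1)) × Equiv.Perm (Fin (n + 1)),
      φ (unitsC (Equiv.Perm.sign y.1 * Equiv.Perm.sign y.2)) *
      ((∏ p, x p ^ (slAct y z - z) (Sum.inl p)) * ∏ q, w q ^ (slAct y z - z) (Sum.inr q)) *
      ((∏ p, x p ^ (-slAct y g) (Sum.inl p)) * ∏ q, w q ^ (-slAct y g) (Sum.inr q)) ^ k =
    alt x (fun p => z (Sum.inl p) - k * g (Sum.inl p)) *
      alt w (fun q => z (Sum.inr q) - k * g (Sum.inr q)) *
      ((∏ p, x p ^ (-z (Sum.inl p))) * ∏ q, w q ^ (-z (Sum.inr q))) := by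
  rw [← sum_perm_eq_alt φ x, ← sum_perm_eq_alt φ w, Fintype.sum_mul_sum, ← Fintype.sum_prod_type',
    Finset.sum_mul]
  refine Finset.sum_congr rfl fun y _ => ?_
  have h : ∀ (N : ℕ) (x : Fin N → K), (∀ p, x p ≠ 0) → ∀ z z' g : Fin N → ℤ,
      (∏ p, x p ^ (z' p - z p)) * (∏ p, x p ^ (-g p)) ^ k =
        (∏ p, x p ^ (z' p - k * g p)) * ∏ p, x p ^ (-z p) := by
    intro N x hx z z' g
    rw [← Finset.prod_pow, ← Finset.prod_mul_distrib, ← Finset.prod_mul_distrib]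
    refine Finset.prod_congr rfl fun p _ => ?_
    rw [← zpow_natCast, ← zpow_mul, ← zpow_add₀ (hx p), ← zpow_add₀ (hx p)]
    congr 1
    ring
  have h1 := h _ x hx (fun p => z (Sum.inl p)) (fun p => z (Sum.inl (y.1⁻¹ p)))
    fun p => g (Sum.inl (y.1⁻¹ p))
  have h2 := h _ w hw (fun p => z (Sum.inr p)) (fun p => z (Sum.inr (y.2⁻¹ p)))
    fun p => g (Sum.inr (y.2⁻¹ p))
  rw [map_mul, map_mul, mul_pow]
  simp only [Pi.sub_apply, Pi.neg_apply, slAct, Sum.elim_inl, Sum.elim_inr]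
  calc _ = φ (unitsC (Equiv.Perm.sign y.1)) * φ (unitsC (Equiv.Perm.sign y.2)) *
        ((∏ p, x p ^ (z (Sum.inl (y.1⁻¹ p)) - z (Sum.inl p))) *
          (∏ p, x p ^ (-g (Sum.inl (y.1⁻¹ p)))) ^ k) *
        ((∏ p, w p ^ (z (Sum.inr (y.2⁻¹ p)) - z (Sum.inr p))) *
          (∏ p, w p ^ (-g (Sum.inr (y.2⁻¹ p)))) ^ k) := by ring
    _ = _ := by rw [h1, h2]; ring

theorem lead_sub_of_coeff {Y : Type} [Fintype Y] {a z : Y → K} {M : ℕ} (hM : 0 < M)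
    (h0 : ∀ k : ℕ, 0 < k → k < M → ∑ y, a y * z y ^ k = 0) :
    Lead (∑ y, HahnSeries.C (a y) * (1 + HahnSeries.single (1 : ℤ) (z y))⁻¹ -
      HahnSeries.single 0 (∑ y, a y) : LaurentSeries K) M ((-1) ^ M * ∑ y, a y * z y ^ M) := by
  refine (lead_sum_sub_inv hM h0).neg.congr ?_ rfl (neg_neg _)
  rw [← HahnSeries.C_apply, map_sum, ← Finset.sum_neg_distrib, ← Finset.sum_sub_distrib]
  refine Finset.sum_congr rfl fun y _ => ?_
  ring

/-- The Weyl group preserves the sum of the ε-coordinates, so e^{w(λ+ρ)-(λ+ρ)} does not involve T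
and e^{-wγ} is T times a unit. The geometric series then give (-1)^k A k as coefficient of T^k. -/
theorem sl_exists_lead (φ : ℂ →+* K) {x : Fin (m + 1) → K} {w : Fin (n + 1) → K}
    (hx : ∀ p, x p ≠ 0) (hw : ∀ q, w q ≠ 0) {γ lam : (slDatum m n).Vec} {i : Fin (m + 1)}
    {j : Fin (n + 1)}
    (hγ : γ = (Pi.single (Sum.inl i) 1 + (-1 : ℂ) • Pi.single (Sum.inr j) 1 :
      Fin (m + 1) ⊕ Fin (n + 1) → ℂ))
    {a : Fin (m + 1) → ℤ} {b : Fin (n + 1) → ℤ} {s t : ℂ}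
    (ha : ∀ p, (lam + (slDatum m n).rho) (Sum.inl p) = s + a p)
    (hb : ∀ q, (lam + (slDatum m n).rho) (Sum.inr q) = t + b q) {A : ℕ → K}
    (hA : ∀ k, A k = alt x (shift a i k) * alt w (shift b j (-k)) *
      ((∏ p, x p ^ (-a p)) * ∏ q, w q ^ (-b q)))
    {e : ℕ} (he : 0 < e) (h0 : ∀ k : ℕ, 0 < k → k < e → A k = 0) :
    ∃ u, Specializes ((slDatum m n).latHom 1)
      (evalMon (HahnSeries.C.comp φ) (slVar x w) (slVar_ne_zero hx hw))
      ((slDatum m n).ordinaryNumerator γ lam) u ∧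
      Lead (u - HahnSeries.single 0 (A 0)) e ((-1) ^ e * A e) := by
  obtain ⟨g, hg⟩ : ∃ g : Fin (m + 1) ⊕ Fin (n + 1) → ℤ,
      g = Sum.elim (Pi.single i 1) (Pi.single j (-1)) := ⟨_, rfl⟩
  have hγg : γ = (slDatum m n).latEmb 1 g := by
    refine hγ.trans (funext fun c => ?_)
    change _ = ((g c : ℤ) : ℂ) / 1
    rw [hg]
    rcases c with c | c
    · simp [Pi.single_apply]
    · simp only [Sum.elim_inr, Pi.single_apply, Pi.add_apply, Pi.smul_apply]
      split_ifs <;> simp_all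
  obtain ⟨v₀, hv₀⟩ : ∃ v₀ : (slDatum m n).Vec, v₀ =
      (Sum.elim (fun _ => s) fun _ => t : Fin (m + 1) ⊕ Fin (n + 1) → ℂ) := ⟨_, rfl⟩
  have hz : lam + (slDatum m n).rho = v₀ + (slDatum m n).latEmb 1 (Sum.elim a b) := by
    subst hv₀
    refine funext fun c => ?_
    rcases c with c | c
    · refine (ha c).trans ?_
      change _ = s + (a c : ℂ) / 1
      rw [div_one]
    · refine (hb c).trans ?_
      change _ = t + (b c : ℂ) / 1
      rw [div_one]
  have hinv : ∀ y, (slModel m n).act y v₀ = v₀ := by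
    intro y
    subst hv₀
    refine funext fun c => ?_
    rcases c with c | c <;> rfl
  let P := (slModel m n).param hinv hz hγg
  have hd : ∀ y, mon (κ := (slDatum m n).κ) (slVar x w) (P.d y) =
      HahnSeries.C ((∏ p, x p ^ (slAct y (Sum.elim a b) - Sum.elim a b) (Sum.inl p)) *
        ∏ q, w q ^ (slAct y (Sum.elim a b) - Sum.elim a b) (Sum.inr q)) := by
    intro y
    refine (mon_slVar x w (slAct y (Sum.elim a b) - Sum.elim a b)).trans ?_
    rw [HahnSeries.C_apply]
    congr 1
    have h1 : ∑ p, (a (y.1⁻¹ p) - a p) = 0 := by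
      rw [Finset.sum_sub_distrib, Equiv.sum_comp, sub_self]
    exact congrArg HahnSeries.single (neg_eq_zero.2 h1)
  have hgy : ∀ y, mon (κ := (slDatum m n).κ) (slVar x w) (-P.g y) =
      HahnSeries.single 1 ((∏ p, x p ^ (-slAct y g) (Sum.inl p)) *
        ∏ q, w q ^ (-slAct y g) (Sum.inr q)) := by
    intro y
    refine (mon_slVar x w (-slAct y g)).trans ?_
    congr 1
    have h1 : ∑ p, (Pi.single i 1 : Fin (m + 1) → ℤ) (y.1⁻¹ p) = 1 := by
      rw [Equiv.sum_comp y.1⁻¹ (Pi.single i 1 : Fin (m + 1) → ℤ)]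
      simp
    have h2 : -∑ p, -(Pi.single i 1 : Fin (m + 1) → ℤ) (y.1⁻¹ p) = 1 := by
      rw [Finset.sum_neg_distrib, neg_neg, h1]
    rw [hg]
    exact congrArg HahnSeries.single h2
  have hsum : ∀ k : ℕ, ∑ y : Equiv.Perm (Fin (m + 1)) × Equiv.Perm (Fin (n + 1)),
      φ (unitsC (Equiv.Perm.sign y.1 * Equiv.Perm.sign y.2)) *
      ((∏ p, x p ^ (slAct y (Sum.elim a b) - Sum.elim a b) (Sum.inl p)) *
        ∏ q, w q ^ (slAct y (Sum.elim a b) - Sum.elim a b) (Sum.inr q)) *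
      ((∏ p, x p ^ (-slAct y g) (Sum.inl p)) * ∏ q, w q ^ (-slAct y g) (Sum.inr q)) ^ k = A k := by
    intro k
    rw [sl_sum_mul_pow φ hx hw, hA]
    congr 2
    · congr 1
      funext p
      by_cases hp : p = i
      · subst hp; simp [hg, shift]
      · simp [hg, shift, hp]
    · congr 1
      funext p
      by_cases hp : p = j
      · subst hp; simp [hg, shift]
      · simp [hg, shift, hp]
  refine ⟨_, P.specializes_ordinary one_ne_zero fun y => ?_, ?_⟩
  · rw [hgy]; exact one_add_single_ne_zero _
  · have h1 := lead_sub_of_coeff he fun k h1 h2 => (hsum k).trans (h0 k h1 h2)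
    rw [hsum] at h1
    have h2 := hsum 0
    simp only [pow_zero, mul_one] at h2
    rw [h2] at h1
    convert h1 using 2
    refine Finset.sum_congr rfl fun y _ => ?_
    rw [hd, hgy, map_mul (HahnSeries.C) (φ _), div_eq_mul_inv, mul_assoc]
    rfl

end Lead

/-- Atypicality determines s + t, and the vanishing of all coordinate sums determines (m+1) s +
(n+1) t. For m ≠ n the two equations have only one solution. -/
theorem sl_ext (hmn : m ≠ n) {v v' : (slDatum m n).Vec} (hv : v ∈ (slDatum m n).hStar)
    (hv' : v' ∈ (slDatum m n).hStar) {a : Fin (m + 1) → ℤ} {b : Fin (n + 1) → ℤ} {s t s' t' : ℂ}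
    (ha : ∀ p, v (Sum.inl p) = s + a p) (hb : ∀ q, v (Sum.inr q) = t + b q)
    (ha' : ∀ p, v' (Sum.inl p) = s' + a p) (hb' : ∀ q, v' (Sum.inr q) = t' + b q)
    {i : Fin (m + 1)} {j : Fin (n + 1)} (h : v (Sum.inl i) + v (Sum.inr j) = 0)
    (h' : v' (Sum.inl i) + v' (Sum.inr j) = 0) : v = v' := by
  have e : ∑ p : Fin (m + 1), v (Sum.inl p) + ∑ q : Fin (n + 1), v (Sum.inr q) = 0 :=
    (Fintype.sum_sum_type fun c : Fin (m + 1) ⊕ Fin (n + 1) => v c).symm.trans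
      (sum_eq_zero_of_mem_hStar hv)
  have e' : ∑ p : Fin (m + 1), v' (Sum.inl p) + ∑ q : Fin (n + 1), v' (Sum.inr q) = 0 :=
    (Fintype.sum_sum_type fun c : Fin (m + 1) ⊕ Fin (n + 1) => v' c).symm.trans
      (sum_eq_zero_of_mem_hStar hv')
  simp only [ha, hb, Finset.sum_add_distrib, Finset.sum_const, Finset.card_univ, Fintype.card_fin,
    nsmul_eq_mul] at e h
  simp only [ha', hb', Finset.sum_add_distrib, Finset.sum_const, Finset.card_univ, Fintype.card_fin,
    nsmul_eq_mul] at e' h'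
  push_cast at e e'
  have h1 : s + t = s' + t' := by linear_combination h - h'
  have h2 : ((m : ℂ) - n) * (s - s') = 0 := by linear_combination e - e' - (n + 1 : ℂ) * h1
  have h3 : s = s' := by
    rcases mul_eq_zero.1 h2 with h3 | h3
    · exact absurd (by exact_mod_cast sub_eq_zero.1 h3) hmn
    · exact sub_eq_zero.1 h3
  have h4 : t = t' := by linear_combination h1 - h3
  refine funext fun c => ?_
  rcases c with c | c
  · rw [ha, ha', h3]
  · rw [hb, hb', h4]

theorem sl_unique_factorization (hmn : m ≠ n) (special : Set (SuperType.sl m n hmn).datum.Vec)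
    (γ : (SuperType.sl m n hmn).datum.Vec) (r s : ℕ) (ν : Fin r → (SuperType.sl m n hmn).datum.Vec)
    (μ : Fin s → (SuperType.sl m n hmn).datum.Vec)
    (hν : ∀ i, (SuperType.sl m n hmn).datum.DominantIntegral (ν i) ∧
      (SuperType.sl m n hmn).datum.SinglyAtypical γ (ν i))
    (hμ : ∀ j, (SuperType.sl m n hmn).datum.DominantIntegral (μ j) ∧
      (SuperType.sl m n hmn).datum.SinglyAtypical γ (μ j))
    (hU : ∏ i, U (.sl m n hmn) special γ (ν i) = ∏ j, U (.sl m n hmn) special γ (μ j)) :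
    ∃ h : r = s, ∃ σ : Equiv.Perm (Fin r),
      ∀ k, U (.sl m n hmn) special γ (ν k) = U (.sl m n hmn) special γ (μ (Fin.cast h (σ k))) := by
  -- If γ is not an odd root there are no weights to consider, and the indices are arbitrary.
  obtain ⟨i, j, hγ⟩ : ∃ i j, γ ∈ (slDatum m n).oddPos →
      γ = (Pi.single (Sum.inl i) 1 + (-1 : ℂ) • Pi.single (Sum.inr j) 1 :
        Fin (m + 1) ⊕ Fin (n + 1) → ℂ) := by
    by_cases h : γ ∈ (slDatum m n).oddPos
    · obtain ⟨i, j, h⟩ := mem_sl_oddPos.1 h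
      exact ⟨i, j, fun _ => h⟩
    · exact ⟨0, 0, fun h' => absurd h' h⟩
  -- The variables for δ are generic over the field that contains the variables for ε. Products of
  -- the two kinds of quotients are then independent by `LinIndep.tower`.
  obtain ⟨K₁, _, φ₁, x₁, hx₁⟩ := exists_genericVars ℂ m
  obtain ⟨K, _, φ₂, x₂, hx₂⟩ := exists_genericVars K₁ n
  set x : Fin (m + 1) → K := fun p => φ₂ (x₁ p) with hxdef
  set w : Fin (n + 1) → K := fun q => (x₂ q.rev)⁻¹ with hwdef
  have hx : ∀ p, x p ≠ 0 := fun p => (map_ne_zero φ₂).2 (hx₁.ne_zero p)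
  have hw : ∀ q, w q ≠ 0 := fun q => inv_ne_zero (hx₂.ne_zero _)
  have ha := fun lam : {lam // (slDatum m n).DominantIntegral lam ∧
    (slDatum m n).SinglyAtypical γ lam} => exists_strictAnti
      (f := fun p => (lam.1 + (slDatum m n).rho) (Sum.inl p)) (sl_exists_inl lam.2.1) (Fin.last m)
  have hb := fun lam : {lam // (slDatum m n).DominantIntegral lam ∧
    (slDatum m n).SinglyAtypical γ lam} => exists_strictAnti
      (f := fun p => (lam.1 + (slDatum m n).rho) (Sum.inr p)) (sl_exists_inr lam.2.1) 0
  choose a ha ha0 hva using ha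
  choose b hb hb0 hvb using hb
  -- For δ the shift increases an entry of b. Negation and reversal make it a decrease, the
  -- situation covered by `GenericVars`.
  obtain ⟨b', hb'⟩ : ∃ b' : _ → Fin (n + 1) → ℤ, ∀ lam q, b' lam q = -b lam q.rev :=
    ⟨fun lam q => -b lam q.rev, fun _ _ => rfl⟩
  have hb'anti : ∀ lam, StrictAnti (b' lam) := fun lam p q hpq => by
    rw [hb', hb']
    exact neg_lt_neg (hb lam (Fin.rev_lt_rev.2 hpq))
  have hb'last : ∀ lam, b' lam (Fin.last n) = 0 := fun lam => by
    rw [hb', Fin.rev_last, hb0, neg_zero]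
  have hshift : ∀ lam (k : ℤ), alt w (shift (b lam) j (-k)) = alt x₂ (shift (b' lam) j.rev k) := by
    intro lam k
    rw [hwdef, alt_inv_rev]
    congr 1
    funext q
    by_cases hq : q = j.rev
    · subst hq
      simp [shift, hb']
      ring
    · have hq' : q.rev ≠ j := fun h => hq (by rw [← h, Fin.rev_rev])
      simp [shift, hq, hq', hb']
  obtain ⟨A, hA⟩ : ∃ A : _ → ℕ → K, ∀ lam k, A lam k =
      alt x (shift (a lam) i k) * alt w (shift (b lam) j (-k)) *
      ((∏ p, x p ^ (-a lam p)) * ∏ q, w q ^ (-b lam q)) := ⟨_, fun _ _ => rfl⟩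
  have hA' : ∀ lam k, A lam k = φ₂ (alt x₁ (shift (a lam) i k)) *
      alt x₂ (shift (b' lam) j.rev k) * ((∏ p, x p ^ (-a lam p)) * ∏ q, w q ^ (-b lam q)) :=
    fun lam k => by rw [hA, hshift, hxdef, map_alt]
  have hA0 : ∀ lam, A lam 0 ≠ 0 := fun lam => by
    have e : ∀ (N : ℕ) (c : Fin (N + 1) → ℤ) (i : Fin (N + 1)), shift c i ((0 : ℕ) : ℤ) = c :=
      fun N c i => by simp [shift]
    rw [hA', e, e]
    exact mul_ne_zero (mul_ne_zero ((map_ne_zero φ₂).2 (hx₁.alt_ne_zero _ (ha lam)))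
      (hx₂.alt_ne_zero _ (hb'anti lam))) (mul_ne_zero
        (Finset.prod_ne_zero_iff.2 fun p _ => zpow_ne_zero _ (hx p))
        (Finset.prod_ne_zero_iff.2 fun p _ => zpow_ne_zero _ (hw p)))
  have hex : ∀ lam, ∃ k : ℕ, 0 < k ∧ Function.Injective (shift (a lam) i k) ∧
      Function.Injective (shift (b' lam) j.rev k) := by
    intro lam
    have h1 := (ha lam).antitone (Fin.zero_le (Fin.last m))
    have h2 := (hb'anti lam).antitone (Fin.zero_le (Fin.last n))
    refine ⟨(a lam 0 - a lam (Fin.last m) + (b' lam 0 - b' lam (Fin.last n)) + 1).toNat, by omega,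
      exists_injective_shift (ha lam) i (by omega),
      exists_injective_shift (hb'anti lam) j.rev (by omega)⟩
  -- For 0 < k < e one of the two alternants has equal columns, so A k = 0. That A e does not vanish
  -- is not needed separately, as it is part of the linear independence.
  obtain ⟨e, he⟩ : ∃ e : _ → ℕ, ∀ lam, e lam = Nat.find (hex lam) := ⟨_, fun _ => rfl⟩
  have hepos : ∀ lam, 0 < e lam := fun lam => by rw [he]; exact (Nat.find_spec (hex lam)).1
  have heinj : ∀ lam, Function.Injective (shift (a lam) i (e lam)) ∧
      Function.Injective (shift (b' lam) j.rev (e lam)) := fun lam => by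
    rw [he]; exact (Nat.find_spec (hex lam)).2
  have hezero : ∀ lam (k : ℕ), 0 < k → k < e lam → A lam k = 0 := by
    intro lam k h0 h1
    rw [he] at h1
    have h2 := Nat.find_min (hex lam) h1
    rw [hA']
    by_cases h3 : Function.Injective (shift (a lam) i k)
    · rw [alt_eq_zero x₂ fun h4 => h2 ⟨h0, h3, h4⟩, mul_zero, zero_mul]
    · rw [alt_eq_zero x₁ h3, map_zero, zero_mul, zero_mul]
  have hu := fun lam : {lam // (slDatum m n).DominantIntegral lam ∧
    (slDatum m n).SinglyAtypical γ lam} =>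
      sl_exists_lead (φ₂.comp φ₁) hx hw (hγ lam.2.2.1) (hva lam) (hvb lam) (hA lam) (hepos lam)
        (hezero lam)
  choose u hu hl using hu
  refine exists_perm_of_specializes (g := .sl m n hmn) one_ne_zero
    (φ := HahnSeries.C.comp (φ₂.comp φ₁)) (X := slVar x w) (hX := slVar_ne_zero hx hw) u
    (fun lam => ?_) (fun s t h => ?_) hν hμ hU
  · have e : U (.sl m n hmn) special γ lam.1 =
        (slDatum m n).ordinaryNumerator γ lam.1 := if_neg fun h => h.1
    rw [e]
    exact hu lam
  -- The monomial factor cancels in A e / A 0, which leaves a product of one quotient in each set of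
  -- variables.
  refine multiset_eq_of_prod_eq (φ := φ₂.comp φ₁) (o := fun _ => 0) (e := fun lam => (e lam : ℤ))
    (c := fun lam => A lam 0) (ρ := fun lam => (-1) ^ e lam *
      (altQuot x₂ j.rev (e lam) (b' lam) * φ₂ (altQuot x₁ i (e lam) (a lam)))) hA0
    (fun lam => by exact_mod_cast hepos lam) (fun lam => ?_) (fun d => ?_) h
  · refine (hl lam).congr rfl (zero_add _).symm ?_
    have e0 : ∀ (N : ℕ) (c : Fin (N + 1) → ℤ) (i : Fin (N + 1)), shift c i ((0 : ℕ) : ℤ) = c :=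
      fun N c i => by simp [shift]
    have h1 := (map_ne_zero φ₂).2 (hx₁.alt_ne_zero _ (ha lam))
    have h2 := hx₂.alt_ne_zero _ (hb'anti lam)
    rw [hA', hA', e0, e0, altQuot, altQuot, map_div₀]
    field_simp
  -- The pair of sequences determines the weight. For a fixed exponent `d` the products are thus a
  -- subfamily of the one obtained from the tower.
  · have hinj : Function.Injective fun lam : {lam // (e lam : ℤ) = d} =>
        (((⟨b' lam.1, hb'anti _, hb'last _, by
          simpa only [lam.2] using (heinj lam.1).2⟩ : AltIdx n j.rev d),
          (⟨a lam.1, ha _, ha0 _, by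
            simpa only [lam.2] using (heinj lam.1).1⟩ : AltIdx m i d)) :
            AltIdx n j.rev d × AltIdx m i d) := by
      intro lam lam' h
      have h1 : a lam.1 = a lam'.1 := congrArg (fun p => p.2.1) h
      have h2 : b lam.1 = b lam'.1 := by
        have h3 : b' lam.1 = b' lam'.1 := congrArg (fun p => p.1.1) h
        funext q
        have h4 := congrFun h3 q.rev
        rw [hb', hb', Fin.rev_rev] at h4
        exact neg_injective h4
      have hat : ∀ lam : {lam // (slDatum m n).DominantIntegral lam ∧
          (slDatum m n).SinglyAtypical γ lam}, (lam.1 + (slDatum m n).rho) (Sum.inl i) +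
          (lam.1 + (slDatum m n).rho) (Sum.inr j) = 0 := by
        intro lam
        have h3 := (form_pair (D := slDatum m n) sl_gram (lam.1 + (slDatum m n).rho) (-1)
          (Sum.inl i) (Sum.inr j)).symm.trans
          ((congrArg _ (hγ lam.2.2.1).symm).trans lam.2.2.2.1)
        simp only [Sum.elim_inl, Sum.elim_inr] at h3
        linear_combination h3
      refine Subtype.ext (Subtype.ext (add_right_cancel (b := (slDatum m n).rho) ?_))
      exact sl_ext hmn (Submodule.add_mem _ lam.1.2.1.1 (slDatum m n).rho_mem_hStar)
        (Submodule.add_mem _ lam'.1.2.1.1 (slDatum m n).rho_mem_hStar)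
        (hva lam.1) (hvb lam.1) (h1 ▸ hva lam'.1) (h2 ▸ hvb lam'.1) (hat lam.1) (hat lam'.1)
    rcases le_or_gt d 0 with hd | hd
    · have : Subsingleton {lam // (e lam : ℤ) = d} := ⟨fun lam => by
        have := lam.2
        have := hepos lam.1
        omega⟩
      refine linIndep_of_subsingleton fun lam => ?_
      have := lam.2
      have := hepos lam.1
      omega
    · have h1 := ((hx₁.quot i d hd).tower (hx₂.quot j.rev d hd)).comp hinj
      have h2 : ∀ lam : {lam // (e lam : ℤ) = d}, e lam.1 = d.toNat := fun lam => by
        have := lam.2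
        omega
      rcases neg_one_pow_eq_or K d.toNat with h3 | h3
      · refine h1.congr fun lam => ?_
        rw [h2, h3, one_mul, Int.toNat_of_nonneg hd.le]
        rfl
      · refine h1.neg.congr fun lam => ?_
        rw [h2, h3, neg_one_mul, Int.toNat_of_nonneg hd.le]
        rfl

end Sl

end SuperFactor
end

theorem mainTheorem5 (g : SuperFactor.SuperType) (special : Set g.datum.Vec) (γ : g.datum.Vec)
    (r s : ℕ) (ν : Fin r → g.datum.Vec) (μ : Fin s → g.datum.Vec)
    (hν : ∀ i, g.datum.DominantIntegral (ν i) ∧ g.datum.SinglyAtypical γ (ν i))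
    (hμ : ∀ j, g.datum.DominantIntegral (μ j) ∧ g.datum.SinglyAtypical γ (μ j))
    (hU : ∏ i, SuperFactor.U g special γ (ν i) = ∏ j, SuperFactor.U g special γ (μ j)) :
    ∃ h : r = s, ∃ σ : Equiv.Perm (Fin r),
      ∀ k, SuperFactor.U g special γ (ν k) =
        SuperFactor.U g special γ (μ (Fin.cast h (σ k))) := by
  cases g with
  | sl m n h => exact SuperFactor.sl_unique_factorization h special γ r s ν μ hν hμ hU
  | osp n h => exact SuperFactor.osp_unique_factorization h special γ r s ν μ hν hμ hU
  | G3 => exact SuperFactor.g3_unique_factorization special γ r s ν μ hν hμ hU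
  | F4 => exact SuperFactor.f4_unique_factorization special γ r s ν μ hν hμ hU
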